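/- For positive integers $d,n$ write $d\Vert n$ if $d\mid n$ and $v_p(d)=v_p(n)$ for every prime $p\mid d$. For $q\in\mathbb Z_+$ let $\Gamma_q=\mathrm{SL}_2(\mathbb Z/q\mathbb Z)$, and for $d\mid q$ let $\pi_d:\Gamma_q\to\Gamma_d$ be reduction modulo $d$. For $L\in\mathbb Z_+$ put $q_l=\prod_{p\,:\,v_p(q)>L}p^{v_p(q)}$. For $A\subset\Gamma_q$ and $k\ge 1$ let $A^k=\{a_1a_2\cdots a_k : a_i\in A\}$. There are absolute constants $C_1,C_2>0$ such that the following holds. Let $L\in\mathbb Z_+$ and $0<\theta<\min\{10^{-12},\frac1L\}$. Then there is a positive integer $k\le C_1(\log\frac1\theta)^2$, depending only on $L$ and $\theta$, such that for every $q\in\mathbb Z_+$, all $q_1\Vert q$ and $q_2\Vert q_l$ with $(q_1,q_2)=1$, and every set $A\subset\Gamma_q$ with $$|\pi_{q_1}(A)|>q_1^{3-\theta},\qquad |\pi_{q_2}(A)|>q_2^{3-\theta},$$ there exists $q_3\Vert q_2$ with $q_3>q_2^{\frac14 10^{-4}}$ such that $$|\pi_{q_1q_3}(A^{k})|>(q_1q_3)^{3-C_2\theta^{1/2}}.$$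 -/

import Mathlib

open scoped MatrixGroups Pointwise

namespace Gluing

/-- `ExactDvd d q` is the relation `d ‖ q`: `d` divides `q`, and for every prime `p ∣ d` the
`p`-adic valuations of `d` and `q` agree. -/
def ExactDvd (d q : ℕ) : Prop :=
  d ∣ q ∧ ∀ p : ℕ, p.Prime → p ∣ d → padicValNat p d = padicValNat p q

/-- The large exponent part `q_l = ∏_{v_p(q) > L} p ^ v_p(q)` of `q`. -/
def largeExponentPart (L q : ℕ) : ℕ :=
  ∏ p ∈ q.primeFactors with L < padicValNat p q, p ^ padicValNat p q

/-- The reduction map `π_d : SL₂(ℤ/qℤ) → SL₂(ℤ/dℤ)` for `d ∣ q`. -/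
def reduction {d q : ℕ} (h : d ∣ q) : SL(2, ZMod q) →* SL(2, ZMod d) :=
  Matrix.SpecialLinearGroup.map (ZMod.castHom h (ZMod d))

theorem largeExponentPart_dvd (L q : ℕ) : largeExponentPart L q ∣ q := by
  rcases Nat.eq_zero_or_pos q with rfl | hq
  · exact dvd_zero _
  · have h : ∏ p ∈ q.primeFactors, p ^ padicValNat p q = q := by
      conv_rhs => rw [← Nat.prod_factorization_pow_eq_self hq.ne']
      rw [Finsupp.prod, Nat.support_factorization]
      refine Finset.prod_congr rfl fun p hp => ?_
      rw [Nat.factorization_def q (Nat.prime_of_mem_primeFactors hp)]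
    calc largeExponentPart L q ∣ ∏ p ∈ q.primeFactors, p ^ padicValNat p q :=
          Finset.prod_dvd_prod_of_subset _ _ _ (Finset.filter_subset _ _)
      _ = q := h

theorem ExactDvd.dvd_of_large {L d q : ℕ} (h : ExactDvd d (largeExponentPart L q)) : d ∣ q :=
  h.1.trans (largeExponentPart_dvd L q)

theorem ExactDvd.mul_dvd {q q₁ q₂ q₃ : ℕ} (h₁ : ExactDvd q₁ q) (h₂ : q₂ ∣ q)
    (hc : Nat.Coprime q₁ q₂) (h₃ : ExactDvd q₃ q₂) : q₁ * q₃ ∣ q :=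
  (hc.coprime_dvd_right h₃.1).mul_dvd_of_dvd_of_dvd h₁.1 (h₃.1.trans h₂)

end Gluing

open scoped MatrixGroups Pointwise
namespace Gluing
open scoped Classical

/-! ### Counting residues and square roots in `ZMod d`. -/

section ZModCounting

variable {d e : ℕ} [NeZero d]

/-! Write s = √θ and m = q₂; the choice q₃ = q₂ works. If m is at most a power of q₁ with exponent
O(s), the density modulo q₁ alone gives the bound. Otherwise A is viewed inside SL₂(ℤ/q₁) ×
SL₂(ℤ/m), and the aim (`exists_expansion`) is a fibre of a product set over one point of the first
factor that has size m^(3 - O(s)). Translating this fibre by a section of A over the first factor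
then fills almost everything. Three mechanisms produce the fibre.

Gluing (`exists_large_fiber`). If A is dense in both factors, A³ has a fibre of size more than
d^(1e-7). Suppose not. By tripling inequalities all bounded word sets have small fibres, so a word
lying over the identity has few conjugates by A, hence a large centralizer, hence is scalar modulo
almost all of d. A Fourier argument shows that bounded words reach a whole congruence subgroup of
the first factor, of level bounded by a small power of d. Choosing such words gives a map from that
subgroup to SL₂(ℤ/d) which is multiplicative up to nearly scalar errors. By majority vote it agrees,
at most primes p of d, with a true homomorphism to PSL₂ of ℤ/p^i. Since p is coprime to q₁,
eigenvalue considerations force such homomorphisms to vanish on a deep congruence subgroup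
(`hom_trivial`). The second coordinate of an element of A is then determined, up to nearly scalar
factors, by its first coordinate modulo a small number, and this contradicts density in the second
factor.

Stages (`exists_hasSpread`). Applying the gluing step to a divisor d of m and selecting an extremal
congruence class yields families over one point that are constant modulo d and equidistributed
beyond d. Every stage replaces d by a divisor of size at most d^(1 - 1e-8), so O(log(1/s)) stages
bring d below m^s.

Collisions (`conjSum_le_of_spread`, `exists_many_words`). Words alternating between the spread
family and elements of A are counted by a second moment. Averaging the interposed elements over the
whole group turns collisions into products of independent random conjugates of quotients of the
family. These equidistribute by a spectral gap: on the new part of functions on SL₂(ℤ/pⁿ), averaging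
over a conjugacy class has small norm unless the class is nearly scalar, because its Hilbert–Schmidt
norm is controlled by a centralizer while its top singular space is large (`nsq_conjAvg_le`). The
number of letters needed is O(log(1/s)).

The word length is the product of the two logarithms, whence k = O(log²(1/θ)). When m^s is below an
absolute constant, density itself forces all prime factors of m to be large, which replaces the
asymptotic estimates. -/

theorem natCast_dvd_iff (h : e ∣ d) (x : ZMod d) : (e : ZMod d) ∣ x ↔ e ∣ x.val := by
  constructor
  · rintro ⟨y, rfl⟩
    rw [ZMod.val_mul, ZMod.val_natCast, Nat.dvd_mod_iff h]
    exact Dvd.dvd.mul_right ((Nat.dvd_mod_iff h).2 dvd_rfl) _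
  · rintro ⟨k, hk⟩
    refine ⟨k, ?_⟩
    rw [← Nat.cast_mul, ← hk, ZMod.natCast_zmod_val]

theorem castHom_eq_zero_iff (h : e ∣ d) (x : ZMod d) :
    ZMod.castHom h (ZMod e) x = 0 ↔ (e : ZMod d) ∣ x := by
  rw [natCast_dvd_iff h, ← ZMod.natCast_eq_zero_iff]
  conv_lhs => rw [← ZMod.natCast_zmod_val x, map_natCast]

theorem castHom_eq_iff (h : e ∣ d) (x y : ZMod d) :
    ZMod.castHom h (ZMod e) x = ZMod.castHom h (ZMod e) y ↔ (e : ZMod d) ∣ x - y := by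
  rw [← castHom_eq_zero_iff h, map_sub, sub_eq_zero]

theorem card_castHom_fiber (h : e ∣ d) (c : ZMod e) :
    (Finset.univ.filter fun x : ZMod d => ZMod.castHom h (ZMod e) x = c).card = d / e := by
  have : NeZero e := ⟨fun h0 => NeZero.ne d (by subst h0; exact zero_dvd_iff.1 h)⟩
  have hs := ZMod.castHom_surjective (n := d) h
  have key : ∀ c' : ZMod e, (Finset.univ.filter fun x : ZMod d => ZMod.castHom h (ZMod e) x = c').card
      = (Finset.univ.filter fun x : ZMod d => ZMod.castHom h (ZMod e) x = c).card := fun c' =>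
    AddMonoidHom.card_fiber_eq_of_mem_range (ZMod.castHom h (ZMod e)) (hs c') (hs c)
  have h1 := Finset.card_eq_sum_card_fiberwise (f := ZMod.castHom h (ZMod e))
    (s := (Finset.univ : Finset (ZMod d))) (t := Finset.univ) (fun _ _ => Finset.mem_univ _)
  rw [Finset.sum_congr rfl (fun c' _ => key c'), Finset.sum_const, Finset.card_univ,
    Finset.card_univ, ZMod.card, ZMod.card, smul_eq_mul] at h1
  have he : 0 < e := Nat.pos_of_ne_zero (NeZero.ne e)
  exact (Nat.div_eq_of_eq_mul_right he h1).symm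

theorem card_dvd_sub (h : e ∣ d) (c : ZMod d) :
    (Finset.univ.filter fun x : ZMod d => (e : ZMod d) ∣ x - c).card = d / e := by
  rw [← card_castHom_fiber h (ZMod.castHom h (ZMod e) c)]
  congr 1
  ext x
  simp only [Finset.mem_filter, Finset.mem_univ, true_and]
  exact (castHom_eq_iff h x c).symm

/-- Two residues congruent modulo coprime-free data: divisibility by `e` and by `f` gives
divisibility by the least common multiple. -/
theorem lcm_dvd_of_dvd {f : ℕ} (he : e ∣ d) (hf : f ∣ d) {x : ZMod d} (h1 : (e : ZMod d) ∣ x)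
    (h2 : (f : ZMod d) ∣ x) : ((e.lcm f : ℕ) : ZMod d) ∣ x := by
  rw [natCast_dvd_iff he] at h1
  rw [natCast_dvd_iff hf] at h2
  rw [natCast_dvd_iff (Nat.lcm_dvd he hf)]
  exact Nat.lcm_dvd h1 h2

/-- The number of square roots of a square of a unit is at most `2 τ(d)`. -/
theorem card_sq_eq_one_le :
    (Finset.univ.filter fun u : ZMod d => u ^ 2 = 1).card ≤ 2 * d.divisors.card := by
  have hd : d ≠ 0 := NeZero.ne d
  -- With e = gcd(u - 1, d) and d = ef, one has e ∣ u - 1 and f ∣ u + 1. So u is determined modulo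
  -- lcm(e, f), and gcd(e, f) divides 2, which leaves at most two u for each divisor e.
  refine Finset.card_le_mul_card_image_of_maps_to (f := fun u : ZMod d => Nat.gcd (u - 1).val d)
    (fun u _ => Nat.mem_divisors.2 ⟨Nat.gcd_dvd_right _ _, hd⟩) 2 ?_
  intro e he
  have hed : e ∣ d := (Nat.mem_divisors.1 he).1
  obtain ⟨f, rfl⟩ := hed
  have he0 : 0 < e := Nat.pos_of_ne_zero (by rintro rfl; simp at hd)
  have hf0 : 0 < f := Nat.pos_of_ne_zero (by rintro rfl; simp at hd)
  have hf : f ∣ e * f := dvd_mul_left _ _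
  have hmem : ∀ u ∈ (Finset.univ.filter fun u : ZMod (e * f) => u ^ 2 = 1).filter
      (fun u => Nat.gcd (u - 1).val (e * f) = e),
      (e : ZMod (e * f)) ∣ u - 1 ∧ (f : ZMod (e * f)) ∣ u + 1 := by
    intro u hu
    simp only [Finset.mem_filter, Finset.mem_univ, true_and] at hu
    obtain ⟨hu1, hu2⟩ := hu
    refine ⟨(natCast_dvd_iff (dvd_mul_right _ _) _).2 (hu2.symm.dvd.trans (Nat.gcd_dvd_left _ _)), ?_⟩
    have h0 : (u - 1) * (u + 1) = 0 := by linear_combination hu1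
    rw [natCast_dvd_iff hf]
    rw [← ZMod.natCast_zmod_val (u - 1), ← ZMod.natCast_zmod_val (u + 1), ← Nat.cast_mul,
      ZMod.natCast_eq_zero_iff] at h0
    obtain ⟨k, hk⟩ : e ∣ (u - 1).val := hu2.symm.dvd.trans (Nat.gcd_dvd_left _ _)
    rw [hk, mul_assoc] at h0
    have h3 := Nat.dvd_of_mul_dvd_mul_left he0 h0
    have hcop : Nat.Coprime f k := by
      rw [hk, Nat.gcd_mul_left] at hu2
      have : Nat.gcd k f = 1 := Nat.eq_of_mul_eq_mul_left he0 (by rw [hu2, mul_one])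
      rwa [Nat.coprime_comm]
    exact hcop.dvd_of_dvd_mul_left h3
  rcases Finset.eq_empty_or_nonempty ((Finset.univ.filter fun u : ZMod (e * f) => u ^ 2 = 1).filter
      (fun u => Nat.gcd (u - 1).val (e * f) = e)) with h | ⟨u0, hu0⟩
  · rw [h]; simp
  have hle : e.lcm f ∣ e * f := Nat.lcm_dvd (dvd_mul_right _ _) hf
  have hg2 : Nat.gcd e f ∣ 2 := by
    obtain ⟨h1, h2⟩ := hmem u0 hu0
    have h3 : ((Nat.gcd e f : ℕ) : ZMod (e * f)) ∣ ((2 : ℕ) : ZMod (e * f)) := by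
      have := dvd_sub ((Nat.cast_dvd_cast (α := ZMod (e * f)) (Nat.gcd_dvd_right e f)).trans h2)
        ((Nat.cast_dvd_cast (α := ZMod (e * f)) (Nat.gcd_dvd_left e f)).trans h1)
      have h5 : u0 + 1 - (u0 - 1) = ((2 : ℕ) : ZMod (e * f)) := by push_cast; ring
      rwa [h5] at this
    have hgd : Nat.gcd e f ∣ e * f := (Nat.gcd_dvd_left e f).trans (dvd_mul_right _ _)
    rw [natCast_dvd_iff hgd, ZMod.val_natCast, Nat.dvd_mod_iff hgd] at h3
    exact h3
  calc _ ≤ (Finset.univ.filter fun x : ZMod (e * f) => ((e.lcm f : ℕ) : ZMod (e * f)) ∣ x - u0).card := by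
        refine Finset.card_le_card fun u hu => ?_
        simp only [Finset.mem_filter, Finset.mem_univ, true_and]
        obtain ⟨h1, h2⟩ := hmem u hu
        obtain ⟨h3, h4⟩ := hmem u0 hu0
        refine lcm_dvd_of_dvd (dvd_mul_right _ _) hf ?_ ?_
        · have := dvd_sub h1 h3
          rwa [sub_sub_sub_cancel_right] at this
        · have := dvd_sub h2 h4
          rwa [add_sub_add_right_eq_sub] at this
    _ = e * f / e.lcm f := card_dvd_sub hle u0
    _ = Nat.gcd e f := by
        rw [← Nat.gcd_mul_lcm e f]
        exact Nat.mul_div_cancel _ (Nat.lcm_pos he0 hf0)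
    _ ≤ 2 := Nat.le_of_dvd two_pos hg2

theorem card_unit_sq_eq_le (c : ZMod d) :
    (Finset.univ.filter fun u : (ZMod d)ˣ => (u : ZMod d) ^ 2 = c).card ≤ 2 * d.divisors.card := by
  rcases Finset.eq_empty_or_nonempty
    (Finset.univ.filter fun u : (ZMod d)ˣ => (u : ZMod d) ^ 2 = c) with h | ⟨u0, hu0⟩
  · rw [h]; simp
  simp only [Finset.mem_filter, Finset.mem_univ, true_and] at hu0
  refine le_trans ?_ card_sq_eq_one_le
  refine Finset.card_le_card_of_injOn (fun u => (u : ZMod d) * (u0⁻¹ : (ZMod d)ˣ)) ?_ ?_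
  · intro u hu
    simp only [Finset.coe_filter, Finset.mem_univ, true_and, Set.mem_ofPred_eq] at hu ⊢
    rw [mul_pow, hu, ← hu0, ← mul_pow, Units.mul_inv, one_pow]
  · intro u _ v _ huv
    have : u * u0⁻¹ = v * u0⁻¹ := Units.ext (by simpa using huv)
    exact mul_right_cancel this

end ZModCounting

/-! ### Divisor function bounds. -/

section Divisors

/-- Both sides are multiplicative, and at pⁿ the claim reduces to p ≤ (p - 1)(n + 1). It lets φ(n)
be replaced by n/τ(n) throughout, where a divisor function costs nothing. -/
theorem le_totient_mul_card_divisors (n : ℕ) : n ≤ n.totient * n.divisors.card := by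
  induction n using Nat.recOnPosPrimePosCoprime with
  | prime_pow p n hp hn =>
    rw [Nat.totient_prime_pow hp hn, Nat.divisors_prime_pow hp, Finset.card_map, Finset.card_range]
    obtain ⟨m, rfl⟩ : ∃ m, n = m + 1 := ⟨n - 1, by omega⟩
    obtain ⟨r, rfl⟩ : ∃ r, p = r + 2 := ⟨p - 2, by have := hp.two_le; omega⟩
    rw [pow_succ, Nat.add_sub_cancel, mul_assoc]
    refine Nat.mul_le_mul_left _ ?_
    have : r + 2 - 1 = r + 1 := by omega
    rw [this]; nlinarith
  | zero => simp
  | one => simp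
  | coprime a b _ _ hab ha hb =>
    rw [Nat.totient_mul hab, hab.card_divisors_mul]
    calc a * b ≤ (a.totient * a.divisors.card) * (b.totient * b.divisors.card) :=
          Nat.mul_le_mul ha hb
      _ = _ := by ring

/-- A divisor-type function `∏_{p ∣ n} B (v_p(n) + 1)` grows slower than any power of `n`. -/
theorem exists_prod_factorization_le (B η : ℝ) (hB : 1 ≤ B) (hη : 0 < η) :
    ∃ C : ℝ, 1 ≤ C ∧ ∀ n : ℕ, n ≠ 0 →
      ∏ p ∈ n.primeFactors, (B * (n.factorization p + 1)) ≤ C * (n : ℝ) ^ η := by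
  have hl2 : 0 < Real.log 2 := Real.log_pos one_lt_two
  set M : ℝ := B * (1 / (η * Real.log 2) + 1) with hM
  have hM1 : 1 ≤ M := by
    have : 0 < 1 / (η * Real.log 2) := by positivity
    nlinarith
  -- Primes p ≥ P satisfy B(k + 1) ≤ (2B)^k ≤ p^(kη) and cost nothing; the fewer than P smaller
  -- primes cost a factor M each.
  obtain ⟨P, hP⟩ : ∃ P : ℕ, 2 * B ≤ (P : ℝ) ^ η := by
    have := (tendsto_rpow_atTop hη).comp tendsto_natCast_atTop_atTop
    exact (this.eventually_ge_atTop (2 * B)).exists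
  refine ⟨M ^ P, one_le_pow₀ hM1, fun n hn => ?_⟩
  have hfac : ∀ p ∈ n.primeFactors, B * (n.factorization p + 1) ≤
      (if p < P then M else 1) * ((p : ℝ) ^ n.factorization p) ^ η := by
    intro p hp
    have hpp := Nat.prime_of_mem_primeFactors hp
    have hk : 1 ≤ n.factorization p :=
      hpp.factorization_pos_of_dvd hn (Nat.dvd_of_mem_primeFactors hp)
    set k := n.factorization p
    have hp2 : (2 : ℝ) ≤ p := by exact_mod_cast hpp.two_le
    split_ifs with h
    · have h1 : (k : ℝ) * (η * Real.log 2) + 1 ≤ ((p : ℝ) ^ k) ^ η := by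
        calc (k : ℝ) * (η * Real.log 2) + 1 ≤ Real.exp (k * (η * Real.log 2)) := Real.add_one_le_exp _
          _ = ((2 : ℝ) ^ k) ^ η := by
            rw [Real.rpow_def_of_pos (by positivity), Real.log_pow]; ring_nf
          _ ≤ _ := by gcongr
      have h2 : (k : ℝ) + 1 ≤ (1 / (η * Real.log 2) + 1) * (k * (η * Real.log 2) + 1) := by
        have h3 : 0 < η * Real.log 2 := by positivity
        have h4 : (1 / (η * Real.log 2) + 1) * (k * (η * Real.log 2) + 1)
          = k + 1 + (1 / (η * Real.log 2) + k * (η * Real.log 2)) := by field_simp; ring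
        rw [h4]
        have : 0 ≤ 1 / (η * Real.log 2) + k * (η * Real.log 2) := by positivity
        linarith
      have h5 : 0 ≤ 1 / (η * Real.log 2) + 1 := by positivity
      calc B * ((k : ℝ) + 1) ≤ B * ((1 / (η * Real.log 2) + 1) * (k * (η * Real.log 2) + 1)) := by gcongr
        _ = M * (k * (η * Real.log 2) + 1) := by rw [hM]; ring
        _ ≤ _ := by gcongr
    · have h1 : (2 * B) ≤ (p : ℝ) ^ η := hP.trans (by gcongr; exact_mod_cast not_lt.1 h)
      have h2 : (k : ℝ) + 1 ≤ 2 ^ k := by exact_mod_cast Nat.lt_two_pow_self (n := k)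
      calc B * ((k : ℝ) + 1) ≤ B ^ k * 2 ^ k := by
            gcongr
            exact le_self_pow₀ hB (by omega)
        _ = (2 * B) ^ k := by rw [mul_pow]; ring
        _ ≤ ((p : ℝ) ^ η) ^ k := by gcongr
        _ = 1 * ((p : ℝ) ^ k) ^ η := by
          rw [one_mul, ← Real.rpow_natCast, ← Real.rpow_natCast, ← Real.rpow_mul (by positivity),
            ← Real.rpow_mul (by positivity), mul_comm]
  calc ∏ p ∈ n.primeFactors, (B * (n.factorization p + 1))
      ≤ ∏ p ∈ n.primeFactors, ((if p < P then M else 1) * ((p : ℝ) ^ n.factorization p) ^ η) :=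
        Finset.prod_le_prod (fun p _ => by positivity) hfac
    _ = (∏ p ∈ n.primeFactors, (if p < P then M else 1)) * (n : ℝ) ^ η := by
        rw [Finset.prod_mul_distrib, Real.finsetProd_rpow _ _ (fun p _ => by positivity)]
        congr 2
        conv_rhs => rw [← Nat.prod_factorization_pow_eq_self hn]
        rw [Finsupp.prod, Nat.support_factorization]
        push_cast; rfl
    _ ≤ M ^ P * (n : ℝ) ^ η := by
        gcongr
        rw [Finset.prod_ite]
        simp only [Finset.prod_const, one_pow, mul_one]
        refine pow_le_pow_right₀ hM1 ?_
        calc _ ≤ (Finset.range P).card := Finset.card_le_card fun p hp => by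
              simpa using (Finset.mem_filter.1 hp).2
          _ = P := Finset.card_range P

/-- Obtained from the previous bound with exponent η/(m + 1), raised to the power m + 1. It absorbs
every loss of the form B^ω(n) τ(n)^m met later. -/
theorem exists_card_divisors_le (B : ℝ) (m : ℕ) (η : ℝ) (hB : 1 ≤ B) (hη : 0 < η) :
    ∃ C : ℝ, 1 ≤ C ∧ ∀ n : ℕ, n ≠ 0 →
      B ^ n.primeFactors.card * (n.divisors.card : ℝ) ^ m ≤ C * (n : ℝ) ^ η := by
  obtain ⟨C, hC, h⟩ := exists_prod_factorization_le B (η / (m + 1)) hB (by positivity)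
  refine ⟨C ^ (m + 1), one_le_pow₀ hC, fun n hn => ?_⟩
  have h1 := h n hn
  rw [Finset.prod_mul_distrib, Finset.prod_const] at h1
  have h2 : (n.divisors.card : ℝ) = ∏ p ∈ n.primeFactors, ((n.factorization p : ℝ) + 1) := by
    rw [Nat.card_divisors hn]; push_cast; rfl
  rw [← h2] at h1
  have hBp : 1 ≤ B ^ n.primeFactors.card := one_le_pow₀ hB
  have ht : (1 : ℝ) ≤ n.divisors.card := by
    exact_mod_cast Finset.card_pos.2 ⟨1, Nat.one_mem_divisors.2 hn⟩
  calc B ^ n.primeFactors.card * (n.divisors.card : ℝ) ^ m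
      ≤ (B ^ n.primeFactors.card) ^ (m + 1) * (n.divisors.card : ℝ) ^ (m + 1) := by
        gcongr
        · exact le_self_pow₀ hBp (by omega)
        · omega
    _ = (B ^ n.primeFactors.card * n.divisors.card) ^ (m + 1) := by rw [mul_pow]
    _ ≤ (C * (n : ℝ) ^ (η / (m + 1))) ^ (m + 1) := by gcongr
    _ = C ^ (m + 1) * (n : ℝ) ^ η := by
        rw [mul_pow, ← Real.rpow_mul_natCast (by positivity)]
        congr 2
        push_cast
        field_simp

end Divisors

/-! ### Levels of matrices, orders of SL₂(ℤ/d), sizes of centralizers. -/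

section Levels

variable {d : ℕ}

theorem SL2_det (z : SL(2, ZMod d)) : z 0 0 * z 1 1 - z 0 1 * z 1 0 = 1 := by
  have := z.2
  rwa [Matrix.det_fin_two] at this

theorem SL2_ext {R : Type*} [CommRing R] {z w : SL(2, R)} (h1 : z 0 0 = w 0 0) (h2 : z 0 1 = w 0 1)
    (h3 : z 1 0 = w 1 0) (h4 : z 1 1 = w 1 1) : z = w := by
  ext i j
  fin_cases i <;> fin_cases j <;> assumption

theorem SL2_mul_apply {R : Type*} [CommRing R] (z w : SL(2, R)) (i j : Fin 2) :
    (z * w) i j = z i 0 * w 0 j + z i 1 * w 1 j := by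
  rw [Matrix.SpecialLinearGroup.coe_mul, Matrix.mul_apply, Fin.sum_univ_two]

/-- Entrywise congruence modulo `e`. -/
def Cong (e : ℕ) (z w : SL(2, ZMod d)) : Prop := ∀ i j, (e : ZMod d) ∣ z i j - w i j

/-- `z` is congruent to a scalar matrix modulo `e`. -/
def ScalarMod (e : ℕ) (z : SL(2, ZMod d)) : Prop :=
  (e : ZMod d) ∣ z 0 1 ∧ (e : ZMod d) ∣ z 1 0 ∧ (e : ZMod d) ∣ z 0 0 - z 1 1

/-- The largest divisor of `d` modulo which `z` is scalar. -/
def lvl (z : SL(2, ZMod d)) : ℕ :=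
  Nat.gcd (Nat.gcd (z 0 1).val (z 1 0).val) (Nat.gcd (z 0 0 - z 1 1).val d)

theorem lvl_dvd (z : SL(2, ZMod d)) : lvl z ∣ d :=
  (Nat.gcd_dvd_right _ _).trans (Nat.gcd_dvd_right _ _)

theorem exists_gcd_combination (a b : ℕ) :
    ∃ x y : ZMod d, ((Nat.gcd a b : ℕ) : ZMod d) = a * x + b * y := by
  refine ⟨(Nat.gcdA a b : ℤ), (Nat.gcdB a b : ℤ), ?_⟩
  have := congrArg (Int.cast : ℤ → ZMod d) (Nat.gcd_eq_gcd_ab a b)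
  push_cast at this
  exact this

variable [NeZero d]

theorem dvd_lvl_iff {e : ℕ} (h : e ∣ d) (z : SL(2, ZMod d)) : e ∣ lvl z ↔ ScalarMod e z := by
  rw [lvl, ScalarMod, Nat.dvd_gcd_iff, Nat.dvd_gcd_iff, Nat.dvd_gcd_iff, natCast_dvd_iff h,
    natCast_dvd_iff h, natCast_dvd_iff h]
  tauto

theorem lvl_pos (z : SL(2, ZMod d)) : 0 < lvl z :=
  Nat.pos_of_dvd_of_pos (lvl_dvd z) (Nat.pos_of_ne_zero (NeZero.ne d))

theorem reduction_eq_iff {e : ℕ} (h : e ∣ d) (z w : SL(2, ZMod d)) :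
    reduction h z = reduction h w ↔ Cong e z w := by
  rw [Matrix.SpecialLinearGroup.ext_iff]
  refine forall₂_congr fun i j => ?_
  exact castHom_eq_iff h (z i j) (w i j)

theorem natCast_mul_eq_zero_iff {e f : ℕ} (h : e * f = d) (x : ZMod d) :
    (e : ZMod d) * x = 0 ↔ (f : ZMod d) ∣ x := by
  have he : 0 < e := Nat.pos_of_ne_zero (by rintro rfl; exact NeZero.ne d (by simpa using h.symm))
  rw [natCast_dvd_iff (h ▸ dvd_mul_left f e)]
  nth_rewrite 1 [← ZMod.natCast_zmod_val x]
  rw [← Nat.cast_mul, ZMod.natCast_eq_zero_iff,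
    show (d ∣ e * x.val) = (e * f ∣ e * x.val) by rw [h]]
  exact Nat.mul_dvd_mul_iff_left he

/-- The first row has (d/e)² possibilities. Relative to a fixed matrix z₀ with the same first row,
the second row is determined by its determinant against the second row of z₀, a multiple of e. -/
theorem card_cong_le {e : ℕ} (h : e ∣ d) (w : SL(2, ZMod d)) :
    (Finset.univ.filter fun z : SL(2, ZMod d) => Cong e z w).card ≤ (d / e) ^ 3 := by
  set s := Finset.univ.filter fun z : SL(2, ZMod d) => Cong e z w
  set t1 := (Finset.univ.filter fun x : ZMod d => (e : ZMod d) ∣ x - w 0 0)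
  set t2 := (Finset.univ.filter fun x : ZMod d => (e : ZMod d) ∣ x - w 0 1)
  have h1 : s.card ≤ (d / e) * (t1 ×ˢ t2).card := by
    refine Finset.card_le_mul_card_image_of_maps_to (f := fun z => (z 0 0, z 0 1)) ?_ _ ?_
    · intro z hz
      have hz' : Cong e z w := (Finset.mem_filter.1 hz).2
      simp only [Finset.mem_product, t1, t2, Finset.mem_filter, Finset.mem_univ, true_and]
      exact ⟨hz' 0 0, hz' 0 1⟩
    · rintro ⟨a, b⟩ -
      rcases Finset.eq_empty_or_nonempty (s.filter fun z => (z 0 0, z 0 1) = (a, b)) with h0 | ⟨z0, hz0⟩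
      · rw [h0]; simp
      rw [← card_dvd_sub h (0 : ZMod d)]
      refine Finset.card_le_card_of_injOn (fun z => z 1 0 * z0 1 1 - z 1 1 * z0 1 0) ?_ ?_
      · intro z hz
        simp only [Finset.coe_filter, s, Finset.mem_filter, Finset.mem_univ, true_and,
          Set.mem_ofPred_eq] at hz hz0 ⊢
        have e1 := dvd_sub (hz.1 1 0) (hz0.1 1 0)
        have e2 := dvd_sub (hz.1 1 1) (hz0.1 1 1)
        have := dvd_sub (Dvd.dvd.mul_right e1 (z0 1 1)) (Dvd.dvd.mul_right e2 (z0 1 0))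
        convert this using 1; ring
      · intro z hz z' hz' hzz
        simp only [Finset.coe_filter, s, Finset.mem_filter, Finset.mem_univ, true_and,
          Set.mem_ofPred_eq, Prod.mk.injEq] at hz hz' hz0 hzz
        have d1 := SL2_det z
        have d2 := SL2_det z'
        have d3 := SL2_det z0
        obtain ⟨-, h3, h4⟩ := hz
        obtain ⟨-, h5, h6⟩ := hz'
        obtain ⟨-, h7, h8⟩ := hz0
        rw [h3, h4] at d1
        rw [h5, h6] at d2
        rw [h7, h8] at d3
        refine SL2_ext (h3.trans h5.symm) (h4.trans h6.symm) ?_ ?_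
        · linear_combination (-z 1 0 + z' 1 0) * d3 + a * hzz + z0 1 0 * (d1 - d2)
        · linear_combination (-z 1 1 + z' 1 1) * d3 + b * hzz + z0 1 1 * (d1 - d2)
  rw [Finset.card_product, card_dvd_sub h, card_dvd_sub h] at h1
  calc s.card ≤ _ := h1
    _ = _ := by ring

theorem card_SL2_le : Fintype.card SL(2, ZMod d) ≤ d ^ 3 := by
  have h := card_cong_le (one_dvd d) (1 : SL(2, ZMod d))
  rw [Nat.div_one] at h
  refine le_trans (le_of_eq ?_) h
  rw [← Finset.card_univ]
  congr 1
  ext z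
  simp [Cong]

/-- Only the matrices with invertible upper left entry are counted. -/
theorem le_card_SL2 : d ^ 2 * d.totient ≤ Fintype.card SL(2, ZMod d) := by
  have : Fintype.card ((ZMod d)ˣ × ZMod d × ZMod d) ≤ Fintype.card SL(2, ZMod d) := by
    refine Fintype.card_le_of_injective
      (fun x => ⟨!![(x.1 : ZMod d), x.2.1; x.2.2, (x.1⁻¹ : (ZMod d)ˣ) * (1 + x.2.1 * x.2.2)], ?_⟩) ?_
    · rw [Matrix.det_fin_two_of, ← mul_assoc, Units.mul_inv]; ring
    · rintro ⟨u, b, c⟩ ⟨u', b', c'⟩ h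
      have h' := congrArg Subtype.val h
      have h1 := congrFun₂ h' 0 0
      have h2 := congrFun₂ h' 0 1
      have h3 := congrFun₂ h' 1 0
      simp at h1 h2 h3
      simp [Units.ext h1, h2, h3]
  rw [Fintype.card_prod, Fintype.card_prod, ZMod.card, ZMod.card_units_eq_totient] at this
  linarith [this, mul_comm d.totient (d * d)]

theorem pow_three_le_card_SL2 : d ^ 3 ≤ Fintype.card SL(2, ZMod d) * d.divisors.card := by
  calc d ^ 3 = d ^ 2 * d := by ring
    _ ≤ d ^ 2 * (d.totient * d.divisors.card) := Nat.mul_le_mul_left _ (le_totient_mul_card_divisors d)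
    _ = d ^ 2 * d.totient * d.divisors.card := by ring
    _ ≤ _ := Nat.mul_le_mul_right _ le_card_SL2

/-- The factor 1 - p⁻² against p³ is what matters: a set missing less than this proportion cannot
live over a modulus divisible by p. -/
theorem card_SL2_prime {p : ℕ} (hp : p.Prime) [NeZero p] :
    Fintype.card SL(2, ZMod p) ≤ (p ^ 2 - 1) * p := by
  have : Fact p.Prime := ⟨hp⟩
  set t := (Finset.univ : Finset (ZMod p × ZMod p)).erase 0
  have ht : t.card = p ^ 2 - 1 := by
    rw [Finset.card_erase_of_mem (Finset.mem_univ _), Finset.card_univ, Fintype.card_prod, ZMod.card]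
    ring_nf
  rw [← ht, ← Finset.card_univ, mul_comm]
  refine Finset.card_le_mul_card_image_of_maps_to (f := fun z => (z 0 0, z 0 1)) ?_ _ ?_
  · intro z _
    refine Finset.mem_erase.2 ⟨fun h => ?_, Finset.mem_univ _⟩
    have d1 := SL2_det z
    simp only [Prod.mk_eq_zero] at h
    rw [h.1, h.2] at d1
    simp at d1
  · rintro ⟨a, b⟩ -
    rcases Finset.eq_empty_or_nonempty
      (Finset.univ.filter fun z : SL(2, ZMod p) => (z 0 0, z 0 1) = (a, b)) with h0 | ⟨z0, hz0⟩
    · rw [h0]; simp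
    conv_rhs => rw [← ZMod.card p, ← Finset.card_univ]
    refine Finset.card_le_card_of_injOn (fun z => z 1 0 * z0 1 1 - z 1 1 * z0 1 0)
      (fun _ _ => Finset.mem_coe.2 (Finset.mem_univ _)) ?_
    intro z hz z' hz' hzz
    simp only [Finset.coe_filter, Finset.mem_filter, Finset.mem_univ, true_and,
      Set.mem_ofPred_eq, Prod.mk.injEq] at hz hz' hz0 hzz
    have d1 := SL2_det z
    have d2 := SL2_det z'
    have d3 := SL2_det z0
    obtain ⟨h3, h4⟩ := hz
    obtain ⟨h5, h6⟩ := hz'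
    obtain ⟨h7, h8⟩ := hz0
    rw [h3, h4] at d1
    rw [h5, h6] at d2
    rw [h7, h8] at d3
    refine SL2_ext (h3.trans h5.symm) (h4.trans h6.symm) ?_ ?_
    · linear_combination (-z 1 0 + z' 1 0) * d3 + a * hzz + z0 1 0 * (d1 - d2)
    · linear_combination (-z 1 1 + z' 1 1) * d3 + b * hzz + z0 1 1 * (d1 - d2)

/-- Number of elements that are scalar modulo `e`. -/
theorem card_scalarMod_le {e : ℕ} (h : e ∣ d) :
    (Finset.univ.filter fun z : SL(2, ZMod d) => ScalarMod e z).card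
      ≤ 2 * e.divisors.card * (d / e) ^ 3 := by
  have : NeZero e := ⟨fun h0 => NeZero.ne d (by subst h0; exact zero_dvd_iff.1 h)⟩
  have h1 : (Finset.univ.filter fun z : SL(2, ZMod d) => ScalarMod e z).card ≤
      (d / e) ^ 3 * (Finset.univ.filter fun u : ZMod e => u ^ 2 = 1).card := by
    refine Finset.card_le_mul_card_image_of_maps_to
      (f := fun z => ZMod.castHom h (ZMod e) (z 0 0)) ?_ _ ?_
    · intro z hz
      simp only [Finset.mem_filter, Finset.mem_univ, true_and] at hz ⊢
      obtain ⟨h1, h2, h3⟩ := hz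
      have d1 := congrArg (ZMod.castHom h (ZMod e)) (SL2_det z)
      rw [← castHom_eq_zero_iff h] at h1 h2
      rw [← castHom_eq_iff h] at h3
      rw [map_sub, map_mul, map_mul, h1, h2, ← h3, map_one] at d1
      linear_combination d1
    · intro c _
      rcases Finset.eq_empty_or_nonempty
        ((Finset.univ.filter fun z : SL(2, ZMod d) => ScalarMod e z).filter
          fun z => ZMod.castHom h (ZMod e) (z 0 0) = c) with h0 | ⟨z0, hz0⟩
      · rw [h0]; simp
      refine le_trans (Finset.card_le_card fun z hz => ?_) (card_cong_le h z0)
      simp only [Finset.mem_filter, Finset.mem_univ, true_and] at hz hz0 ⊢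
      obtain ⟨⟨h1, h2, h3⟩, h4⟩ := hz
      obtain ⟨⟨h5, h6, h7⟩, h8⟩ := hz0
      have h9 : (e : ZMod d) ∣ z 0 0 - z0 0 0 := (castHom_eq_iff h _ _).1 (h4.trans h8.symm)
      intro i j
      fin_cases i <;> fin_cases j
      · exact h9
      · exact dvd_sub h1 h5
      · exact dvd_sub h2 h6
      · have := dvd_add (dvd_sub h9 h3) h7
        convert this using 1
        simp only [Fin.mk_one]; ring
  calc _ ≤ _ := h1
    _ ≤ (d / e) ^ 3 * (2 * e.divisors.card) := Nat.mul_le_mul_left _ card_sq_eq_one_le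
    _ = _ := by ring

/-- Vectors parallel to a given vector of level `g`. -/
theorem card_parallel_le (a b c : ZMod d) (g : ℕ)
    (hg : g = Nat.gcd (Nat.gcd a.val b.val) (Nat.gcd c.val d)) :
    (Finset.univ.filter fun w : ZMod d × ZMod d × ZMod d =>
      w.1 * b = w.2.1 * a ∧ w.1 * c = w.2.2 * a ∧ w.2.1 * c = w.2.2 * b).card ≤ d * g ^ 2 := by
  have hgd : g ∣ d := hg ▸ (Nat.gcd_dvd_right _ _).trans (Nat.gcd_dvd_right _ _)
  obtain ⟨f, hf⟩ := hgd
  have hfd : f ∣ d := hf ▸ dvd_mul_left _ _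
  have hd0 : 0 < d := Nat.pos_of_ne_zero (NeZero.ne d)
  have hf0 : 0 < f := Nat.pos_of_dvd_of_pos hfd hd0
  have : NeZero f := ⟨hf0.ne'⟩
  have hga : g ∣ a.val := hg ▸ (Nat.gcd_dvd_left _ _).trans (Nat.gcd_dvd_left _ _)
  have hgb : g ∣ b.val := hg ▸ (Nat.gcd_dvd_left _ _).trans (Nat.gcd_dvd_right _ _)
  have hgc : g ∣ c.val := hg ▸ (Nat.gcd_dvd_right _ _).trans (Nat.gcd_dvd_left _ _)
  obtain ⟨a', ha⟩ := (natCast_dvd_iff (Dvd.intro _ hf.symm) a).2 hga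
  obtain ⟨b', hb⟩ := (natCast_dvd_iff (Dvd.intro _ hf.symm) b).2 hgb
  obtain ⟨c', hc⟩ := (natCast_dvd_iff (Dvd.intro _ hf.symm) c).2 hgc
  obtain ⟨x, y, z, hxyz⟩ : ∃ x y z : ZMod d, (g : ZMod d) = a * x + b * y + c * z := by
    obtain ⟨x1, y1, h1⟩ := exists_gcd_combination (d := d) (Nat.gcd a.val b.val) (Nat.gcd c.val d)
    obtain ⟨x2, y2, h2⟩ := exists_gcd_combination (d := d) a.val b.val
    obtain ⟨x3, y3, h3⟩ := exists_gcd_combination (d := d) c.val d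
    rw [← hg, h2, h3] at h1
    simp only [ZMod.natCast_zmod_val, CharP.cast_eq_zero, zero_mul, add_zero] at h1
    exact ⟨x2 * x1, y2 * x1, x3 * y1, by rw [h1]; ring⟩
  have key := fun t => natCast_mul_eq_zero_iff hf.symm t
  have hbez : (f : ZMod d) ∣ a' * x + b' * y + c' * z - 1 := by
    rw [← key]; linear_combination -hxyz - x * ha - y * hb - z * hc
  set W := Finset.univ.filter fun w : ZMod d × ZMod d × ZMod d =>
      w.1 * b = w.2.1 * a ∧ w.1 * c = w.2.2 * a ∧ w.2.1 * c = w.2.2 * b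
  have hW : ∀ w ∈ W, (f : ZMod d) ∣ w.1 * b' - w.2.1 * a' ∧ (f : ZMod d) ∣ w.1 * c' - w.2.2 * a' ∧
      (f : ZMod d) ∣ w.2.1 * c' - w.2.2 * b' := by
    intro w hw
    obtain ⟨-, h1, h2, h3⟩ := Finset.mem_filter.1 hw
    refine ⟨(key _).1 ?_, (key _).1 ?_, (key _).1 ?_⟩
    · linear_combination h1 - w.1 * hb + w.2.1 * ha
    · linear_combination h2 - w.1 * hc + w.2.2 * ha
    · linear_combination h3 - w.2.1 * hc + w.2.2 * hb
  -- The vector (a', b', c') is unimodular modulo f = d/g, so a vector w parallel to it is S(w)·(a',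
  -- b', c') modulo f. This leaves f values of S modulo f and g³ lifts for each.
  set S : ZMod d × ZMod d × ZMod d → ZMod d := fun w => x * w.1 + y * w.2.1 + z * w.2.2
  have hS : ∀ w ∈ W, (f : ZMod d) ∣ w.1 - S w * a' ∧ (f : ZMod d) ∣ w.2.1 - S w * b' ∧
      (f : ZMod d) ∣ w.2.2 - S w * c' := by
    intro w hw
    obtain ⟨h1, h2, h3⟩ := hW w hw
    simp only [S]
    refine ⟨?_, ?_, ?_⟩
    · have := dvd_add (dvd_add (Dvd.dvd.mul_right h1 y) (Dvd.dvd.mul_right h2 z))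
        ((dvd_neg.2 hbez).mul_right w.1)
      convert this using 1; ring
    · have := dvd_add (dvd_sub (Dvd.dvd.mul_right h3 z) (Dvd.dvd.mul_right h1 x))
        ((dvd_neg.2 hbez).mul_right w.2.1)
      convert this using 1; ring
    · have := dvd_add (dvd_add (Dvd.dvd.mul_right (dvd_neg.2 h3) y) (Dvd.dvd.mul_right (dvd_neg.2 h2) x))
        ((dvd_neg.2 hbez).mul_right w.2.2)
      convert this using 1; ring
  have hfg : d / f = g := by rw [hf]; exact Nat.mul_div_cancel _ hf0
  have h1 : W.card ≤ (g * (g * g)) * (Finset.univ : Finset (ZMod f)).card := by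
    refine Finset.card_le_mul_card_image_of_maps_to (f := fun w => ZMod.castHom hfd (ZMod f) (S w))
      (fun _ _ => Finset.mem_univ _) _ ?_
    intro s _
    rcases Finset.eq_empty_or_nonempty (W.filter fun w => ZMod.castHom hfd (ZMod f) (S w) = s)
      with h0 | ⟨w0, hw0⟩
    · rw [h0]; simp
    set T : ZMod d → Finset (ZMod d) := fun c => Finset.univ.filter fun x : ZMod d => (f : ZMod d) ∣ x - c
    have hT : ∀ c, (T c).card = g := fun c => by rw [← hfg]; exact card_dvd_sub hfd c
    calc _ ≤ (T w0.1 ×ˢ (T w0.2.1 ×ˢ T w0.2.2)).card := by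
          refine Finset.card_le_card fun w hw => ?_
          obtain ⟨hw1, hw2⟩ := Finset.mem_filter.1 hw
          obtain ⟨hw3, hw4⟩ := Finset.mem_filter.1 hw0
          obtain ⟨h1, h2, h3⟩ := hS w hw1
          obtain ⟨h4, h5, h6⟩ := hS w0 hw3
          have hs := (castHom_eq_iff hfd _ _).1 (hw2.trans hw4.symm)
          simp only [T, Finset.mem_product, Finset.mem_filter, Finset.mem_univ, true_and]
          refine ⟨?_, ?_, ?_⟩
          · have := dvd_add (dvd_sub h1 h4) (hs.mul_right a'); convert this using 1; ring
          · have := dvd_add (dvd_sub h2 h5) (hs.mul_right b'); convert this using 1; ring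
          · have := dvd_add (dvd_sub h3 h6) (hs.mul_right c'); convert this using 1; ring
      _ = g * (g * g) := by rw [Finset.card_product, Finset.card_product, hT, hT, hT]
  rw [Finset.card_univ, ZMod.card] at h1
  calc W.card ≤ _ := h1
    _ = g * f * g ^ 2 := by ring
    _ = d * g ^ 2 := by rw [← hf]

/-- Size of centralizers in terms of the level. -/
theorem card_centralizer_mul_totient_le (z : SL(2, ZMod d)) :
    (Finset.univ.filter fun y : SL(2, ZMod d) => y * z = z * y).card * d.totient
      ≤ 2 * d.divisors.card * (d ^ 2 * lvl z ^ 2) := by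
  set C := Finset.univ.filter fun y : SL(2, ZMod d) => y * z = z * y
  set W := Finset.univ.filter fun w : ZMod d × ZMod d × ZMod d =>
      w.1 * z 1 0 = w.2.1 * z 0 1 ∧ w.1 * (z 0 0 - z 1 1) = w.2.2 * z 0 1 ∧
      w.2.1 * (z 0 0 - z 1 1) = w.2.2 * z 1 0
  have hW : W.card ≤ d * lvl z ^ 2 := card_parallel_le _ _ _ _ rfl
  -- The traceless part of a commuting matrix is parallel to that of z, which bounds all commuting
  -- matrices by d·d·g². To use determinant one, each y is multiplied by all units u: the
  -- determinant of uy is u², so u is recovered up to 2τ(d) choices, and a factor φ(d) is gained.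
  have h1 : (C ×ˢ (Finset.univ : Finset (ZMod d)ˣ)).card ≤
      2 * d.divisors.card * ((Finset.univ : Finset (ZMod d)) ×ˢ W).card := by
    refine Finset.card_le_mul_card_image_of_maps_to
      (f := fun x => ((x.2 : ZMod d) * x.1 1 1, (x.2 : ZMod d) * x.1 0 1, (x.2 : ZMod d) * x.1 1 0,
        (x.2 : ZMod d) * (x.1 0 0 - x.1 1 1))) ?_ _ ?_
    · rintro ⟨y, u⟩ hy
      have hy' : y * z = z * y := (Finset.mem_filter.1 (Finset.mem_product.1 hy).1).2
      have e1 := congrArg (fun m : SL(2, ZMod d) => m 0 0) hy'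
      have e2 := congrArg (fun m : SL(2, ZMod d) => m 0 1) hy'
      have e3 := congrArg (fun m : SL(2, ZMod d) => m 1 0) hy'
      simp only [SL2_mul_apply] at e1 e2 e3
      simp only [Finset.mem_product, Finset.mem_univ, true_and, W, Finset.mem_filter]
      refine ⟨?_, ?_, ?_⟩
      · linear_combination (u : ZMod d) * e1
      · linear_combination -(u : ZMod d) * e2
      · linear_combination (u : ZMod d) * e3
    · rintro ⟨δ, β, γ, η⟩ -
      refine le_trans ?_ (card_unit_sq_eq_le ((η + δ) * δ - β * γ))
      refine Finset.card_le_card_of_injOn (fun x => x.2) ?_ ?_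
      · rintro ⟨y, u⟩ hy
        simp only [Finset.coe_filter, Set.mem_ofPred_eq, Prod.mk.injEq, Finset.mem_univ, true_and] at hy ⊢
        obtain ⟨-, rfl, rfl, rfl, rfl⟩ := hy
        linear_combination -(u : ZMod d) ^ 2 * SL2_det y
      · rintro ⟨y, u⟩ hy ⟨y', u'⟩ hy' huu
        simp only [Finset.coe_filter, Set.mem_ofPred_eq, Prod.mk.injEq] at hy hy' huu
        subst huu
        obtain ⟨-, e1, e2, e3, e4⟩ := hy
        obtain ⟨-, f1, f2, f3, f4⟩ := hy'
        have g1 := u.isUnit.mul_left_cancel (e1.trans f1.symm)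
        have g2 := u.isUnit.mul_left_cancel (e2.trans f2.symm)
        have g3 := u.isUnit.mul_left_cancel (e3.trans f3.symm)
        have g4 := u.isUnit.mul_left_cancel (e4.trans f4.symm)
        have : y = y' := SL2_ext (by linear_combination g4 + g1) g2 g3 g1
        rw [this]
  rw [Finset.card_product, Finset.card_product, Finset.card_univ, Finset.card_univ,
    ZMod.card_units_eq_totient, ZMod.card] at h1
  calc _ ≤ _ := h1
    _ ≤ 2 * d.divisors.card * (d * (d * lvl z ^ 2)) := by gcongr
    _ = _ := by ring

theorem card_centralizer_le (z : SL(2, ZMod d)) :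
    (Finset.univ.filter fun y : SL(2, ZMod d) => y * z = z * y).card
      ≤ 2 * d.divisors.card ^ 2 * d * lvl z ^ 2 := by
  have h := card_centralizer_mul_totient_le z
  have h2 := le_totient_mul_card_divisors d
  have hd0 : 0 < d := Nat.pos_of_ne_zero (NeZero.ne d)
  refine Nat.le_of_mul_le_mul_right (c := d) ?_ hd0
  calc _ ≤ _ * (d.totient * d.divisors.card) := Nat.mul_le_mul_left _ h2
    _ = (_ * d.totient) * d.divisors.card := by ring
    _ ≤ (2 * d.divisors.card * (d ^ 2 * lvl z ^ 2)) * d.divisors.card := Nat.mul_le_mul_right _ h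
    _ = _ := by ring

end Levels

/-! ### Averaging operators over conjugacy classes. -/

section ConjAverage

variable {G : Type*} [Group G] [Fintype G]

/-- The squared `ℓ²` norm. -/
noncomputable def nsq {X : Type*} [Fintype X] (φ : X → ℂ) : ℝ := ∑ x, ‖φ x‖ ^ 2

/-- Right convolution with the uniform measure on a conjugacy class. -/
noncomputable def conjAvg (h : G) : (G → ℂ) →ₗ[ℂ] (G → ℂ) where
  toFun φ x := (Fintype.card G : ℂ)⁻¹ * ∑ g, φ (x * (g * h * g⁻¹))
  map_add' φ ψ := by
    ext x; simp only [Pi.add_apply, Finset.sum_add_distrib, mul_add]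
  map_smul' c φ := by
    ext x; simp only [Pi.smul_apply, smul_eq_mul, ← Finset.mul_sum, RingHom.id_apply]; ring

theorem conjAvg_apply (h : G) (φ : G → ℂ) (x : G) :
    conjAvg h φ x = (Fintype.card G : ℂ)⁻¹ * ∑ g, φ (x * (g * h * g⁻¹)) := rfl

theorem conjAvg_mul_left (h a : G) (φ : G → ℂ) (x : G) :
    conjAvg h (fun y => φ (a * y)) x = conjAvg h φ (a * x) := by
  simp only [conjAvg_apply, mul_assoc]

theorem conjAvg_mul_right (h b : G) (φ : G → ℂ) (x : G) :
    conjAvg h (fun y => φ (y * b)) x = conjAvg h φ (x * b) := by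
  simp only [conjAvg_apply]
  congr 1
  refine Fintype.sum_equiv (Equiv.mulLeft b⁻¹) _ _ fun g => ?_
  congr 1
  simp only [Equiv.coe_mulLeft]
  group

theorem nsq_nonneg {X : Type*} [Fintype X] (φ : X → ℂ) : 0 ≤ nsq φ :=
  Finset.sum_nonneg fun _ _ => by positivity

theorem nsq_comp {X : Type*} [Fintype X] (φ : X → ℂ) (e : X ≃ X) : nsq (fun x => φ (e x)) = nsq φ :=
  Fintype.sum_equiv e _ _ fun _ => rfl

theorem nsq_eq_zero {X : Type*} [Fintype X] {φ : X → ℂ} (h : nsq φ = 0) : φ = 0 := by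
  funext x
  have := (Finset.sum_eq_zero_iff_of_nonneg (fun x _ => by positivity)).1 h x (Finset.mem_univ x)
  simpa using this

theorem nsq_smul {X : Type*} [Fintype X] (c : ℂ) (φ : X → ℂ) : nsq (c • φ) = ‖c‖ ^ 2 * nsq φ := by
  simp only [nsq, Pi.smul_apply, norm_smul, mul_pow, Finset.mul_sum]

theorem nsq_parallelogram {X : Type*} [Fintype X] (φ ψ : X → ℂ) :
    nsq (φ + ψ) + nsq (φ - ψ) = 2 * (nsq φ + nsq ψ) := by
  simp only [nsq, ← Finset.sum_add_distrib, Finset.mul_sum, Pi.add_apply, Pi.sub_apply]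
  refine Finset.sum_congr rfl fun x _ => ?_
  have := parallelogram_law_with_norm ℂ (φ x) (ψ x)
  linear_combination this

theorem continuous_nsq {X : Type*} [Fintype X] : Continuous (nsq : (X → ℂ) → ℝ) := by
  unfold nsq; fun_prop

/-- The vectors on which an operator attains its norm on a subspace form a nonzero subspace. -/
theorem exists_top_space {X : Type*} [Fintype X] (T : (X → ℂ) →ₗ[ℂ] (X → ℂ)) (E : Submodule ℂ (X → ℂ))
    (hE : E ≠ ⊥) : ∃ m : ℝ, 0 ≤ m ∧ (∀ φ ∈ E, nsq (T φ) ≤ m * nsq φ) ∧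
      ∃ W : Submodule ℂ (X → ℂ), W ≠ ⊥ ∧ ∀ φ, φ ∈ W ↔ φ ∈ E ∧ nsq (T φ) = m * nsq φ := by
  set S : Set (X → ℂ) := (E : Set (X → ℂ)) ∩ {φ | nsq φ = 1}
  have hnorm : ∀ φ ∈ E, φ ≠ 0 → ((((Real.sqrt (nsq φ))⁻¹ : ℝ) : ℂ)) • φ ∈ S := by
    intro φ hφ h0
    have hpos : 0 < nsq φ := lt_of_le_of_ne (nsq_nonneg φ) fun h => h0 (nsq_eq_zero h.symm)
    refine ⟨E.smul_mem _ hφ, ?_⟩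
    rw [Set.mem_ofPred_eq, nsq_smul, Complex.norm_real, Real.norm_eq_abs, sq_abs, inv_pow,
      Real.sq_sqrt hpos.le, inv_mul_cancel₀ hpos.ne']
  have hS : IsCompact S := by
    refine Metric.isCompact_of_isClosed_isBounded ?_ ?_
    · exact (Submodule.closed_of_finiteDimensional E).inter (isClosed_eq continuous_nsq continuous_const)
    · refine (Metric.isBounded_closedBall (x := (0 : X → ℂ)) (r := 1)).subset fun φ hφ => ?_
      rw [mem_closedBall_zero_iff, pi_norm_le_iff_of_nonneg zero_le_one]
      intro x
      have h1 : nsq φ = 1 := hφ.2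
      have h2 : ‖φ x‖ ^ 2 ≤ nsq φ :=
        Finset.single_le_sum (f := fun x => ‖φ x‖ ^ 2) (fun _ _ => by positivity) (Finset.mem_univ x)
      nlinarith [norm_nonneg (φ x)]
  obtain ⟨φ0, hφ0, hne⟩ := Submodule.exists_mem_ne_zero_of_ne_bot hE
  have hTc : Continuous fun φ => nsq (T φ) := continuous_nsq.comp T.continuous_of_finiteDimensional
  obtain ⟨w, hw, hmax⟩ := hS.exists_isMaxOn ⟨_, hnorm φ0 hφ0 hne⟩ hTc.continuousOn
  have hle : ∀ φ ∈ E, nsq (T φ) ≤ nsq (T w) * nsq φ := by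
    intro φ hφ
    by_cases h0 : φ = 0
    · subst h0; simp [nsq]
    have hpos : 0 < nsq φ := lt_of_le_of_ne (nsq_nonneg φ) fun h => h0 (nsq_eq_zero h.symm)
    have := hmax (hnorm φ hφ h0)
    simp only [Set.mem_ofPred_eq, map_smul] at this
    rw [nsq_smul, Complex.norm_real, Real.norm_eq_abs, sq_abs, inv_pow, Real.sq_sqrt hpos.le,
      inv_mul_le_iff₀ hpos] at this
    linarith
  refine ⟨nsq (T w), nsq_nonneg _, hle, ⟨⟨⟨{φ | φ ∈ E ∧ nsq (T φ) = nsq (T w) * nsq φ}, ?_⟩, ?_⟩, ?_⟩, ?_, ?_⟩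
  -- By the parallelogram law for φ, ψ and for their images, the bounds at φ + ψ and φ - ψ add up to
  -- an equality, so each is an equality.
  · rintro φ ψ ⟨h1, h2⟩ ⟨h3, h4⟩
    refine ⟨E.add_mem h1 h3, ?_⟩
    have e1 := hle _ (E.add_mem h1 h3)
    have e2 := hle _ (E.sub_mem h1 h3)
    have e3 := nsq_parallelogram φ ψ
    have e4 := nsq_parallelogram (T φ) (T ψ)
    rw [← map_add, ← map_sub] at e4
    rw [h2, h4] at e4
    have e5 : nsq (T w) * nsq (φ + ψ) + nsq (T w) * nsq (φ - ψ)
        = 2 * (nsq (T w) * nsq φ + nsq (T w) * nsq ψ) := by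
      rw [← mul_add, e3]; ring
    linarith
  · simp [nsq]
  · rintro c φ ⟨h1, h2⟩
    refine ⟨E.smul_mem _ h1, ?_⟩
    rw [map_smul, nsq_smul, nsq_smul, h2]; ring
  · rw [Submodule.ne_bot_iff]
    refine ⟨w, ⟨hw.1, ?_⟩, ?_⟩
    · have : nsq w = 1 := hw.2
      rw [this, mul_one]
    · rintro rfl
      have : nsq (0 : X → ℂ) = 1 := hw.2
      simp [nsq] at this
  · intro φ; rfl

/-- Bessel's inequality for an orthogonal family of common squared norm c. -/
theorem sum_norm_sq_inner_le {X ι : Type*} [Fintype X] [Fintype ι] (w : ι → X → ℂ) (c : ℝ) (hc : 0 < c)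
    (hn : ∀ i, nsq (w i) = c) (ho : ∀ i j, i ≠ j → ∑ x, (starRingEnd ℂ) (w i x) * w j x = 0)
    (v : X → ℂ) : ∑ i, ‖∑ x, (starRingEnd ℂ) (w i x) * v x‖ ^ 2 ≤ c * nsq v := by
  set s : ℂ := (((Real.sqrt c)⁻¹ : ℝ) : ℂ)
  have hs : ‖s‖ ^ 2 = c⁻¹ := by
    rw [Complex.norm_real, Real.norm_eq_abs, sq_abs, inv_pow, Real.sq_sqrt hc.le]
  have hinner : ∀ a b : X → ℂ, inner ℂ (WithLp.toLp 2 a : EuclideanSpace ℂ X) (WithLp.toLp 2 b) =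
      ∑ x, (starRingEnd ℂ) (a x) * b x := by
    intro a b
    rw [PiLp.inner_apply]
    refine Finset.sum_congr rfl fun x _ => ?_
    simp [mul_comm]
  have hnsq : ∀ a : X → ℂ, ‖(WithLp.toLp 2 a : EuclideanSpace ℂ X)‖ ^ 2 = nsq a := by
    intro a
    rw [EuclideanSpace.norm_sq_eq]; rfl
  have hort : Orthonormal ℂ fun i => (WithLp.toLp 2 (s • w i) : EuclideanSpace ℂ X) := by
    constructor
    · intro i
      have : ‖(WithLp.toLp 2 (s • w i) : EuclideanSpace ℂ X)‖ ^ 2 = 1 := by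
        rw [hnsq, nsq_smul, hs, hn, inv_mul_cancel₀ hc.ne']
      nlinarith [norm_nonneg (WithLp.toLp 2 (s • w i) : EuclideanSpace ℂ X)]
    · intro i j hij
      change inner ℂ (WithLp.toLp 2 (s • w i) : EuclideanSpace ℂ X) (WithLp.toLp 2 (s • w j)) = 0
      rw [hinner]
      have := ho i j hij
      simp only [Pi.smul_apply, smul_eq_mul, map_mul]
      calc _ = ∑ x, ((starRingEnd ℂ) s * s) * ((starRingEnd ℂ) (w i x) * w j x) :=
            Finset.sum_congr rfl fun x _ => by ring
        _ = 0 := by rw [← Finset.mul_sum, this, mul_zero]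
  have hb := hort.sum_inner_products_le (s := Finset.univ) (WithLp.toLp 2 v : EuclideanSpace ℂ X)
  rw [hnsq] at hb
  have : ∀ i, ‖inner ℂ (WithLp.toLp 2 (s • w i) : EuclideanSpace ℂ X) (WithLp.toLp 2 v)‖ ^ 2
      = c⁻¹ * ‖∑ x, (starRingEnd ℂ) (w i x) * v x‖ ^ 2 := by
    intro i
    rw [hinner, ← hs, ← Complex.norm_conj s, ← mul_pow, ← norm_mul, Finset.mul_sum]
    congr 2
    refine Finset.sum_congr rfl fun x _ => ?_
    simp only [Pi.smul_apply, smul_eq_mul, map_mul]; ring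
  rw [Finset.sum_congr rfl fun i _ => this i, ← Finset.mul_sum, inv_mul_le_iff₀ hc] at hb
  exact hb

/-- The left side counts pairs (g, x) giving the same conjugate of h, and for such a pair g⁻¹x
centralizes h. -/
theorem card_conj_fiber_sq (h : G) :
    ∑ u : G, ((Finset.univ.filter fun g : G => g * h * g⁻¹ = u).card) ^ 2
      = Fintype.card G * (Finset.univ.filter fun y : G => y * h = h * y).card := by
  set n : G → ℕ := fun u => (Finset.univ.filter fun g : G => g * h * g⁻¹ = u).card
  have h1 : ∑ u : G, n u ^ 2 = ∑ g : G, n (g * h * g⁻¹) := by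
    rw [← Finset.sum_fiberwise Finset.univ (fun g : G => g * h * g⁻¹) (fun g => n (g * h * g⁻¹))]
    refine Finset.sum_congr rfl fun u _ => ?_
    have : ∀ g ∈ Finset.univ.filter (fun g : G => g * h * g⁻¹ = u), n (g * h * g⁻¹) = n u :=
      fun g hg => by rw [(Finset.mem_filter.1 hg).2]
    rw [Finset.sum_congr rfl this, Finset.sum_const, smul_eq_mul, sq]
  rw [h1, Finset.sum_congr rfl (g := fun _ => (Finset.univ.filter fun y : G => y * h = h * y).card),
    Finset.sum_const, Finset.card_univ, smul_eq_mul]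
  intro g _
  refine Finset.card_bij (fun x _ => g⁻¹ * x) ?_ ?_ ?_
  · intro x hx
    simp only [Finset.mem_filter, Finset.mem_univ, true_and] at hx ⊢
    calc g⁻¹ * x * h = g⁻¹ * (x * h * x⁻¹) * x := by group
      _ = h * (g⁻¹ * x) := by rw [hx]; group
  · intro x _ y _ hxy; exact mul_left_cancel hxy
  · intro y hy
    simp only [Finset.mem_filter, Finset.mem_univ, true_and] at hy
    refine ⟨g * y, ?_, by group⟩
    simp only [Finset.mem_filter, Finset.mem_univ, true_and]
    calc g * y * h * (g * y)⁻¹ = g * (y * h) * y⁻¹ * g⁻¹ := by group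
      _ = g * h * g⁻¹ := by rw [hy]; group

/-- Hilbert–Schmidt bound for averages over a conjugacy class. -/
theorem sum_nsq_conjAvg_le {ι : Type*} [Fintype ι] (h : G) (w : ι → G → ℂ) (c : ℝ) (hc : 0 < c)
    (hn : ∀ i, nsq (w i) = c) (ho : ∀ i j, i ≠ j → ∑ x, (starRingEnd ℂ) (w i x) * w j x = 0) :
    ∑ i, nsq (conjAvg h (w i)) ≤
      c * (Finset.univ.filter fun y : G => y * h = h * y).card := by
  set n : G → ℕ := fun u => (Finset.univ.filter fun g : G => g * h * g⁻¹ = u).card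
  have hN : (0 : ℝ) < Fintype.card G := by exact_mod_cast Fintype.card_pos
  have hT : ∀ (φ : G → ℂ) (y : G), conjAvg h φ y = (Fintype.card G : ℂ)⁻¹ * ∑ x, n (y⁻¹ * x) * φ x := by
    intro φ y
    rw [conjAvg_apply]
    congr 1
    rw [← Finset.sum_fiberwise Finset.univ (fun g : G => y * (g * h * g⁻¹))]
    refine Finset.sum_congr rfl fun x _ => ?_
    rw [Finset.sum_congr rfl fun g hg => show φ (y * (g * h * g⁻¹)) = φ x by rw [(Finset.mem_filter.1 hg).2],
      Finset.sum_const, nsmul_eq_mul]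
    congr 3
    ext g
    simp only [Finset.mem_filter, Finset.mem_univ, true_and]
    rw [eq_inv_mul_iff_mul_eq]
  -- Bessel is applied to the row of the convolution kernel at y. All rows have the same norm, and
  -- their sum is the squared Hilbert–Schmidt norm, equal to the order of the centralizer of h.
  have hrow : ∀ y : G, ∑ i, ‖conjAvg h (w i) y‖ ^ 2 ≤
      ((Fintype.card G : ℝ)⁻¹) ^ 2 * (c * ∑ u, (n u : ℝ) ^ 2) := by
    intro y
    have hb := sum_norm_sq_inner_le w c hc hn ho (fun x => (n (y⁻¹ * x) : ℂ))
    have h1 : nsq (fun x => (n (y⁻¹ * x) : ℂ)) = ∑ u, (n u : ℝ) ^ 2 := by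
      refine Fintype.sum_equiv (Equiv.mulLeft y⁻¹) _ _ fun x => ?_
      simp
    rw [h1] at hb
    calc ∑ i, ‖conjAvg h (w i) y‖ ^ 2
        = ((Fintype.card G : ℝ)⁻¹) ^ 2 * ∑ i, ‖∑ x, (starRingEnd ℂ) (w i x) * (n (y⁻¹ * x) : ℂ)‖ ^ 2 := by
          rw [Finset.mul_sum]
          refine Finset.sum_congr rfl fun i _ => ?_
          rw [hT, norm_mul, mul_pow, norm_inv, Complex.norm_natCast]
          congr 2
          rw [← Complex.norm_conj, map_sum]
          congr 1
          refine Finset.sum_congr rfl fun x _ => ?_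
          rw [map_mul, Complex.conj_natCast, mul_comm]
      _ ≤ _ := by gcongr
  have h2 : ∑ u, (n u : ℝ) ^ 2 = Fintype.card G * (Finset.univ.filter fun y : G => y * h = h * y).card := by
    exact_mod_cast card_conj_fiber_sq h
  unfold nsq
  rw [Finset.sum_comm]
  calc ∑ y, ∑ i, ‖conjAvg h (w i) y‖ ^ 2 ≤ ∑ y : G, ((Fintype.card G : ℝ)⁻¹) ^ 2 * (c * ∑ u, (n u : ℝ) ^ 2) :=
        Finset.sum_le_sum fun y _ => hrow y
    _ = _ := by
      rw [Finset.sum_const, Finset.card_univ, nsmul_eq_mul, h2]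
      field_simp

end ConjAverage

/-! ### Elementary and diagonal matrices. -/

section Elementary

variable {R : Type*} [CommRing R]

/-- Upper unipotent matrix. -/
def uU (t : R) : SL(2, R) := ⟨!![1, t; 0, 1], by simp [Matrix.det_fin_two_of]⟩

/-- Lower unipotent matrix. -/
def uV (t : R) : SL(2, R) := ⟨!![1, 0; t, 1], by simp [Matrix.det_fin_two_of]⟩

/-- Diagonal matrix. -/
def dD (u : Rˣ) : SL(2, R) := ⟨!![(u : R), 0; 0, (u⁻¹ : Rˣ)], by simp [Matrix.det_fin_two_of]⟩

@[simp] theorem uU_00 (t : R) : (uU t) 0 0 = 1 := rfl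
@[simp] theorem uU_01 (t : R) : (uU t) 0 1 = t := rfl
@[simp] theorem uU_10 (t : R) : (uU t) 1 0 = 0 := rfl
@[simp] theorem uU_11 (t : R) : (uU t) 1 1 = 1 := rfl
@[simp] theorem uV_00 (t : R) : (uV t) 0 0 = 1 := rfl
@[simp] theorem uV_01 (t : R) : (uV t) 0 1 = 0 := rfl
@[simp] theorem uV_10 (t : R) : (uV t) 1 0 = t := rfl
@[simp] theorem uV_11 (t : R) : (uV t) 1 1 = 1 := rfl
@[simp] theorem dD_00 (u : Rˣ) : (dD u) 0 0 = (u : R) := rfl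
@[simp] theorem dD_01 (u : Rˣ) : (dD u) 0 1 = 0 := rfl
@[simp] theorem dD_10 (u : Rˣ) : (dD u) 1 0 = 0 := rfl
@[simp] theorem dD_11 (u : Rˣ) : (dD u) 1 1 = ((u⁻¹ : Rˣ) : R) := rfl

theorem uU_add (s t : R) : uU (s + t) = uU s * uU t := by
  refine SL2_ext ?_ ?_ ?_ ?_ <;> simp [SL2_mul_apply, add_comm]

theorem uV_add (s t : R) : uV (s + t) = uV s * uV t := by
  refine SL2_ext ?_ ?_ ?_ ?_ <;> simp [SL2_mul_apply]

theorem uU_zero : uU (0 : R) = 1 := by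
  refine SL2_ext ?_ ?_ ?_ ?_ <;> simp

theorem uV_zero : uV (0 : R) = 1 := by
  refine SL2_ext ?_ ?_ ?_ ?_ <;> simp

theorem uU_neg (t : R) : uU (-t) = (uU t)⁻¹ := by
  rw [eq_inv_iff_mul_eq_one, ← uU_add, neg_add_cancel, uU_zero]

theorem uV_neg (t : R) : uV (-t) = (uV t)⁻¹ := by
  rw [eq_inv_iff_mul_eq_one, ← uV_add, neg_add_cancel, uV_zero]

theorem dD_mul_uU (u : Rˣ) (s : R) : dD u * uU s = uU ((u : R) ^ 2 * s) * dD u := by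
  refine SL2_ext ?_ ?_ ?_ ?_ <;> simp [SL2_mul_apply]
  linear_combination (-(u : R) * s) * u.mul_inv

theorem conj_uU (t : R) : ((uU 1 * uV (-1) * uU 1) * uU t * (uU 1 * uV (-1) * uU 1)⁻¹ : SL(2, R)) = uV (-t) := by
  rw [mul_inv_eq_iff_eq_mul]
  refine SL2_ext ?_ ?_ ?_ ?_ <;> simp [SL2_mul_apply]

/-- Expresses a diagonal matrix through unipotents whose parameters are multiples of x and a
conjugate of one of them, so that diagonal matrices lie in the normal closure of small unipotents.
-/
theorem conj_uU_lower (x : R) (u : Rˣ) (hu : (u : R) = 1 - x) :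
    dD u = uV (x * (u⁻¹ : Rˣ)) * (uV 1 * uU x * (uV 1)⁻¹) * uU (-(x * (u⁻¹ : Rˣ))) := by
  have h := u.mul_inv
  rw [← uV_neg]
  rw [hu] at h
  refine SL2_ext ?_ ?_ ?_ ?_
  · simp [SL2_mul_apply, hu]; ring
  · simp [SL2_mul_apply]; linear_combination x * h
  · simp [SL2_mul_apply]; linear_combination (-x) * h
  · simp [SL2_mul_apply]
    linear_combination (1 + x + x ^ 2 * ((u⁻¹ : Rˣ) : R)) * h

theorem eq_uV_dD_uU (z : SL(2, R)) (u : Rˣ) (hu : (u : R) = z 0 0) :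
    z = uV (z 1 0 * (u⁻¹ : Rˣ)) * dD u * uU ((u⁻¹ : Rˣ) * z 0 1) := by
  have h := u.mul_inv
  have hd : z 0 0 * z 1 1 - z 0 1 * z 1 0 = 1 := by
    have := z.2
    rwa [Matrix.det_fin_two] at this
  rw [hu] at h
  refine SL2_ext ?_ ?_ ?_ ?_
  · simp [SL2_mul_apply, hu]
  · simp [SL2_mul_apply, hu]; linear_combination (-z 0 1) * h
  · simp [SL2_mul_apply, hu]; linear_combination (-z 1 0) * h
  · simp [SL2_mul_apply, hu]
    linear_combination (((u⁻¹ : Rˣ) : R)) * hd + (-z 1 1 - z 1 0 * z 0 1 * ((u⁻¹ : Rˣ) : R)) * h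

end Elementary

/-! ### Spectral gap on the new part of functions on SL₂(ℤ/pⁿ). -/

section PrimePower

variable {p n : ℕ}

theorem isUnit_zmod_prime_pow (hp : p.Prime) (hn : 0 < n) (x : ZMod (p ^ n)) :
    IsUnit x ↔ ¬ ((p : ℕ) : ZMod (p ^ n)) ∣ x := by
  have : NeZero (p ^ n) := ⟨(pow_pos hp.pos n).ne'⟩
  rw [natCast_dvd_iff (dvd_pow_self p hn.ne')]
  conv_lhs => rw [← ZMod.natCast_zmod_val x]
  rw [ZMod.isUnit_iff_coprime, Nat.coprime_pow_right_iff hn, Nat.coprime_comm,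
    hp.coprime_iff_not_dvd]

/-- The normal closure of the last unipotent subgroup is the last congruence subgroup. -/
theorem mem_of_cong_last (hp : p.Prime) (hn : 0 < n) (H : Subgroup SL(2, ZMod (p ^ n))) [H.Normal]
    (hU : ∀ t, uU (((p ^ (n - 1) : ℕ) : ZMod (p ^ n)) * t) ∈ H) (z : SL(2, ZMod (p ^ n)))
    (hz : Cong (p ^ (n - 1)) z 1) : z ∈ H := by
  set π := ((p ^ (n - 1) : ℕ) : ZMod (p ^ n)) with hπ
  have hV : ∀ t, uV (π * t) ∈ H := by
    intro t
    have := Subgroup.Normal.conj_mem (inferInstance : H.Normal) _ (hU (-t)) (uU 1 * uV (-1) * uU 1)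
    rw [conj_uU] at this
    convert this using 2; ring
  have hD : ∀ (u : (ZMod (p ^ n))ˣ) (t), (u : ZMod (p ^ n)) = 1 - π * t → dD u ∈ H := by
    intro u t hu
    rw [conj_uU_lower _ u hu]
    refine H.mul_mem (H.mul_mem ?_ (Subgroup.Normal.conj_mem inferInstance _ (hU t) _)) ?_
    · rw [mul_assoc]; exact hV _
    · rw [mul_assoc, ← mul_neg]; exact hU _
  have main : ∀ z : SL(2, ZMod (p ^ n)), Cong (p ^ (n - 1)) z 1 → IsUnit (z 0 0) → z ∈ H := by
    intro z hz hu
    obtain ⟨u, hu⟩ := hu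
    rw [eq_uV_dD_uU z u hu]
    obtain ⟨a, ha⟩ := hz 0 0
    obtain ⟨b, hb⟩ := hz 0 1
    obtain ⟨c, hc⟩ := hz 1 0
    simp only [Matrix.SpecialLinearGroup.coe_one, Matrix.one_apply_eq, ne_eq, zero_ne_one, one_ne_zero,
      not_false_eq_true, Matrix.one_apply_ne, sub_zero] at ha hb hc
    refine H.mul_mem (H.mul_mem ?_ (hD u (-a) ?_)) ?_
    · rw [hc, mul_assoc]; exact hV _
    · rw [hu, hπ]; linear_combination ha
    · rw [hb, mul_left_comm]; exact hU _
  by_cases h1 : IsUnit (z 0 0)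
  · exact main z hz h1
  -- For n = 1 the last congruence subgroup is the whole group and the upper left entry may vanish;
  -- then the lower left one does not, and `uU 1` repairs it. For n > 1 that entry is 1 modulo p,
  -- hence a unit.
  rcases Nat.eq_or_lt_of_le hn with hn1 | hn1
  · have hπ1 : π = 1 := by rw [hπ, ← hn1]; simp
    have h2 : IsUnit ((uU 1 * z : SL(2, ZMod (p ^ n))) 0 0) := by
      rw [isUnit_zmod_prime_pow hp hn] at h1 ⊢
      push Not at h1
      intro h3
      simp only [SL2_mul_apply, uU_00, uU_01, one_mul] at h3
      have h4 := (dvd_add_right h1).1 h3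
      have h5 := dvd_sub (h1.mul_right (z 1 1)) (h4.mul_left (z 0 1))
      rw [SL2_det z] at h5
      exact (isUnit_zmod_prime_pow hp hn 1).1 isUnit_one h5
    have h3 : uU 1 * z ∈ H := main _ (fun i j => by
      change π ∣ _; rw [hπ1]; exact one_dvd _) h2
    have h4 := hU 1
    rw [hπ1, mul_one] at h4
    exact (Subgroup.mul_mem_cancel_left H h4).1 h3
  · exfalso
    refine h1 ((isUnit_zmod_prime_pow hp hn _).2 fun h => ?_)
    have h2 := hz 0 0
    have h3 : ((p : ℕ) : ZMod (p ^ n)) ∣ ((p ^ (n - 1) : ℕ) : ZMod (p ^ n)) :=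
      Nat.cast_dvd_cast (dvd_pow_self p (by omega))
    have h4 := dvd_sub h (h3.trans h2)
    simp only [Matrix.SpecialLinearGroup.coe_one, Matrix.one_apply_eq, sub_sub_cancel] at h4
    exact (isUnit_zmod_prime_pow hp hn 1).1 isUnit_one h4

/-- A representation on functions without vectors fixed by the last congruence subgroup contains
an eigenvector of the unipotent subgroup with a primitive character. -/
theorem exists_unipotent_eigenvector (hp : p.Prime) (hn : 0 < n) [NeZero (p ^ n)] {X : Type*}
    (act : SL(2, ZMod (p ^ n)) →* Equiv.Perm X) (W : Submodule ℂ (X → ℂ)) (hW : W ≠ ⊥)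
    (hinv : ∀ φ ∈ W, ∀ g, (fun x => φ (act g x)) ∈ W)
    (hfix : ∀ φ ∈ W, (∀ k, Cong (p ^ (n - 1)) k 1 → ∀ x, φ (act k x) = φ x) → φ = 0) :
    ∃ α : ZMod (p ^ n), IsUnit α ∧ ∃ w ∈ W, w ≠ 0 ∧
      ∀ s x, w (act (uU s) x) = ZMod.stdAddChar (α * s) * w x := by
  set ψ : AddChar (ZMod (p ^ n)) ℂ := ZMod.stdAddChar
  -- Up to the factor pⁿ, the projections onto the characters of the unipotent subgroup.
  set P : ZMod (p ^ n) → (X → ℂ) → X → ℂ := fun α w x => ∑ s, ψ (-(α * s)) * w (act (uU s) x)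
  have hP : ∀ α, ∀ w ∈ W, P α w ∈ W := by
    intro α w hw
    have : P α w = ∑ s, ψ (-(α * s)) • (fun x => w (act (uU s) x)) := by
      ext x; simp [P]
    rw [this]
    exact W.sum_mem fun s _ => W.smul_mem _ (hinv w hw _)
  have hPc : ∀ α w s x, P α w (act (uU s) x) = ψ (α * s) * P α w x := by
    intro α w s x
    simp only [P, Finset.mul_sum]
    refine Fintype.sum_equiv (Equiv.addRight s) _ _ fun t => ?_
    rw [Equiv.coe_addRight, uU_add, map_mul act, Equiv.Perm.mul_apply, ← mul_assoc, ← AddChar.map_add_eq_mul]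
    congr 2; ring
  have hsum : ∀ w x, ∑ α, P α w x = (Fintype.card (ZMod (p ^ n)) : ℂ) * w x := by
    intro w x
    simp only [P]
    rw [Finset.sum_comm]
    have h1 : ∀ s : ZMod (p ^ n), ∑ α, ψ (-(α * s)) * w (act (uU s) x) =
        if s = 0 then (Fintype.card (ZMod (p ^ n)) : ℂ) * w x else 0 := by
      intro s
      rw [← Finset.sum_mul]
      have := AddChar.sum_mulShift (-s) (ZMod.isPrimitive_stdAddChar (p ^ n))
      simp only [mul_neg, neg_eq_zero] at this
      rw [this]
      split_ifs with h
      · rw [h, uU_zero]; simp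
      · simp
    rw [Finset.sum_congr rfl fun s _ => h1 s, Finset.sum_ite_eq' Finset.univ (0 : ZMod (p ^ n))]
    simp
  by_contra hcon
  push Not at hcon
  have h0 : ∀ α, IsUnit α → ∀ w ∈ W, P α w = 0 := by
    intro α hα w hw
    by_contra hne
    obtain ⟨s, x, h⟩ := hcon α hα (P α w) (hP α w hw) hne
    exact h (hPc α w s x)
  have hq : (Fintype.card (ZMod (p ^ n)) : ℂ) ≠ 0 := by
    exact_mod_cast Fintype.card_ne_zero
  let H : Subgroup SL(2, ZMod (p ^ n)) :=
    { carrier := {k | ∀ w ∈ W, ∀ x, w (act k x) = w x}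
      one_mem' := fun w _ x => by simp
      mul_mem' := fun {a b} ha hb w hw x => by
        rw [map_mul, Equiv.Perm.mul_apply, ha w hw, hb w hw]
      inv_mem' := fun {a} ha w hw x => by
        have := ha w hw (act a⁻¹ x)
        rw [← Equiv.Perm.mul_apply, ← map_mul, mul_inv_cancel, map_one, Equiv.Perm.one_apply] at this
        exact this.symm }
  have hHn : H.Normal := ⟨fun k hk g w hw x => by
    rw [map_mul, map_mul, Equiv.Perm.mul_apply, Equiv.Perm.mul_apply,
      hk _ (hinv w hw g) (act g⁻¹ x), ← Equiv.Perm.mul_apply, ← map_mul, mul_inv_cancel, map_one,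
      Equiv.Perm.one_apply]⟩
  -- If no primitive character occurs, only α divisible by p remain, and these are trivial on
  -- multiples of p^(n-1). The kernel H of the action on W is normal, so it contains the whole last
  -- congruence subgroup, contradicting the absence of fixed vectors.
  have hU : ∀ t, uU (((p ^ (n - 1) : ℕ) : ZMod (p ^ n)) * t) ∈ H := by
    intro t w hw x
    refine mul_left_cancel₀ hq ?_
    rw [← hsum, ← hsum]
    refine Finset.sum_congr rfl fun α _ => ?_
    by_cases hα : IsUnit α
    · rw [h0 α hα w hw]; rfl
    · rw [hPc]
      rw [isUnit_zmod_prime_pow hp hn, not_not] at hα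
      obtain ⟨β, rfl⟩ := hα
      have : ((p : ℕ) : ZMod (p ^ n)) * β * (((p ^ (n - 1) : ℕ) : ZMod (p ^ n)) * t) = 0 := by
        have h3 : ((p : ℕ) : ZMod (p ^ n)) * ((p ^ (n - 1) : ℕ) : ZMod (p ^ n)) = 0 := by
          rw [← Nat.cast_mul, ← pow_succ', Nat.sub_add_cancel hn, ZMod.natCast_self]
        linear_combination (β * t) * h3
      rw [this, AddChar.map_zero_eq_one, one_mul]
  obtain ⟨w, hw, hw0⟩ := Submodule.exists_mem_ne_zero_of_ne_bot hW
  exact hw0 (hfix w hw fun k hk x => mem_of_cong_last hp hn H hU k hk w hw x)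

theorem sum_conj_mul_eq_zero {X : Type*} [Fintype X] (e : Equiv.Perm X) (w₁ w₂ : X → ℂ) (c₁ c₂ : ℂ)
    (h₁ : ∀ x, w₁ (e x) = c₁ * w₁ x) (h₂ : ∀ x, w₂ (e x) = c₂ * w₂ x)
    (hc : (starRingEnd ℂ) c₁ * c₂ ≠ 1) : ∑ x, (starRingEnd ℂ) (w₁ x) * w₂ x = 0 := by
  have h : ∑ x, (starRingEnd ℂ) (w₁ x) * w₂ x
      = ((starRingEnd ℂ) c₁ * c₂) * ∑ x, (starRingEnd ℂ) (w₁ x) * w₂ x := by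
    rw [Finset.mul_sum]
    conv_lhs => rw [← Equiv.sum_comp e]
    refine Finset.sum_congr rfl fun x _ => ?_
    rw [h₁, h₂, map_mul]; ring
  have h' : (1 - (starRingEnd ℂ) c₁ * c₂) * ∑ x, (starRingEnd ℂ) (w₁ x) * w₂ x = 0 := by
    rw [sub_mul, one_mul, sub_eq_zero]; exact h
  exact (mul_eq_zero.1 h').resolve_left (sub_ne_zero.2 hc.symm)

theorem nsq_conjAvg_le_self {G : Type*} [Group G] [Fintype G] (h : G) (φ : G → ℂ) :
    nsq (conjAvg h φ) ≤ nsq φ := by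
  have hN : (0 : ℝ) < Fintype.card G := by exact_mod_cast Fintype.card_pos
  have h1 : ∀ x, ‖conjAvg h φ x‖ ^ 2 ≤ (Fintype.card G : ℝ)⁻¹ * ∑ g, ‖φ (x * (g * h * g⁻¹))‖ ^ 2 := by
    intro x
    rw [conjAvg_apply, norm_mul, mul_pow, norm_inv, Complex.norm_natCast]
    have h2 : ‖∑ g, φ (x * (g * h * g⁻¹))‖ ^ 2 ≤ Fintype.card G * ∑ g, ‖φ (x * (g * h * g⁻¹))‖ ^ 2 := by
      refine (pow_le_pow_left₀ (norm_nonneg _) (norm_sum_le _ _) 2).trans ?_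
      exact sq_sum_le_card_mul_sum_sq
    calc _ ≤ ((Fintype.card G : ℝ)⁻¹) ^ 2 * (Fintype.card G * ∑ g, ‖φ (x * (g * h * g⁻¹))‖ ^ 2) := by gcongr
      _ = _ := by field_simp
  calc nsq (conjAvg h φ) ≤ ∑ x, (Fintype.card G : ℝ)⁻¹ * ∑ g, ‖φ (x * (g * h * g⁻¹))‖ ^ 2 :=
        Finset.sum_le_sum fun x _ => h1 x
    _ = (Fintype.card G : ℝ)⁻¹ * ∑ g : G, nsq φ := by
        rw [← Finset.mul_sum, Finset.sum_comm]
        congr 1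
        exact Finset.sum_congr rfl fun g _ => nsq_comp φ (Equiv.mulRight (g * h * g⁻¹))
    _ = nsq φ := by
        rw [Finset.sum_const, Finset.card_univ, nsmul_eq_mul, inv_mul_cancel_left₀ hN.ne']

theorem Cong.conj {d e : ℕ} {k : SL(2, ZMod d)} [NeZero d] (h : e ∣ d) (hk : Cong e k 1) (g : SL(2, ZMod d)) :
    Cong e (g * k * g⁻¹) 1 := by
  rw [← reduction_eq_iff h] at hk ⊢
  rw [map_mul, map_mul, hk, map_one, mul_one, map_inv, mul_inv_cancel]

-- The operator commutes with left and right translations, so the space W where it attains its norm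
-- on the new functions is stable under both. W contains a vector with primitive characters under
-- the left and the right unipotents; translating it by diagonal matrices on both sides multiplies
-- the two characters by arbitrary squares of units. This produces |S|² orthogonal vectors in W of
-- equal norm, and the Hilbert–Schmidt bound limits their number times the squared operator norm by
-- the order of the centralizer.
set_option maxHeartbeats 1000000 in
theorem nsq_conjAvg_mul_le (hp : p.Prime) (hn : 0 < n) [NeZero (p ^ n)] (h : SL(2, ZMod (p ^ n)))
    (φ : SL(2, ZMod (p ^ n)) → ℂ)
    (hφ : ∀ x, ∑ k ∈ Finset.univ.filter (fun k => Cong (p ^ (n - 1)) k 1), φ (x * k) = 0) :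
    nsq (conjAvg h φ) * ((Finset.univ.image fun u : (ZMod (p ^ n))ˣ => (u : ZMod (p ^ n)) ^ 2).card : ℝ) ^ 2
      ≤ (Finset.univ.filter fun y => y * h = h * y).card * nsq φ := by
  set K := Finset.univ.filter fun k : SL(2, ZMod (p ^ n)) => Cong (p ^ (n - 1)) k 1
  set S := Finset.univ.image fun u : (ZMod (p ^ n))ˣ => (u : ZMod (p ^ n)) ^ 2
  have hdvd : p ^ (n - 1) ∣ p ^ n := pow_dvd_pow p (Nat.sub_le n 1)
  let E : Submodule ℂ (SL(2, ZMod (p ^ n)) → ℂ) :=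
    { carrier := {φ | ∀ x, ∑ k ∈ K, φ (x * k) = 0}
      add_mem' := fun {a b} ha hb x => by
        simp only [Pi.add_apply, Finset.sum_add_distrib, ha x, hb x, add_zero]
      zero_mem' := fun x => by simp
      smul_mem' := fun c a ha x => by
        simp only [Pi.smul_apply, smul_eq_mul, ← Finset.mul_sum, ha x, mul_zero] }
  by_cases hE : E = ⊥
  · have : φ = 0 := by
      have h1 : φ ∈ E := hφ
      rwa [hE, Submodule.mem_bot] at h1
    subst this; simp [nsq]
  obtain ⟨m, hm0, hm, W, hW, hWmem⟩ := exists_top_space (conjAvg h) E hE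
  have hleft : ∀ φ ∈ W, ∀ g, (fun x => φ (g * x)) ∈ W := by
    intro φ hφ g
    obtain ⟨h1, h2⟩ := (hWmem φ).1 hφ
    refine (hWmem _).2 ⟨fun x => ?_, ?_⟩
    · simp only [← mul_assoc]; exact h1 (g * x)
    · rw [funext (conjAvg_mul_left h g φ)]
      exact (nsq_comp (conjAvg h φ) (Equiv.mulLeft g)).trans
        (h2.trans (congrArg (m * ·) (nsq_comp φ (Equiv.mulLeft g)).symm))
  have hright : ∀ φ ∈ W, ∀ g, (fun x => φ (x * g)) ∈ W := by
    intro φ hφ g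
    obtain ⟨h1, h2⟩ := (hWmem φ).1 hφ
    refine (hWmem _).2 ⟨fun x => ?_, ?_⟩
    · rw [← h1 (x * g)]
      refine Finset.sum_bij (fun k _ => g⁻¹ * k * g) ?_ ?_ ?_ ?_
      · intro k hk
        have := Cong.conj hdvd (Finset.mem_filter.1 hk).2 g⁻¹
        rw [inv_inv] at this
        exact Finset.mem_filter.2 ⟨Finset.mem_univ _, this⟩
      · intro a _ b _ hab; exact mul_left_cancel (mul_right_cancel hab)
      · intro b hb
        exact ⟨g * b * g⁻¹, Finset.mem_filter.2 ⟨Finset.mem_univ _,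
          Cong.conj hdvd (Finset.mem_filter.1 hb).2 g⟩, by group⟩
      · intro k _; group
    · rw [funext (conjAvg_mul_right h g φ)]
      exact (nsq_comp (conjAvg h φ) (Equiv.mulRight g)).trans
        (h2.trans (congrArg (m * ·) (nsq_comp φ (Equiv.mulRight g)).symm))
  have hK1 : (K.card : ℂ) ≠ 0 := by
    have : 0 < K.card := Finset.card_pos.2 ⟨1, Finset.mem_filter.2 ⟨Finset.mem_univ _, fun i j => by simp⟩⟩
    exact_mod_cast this.ne'
  have hfixR : ∀ φ ∈ W, (∀ k, Cong (p ^ (n - 1)) k 1 → ∀ x, φ (x * k) = φ x) → φ = 0 := by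
    intro φ hφ hk
    funext x
    have h1 := ((hWmem φ).1 hφ).1 x
    rw [Finset.sum_congr rfl fun k hkK => hk k (Finset.mem_filter.1 hkK).2 x, Finset.sum_const,
      nsmul_eq_mul] at h1
    exact (mul_eq_zero.1 h1).resolve_left hK1
  obtain ⟨α, hα, w0, hw0W, hw0ne, hw0⟩ := exists_unipotent_eigenvector hp hn
    (MulAction.toPermHom SL(2, ZMod (p ^ n)) SL(2, ZMod (p ^ n))) W hW hleft
    (fun φ hφ hk => hfixR φ hφ fun k hkc x => by
      have := hk (x * k * x⁻¹) (Cong.conj hdvd hkc x) x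
      simpa using this)
  -- The left eigenspace for α inside W is still stable under right translations, so the eigenvector
  -- statement applies a second time.
  let W₁ : Submodule ℂ (SL(2, ZMod (p ^ n)) → ℂ) :=
    { carrier := {w | w ∈ W ∧ ∀ s x, w (uU s * x) = ZMod.stdAddChar (α * s) * w x}
      add_mem' := fun {a b} ha hb => ⟨W.add_mem ha.1 hb.1, fun s x => by
        simp only [Pi.add_apply, ha.2 s x, hb.2 s x]; ring⟩
      zero_mem' := ⟨W.zero_mem, fun s x => by simp⟩
      smul_mem' := fun c a ha => ⟨W.smul_mem c ha.1, fun s x => by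
        simp only [Pi.smul_apply, smul_eq_mul, ha.2 s x]; ring⟩ }
  have hW₁ : W₁ ≠ ⊥ := (Submodule.ne_bot_iff _).2 ⟨w0, ⟨hw0W, hw0⟩, hw0ne⟩
  let actR : SL(2, ZMod (p ^ n)) →* Equiv.Perm SL(2, ZMod (p ^ n)) :=
    { toFun := fun g => Equiv.mulRight g⁻¹
      map_one' := by ext x; simp
      map_mul' := fun a b => by ext x; simp [mul_assoc] }
  obtain ⟨β, hβ, w, hwW, hwne, hw⟩ := exists_unipotent_eigenvector hp hn actR W₁ hW₁
    (fun φ hφ g => ⟨hright φ hφ.1 g⁻¹, fun s x => by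
      have := hφ.2 s (x * g⁻¹)
      rw [← mul_assoc] at this
      exact this⟩)
    (fun φ hφ hk => hfixR φ hφ.1 fun k hkc x => (hk k hkc (x * k)).symm.trans
      (by simp [actR]))
  have hw' : ∀ s x, w (x * (uU s)⁻¹) = ZMod.stdAddChar (β * s) * w x := hw
  have hroot : ∀ c : S, ∃ u : (ZMod (p ^ n))ˣ, (u : ZMod (p ^ n)) ^ 2 = c := by
    rintro ⟨c, hc⟩
    obtain ⟨u, -, hu⟩ := Finset.mem_image.1 hc
    exact ⟨u, hu⟩
  choose r hr using hroot
  set f : S × S → SL(2, ZMod (p ^ n)) → ℂ := fun i x => w (dD (r i.1) * x * (dD (r i.2))⁻¹)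
  have hfW : ∀ i, f i ∈ W := fun i => by
    have := hright _ (hleft w hwW.1 (dD (r i.1))) (dD (r i.2))⁻¹
    simpa only [f, mul_assoc] using this
  have hc : 0 < nsq w := lt_of_le_of_ne (nsq_nonneg w) fun h => hwne (nsq_eq_zero h.symm)
  have hfn : ∀ i, nsq (f i) = nsq w := fun i =>
    nsq_comp w ((Equiv.mulLeft (dD (r i.1))).trans (Equiv.mulRight (dD (r i.2))⁻¹))
  have hfl : ∀ (i : S × S) s x, f i (uU s * x) = ZMod.stdAddChar (α * ((i.1 : ZMod (p ^ n)) * s)) * f i x := by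
    intro i s x
    simp only [f]
    rw [← hr i.1, ← hwW.2, ← mul_assoc, ← mul_assoc, ← mul_assoc, dD_mul_uU]
  have hfr : ∀ (i : S × S) s x, f i (x * (uU s)⁻¹) = ZMod.stdAddChar (β * ((i.2 : ZMod (p ^ n)) * s)) * f i x := by
    intro i s x
    simp only [f]
    rw [← hr i.2, ← hw']
    congr 1
    rw [mul_assoc (dD (r i.1)), mul_assoc x, ← mul_inv_rev, dD_mul_uU, mul_inv_rev]
    simp only [mul_assoc]
  have hψ : ∀ (γ a b : ZMod (p ^ n)), IsUnit γ → a ≠ b →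
      (starRingEnd ℂ) (ZMod.stdAddChar (γ * (a * 1))) * ZMod.stdAddChar (γ * (b * 1)) ≠ 1 := by
    intro γ a b hγ hab h1
    rw [← AddChar.map_neg_eq_conj, ← AddChar.map_add_eq_mul] at h1
    have h2 : -(γ * (a * 1)) + γ * (b * 1) = 0 := by
      refine ZMod.injective_stdAddChar ?_
      rw [h1, AddChar.map_zero_eq_one]
    have h3 : γ * (b - a) = 0 := by linear_combination h2
    exact hab (sub_eq_zero.1 (hγ.mul_right_eq_zero.1 h3)).symm
  have horth : ∀ i j, i ≠ j → ∑ x, (starRingEnd ℂ) (f i x) * f j x = 0 := by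
    intro i j hij
    by_cases h1 : i.1 = j.1
    · have h2 : (i.2 : ZMod (p ^ n)) ≠ j.2 := fun h => hij (Prod.ext h1 (Subtype.ext h))
      exact sum_conj_mul_eq_zero (Equiv.mulRight (uU 1)⁻¹) _ _ _ _ (hfr i 1) (hfr j 1) (hψ β _ _ hβ h2)
    · have h2 : (i.1 : ZMod (p ^ n)) ≠ j.1 := fun h => h1 (Subtype.ext h)
      exact sum_conj_mul_eq_zero (Equiv.mulLeft (uU 1)) _ _ _ _ (hfl i 1) (hfl j 1) (hψ α _ _ hα h2)
  have hHS := sum_nsq_conjAvg_le h f (nsq w) hc hfn horth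
  have hTf : ∀ i, nsq (conjAvg h (f i)) = m * nsq w := fun i => by
    rw [((hWmem _).1 (hfW i)).2, hfn]
  rw [Finset.sum_congr rfl fun i _ => hTf i, Finset.sum_const, Finset.card_univ, Fintype.card_prod,
    Fintype.card_coe, nsmul_eq_mul] at hHS
  have hmS : m * (S.card : ℝ) ^ 2 ≤ (Finset.univ.filter fun y => y * h = h * y).card := by
    refine le_of_mul_le_mul_left ?_ hc
    push_cast at hHS
    calc nsq w * (m * (S.card : ℝ) ^ 2) = S.card * S.card * (m * nsq w) := by ring
      _ ≤ _ := hHS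
      _ = _ := by congr!
  calc nsq (conjAvg h φ) * (S.card : ℝ) ^ 2 ≤ (m * nsq φ) * (S.card : ℝ) ^ 2 :=
        mul_le_mul_of_nonneg_right (hm φ hφ) (sq_nonneg _)
    _ = (m * (S.card : ℝ) ^ 2) * nsq φ := by ring
    _ ≤ _ := mul_le_mul_of_nonneg_right hmS (nsq_nonneg φ)

theorem spectral_bound_aux {Q Q' d τ s C g : ℝ} (hd : 0 < d) (h1 : Q * s ^ 2 ≤ C * Q')
    (h2 : C ≤ 2 * τ ^ 2 * d * g ^ 2) (h6 : d ≤ 2 * τ ^ 2 * s) (hQ : 0 ≤ Q) (hQ' : 0 ≤ Q') :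
    Q ≤ 8 * τ ^ 6 * g ^ 2 / d * Q' := by
  have h7 : d ^ 2 ≤ (2 * τ ^ 2 * s) ^ 2 := by gcongr
  rw [← mul_le_mul_iff_left₀ (show (0 : ℝ) < d ^ 2 by positivity)]
  calc Q * d ^ 2 ≤ Q * (2 * τ ^ 2 * s) ^ 2 := by gcongr
    _ = 4 * τ ^ 4 * (Q * s ^ 2) := by ring
    _ ≤ 4 * τ ^ 4 * ((2 * τ ^ 2 * d * g ^ 2) * Q') :=
        mul_le_mul_of_nonneg_left (h1.trans (mul_le_mul_of_nonneg_right h2 hQ')) (by positivity)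
    _ = 8 * τ ^ 6 * g ^ 2 / d * Q' * d ^ 2 := by field_simp; ring

/-- Spectral gap at the top level of `SL₂(ℤ/pⁿ)`. -/
theorem nsq_conjAvg_le (hp : p.Prime) (hn : 0 < n) [NeZero (p ^ n)] (h : SL(2, ZMod (p ^ n)))
    (φ : SL(2, ZMod (p ^ n)) → ℂ)
    (hφ : ∀ x, ∑ k ∈ Finset.univ.filter (fun k => Cong (p ^ (n - 1)) k 1), φ (x * k) = 0) :
    nsq (conjAvg h φ) ≤
      min 1 (8 * ((p ^ n).divisors.card : ℝ) ^ 6 * (lvl h : ℝ) ^ 2 / (p ^ n : ℕ)) * nsq φ := by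
  rw [min_mul_of_nonneg _ _ (nsq_nonneg φ), one_mul]
  refine le_min (nsq_conjAvg_le_self h φ) ?_
  have h1 := nsq_conjAvg_mul_le hp hn h φ hφ
  have h2 : (((Finset.univ.filter fun y => y * h = h * y).card : ℕ) : ℝ) ≤
      ((2 * (p ^ n).divisors.card ^ 2 * (p ^ n) * lvl h ^ 2 : ℕ) : ℝ) := by
    exact_mod_cast card_centralizer_le h
  set S := Finset.univ.image fun u : (ZMod (p ^ n))ˣ => (u : ZMod (p ^ n)) ^ 2
  have h3 : (p ^ n).totient ≤ 2 * (p ^ n).divisors.card * S.card := by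
    rw [← ZMod.card_units_eq_totient, ← Finset.card_univ]
    exact Finset.card_le_mul_card_image _ _ fun c _ => card_unit_sq_eq_le c
  have h4 := le_totient_mul_card_divisors (p ^ n)
  have h5 : p ^ n ≤ 2 * (p ^ n).divisors.card ^ 2 * S.card := by
    calc p ^ n ≤ _ := h4
      _ ≤ (2 * (p ^ n).divisors.card * S.card) * (p ^ n).divisors.card := Nat.mul_le_mul_right _ h3
      _ = _ := by ring
  refine spectral_bound_aux (by exact_mod_cast Nat.pos_of_ne_zero (NeZero.ne (p ^ n))) h1 ?_ ?_
    (nsq_nonneg _) (nsq_nonneg _)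
  · refine h2.trans (le_of_eq ?_)
    rw [Nat.cast_mul, Nat.cast_mul, Nat.cast_mul, Nat.cast_pow, Nat.cast_pow (lvl h), Nat.cast_two]
  · refine (Nat.cast_le.2 h5).trans (le_of_eq ?_)
    rw [Nat.cast_mul, Nat.cast_mul, Nat.cast_pow (Finset.card _), Nat.cast_two]

end PrimePower

/-! ### Products of independent random conjugates. -/

section ConjProb

variable {G : Type*} [Group G] [Fintype G]

/-- The density at `y` of the distribution of a product of independent random conjugates of the
inverses of the members of a list. -/
noncomputable def conjProb : List G → G → ℝ
  | [], y => if y = 1 then 1 else 0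
  | h :: L, y => (Fintype.card G : ℝ)⁻¹ * ∑ g, conjProb L (y * (g * h * g⁻¹))

theorem conjProb_nonneg (L : List G) (y : G) : 0 ≤ conjProb L y := by
  induction L generalizing y with
  | nil => rw [conjProb]; split_ifs <;> norm_num
  | cons h L ih => rw [conjProb]; exact mul_nonneg (by positivity) (Finset.sum_nonneg fun g _ => ih _)

theorem conjProb_le_one (L : List G) (y : G) : conjProb L y ≤ 1 := by
  induction L generalizing y with
  | nil => rw [conjProb]; split_ifs <;> norm_num
  | cons h L ih =>
    rw [conjProb]
    have hN : (0 : ℝ) < Fintype.card G := by exact_mod_cast Fintype.card_pos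
    rw [inv_mul_le_iff₀ hN, mul_one]
    calc _ ≤ ∑ g : G, (1 : ℝ) := Finset.sum_le_sum fun g _ => ih _
      _ = _ := by simp

variable {H : Type*} [Group H] [Fintype H]

theorem average_comp_surjective (π : G →* H) (hπ : Function.Surjective π) (F : H → ℝ) :
    (Fintype.card G : ℝ)⁻¹ * ∑ g, F (π g) = (Fintype.card H : ℝ)⁻¹ * ∑ h, F h := by
  have hG : (0 : ℝ) < Fintype.card G := by exact_mod_cast Fintype.card_pos
  have hH : (0 : ℝ) < Fintype.card H := by exact_mod_cast Fintype.card_pos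
  set k := (Finset.univ.filter fun g => π g = 1).card
  have hk : ∀ h, (Finset.univ.filter fun g => π g = h).card = k := fun h =>
    MonoidHom.card_fiber_eq_of_mem_range π (hπ h) (hπ 1)
  have h1 : ∑ g, F (π g) = k * ∑ h, F h := by
    rw [← Finset.sum_fiberwise Finset.univ π, Finset.mul_sum]
    refine Finset.sum_congr rfl fun h _ => ?_
    rw [Finset.sum_congr rfl (g := fun _ => F h) fun g hg => by rw [(Finset.mem_filter.1 hg).2],
      Finset.sum_const, hk, nsmul_eq_mul]
  have h2 : (Fintype.card G : ℝ) = k * Fintype.card H := by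
    have := Finset.card_eq_sum_card_fiberwise (f := π) (s := Finset.univ) (t := Finset.univ)
      (fun _ _ => Finset.mem_coe.2 (Finset.mem_univ _))
    rw [Finset.sum_congr rfl fun h _ => hk h, Finset.sum_const, Finset.card_univ, Finset.card_univ,
      smul_eq_mul] at this
    rw [this]; push_cast; ring
  have hk0 : (k : ℝ) ≠ 0 := fun h => by rw [h, zero_mul] at h2; exact hG.ne' h2
  rw [h1, h2]
  field_simp

/-- The push-forward of the distribution is again of the same kind, since a uniform element of G
maps to a uniform element of H. -/
theorem sum_fiber_conjProb (π : G →* H) (hπ : Function.Surjective π) (L : List G) (y : H) :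
    ∑ z ∈ Finset.univ.filter (fun z => π z = y), conjProb L z = conjProb (L.map π) y := by
  induction L generalizing y with
  | nil =>
    simp only [conjProb, List.map_nil]
    rw [Finset.sum_filter]
    have : ∀ z : G, (if π z = y then (if z = 1 then (1 : ℝ) else 0) else 0) =
        if z = 1 then (if y = 1 then 1 else 0) else 0 := by
      intro z
      by_cases hz : z = 1
      · subst hz; simp [eq_comm]
      · simp [hz]
    rw [Finset.sum_congr rfl fun z _ => this z]
    simp
  | cons h L ih =>
    rw [List.map_cons, conjProb]
    simp only [conjProb]
    rw [← Finset.mul_sum, Finset.sum_comm,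
      ← average_comp_surjective π hπ (fun g => conjProb (L.map π) (y * (g * π h * g⁻¹)))]
    congr 1
    refine Finset.sum_congr rfl fun g _ => ?_
    rw [← ih]
    refine Finset.sum_bij (fun z _ => z * (g * h * g⁻¹)) ?_ ?_ ?_ ?_
    · intro z hz
      simp only [Finset.mem_filter, Finset.mem_univ, true_and] at hz ⊢
      rw [map_mul, hz]; simp
    · intro a _ b _ hab; exact mul_right_cancel hab
    · intro b hb
      simp only [Finset.mem_filter, Finset.mem_univ, true_and] at hb
      refine ⟨b * (g * h * g⁻¹)⁻¹, ?_, by group⟩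
      simp only [Finset.mem_filter, Finset.mem_univ, true_and]
      rw [map_mul, hb]; simp [mul_assoc]
    · intro z _; rfl

/-- The coordinates of a uniform element of G × H are independent, so the distribution factorizes.
-/
theorem conjProb_prod (L : List (G × H)) (y : G × H) :
    conjProb L y = conjProb (L.map Prod.fst) y.1 * conjProb (L.map Prod.snd) y.2 := by
  induction L generalizing y with
  | nil =>
    simp only [conjProb, List.map_nil, Prod.ext_iff, Prod.fst_one, Prod.snd_one]
    by_cases h1 : y.1 = 1 <;> by_cases h2 : y.2 = 1 <;> simp [h1, h2]
  | cons h L ih =>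
    simp only [conjProb, List.map_cons]
    simp only [ih]
    rw [Fintype.card_prod, Fintype.sum_prod_type]
    simp only [Prod.fst_mul, Prod.snd_mul, Prod.fst_inv, Prod.snd_inv]
    simp only [← Finset.mul_sum]
    rw [← Finset.sum_mul]
    push_cast
    rw [mul_inv]; ring

theorem conjProb_mulEquiv (e : G ≃* H) (L : List G) (y : G) :
    conjProb L y = conjProb (L.map e) (e y) := by
  rw [show L.map e = L.map (e : G →* H) from rfl, ← sum_fiber_conjProb (e : G →* H) e.surjective]
  have : (Finset.univ.filter fun z => (e : G →* H) z = e y) = {y} := by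
    ext z; simp
  rw [this, Finset.sum_singleton]

end ConjProb

/-! ### Pointwise density bound for products of conjugates modulo q. -/

section MultiPrime

/-- The spectral bound attached to a modulus `l` and an element of level `g`. -/
noncomputable def muBound (l g : ℕ) : ℝ :=
  min 1 (Real.sqrt (8 ^ l.primeFactors.card * (l.divisors.card : ℝ) ^ 6 * (g : ℝ) ^ 2 / l))

theorem muBound_nonneg (l g : ℕ) : 0 ≤ muBound l g := le_min zero_le_one (Real.sqrt_nonneg _)

theorem muBound_le_one (l g : ℕ) : muBound l g ≤ 1 := min_le_left _ _

theorem muBound_one : muBound 1 1 = 1 := by simp [muBound]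

/-- The constant 8 enters once per prime in `muBound` so that its untruncated part is exactly
multiplicative over coprime moduli. -/
theorem muBound_mul_le {a b : ℕ} (hab : a.Coprime b) (g g' : ℕ) :
    muBound a g * muBound b g' ≤ muBound (a * b) (g * g') := by
  refine le_min (mul_le_one₀ (muBound_le_one _ _) (muBound_nonneg _ _) (muBound_le_one _ _)) ?_
  calc muBound a g * muBound b g' ≤ Real.sqrt _ * Real.sqrt _ :=
        mul_le_mul (min_le_right _ _) (min_le_right _ _) (muBound_nonneg _ _) (Real.sqrt_nonneg _)
    _ = _ := by
      rw [← Real.sqrt_mul (by positivity), hab.primeFactors_mul,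
        Finset.card_union_of_disjoint hab.disjoint_primeFactors, hab.card_divisors_mul]
      push_cast
      congr 1
      rw [pow_add, mul_pow, mul_pow, div_mul_div_comm]
      ring

theorem dvd_lvl_reduction_iff {d m e : ℕ} [NeZero d] [NeZero m] (hm : m ∣ d) (he : e ∣ m)
    (h : SL(2, ZMod d)) : e ∣ lvl (reduction hm h) ↔ e ∣ lvl h := by
  rw [dvd_lvl_iff he, dvd_lvl_iff (he.trans hm), ScalarMod, ScalarMod,
    ← castHom_eq_zero_iff he, ← castHom_eq_zero_iff he, ← castHom_eq_zero_iff he,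
    ← castHom_eq_zero_iff (he.trans hm), ← castHom_eq_zero_iff (he.trans hm),
    ← castHom_eq_zero_iff (he.trans hm)]
  have hc : ∀ x : ZMod d, ZMod.castHom he (ZMod e) (ZMod.castHom hm (ZMod m) x) =
      ZMod.castHom (he.trans hm) (ZMod e) x := fun x =>
    congrArg (fun f : ZMod d →+* ZMod e => f x) (ZMod.castHom_comp he hm)
  have hr : ∀ i j, (reduction hm h) i j = ZMod.castHom hm (ZMod m) (h i j) := fun i j => rfl
  rw [hr, hr, hr, hr, ← map_sub, hc, hc, hc]

theorem gcd_lvl_reduction {d m l : ℕ} [NeZero d] [NeZero m] (hm : m ∣ d) (hl : l ∣ m)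
    (h : SL(2, ZMod d)) : Nat.gcd (lvl (reduction hm h)) l = Nat.gcd (lvl h) l := by
  refine Nat.dvd_antisymm (Nat.dvd_gcd ?_ (Nat.gcd_dvd_right _ _)) (Nat.dvd_gcd ?_ (Nat.gcd_dvd_right _ _))
  · exact (dvd_lvl_reduction_iff hm ((Nat.gcd_dvd_right _ _).trans hl) h).1 (Nat.gcd_dvd_left _ _)
  · exact (dvd_lvl_reduction_iff hm ((Nat.gcd_dvd_right _ _).trans hl) h).2 (Nat.gcd_dvd_left _ _)

/-- Lift the entries arbitrarily; the determinant of the lift is a unit congruent to 1, and dividing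
the first row by it corrects the lift. -/
theorem reduction_surjective_prime_pow {p m n : ℕ} (hp : p.Prime) (hmn : m ≤ n) :
    Function.Surjective (reduction (pow_dvd_pow p hmn)) := by
  intro z
  rcases Nat.eq_zero_or_pos m with rfl | hm
  · refine ⟨1, ?_⟩
    have : Subsingleton (ZMod (p ^ 0)) := by rw [pow_zero]; infer_instance
    exact SL2_ext (Subsingleton.elim _ _) (Subsingleton.elim _ _) (Subsingleton.elim _ _)
      (Subsingleton.elim _ _)
  have hn : 0 < n := by omega
  have : NeZero (p ^ n) := ⟨(pow_pos hp.pos n).ne'⟩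
  have : NeZero (p ^ m) := ⟨(pow_pos hp.pos m).ne'⟩
  set f := ZMod.castHom (pow_dvd_pow p hmn) (ZMod (p ^ m))
  have hs : Function.Surjective f := ZMod.castHom_surjective _
  obtain ⟨a, ha⟩ := hs (z 0 0)
  obtain ⟨b, hb⟩ := hs (z 0 1)
  obtain ⟨c, hc⟩ := hs (z 1 0)
  obtain ⟨e, he⟩ := hs (z 1 1)
  have h1 : f (a * e - b * c) = 1 := by
    rw [map_sub, map_mul, map_mul, ha, hb, hc, he]; exact SL2_det z
  have hu : IsUnit (a * e - b * c) := by
    rw [isUnit_zmod_prime_pow hp hn]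
    rintro ⟨t, ht⟩
    rw [ht, map_mul, map_natCast] at h1
    exact (isUnit_zmod_prime_pow hp hm 1).1 isUnit_one ⟨f t, h1.symm⟩
  obtain ⟨u, hu⟩ := hu
  have hv : f ((u⁻¹ : (ZMod (p ^ n))ˣ) : ZMod (p ^ n)) = 1 := by
    have h2 := congrArg f u.inv_mul
    rw [map_mul, hu, h1, map_one, mul_one] at h2
    exact h2
  refine ⟨⟨!![(u⁻¹ : (ZMod (p ^ n))ˣ) * a, (u⁻¹ : (ZMod (p ^ n))ˣ) * b; c, e], ?_⟩, ?_⟩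
  · rw [Matrix.det_fin_two_of]
    have := u.inv_mul
    rw [hu] at this
    linear_combination this
  · refine SL2_ext ?_ ?_ ?_ ?_
    · change f ((u⁻¹ : (ZMod (p ^ n))ˣ) * a) = _
      rw [map_mul, hv, one_mul, ha]
    · change f ((u⁻¹ : (ZMod (p ^ n))ˣ) * b) = _
      rw [map_mul, hv, one_mul, hb]
    · exact hc
    · exact he

/-- The component of `conjProb` at the last level of `SL₂(ℤ/pⁿ)`. -/
noncomputable def topPart {d : ℕ} [NeZero d] (e : ℕ) (L : List SL(2, ZMod d)) (y : SL(2, ZMod d)) : ℝ :=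
  conjProb L y - ((Finset.univ.filter fun k : SL(2, ZMod d) => Cong e k 1).card : ℝ)⁻¹ *
    ∑ k ∈ Finset.univ.filter (fun k : SL(2, ZMod d) => Cong e k 1), conjProb L (y * k)

/-- Averaging over a conjugacy class commutes with right translation, so prefixing h to the list
applies the class average to the new part. -/
theorem topPart_cons {d e : ℕ} [NeZero d] (h : SL(2, ZMod d)) (L : List SL(2, ZMod d)) :
    (fun y => (topPart e (h :: L) y : ℂ)) = conjAvg h (fun y => (topPart e L y : ℂ)) := by
  funext y
  rw [conjAvg_apply]
  simp only [topPart, conjProb]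
  push_cast
  rw [Finset.sum_sub_distrib, mul_sub]
  congr 1
  rw [← Finset.mul_sum, mul_left_comm]
  congr 1
  rw [← Finset.mul_sum, Finset.sum_comm]
  congr 1
  rw [Finset.sum_comm]
  nth_rewrite 2 [Finset.sum_comm]
  refine Finset.sum_congr rfl fun k _ => ?_
  refine Fintype.sum_equiv (Equiv.mulLeft k) _ _ fun g => ?_
  congr 2
  simp only [Equiv.coe_mulLeft]
  group

theorem sum_topPart {d e : ℕ} [NeZero d] (he : e ∣ d) (L : List SL(2, ZMod d)) (x : SL(2, ZMod d)) :
    ∑ k ∈ Finset.univ.filter (fun k : SL(2, ZMod d) => Cong e k 1), topPart e L (x * k) = 0 := by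
  set K := Finset.univ.filter fun k : SL(2, ZMod d) => Cong e k 1
  have hK : (K.card : ℝ) ≠ 0 := by
    have : 0 < K.card := Finset.card_pos.2 ⟨1, Finset.mem_filter.2 ⟨Finset.mem_univ _, fun i j => by simp⟩⟩
    exact_mod_cast this.ne'
  have hmul : ∀ k ∈ K, ∑ k' ∈ K, conjProb L (x * k * k') = ∑ k' ∈ K, conjProb L (x * k') := by
    intro k hk
    refine Finset.sum_bij (fun k' _ => k * k') ?_ ?_ ?_ ?_
    · intro k' hk'
      simp only [K, Finset.mem_filter, Finset.mem_univ, true_and, ← reduction_eq_iff he, map_mul] at *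
      rw [hk, hk', map_one, mul_one]
    · intro a _ b _ hab; exact mul_left_cancel hab
    · intro b hb
      refine ⟨k⁻¹ * b, ?_, by group⟩
      simp only [K, Finset.mem_filter, Finset.mem_univ, true_and, ← reduction_eq_iff he, map_mul, map_inv] at *
      rw [hk, hb, map_one, inv_one, mul_one]
    · intro k' _; rw [mul_assoc]
  unfold topPart
  rw [Finset.sum_sub_distrib, ← Finset.mul_sum, Finset.sum_congr rfl hmul, Finset.sum_const, nsmul_eq_mul,
    inv_mul_cancel_left₀ hK, sub_self]

theorem nsq_topPart_nil {d e : ℕ} [NeZero d] :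
    nsq (fun y => (topPart e ([] : List SL(2, ZMod d)) y : ℂ)) ≤ 1 := by
  set K := Finset.univ.filter fun k : SL(2, ZMod d) => Cong e k 1
  have hK0 : 0 < K.card :=
    Finset.card_pos.2 ⟨1, Finset.mem_filter.2 ⟨Finset.mem_univ _, fun i j => by simp⟩⟩
  have hK : (0 : ℝ) < K.card := by exact_mod_cast hK0
  have h1 : ∀ y : SL(2, ZMod d), ∑ k ∈ K, conjProb [] (y * k) = if y⁻¹ ∈ K then (1 : ℝ) else 0 := by
    intro y
    simp only [conjProb, mul_eq_one_iff_inv_eq]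
    rw [Finset.sum_ite_eq]
  have h2 : ∀ y : SL(2, ZMod d), ‖(topPart e [] y : ℂ)‖ ^ 2 = (if y = 1 then 1 - 2 * (K.card : ℝ)⁻¹ else 0) +
      ((K.card : ℝ)⁻¹) ^ 2 * if y⁻¹ ∈ K then (1 : ℝ) else 0 := by
    intro y
    have h1K : (1 : SL(2, ZMod d)) ∈ K := Finset.mem_filter.2 ⟨Finset.mem_univ _, fun i j => by simp⟩
    rw [Complex.norm_real, Real.norm_eq_abs, sq_abs, topPart, h1, conjProb]
    by_cases hy : y = 1
    · subst hy; simp only [inv_one, h1K, if_true]; ring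
    · by_cases hyK : y⁻¹ ∈ K <;> simp [hy, hyK, K]
  unfold nsq
  rw [Finset.sum_congr rfl fun y _ => h2 y, Finset.sum_add_distrib, Finset.sum_ite_eq', ← Finset.mul_sum,
    if_pos (Finset.mem_univ _)]
  have h3 : ∑ y : SL(2, ZMod d), (if y⁻¹ ∈ K then (1 : ℝ) else 0) = K.card := by
    refine (Fintype.sum_equiv (Equiv.inv _) _ (fun y => if y ∈ K then (1 : ℝ) else 0) fun y => rfl).trans ?_
    simp
  rw [h3]
  have : (K.card : ℝ)⁻¹ ^ 2 * K.card = (K.card : ℝ)⁻¹ := by field_simp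
  rw [this]
  have : 0 ≤ (K.card : ℝ)⁻¹ := by positivity
  linarith

theorem muBound_sq {p n : ℕ} (hp : p.Prime) (hn : 0 < n) (g : ℕ) :
    muBound (p ^ n) g ^ 2 = min 1 (8 * ((p ^ n).divisors.card : ℝ) ^ 6 * (g : ℝ) ^ 2 / (p ^ n : ℕ)) := by
  unfold muBound
  rw [Nat.primeFactors_prime_pow hn.ne' hp, Finset.card_singleton, pow_one]
  set X := 8 * ((p ^ n).divisors.card : ℝ) ^ 6 * (g : ℝ) ^ 2 / (p ^ n : ℕ)
  have hX : 0 ≤ X := by positivity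
  rcases le_total 1 X with h | h
  · rw [min_eq_left h, min_eq_left (Real.one_le_sqrt.2 h), one_pow]
  · rw [min_eq_right h, min_eq_right (Real.sqrt_le_one.2 h), Real.sq_sqrt hX]

theorem nsq_topPart_le {p n : ℕ} (hp : p.Prime) (hn : 0 < n) [NeZero (p ^ n)]
    (L : List SL(2, ZMod (p ^ n))) :
    nsq (fun y => (topPart (p ^ (n - 1)) L y : ℂ)) ≤ ((L.map fun h => muBound (p ^ n) (lvl h)).prod) ^ 2 := by
  have hd : p ^ (n - 1) ∣ p ^ n := pow_dvd_pow p (Nat.sub_le n 1)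
  induction L with
  | nil => simpa using nsq_topPart_nil
  | cons h L ih =>
    rw [topPart_cons, List.map_cons, List.prod_cons, mul_pow, muBound_sq hp hn]
    refine (nsq_conjAvg_le hp hn h _ fun x => ?_).trans ?_
    · have := sum_topPart hd L x
      exact_mod_cast this
    · exact mul_le_mul_of_nonneg_left ih (le_min zero_le_one (by positivity))

/-- Induction on n: the density splits into its part new at level pⁿ, bounded pointwise by its ℓ²
norm and hence by the spectral gap, and the pull-back of the corresponding density one level lower.
The weight p^(3i) bounds the order of the group at level i. -/
theorem conjProb_prime_pow_le {p : ℕ} (hp : p.Prime) (n : ℕ) [NeZero (p ^ n)]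
    (L : List SL(2, ZMod (p ^ n))) (y : SL(2, ZMod (p ^ n))) :
    (Fintype.card SL(2, ZMod (p ^ n)) : ℝ) * conjProb L y ≤ ∑ i ∈ Finset.range (n + 1),
      ((p ^ i : ℕ) : ℝ) ^ 3 * (L.map fun h => muBound (p ^ i) (Nat.gcd (lvl h) (p ^ i))).prod := by
  revert L y
  revert n
  suffices H : ∀ n : ℕ, ∀ hq : NeZero (p ^ n), ∀ (L : List SL(2, ZMod (p ^ n))) (y : SL(2, ZMod (p ^ n))),
      (Fintype.card SL(2, ZMod (p ^ n)) : ℝ) * conjProb L y ≤ ∑ i ∈ Finset.range (n + 1),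
      ((p ^ i : ℕ) : ℝ) ^ 3 * (L.map fun h => muBound (p ^ i) (Nat.gcd (lvl h) (p ^ i))).prod from
    fun n hq => H n hq
  intro n
  induction n with
  | zero =>
    intro hq L y
    have hsub : Subsingleton (ZMod (p ^ 0)) := by rw [pow_zero]; infer_instance
    have hcard : Fintype.card SL(2, ZMod (p ^ 0)) ≤ 1 := by
      refine Fintype.card_le_one_iff.2 fun z w => ?_
      exact SL2_ext (Subsingleton.elim _ _) (Subsingleton.elim _ _) (Subsingleton.elim _ _)
        (Subsingleton.elim _ _)
    have h1 : (L.map fun h => muBound (p ^ 0) (Nat.gcd (lvl h) (p ^ 0))).prod = 1 := by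
      rw [List.prod_eq_one]
      intro x hx
      obtain ⟨h, -, rfl⟩ := List.mem_map.1 hx
      simp [muBound_one]
    rw [Finset.sum_range_one, h1]
    have h2 : (Fintype.card SL(2, ZMod (p ^ 0)) : ℝ) ≤ 1 := by exact_mod_cast hcard
    have h3 := mul_le_mul h2 (conjProb_le_one L y) (conjProb_nonneg L y) zero_le_one
    simpa using h3
  | succ n ih =>
    intro hq L y
    have : NeZero (p ^ n) := ⟨(pow_pos hp.pos n).ne'⟩
    have hd : p ^ n ∣ p ^ (n + 1) := pow_dvd_pow p (Nat.le_succ n)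
    set K := Finset.univ.filter fun k : SL(2, ZMod (p ^ (n + 1))) => Cong (p ^ n) k 1
    have hK0 : 0 < K.card :=
      Finset.card_pos.2 ⟨1, Finset.mem_filter.2 ⟨Finset.mem_univ _, fun i j => by simp⟩⟩
    have hK : (0 : ℝ) < K.card := by exact_mod_cast hK0
    have hsurj : Function.Surjective (reduction hd) := reduction_surjective_prime_pow hp (Nat.le_succ n)
    have hcard : (Fintype.card SL(2, ZMod (p ^ (n + 1))) : ℝ) = K.card * Fintype.card SL(2, ZMod (p ^ n)) := by
      have h1 := average_comp_surjective (reduction hd) hsurj fun z => if z = 1 then (1 : ℝ) else 0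
      have h2 : ∑ g, (if reduction hd g = 1 then (1 : ℝ) else 0) = K.card := by
        rw [Finset.sum_boole]
        congr 2
        ext k
        simp only [K, Finset.mem_filter, Finset.mem_univ, true_and]
        rw [← reduction_eq_iff hd, map_one]
      rw [h2, Finset.sum_ite_eq', if_pos (Finset.mem_univ _), mul_one] at h1
      have h3 : (Fintype.card SL(2, ZMod (p ^ n)) : ℝ) ≠ 0 := by exact_mod_cast Fintype.card_ne_zero
      have h4 : (Fintype.card SL(2, ZMod (p ^ (n + 1))) : ℝ) ≠ 0 := by exact_mod_cast Fintype.card_ne_zero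
      field_simp at h1
      linarith
    have hsum : ∑ k ∈ K, conjProb L (y * k) = conjProb (L.map (reduction hd)) (reduction hd y) := by
      rw [← sum_fiber_conjProb _ hsurj]
      refine Finset.sum_bij (fun k _ => y * k) ?_ ?_ ?_ ?_
      · intro k hk
        simp only [K, Finset.mem_filter, Finset.mem_univ, true_and, ← reduction_eq_iff hd] at hk ⊢
        rw [map_mul, hk, map_one, mul_one]
      · intro a _ b _ hab; exact mul_left_cancel hab
      · intro b hb
        refine ⟨y⁻¹ * b, ?_, by group⟩
        simp only [K, Finset.mem_filter, Finset.mem_univ, true_and, ← reduction_eq_iff hd] at hb ⊢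
        rw [map_mul, hb, map_inv, map_one, inv_mul_cancel]
      · intro k _; rfl
    have htop : topPart (p ^ n) L y ≤ (L.map fun h => muBound (p ^ (n + 1)) (lvl h)).prod := by
      have h1 := nsq_topPart_le hp (Nat.succ_pos n) L
      have h2 : ‖(topPart (p ^ n) L y : ℂ)‖ ^ 2 ≤ nsq (fun y => (topPart (p ^ n) L y : ℂ)) :=
        Finset.single_le_sum (f := fun y => ‖(topPart (p ^ n) L y : ℂ)‖ ^ 2)
          (fun _ _ => by positivity) (Finset.mem_univ y)
      rw [Complex.norm_real, Real.norm_eq_abs, sq_abs] at h2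
      have h3 : 0 ≤ (L.map fun h => muBound (p ^ (n + 1)) (lvl h)).prod := by
        refine List.prod_nonneg fun x hx => ?_
        obtain ⟨h, -, rfl⟩ := List.mem_map.1 hx
        exact muBound_nonneg _ _
      exact le_of_sq_le_sq (h2.trans h1) h3
    have hlvl : ∀ h : SL(2, ZMod (p ^ (n + 1))), Nat.gcd (lvl h) (p ^ (n + 1)) = lvl h := fun h =>
      Nat.gcd_eq_left (lvl_dvd h)
    have hIH := ih inferInstance (L.map (reduction hd)) (reduction hd y)
    rw [Finset.sum_range_succ]
    simp only [hlvl]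
    have hterm : ∀ i ∈ Finset.range (n + 1), ((p ^ i : ℕ) : ℝ) ^ 3 *
        ((L.map (reduction hd)).map fun h => muBound (p ^ i) (Nat.gcd (lvl h) (p ^ i))).prod =
        ((p ^ i : ℕ) : ℝ) ^ 3 * (L.map fun h => muBound (p ^ i) (Nat.gcd (lvl h) (p ^ i))).prod := by
      intro i hi
      have hi' : p ^ i ∣ p ^ n := pow_dvd_pow p (by have := Finset.mem_range.1 hi; omega)
      rw [List.map_map]
      congr 3
      funext h
      simp only [Function.comp_apply, gcd_lvl_reduction hd hi' h]
    rw [Finset.sum_congr rfl hterm] at hIH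
    have hsplit : conjProb L y = topPart (p ^ n) L y + (K.card : ℝ)⁻¹ * ∑ k ∈ K, conjProb L (y * k) := by
      rw [topPart]; ring
    rw [hsplit, mul_add, add_comm]
    refine add_le_add ?_ ?_
    · refine le_trans (le_of_eq ?_) hIH
      rw [hsum, hcard]
      field_simp
    · have hc3 : (Fintype.card SL(2, ZMod (p ^ (n + 1))) : ℝ) ≤ ((p ^ (n + 1) : ℕ) : ℝ) ^ 3 := by
        exact_mod_cast card_SL2_le (d := p ^ (n + 1))
      refine (mul_le_mul_of_nonneg_left htop (Nat.cast_nonneg _)).trans ?_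
      refine mul_le_mul_of_nonneg_right hc3 ?_
      refine List.prod_nonneg fun x hx => ?_
      obtain ⟨h, -, rfl⟩ := List.mem_map.1 hx
      exact muBound_nonneg _ _

/-- Chinese remainder theorem for `SL₂`. -/
theorem reduction_prod_bijective {a b : ℕ} (hab : a.Coprime b) [NeZero (a * b)] :
    Function.Bijective ((reduction (dvd_mul_right a b)).prod (reduction (dvd_mul_left b a))) := by
  have hz : ∀ x : ZMod (a * b), ZMod.castHom (dvd_mul_right a b) (ZMod a) x = 0 →
      ZMod.castHom (dvd_mul_left b a) (ZMod b) x = 0 → x = 0 := by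
    intro x h1 h2
    rw [castHom_eq_zero_iff] at h1 h2
    have := lcm_dvd_of_dvd (dvd_mul_right a b) (dvd_mul_left b a) h1 h2
    rw [hab.lcm_eq_mul, ZMod.natCast_self, zero_dvd_iff] at this
    exact this
  have hinj : ∀ x y : ZMod (a * b), ZMod.castHom (dvd_mul_right a b) (ZMod a) x =
      ZMod.castHom (dvd_mul_right a b) (ZMod a) y →
      ZMod.castHom (dvd_mul_left b a) (ZMod b) x = ZMod.castHom (dvd_mul_left b a) (ZMod b) y → x = y := by
    intro x y h1 h2
    exact sub_eq_zero.1 (hz _ (by rw [map_sub, h1, sub_self]) (by rw [map_sub, h2, sub_self]))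
  constructor
  · intro z w hzw
    rw [MonoidHom.prod_apply, MonoidHom.prod_apply, Prod.mk.injEq] at hzw
    ext i j
    exact hinj _ _ (congrArg (fun m : SL(2, ZMod a) => m i j) hzw.1)
      (congrArg (fun m : SL(2, ZMod b) => m i j) hzw.2)
  · rintro ⟨z, w⟩
    have hs : ∀ (x : ZMod a) (y : ZMod b), ∃ c : ZMod (a * b),
        ZMod.castHom (dvd_mul_right a b) (ZMod a) c = x ∧ ZMod.castHom (dvd_mul_left b a) (ZMod b) c = y := by
      intro x y
      have hb0 : NeZero b := ⟨fun h => NeZero.ne (a * b) (by rw [h, mul_zero])⟩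
      have ha0 : NeZero a := ⟨fun h => NeZero.ne (a * b) (by rw [h, zero_mul])⟩
      obtain ⟨k, hk1, hk2⟩ := Nat.chineseRemainder hab x.val y.val
      refine ⟨(k : ZMod (a * b)), ?_, ?_⟩
      · rw [map_natCast, ← ZMod.natCast_zmod_val x]
        exact (ZMod.natCast_eq_natCast_iff _ _ _).2 hk1
      · rw [map_natCast, ← ZMod.natCast_zmod_val y]
        exact (ZMod.natCast_eq_natCast_iff _ _ _).2 hk2
    choose c hc1 hc2 using fun i j => hs (z i j) (w i j)
    refine ⟨⟨!![c 0 0, c 0 1; c 1 0, c 1 1], ?_⟩, ?_⟩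
    · rw [Matrix.det_fin_two_of]
      refine hinj _ _ ?_ ?_
      · rw [map_sub, map_mul, map_mul, hc1, hc1, hc1, hc1, map_one]; exact SL2_det z
      · rw [map_sub, map_mul, map_mul, hc2, hc2, hc2, hc2, map_one]; exact SL2_det w
    · refine Prod.ext ?_ ?_
      · exact SL2_ext (hc1 0 0) (hc1 0 1) (hc1 1 0) (hc1 1 1)
      · exact SL2_ext (hc2 0 0) (hc2 0 1) (hc2 1 0) (hc2 1 1)

/-- The Chinese remainder theorem makes the density a product over prime powers, and the product of
the sums over levels expands into a sum over divisors l of q. This is the form in which the spectral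
gap is used. -/
theorem card_mul_conjProb_le (q : ℕ) [NeZero q] (L : List SL(2, ZMod q)) (y : SL(2, ZMod q)) :
    (Fintype.card SL(2, ZMod q) : ℝ) * conjProb L y ≤ ∑ l ∈ q.divisors,
      (l : ℝ) ^ 3 * (L.map fun h => muBound l (Nat.gcd (lvl h) l)).prod := by
  revert L y
  revert q
  suffices H : ∀ q : ℕ, ∀ hq : NeZero q, ∀ (L : List SL(2, ZMod q)) (y : SL(2, ZMod q)),
      (Fintype.card SL(2, ZMod q) : ℝ) * conjProb L y ≤ ∑ l ∈ q.divisors,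
      (l : ℝ) ^ 3 * (L.map fun h => muBound l (Nat.gcd (lvl h) l)).prod from fun q hq => H q hq
  have hnn : ∀ {q : ℕ} (l : ℕ) (L : List SL(2, ZMod q)),
      0 ≤ (L.map fun h => muBound l (Nat.gcd (lvl h) l)).prod := by
    intro q l L
    refine List.prod_nonneg fun x hx => ?_
    obtain ⟨h, -, rfl⟩ := List.mem_map.1 hx
    exact muBound_nonneg _ _
  intro q
  induction q using Nat.recOnPosPrimePosCoprime with
  | prime_pow p n hp hn =>
    intro hq L y
    rw [Nat.sum_divisors_prime_pow hp]
    exact conjProb_prime_pow_le hp n L y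
  | zero => intro hq; exact absurd rfl (NeZero.ne 0)
  | one =>
    intro hq L y
    have := conjProb_prime_pow_le Nat.prime_two 0 L y
    simpa using this
  | coprime a b ha hb hab iha ihb =>
    intro hq L y
    have ha0 : NeZero a := ⟨by omega⟩
    have hb0 : NeZero b := ⟨by omega⟩
    set e := MulEquiv.ofBijective _ (reduction_prod_bijective hab)
    have he1 : ∀ z, (e z).1 = reduction (dvd_mul_right a b) z := fun z => rfl
    have he2 : ∀ z, (e z).2 = reduction (dvd_mul_left b a) z := fun z => rfl
    rw [conjProb_mulEquiv e, conjProb_prod, Fintype.card_congr e.toEquiv, Fintype.card_prod, List.map_map,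
      List.map_map]
    push_cast
    have h1 := iha ha0 (L.map (Prod.fst ∘ e)) (e y).1
    have h2 := ihb hb0 (L.map (Prod.snd ∘ e)) (e y).2
    have h3 := mul_le_mul h1 h2 (mul_nonneg (Nat.cast_nonneg _) (conjProb_nonneg _ _))
      (Finset.sum_nonneg fun l _ => mul_nonneg (by positivity) (hnn l _))
    calc _ = _ := by ring
      _ ≤ _ := h3
      _ ≤ _ := ?_
    rw [Finset.sum_mul_sum, ← Finset.sum_product']
    have hmaps : ∀ x ∈ a.divisors ×ˢ b.divisors, x.1 * x.2 ∈ (a * b).divisors := by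
      intro x hx
      obtain ⟨hx1, hx2⟩ := Finset.mem_product.1 hx
      exact Nat.mem_divisors.2 ⟨mul_dvd_mul (Nat.mem_divisors.1 hx1).1 (Nat.mem_divisors.1 hx2).1,
        NeZero.ne _⟩
    have hinj : Set.InjOn (fun x : ℕ × ℕ => x.1 * x.2) (a.divisors ×ˢ b.divisors : Finset (ℕ × ℕ)) := by
      intro x hx x' hx' hxx
      obtain ⟨hx1, hx2⟩ := Finset.mem_product.1 (Finset.mem_coe.1 hx)
      obtain ⟨hx1', hx2'⟩ := Finset.mem_product.1 (Finset.mem_coe.1 hx')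
      have d1 := (Nat.mem_divisors.1 hx1).1
      have d2 := (Nat.mem_divisors.1 hx2).1
      have d1' := (Nat.mem_divisors.1 hx1').1
      have d2' := (Nat.mem_divisors.1 hx2').1
      have e1 : ∀ u v, u ∣ a → v ∣ b → Nat.gcd (u * v) a = u := by
        intro u v hu hv
        rw [Nat.Coprime.gcd_mul_right_cancel _ (hab.symm.coprime_dvd_left hv), Nat.gcd_eq_left hu]
      have h4 : x.1 = x'.1 := by
        rw [← e1 x.1 x.2 d1 d2, ← e1 x'.1 x'.2 d1' d2']
        exact congrArg (fun t => Nat.gcd t a) hxx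
      have h5 : x.2 = x'.2 := by
        have hpos : 0 < x.1 := Nat.pos_of_dvd_of_pos d1 (Nat.pos_of_ne_zero (NeZero.ne a))
        have hxx' : x.1 * x.2 = x.1 * x'.2 := by
          have := hxx
          simp only [← h4] at this
          exact this
        exact Nat.eq_of_mul_eq_mul_left hpos hxx'
      exact Prod.ext h4 h5
    refine le_trans (Finset.sum_le_sum (g := fun x : ℕ × ℕ => ((x.1 * x.2 : ℕ) : ℝ) ^ 3 *
      (L.map fun h => muBound (x.1 * x.2) (Nat.gcd (lvl h) (x.1 * x.2))).prod) ?_) ?_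
    · intro x hx
      obtain ⟨hx1, hx2⟩ := Finset.mem_product.1 hx
      have d1 := (Nat.mem_divisors.1 hx1).1
      have d2 := (Nat.mem_divisors.1 hx2).1
      have hcop : x.1.Coprime x.2 := (hab.coprime_dvd_left d1).coprime_dvd_right d2
      have hprod : ((L.map (Prod.fst ∘ e)).map fun h => muBound x.1 (Nat.gcd (lvl h) x.1)).prod *
          ((L.map (Prod.snd ∘ e)).map fun h => muBound x.2 (Nat.gcd (lvl h) x.2)).prod ≤
          (L.map fun h => muBound (x.1 * x.2) (Nat.gcd (lvl h) (x.1 * x.2))).prod := by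
        rw [List.map_map, List.map_map, ← List.prod_map_mul]
        refine List.prod_map_le_prod_map₀ _ _ (fun h _ => mul_nonneg (muBound_nonneg _ _) (muBound_nonneg _ _)) ?_
        intro h _
        simp only [Function.comp_apply, he1, he2]
        rw [gcd_lvl_reduction _ d1, gcd_lvl_reduction _ d2, hcop.gcd_mul]
        exact muBound_mul_le hcop _ _
      calc _ = ((x.1 : ℝ) ^ 3 * (x.2 : ℝ) ^ 3) * (((L.map (Prod.fst ∘ e)).map fun h => muBound x.1 (Nat.gcd (lvl h) x.1)).prod *
          ((L.map (Prod.snd ∘ e)).map fun h => muBound x.2 (Nat.gcd (lvl h) x.2)).prod) := by ring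
        _ ≤ ((x.1 : ℝ) ^ 3 * (x.2 : ℝ) ^ 3) * _ := mul_le_mul_of_nonneg_left hprod (by positivity)
        _ = _ := by push_cast; ring
    · rw [← Finset.sum_image (g := fun x : ℕ × ℕ => x.1 * x.2) (f := fun l : ℕ => (l : ℝ) ^ 3 *
        (L.map fun h => muBound l (Nat.gcd (lvl h) l)).prod) hinj]
      refine Finset.sum_le_sum_of_subset_of_nonneg ?_ fun l _ _ => mul_nonneg (by positivity) (hnn l _)
      intro l hl
      obtain ⟨x, hx, rfl⟩ := Finset.mem_image.1 hl
      exact hmaps x hx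

end MultiPrime

/-! ### A bilinear exponential sum estimate in ℤ/q. -/

section RingFourier

variable {q : ℕ} [NeZero q]

/-- The size of the principal ideal generated by `b`. -/
noncomputable def idealCard (b : ZMod q) : ℕ := (Finset.univ.image fun r : ZMod q => b * r).card

theorem idealCard_pos (b : ZMod q) : 0 < idealCard b :=
  Finset.card_pos.2 (Finset.univ_nonempty.image _)

theorem card_mul_fiber (b r₀ : ZMod q) :
    (Finset.univ.filter fun r : ZMod q => b * r = b * r₀).card
      = (Finset.univ.filter fun r : ZMod q => b * r = 0).card := by
  refine Finset.card_bij (fun r _ => r - r₀) ?_ (fun _ _ _ _ h => sub_left_injective h) ?_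
  · intro r hr
    simp only [Finset.mem_filter, Finset.mem_univ, true_and] at hr ⊢
    rw [mul_sub, hr, sub_self]
  · intro r hr
    simp only [Finset.mem_filter, Finset.mem_univ, true_and] at hr
    exact ⟨r + r₀, by simp [mul_add, hr], by ring⟩

theorem sum_ideal {M : Type*} [AddCommMonoid M] (b : ZMod q) (F : ZMod q → M) :
    ∑ r, F (b * r) = (Finset.univ.filter fun r : ZMod q => b * r = 0).card •
      ∑ η ∈ Finset.univ.image (fun r : ZMod q => b * r), F η := by
  rw [Finset.smul_sum, ← Finset.sum_fiberwise_of_maps_to (g := fun r => b * r)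
    (t := Finset.univ.image fun r : ZMod q => b * r) (fun r _ => Finset.mem_image_of_mem _ (Finset.mem_univ r))]
  refine Finset.sum_congr rfl fun η hη => ?_
  obtain ⟨r₀, -, rfl⟩ := Finset.mem_image.1 hη
  rw [Finset.sum_congr rfl (g := fun _ => F (b * r₀)) fun r hr => by rw [(Finset.mem_filter.1 hr).2],
    Finset.sum_const, card_mul_fiber]

theorem card_ann_mul_idealCard (b : ZMod q) :
    (Finset.univ.filter fun r : ZMod q => b * r = 0).card * idealCard b = q := by
  have := sum_ideal b (fun _ => (1 : ℕ))
  simp only [Finset.sum_const, smul_eq_mul, mul_one, Finset.card_univ, ZMod.card] at this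
  exact this.symm

theorem idealCard_dvd (b : ZMod q) : idealCard b ∣ q := ⟨_, ((mul_comm _ _).trans (card_ann_mul_idealCard b)).symm⟩

theorem idealCard_mul_self (b : ZMod q) : (idealCard b : ZMod q) * b = 0 := by
  have h1 : idealCard b = Nat.card (AddMonoidHom.mulLeft b).range := by
    rw [idealCard, ← Set.ncard_coe_finset, ← Nat.card_coe_set_eq]
    congr 1
    rw [Finset.coe_image, Finset.coe_univ, Set.image_univ]
    rfl
  have h2 : Nat.card (AddMonoidHom.mulLeft b).range • (⟨b, 1, by simp⟩ : (AddMonoidHom.mulLeft b).range) = 0 :=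
    card_nsmul_eq_zero'
  have h3 := congrArg Subtype.val h2
  rw [← h1] at h3
  simpa using h3

/-- One inclusion is Lagrange's theorem in the ideal generated by c; the two sets have the same
cardinality. -/
theorem mul_eq_zero_iff_idealCard (c z : ZMod q) : c * z = 0 ↔ (idealCard c : ZMod q) ∣ z := by
  obtain ⟨n, hn⟩ := idealCard_dvd c
  have hsub : (Finset.univ.filter fun z : ZMod q => (idealCard c : ZMod q) ∣ z - 0) ⊆
      Finset.univ.filter fun r : ZMod q => c * r = 0 := by
    intro z hz
    simp only [Finset.mem_filter, Finset.mem_univ, true_and, sub_zero] at hz ⊢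
    obtain ⟨w, rfl⟩ := hz
    rw [← mul_assoc, mul_comm c, idealCard_mul_self, zero_mul]
  have hcard : (Finset.univ.filter fun r : ZMod q => c * r = 0).card ≤
      (Finset.univ.filter fun z : ZMod q => (idealCard c : ZMod q) ∣ z - 0).card := by
    rw [card_dvd_sub (idealCard_dvd c)]
    refine le_of_eq (Nat.div_eq_of_eq_mul_left (idealCard_pos c) ?_).symm
    exact (card_ann_mul_idealCard c).symm
  have heq := Finset.eq_of_subset_of_card_le hsub hcard
  have := Finset.ext_iff.1 heq z
  simp only [Finset.mem_filter, Finset.mem_univ, true_and, sub_zero] at this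
  exact this.symm

theorem idealCard_le_of_mul_eq_zero (b : ZMod q) {k : ℕ} (hk : k ∣ q) (h : (k : ZMod q) * b = 0) :
    idealCard b ≤ k := by
  obtain ⟨n, hn⟩ := hk
  have hk0 : 0 < k := Nat.pos_of_ne_zero (by rintro rfl; exact NeZero.ne q (by simpa using hn))
  have hn0 : 0 < n := Nat.pos_of_ne_zero (by rintro rfl; exact NeZero.ne q (by simpa using hn))
  have h1 : idealCard b ≤ (Finset.univ.filter fun x : ZMod q => (n : ZMod q) ∣ x - 0).card := by
    refine Finset.card_le_card fun x hx => ?_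
    obtain ⟨r, -, rfl⟩ := Finset.mem_image.1 hx
    simp only [Finset.mem_filter, Finset.mem_univ, true_and, sub_zero]
    rw [← natCast_mul_eq_zero_iff hn.symm, ← mul_assoc, h, zero_mul]
  rw [card_dvd_sub (Dvd.intro_left _ hn.symm)] at h1
  refine h1.trans (le_of_eq ?_)
  rw [Nat.div_eq_of_eq_mul_left hn0 hn]

theorem card_idealCard_eq_le (g : ℕ) (hg : g ∣ q) :
    (Finset.univ.filter fun b : ZMod q => idealCard b = g).card ≤ g := by
  obtain ⟨n, hn⟩ := hg
  have hn0 : 0 < n := Nat.pos_of_ne_zero (by rintro rfl; exact NeZero.ne q (by simpa using hn))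
  calc _ ≤ (Finset.univ.filter fun x : ZMod q => (n : ZMod q) ∣ x - 0).card := by
        refine Finset.card_le_card fun b hb => ?_
        simp only [Finset.mem_filter, Finset.mem_univ, true_and, sub_zero] at hb ⊢
        rw [← natCast_mul_eq_zero_iff hn.symm, ← hb, idealCard_mul_self]
    _ = q / n := card_dvd_sub (Dvd.intro_left _ hn.symm) 0
    _ = g := Nat.div_eq_of_eq_mul_left hn0 hn

theorem sum_stdAddChar_mul (c : ZMod q) :
    ∑ r : ZMod q, ZMod.stdAddChar (r * c) = if c = 0 then (q : ℂ) else 0 := by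
  have := AddChar.sum_mulShift c (ZMod.isPrimitive_stdAddChar q)
  rw [this, ZMod.card]
  split_ifs <;> simp

theorem stdAddChar_sum {ι : Type*} (s : Finset ι) (F : ι → ZMod q) :
    (ZMod.stdAddChar (∑ i ∈ s, F i) : ℂ) = ∏ i ∈ s, ZMod.stdAddChar (F i) := by
  induction s using Finset.induction_on with
  | empty => simp
  | insert a s ha ih => rw [Finset.sum_insert ha, Finset.prod_insert ha, AddChar.map_add_eq_mul, ih]

theorem normSq_sum_eq {ι : Type*} [Fintype ι] (F : ι → ZMod q) :
    ((‖∑ i, (ZMod.stdAddChar (F i) : ℂ)‖ ^ 2 : ℝ) : ℂ) = ∑ i, ∑ j, ZMod.stdAddChar (F i - F j) := by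
  rw [Complex.ofReal_pow, ← Complex.mul_conj', map_sum, Finset.sum_mul_sum]
  refine Finset.sum_congr rfl fun i _ => Finset.sum_congr rfl fun j _ => ?_
  rw [← AddChar.map_neg_eq_conj, ← AddChar.map_add_eq_mul, sub_eq_add_neg]

/-- The bilinear exponential sum attached to two families. -/
noncomputable def bilin {Λ T : Type*} [Fintype Λ] [Fintype T] (x : Λ → ZMod q) (u : T → ZMod q) (b : ZMod q) : ℝ :=
  ∑ t, ∑ t', ‖∑ l, (ZMod.stdAddChar (x l * (b * (u t - u t'))) : ℂ)‖ ^ 2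

/-- For fixed t' the frequency b(u t - u t') takes each value of the ideal (b) at most M₂ times.
Summing over the whole ideal instead, Parseval counts the pairs l, l' with b x l = b x l', at most
|Λ|M₁ of them. -/
theorem bilin_le {Λ T : Type*} [Fintype Λ] [Fintype T] (x : Λ → ZMod q) (u : T → ZMod q) (b : ZMod q)
    (M₁ M₂ : ℝ) (h₁ : ∀ ξ, ((Finset.univ.filter fun l => b * x l = ξ).card : ℝ) ≤ M₁)
    (h₂ : ∀ ξ, ((Finset.univ.filter fun t => b * u t = ξ).card : ℝ) ≤ M₂) :
    bilin x u b ≤ Fintype.card T * (M₂ * (idealCard b * (Fintype.card Λ * M₁))) := by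
  have hM2 : 0 ≤ M₂ := (Nat.cast_nonneg _).trans (h₂ 0)
  set F : ZMod q → ℝ := fun η => ‖∑ l, (ZMod.stdAddChar (x l * η) : ℂ)‖ ^ 2
  have hF : ∀ η, 0 ≤ F η := fun η => by positivity
  set I := Finset.univ.image fun r : ZMod q => b * r
  have hq : (0 : ℝ) < q := by exact_mod_cast Nat.pos_of_ne_zero (NeZero.ne q)
  have hsumF : ∑ η ∈ I, F η ≤ idealCard b * (Fintype.card Λ * M₁) := by
    have h3 : ∑ r, F (b * r) = q * ∑ l, ((Finset.univ.filter fun l' => b * x l' = b * x l).card : ℝ) := by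
      have h4 : ((∑ r, F (b * r) : ℝ) : ℂ) = ((q * ∑ l, ((Finset.univ.filter fun l' => b * x l' = b * x l).card : ℝ) : ℝ) : ℂ) := by
        rw [Complex.ofReal_sum]
        simp only [F, normSq_sum_eq]
        rw [Finset.sum_comm]
        push_cast
        rw [Finset.mul_sum]
        refine Finset.sum_congr rfl fun l _ => ?_
        rw [Finset.sum_comm]
        have h5 : ∀ l', ∑ r, (ZMod.stdAddChar (x l * (b * r) - x l' * (b * r)) : ℂ) =
            if b * x l' = b * x l then (q : ℂ) else 0 := by
          intro l'
          have := sum_stdAddChar_mul (b * (x l - x l'))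
          have h6 : (b * (x l - x l') = 0) ↔ b * x l' = b * x l := by
            rw [mul_sub, sub_eq_zero, eq_comm]
          simp only [h6] at this
          rw [← this]
          refine Finset.sum_congr rfl fun r _ => ?_
          congr 1; ring
        rw [Finset.sum_congr rfl fun l' _ => h5 l', ← Finset.sum_filter, Finset.sum_const, nsmul_eq_mul, mul_comm]
      exact_mod_cast h4
    rw [sum_ideal, nsmul_eq_mul] at h3
    have h4 : ((Finset.univ.filter fun r : ZMod q => b * r = 0).card : ℝ) * idealCard b = q := by
      exact_mod_cast card_ann_mul_idealCard b
    have h5 : (0 : ℝ) < (Finset.univ.filter fun r : ZMod q => b * r = 0).card := by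
      exact_mod_cast Finset.card_pos.2 ⟨0, by simp⟩
    refine le_of_mul_le_mul_left ?_ h5
    rw [h3, ← mul_assoc, h4]
    refine mul_le_mul_of_nonneg_left ?_ hq.le
    calc _ ≤ ∑ l : Λ, M₁ := Finset.sum_le_sum fun l _ => h₁ _
      _ = _ := by rw [Finset.sum_const, Finset.card_univ, nsmul_eq_mul]
  unfold bilin
  rw [Finset.sum_comm]
  have hrow : ∀ t', ∑ t, ‖∑ l, (ZMod.stdAddChar (x l * (b * (u t - u t'))) : ℂ)‖ ^ 2 ≤
      M₂ * (idealCard b * (Fintype.card Λ * M₁)) := by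
    intro t'
    calc ∑ t, F (b * (u t - u t'))
        = ∑ η ∈ I, ∑ t ∈ Finset.univ.filter (fun t => b * (u t - u t') = η), F (b * (u t - u t')) :=
          (Finset.sum_fiberwise_of_maps_to (fun t _ => Finset.mem_image_of_mem _ (Finset.mem_univ _)) _).symm
      _ ≤ ∑ η ∈ I, M₂ * F η := by
          refine Finset.sum_le_sum fun η _ => ?_
          rw [Finset.sum_congr rfl (g := fun _ => F η) fun t ht => by rw [(Finset.mem_filter.1 ht).2],
            Finset.sum_const, nsmul_eq_mul]
          refine mul_le_mul_of_nonneg_right ?_ (hF η)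
          refine le_trans (le_of_eq ?_) (h₂ (η + b * u t'))
          congr 2
          ext t
          simp only [Finset.mem_filter, Finset.mem_univ, true_and]
          rw [mul_sub, sub_eq_iff_eq_add]
      _ = M₂ * ∑ η ∈ I, F η := by rw [Finset.mul_sum]
      _ ≤ _ := mul_le_mul_of_nonneg_left hsumF hM2
  calc _ ≤ ∑ t' : T, M₂ * (idealCard b * (Fintype.card Λ * M₁)) := Finset.sum_le_sum fun t' _ => hrow t'
    _ = _ := by rw [Finset.sum_const, Finset.card_univ, nsmul_eq_mul]

theorem sum_inv_cube_le (n : ℕ) : ∑ g ∈ Finset.Icc 2 n, ((g : ℝ) * ((g : ℝ) ^ 4)⁻¹) ≤ 1 / 4 := by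
  have h : ∀ m : ℕ, ∑ g ∈ Finset.Icc 2 (m + 1), ((g : ℝ) * ((g : ℝ) ^ 4)⁻¹)
      ≤ 1 / 4 - 1 / (2 * ((m : ℝ) + 1) * (m + 2)) := by
    intro m
    induction m with
    | zero => norm_num
    | succ m ih =>
      rw [Finset.sum_Icc_succ_top (by omega)]
      have h1 : (((m + 1 + 1 : ℕ) : ℝ) * (((m + 1 + 1 : ℕ) : ℝ) ^ 4)⁻¹) ≤
          1 / (2 * ((m : ℝ) + 1) * (m + 2)) - 1 / (2 * ((m : ℝ) + 2) * (m + 3)) := by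
        push_cast
        have hm : (0 : ℝ) ≤ m := Nat.cast_nonneg m
        have e1 : ((m : ℝ) + 1 + 1) * (((m : ℝ) + 1 + 1) ^ 4)⁻¹ = 1 / (m + 2) ^ 3 := by
          rw [show (m : ℝ) + 1 + 1 = m + 2 by ring]; field_simp
        have e2 : 1 / (2 * ((m : ℝ) + 1) * (m + 2)) - 1 / (2 * ((m : ℝ) + 2) * (m + 3))
            = 1 / (((m : ℝ) + 1) * (m + 2) * (m + 3)) := by field_simp; ring
        rw [e1, e2]
        refine one_div_le_one_div_of_le (by positivity) ?_
        nlinarith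
      push_cast at ih ⊢
      have e3 : (m : ℝ) + 1 + 1 = m + 2 := by ring
      have e4 : (m : ℝ) + 1 + 2 = m + 3 := by ring
      rw [e3, e4]
      push_cast at h1
      rw [e3] at h1
      linarith
  rcases n with _ | m
  · norm_num
  · refine (h m).trans ?_
    have : (0 : ℝ) ≤ 1 / (2 * ((m : ℝ) + 1) * (m + 2)) := by positivity
    linarith

/-- At most g residues generate an ideal of size g, and only 0 generates one of size 1, so the sum
is at most ∑_{g ≥ 2} g⁻³. -/
theorem sum_idealCard_inv_le :
    ∑ b ∈ (Finset.univ : Finset (ZMod q)).erase 0, ((idealCard b : ℝ) ^ 4)⁻¹ ≤ 1 / 4 := by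
  have hq : 0 < q := Nat.pos_of_ne_zero (NeZero.ne q)
  have hmaps : ∀ b ∈ (Finset.univ : Finset (ZMod q)).erase 0, idealCard b ∈ Finset.Icc 2 q := by
    intro b hb
    refine Finset.mem_Icc.2 ⟨?_, Nat.le_of_dvd hq (idealCard_dvd b)⟩
    by_contra hlt
    have h1 : idealCard b = 1 := by have := idealCard_pos b; omega
    have h2 := idealCard_mul_self b
    rw [h1, Nat.cast_one, one_mul] at h2
    exact (Finset.mem_erase.1 hb).1 h2
  rw [← Finset.sum_fiberwise_of_maps_to hmaps]
  refine le_trans (Finset.sum_le_sum fun g hg => ?_) (sum_inv_cube_le q)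
  rw [Finset.sum_congr rfl (g := fun _ => ((g : ℝ) ^ 4)⁻¹) fun b hb => by rw [(Finset.mem_filter.1 hb).2],
    Finset.sum_const, nsmul_eq_mul]
  refine mul_le_mul_of_nonneg_right ?_ (by positivity)
  by_cases hgq : g ∣ q
  · have h1 := card_idealCard_eq_le g hgq
    have h2 : (((Finset.univ : Finset (ZMod q)).erase 0).filter fun b => idealCard b = g).card ≤
        (Finset.univ.filter fun b : ZMod q => idealCard b = g).card :=
      Finset.card_le_card (Finset.filter_subset_filter _ (Finset.erase_subset _ _))
    exact_mod_cast h2.trans h1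
  · rw [Finset.filter_false_of_mem]
    · simp
    · rintro b - rfl; exact hgq (idealCard_dvd b)

/-- Six bilinear terms with spread families cover a whole ideal. -/
theorem exists_bilinear_rep {Λ T : Type*} [Fintype Λ] [Fintype T] [Nonempty Λ] [Nonempty T]
    (x : Λ → ZMod q) (u : T → ZMod q) (f : ZMod q)
    (h₁ : ∀ a ξ, ((Finset.univ.filter fun l => f * a * x l = ξ).card : ℝ) ≤
      Fintype.card Λ * (idealCard (f * a) : ℝ) ^ (-(5 / 6) : ℝ))
    (h₂ : ∀ a ξ, ((Finset.univ.filter fun t => f * a * u t = ξ).card : ℝ) ≤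
      Fintype.card T * (idealCard (f * a) : ℝ) ^ (-(5 / 6) : ℝ)) (y : ZMod q) :
    ∃ w : Fin 6 → (Λ × Λ) × (T × T),
      f * y = ∑ i, f * ((x (w i).1.1 - x (w i).1.2) * (u (w i).2.1 - u (w i).2.2)) := by
  set J := (Λ × Λ) × (T × T)
  set v : J → ZMod q := fun w => (x w.1.1 - x w.1.2) * (u w.2.1 - u w.2.2)
  set M : ℝ := (Fintype.card Λ : ℝ) ^ 2 * (Fintype.card T : ℝ) ^ 2
  have hM : 0 < M := by
    have h1 : 0 < (Fintype.card Λ : ℝ) := by exact_mod_cast Fintype.card_pos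
    have h2 : 0 < (Fintype.card T : ℝ) := by exact_mod_cast Fintype.card_pos
    positivity
  have hS : ∀ b, ∑ w : J, (ZMod.stdAddChar (b * v w) : ℂ) = (bilin x u b : ℂ) := by
    intro b
    simp only [bilin, Complex.ofReal_sum, normSq_sum_eq]
    rw [Fintype.sum_prod_type, Finset.sum_comm, Fintype.sum_prod_type]
    refine Finset.sum_congr rfl fun t _ => Finset.sum_congr rfl fun t' _ => ?_
    rw [Fintype.sum_prod_type]
    refine Finset.sum_congr rfl fun l _ => Finset.sum_congr rfl fun l' _ => ?_
    congr 1
    simp only [v]; ring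
  -- With g the ideal size, the bilinear bound saves g^(-5/6)·g·g^(-5/6) = g^(-2/3). Six summands
  -- are taken so that the saving becomes g⁻⁴, summable with total at most 1/4.
  have hb : ∀ a, bilin x u (f * a) ^ 6 ≤ M ^ 6 * ((idealCard (f * a) : ℝ) ^ 4)⁻¹ := by
    intro a
    have h3 := bilin_le x u (f * a) _ _ (h₁ a) (h₂ a)
    have h0 : 0 ≤ bilin x u (f * a) := Finset.sum_nonneg fun _ _ => Finset.sum_nonneg fun _ _ => by positivity
    have hg : (0 : ℝ) < idealCard (f * a) := by exact_mod_cast idealCard_pos _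
    set g : ℝ := (idealCard (f * a) : ℝ)
    have h4 : (Fintype.card T : ℝ) * (Fintype.card T * g ^ (-(5 / 6) : ℝ) * (g * (Fintype.card Λ *
        (Fintype.card Λ * g ^ (-(5 / 6) : ℝ))))) = M * g ^ (-(2 / 3) : ℝ) := by
      have : g ^ (-(2 / 3) : ℝ) = g ^ (-(5 / 6) : ℝ) * g * g ^ (-(5 / 6) : ℝ) := by
        nth_rewrite 3 [← Real.rpow_one g]
        rw [← Real.rpow_add hg, ← Real.rpow_add hg]; norm_num
      rw [this]; simp only [M]; ring
    rw [h4] at h3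
    calc bilin x u (f * a) ^ 6 ≤ (M * g ^ (-(2 / 3) : ℝ)) ^ 6 := by gcongr
      _ = M ^ 6 * (g ^ 4)⁻¹ := by
        rw [mul_pow, ← Real.rpow_natCast (g ^ (-(2 / 3) : ℝ)) 6, ← Real.rpow_mul hg.le,
          ← Real.rpow_natCast g 4, ← Real.rpow_neg hg.le]
        norm_num
  have hb0 : bilin x u 0 = M := by
    simp only [bilin, zero_mul, mul_zero, AddChar.map_zero_eq_one, Finset.sum_const, Finset.card_univ,
      nsmul_eq_mul, mul_one, Complex.norm_natCast, M]
    ring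
  by_contra hcon
  push Not at hcon
  -- Up to the factor q, this Fourier sum counts representations of f y. The frequencies with f a =
  -- 0 give the main term and all others together at most a quarter of it, so the count cannot
  -- vanish.
  have hzero : ∑ a : ZMod q, (ZMod.stdAddChar (-(a * (f * y))) : ℂ) * (bilin x u (f * a) : ℂ) ^ 6 = 0 := by
    have h3 : ∀ a : ZMod q, (ZMod.stdAddChar (-(a * (f * y))) : ℂ) * (bilin x u (f * a) : ℂ) ^ 6 =
        ∑ w : Fin 6 → J, ZMod.stdAddChar (a * (∑ i, f * v (w i) - f * y)) := by
      intro a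
      rw [← hS, Finset.sum_pow', Fintype.piFinset_univ, Finset.mul_sum]
      refine Finset.sum_congr rfl fun w _ => ?_
      rw [← stdAddChar_sum, ← AddChar.map_add_eq_mul]
      congr 1
      rw [mul_sub, Finset.mul_sum, sub_eq_neg_add]
      congr 1
      exact Finset.sum_congr rfl fun i _ => by ring
    rw [Finset.sum_congr rfl fun a _ => h3 a, Finset.sum_comm]
    refine Finset.sum_eq_zero fun w _ => ?_
    rw [sum_stdAddChar_mul, if_neg]
    exact fun h => hcon w (sub_eq_zero.1 h).symm
  set N := (Finset.univ.filter fun a : ZMod q => f * a = 0)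
  have hN : (0 : ℝ) < N.card := by exact_mod_cast Finset.card_pos.2 ⟨0, by simp [N]⟩
  have hmain : ∑ a ∈ N, (ZMod.stdAddChar (-(a * (f * y))) : ℂ) * (bilin x u (f * a) : ℂ) ^ 6 =
      ((N.card * M ^ 6 : ℝ) : ℂ) := by
    have : ∀ a ∈ N, (ZMod.stdAddChar (-(a * (f * y))) : ℂ) * (bilin x u (f * a) : ℂ) ^ 6 = (M : ℂ) ^ 6 := by
      intro a ha
      have ha' : f * a = 0 := (Finset.mem_filter.1 ha).2
      rw [← mul_assoc, mul_comm a f, ha', hb0, zero_mul, neg_zero, AddChar.map_zero_eq_one, one_mul]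
    rw [Finset.sum_congr rfl this, Finset.sum_const, nsmul_eq_mul]
    push_cast; rfl
  rw [← Finset.sum_filter_add_sum_filter_not Finset.univ (fun a => f * a = 0), hmain] at hzero
  have herr : ‖∑ a ∈ Finset.univ.filter (fun a : ZMod q => ¬ f * a = 0),
      (ZMod.stdAddChar (-(a * (f * y))) : ℂ) * (bilin x u (f * a) : ℂ) ^ 6‖ ≤ N.card * (M ^ 6 * (1 / 4)) := by
    calc _ ≤ ∑ a ∈ Finset.univ.filter (fun a : ZMod q => ¬ f * a = 0), M ^ 6 * ((idealCard (f * a) : ℝ) ^ 4)⁻¹ := by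
          refine norm_sum_le_of_le _ fun a _ => ?_
          rw [norm_mul, AddChar.norm_apply, one_mul, norm_pow, Complex.norm_real, Real.norm_eq_abs,
            Even.pow_abs (by decide)]
          exact hb a
      _ = ∑ a, (if f * a ≠ 0 then M ^ 6 * ((idealCard (f * a) : ℝ) ^ 4)⁻¹ else 0) := by rw [Finset.sum_filter]
      _ = N.card • ∑ η ∈ Finset.univ.image (fun r : ZMod q => f * r),
            (if η ≠ 0 then M ^ 6 * ((idealCard η : ℝ) ^ 4)⁻¹ else 0) :=
          sum_ideal f (fun η => if η ≠ 0 then M ^ 6 * ((idealCard η : ℝ) ^ 4)⁻¹ else 0)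
      _ ≤ N.card * (M ^ 6 * (1 / 4)) := by
          rw [nsmul_eq_mul]
          refine mul_le_mul_of_nonneg_left ?_ hN.le
          rw [← Finset.sum_filter, ← Finset.mul_sum]
          refine mul_le_mul_of_nonneg_left ?_ (by positivity)
          refine le_trans (Finset.sum_le_sum_of_subset_of_nonneg ?_ fun _ _ _ => by positivity)
            (sum_idealCard_inv_le (q := q))
          intro η hη
          exact Finset.mem_erase.2 ⟨(Finset.mem_filter.1 hη).2, Finset.mem_univ _⟩
  have h5 := eq_neg_of_add_eq_zero_left hzero
  have h6 := congrArg norm h5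
  rw [norm_neg, Complex.norm_real, Real.norm_of_nonneg (by positivity)] at h6
  rw [← h6] at herr
  have h7 : 0 < N.card * M ^ 6 := by positivity
  nlinarith

end RingFourier

/-! ### Extremal residue classes. -/

section Spread

variable {q : ℕ} [NeZero q]

/-- Passing to a residue class in which a family becomes spread. -/
theorem exists_spread {I : Type*} [Fintype I] [Nonempty I] (v : I → ZMod q) :
    ∃ (f : ℕ) (c : ZMod q) (I' : Finset I) (u : I → ZMod q), f ∣ q ∧ I'.Nonempty ∧
      (∀ i ∈ I', v i = c + f * u i) ∧ (Fintype.card I : ℝ) ≤ I'.card * (f : ℝ) ^ (5 / 6 : ℝ) ∧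
      ∀ a ξ, ((I'.filter fun i => (f : ZMod q) * a * u i = ξ).card : ℝ) ≤
        I'.card * (idealCard ((f : ZMod q) * a) : ℝ) ^ (-(5 / 6) : ℝ) := by
  have hq0 : q ≠ 0 := NeZero.ne q
  set cl : ℕ × ZMod q → Finset I := fun w => Finset.univ.filter fun i => (w.1 : ZMod q) ∣ v i - w.2
  -- The class maximizing size times modulus^(5/6) is chosen. Further concentration inside it would
  -- place too many members in a class of larger modulus, contradicting maximality.
  obtain ⟨⟨f, c⟩, hfc, hmax⟩ := Finset.exists_max_image (q.divisors ×ˢ (Finset.univ : Finset (ZMod q)))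
    (fun w => ((cl w).card : ℝ) * (w.1 : ℝ) ^ (5 / 6 : ℝ))
    ⟨(1, 0), Finset.mem_product.2 ⟨Nat.one_mem_divisors.2 hq0, Finset.mem_univ _⟩⟩
  have hfq : f ∣ q := (Nat.mem_divisors.1 (Finset.mem_product.1 hfc).1).1
  have hf0 : 0 < f := Nat.pos_of_dvd_of_pos hfq (Nat.pos_of_ne_zero hq0)
  have hf0' : (0 : ℝ) < f := by exact_mod_cast hf0
  have hmax' : ∀ m, m ∣ q → ∀ c', ((cl (m, c')).card : ℝ) * (m : ℝ) ^ (5 / 6 : ℝ) ≤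
      (cl (f, c)).card * (f : ℝ) ^ (5 / 6 : ℝ) := fun m hm c' =>
    hmax (m, c') (Finset.mem_product.2 ⟨Nat.mem_divisors.2 ⟨hm, hq0⟩, Finset.mem_univ _⟩)
  have hbig : (Fintype.card I : ℝ) ≤ (cl (f, c)).card * (f : ℝ) ^ (5 / 6 : ℝ) := by
    have := hmax' 1 (one_dvd _) 0
    simpa [cl] using this
  have hex : ∀ i, ∃ u, i ∈ cl (f, c) → v i = c + f * u := by
    intro i
    by_cases hi : i ∈ cl (f, c)
    · obtain ⟨u, hu⟩ := (Finset.mem_filter.1 hi).2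
      exact ⟨u, fun _ => by linear_combination hu⟩
    · exact ⟨0, fun h => absurd h hi⟩
  choose u hu using hex
  refine ⟨f, c, cl (f, c), u, hfq, ?_, hu, hbig, ?_⟩
  · by_contra hne
    rw [Finset.not_nonempty_iff_eq_empty.1 hne] at hbig
    have : (0 : ℝ) < Fintype.card I := by exact_mod_cast Fintype.card_pos
    simp at hbig
  · intro a ξ
    rcases Finset.eq_empty_or_nonempty ((cl (f, c)).filter fun i => (f : ZMod q) * a * u i = ξ) with h0 | ⟨i₀, hi₀⟩
    · rw [h0]; simp only [Finset.card_empty, Nat.cast_zero]; positivity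
    set m := idealCard a
    have hm : m ∣ q := idealCard_dvd a
    set l := Nat.lcm m f
    have hl : l ∣ q := Nat.lcm_dvd hm hfq
    obtain ⟨k, hk⟩ : f ∣ l := Nat.dvd_lcm_right m f
    have hl0 : 0 < l := Nat.lcm_pos (idealCard_pos a) hf0
    have hk0 : 0 < k := Nat.pos_of_ne_zero (by rintro rfl; omega)
    have hkq : k ∣ q := (Dvd.intro_left f hk.symm).trans hl
    have hbk : idealCard ((f : ZMod q) * a) ≤ k := by
      refine idealCard_le_of_mul_eq_zero _ hkq ?_
      rw [← mul_assoc, ← Nat.cast_mul, mul_comm k f, ← hk, mul_comm, mul_eq_zero_iff_idealCard]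
      exact Nat.cast_dvd_cast (Nat.dvd_lcm_left m f)
    have hsub : ((cl (f, c)).filter fun i => (f : ZMod q) * a * u i = ξ) ⊆ cl (l, v i₀) := by
      intro i hi
      obtain ⟨hi1, hi2⟩ := Finset.mem_filter.1 hi
      obtain ⟨hj1, hj2⟩ := Finset.mem_filter.1 hi₀
      refine Finset.mem_filter.2 ⟨Finset.mem_univ _, lcm_dvd_of_dvd hm hfq ?_ ?_⟩
      · rw [← mul_eq_zero_iff_idealCard, hu i hi1, hu i₀ hj1]
        linear_combination hi2 - hj2
      · exact ⟨u i - u i₀, by rw [hu i hi1, hu i₀ hj1]; ring⟩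
    have h1 := hmax' l hl (v i₀)
    have h2 : (((cl (f, c)).filter fun i => (f : ZMod q) * a * u i = ξ).card : ℝ) ≤ (cl (l, v i₀)).card := by
      exact_mod_cast Finset.card_le_card hsub
    have hk0' : (0 : ℝ) < k := by exact_mod_cast hk0
    have hg0 : (0 : ℝ) < idealCard ((f : ZMod q) * a) := by exact_mod_cast idealCard_pos _
    have h3 : (l : ℝ) ^ (5 / 6 : ℝ) = (f : ℝ) ^ (5 / 6 : ℝ) * (k : ℝ) ^ (5 / 6 : ℝ) := by
      rw [hk, Nat.cast_mul, Real.mul_rpow hf0'.le hk0'.le]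
    rw [h3] at h1
    have h4 : ((cl (l, v i₀)).card : ℝ) * (k : ℝ) ^ (5 / 6 : ℝ) ≤ (cl (f, c)).card := by
      have hfp : 0 < (f : ℝ) ^ (5 / 6 : ℝ) := by positivity
      refine le_of_mul_le_mul_right ?_ hfp
      calc _ = _ := by ring
        _ ≤ _ := h1
    have h5 : (idealCard ((f : ZMod q) * a) : ℝ) ^ (5 / 6 : ℝ) ≤ (k : ℝ) ^ (5 / 6 : ℝ) := by
      gcongr
    rw [Real.rpow_neg hg0.le, ← div_eq_mul_inv, le_div_iff₀ (by positivity)]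
    calc _ ≤ ((cl (l, v i₀)).card : ℝ) * (k : ℝ) ^ (5 / 6 : ℝ) := by gcongr
      _ ≤ _ := h4

end Spread

/-! ### Word sets and translates. -/

section Words

variable {G : Type*} [Group G]

theorem mul_mem_pow_add {S : Set G} {m n k : ℕ} (hk : m + n = k) {x y : G} (hx : x ∈ S ^ m)
    (hy : y ∈ S ^ n) : x * y ∈ S ^ k := by
  rw [← hk, pow_add]; exact Set.mul_mem_mul hx hy

theorem inv_mem_pow {S : Set G} (hS : S⁻¹ = S) {n : ℕ} {x : G} (hx : x ∈ S ^ n) : x⁻¹ ∈ S ^ n := by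
  have : (S ^ n)⁻¹ = S ^ n := by rw [← inv_pow, hS]
  rw [← this]; exact Set.inv_mem_inv.2 hx

theorem card_filter_subtype {I : Type*} (s : Finset I) (P : I → Prop) :
    (Finset.univ.filter fun i : s => P i).card = (s.filter P).card := by
  rw [← Finset.card_map (Function.Embedding.subtype _)]
  congr 1
  ext i
  simp only [Finset.mem_map, Finset.mem_filter, Finset.mem_univ, true_and, Function.Embedding.subtype_apply]
  constructor
  · rintro ⟨a, ha, rfl⟩; exact ⟨a.2, ha⟩
  · rintro ⟨h1, h2⟩; exact ⟨⟨i, h1⟩, h2, rfl⟩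

/-- The average over g of the number of t with g · j t in B is |T||B|/|Γ|. -/
theorem exists_translate_card {Γ T : Type*} [Group Γ] [Fintype Γ] [Fintype T] (j : T → Γ) (B : Finset Γ)
    (δ : ℝ) (hB : δ * Fintype.card Γ ≤ B.card) :
    ∃ g, δ * Fintype.card T ≤ (Finset.univ.filter fun t => g * j t ∈ B).card := by
  by_contra hcon
  push Not at hcon
  have hpos : 0 < Fintype.card Γ := Fintype.card_pos
  have h1 : ∑ g : Γ, ((Finset.univ.filter fun t => g * j t ∈ B).card : ℝ) = Fintype.card T * B.card := by
    simp only [Finset.card_filter, Nat.cast_sum]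
    rw [Finset.sum_comm]
    have h2 : ∀ t, ∑ g : Γ, (((if g * j t ∈ B then 1 else 0 : ℕ)) : ℝ) = B.card := by
      intro t
      refine (Fintype.sum_equiv (Equiv.mulRight (j t)) _ (fun g => (((if g ∈ B then 1 else 0 : ℕ)) : ℝ))
        fun g => rfl).trans ?_
      simp
    rw [Finset.sum_congr rfl fun t _ => h2 t, Finset.sum_const, Finset.card_univ, nsmul_eq_mul]
  have h3 : ∑ g : Γ, ((Finset.univ.filter fun t => g * j t ∈ B).card : ℝ) < ∑ g : Γ, δ * Fintype.card T :=
    Finset.sum_lt_sum_of_nonempty Finset.univ_nonempty fun g _ => hcon g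
  rw [h1, Finset.sum_const, Finset.card_univ, nsmul_eq_mul] at h3
  have h4 := mul_le_mul_of_nonneg_left hB (Nat.cast_nonneg (α := ℝ) (Fintype.card T))
  linarith

end Words

/-! ### Bounded words covering a large group of upper unipotents. -/

section Coverage

theorem dD_conj_uU {R : Type*} [CommRing R] (u : Rˣ) (s : R) : dD u * uU s * (dD u)⁻¹ = uU ((u : R) ^ 2 * s) := by
  rw [dD_mul_uU, mul_inv_cancel_right]

theorem dD_mul {R : Type*} [CommRing R] (u v : Rˣ) : dD (u * v) = dD u * dD v := by
  refine SL2_ext ?_ ?_ ?_ ?_ <;> simp [SL2_mul_apply, mul_comm]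

theorem dD_inv {R : Type*} [CommRing R] (u : Rˣ) : dD u⁻¹ = (dD u)⁻¹ := by
  rw [eq_inv_iff_mul_eq_one, ← dD_mul, inv_mul_cancel]
  refine SL2_ext ?_ ?_ ?_ ?_ <;> simp

theorem card_units_fiber {q f : ℕ} [NeZero q] [NeZero f] (hf : f ∣ q) (v : (ZMod f)ˣ) :
    (Finset.univ.filter fun u : (ZMod q)ˣ => ZMod.unitsMap hf u = v).card * f.totient = q.totient := by
  have hs : Function.Surjective (ZMod.unitsMap hf) := ZMod.unitsMap_surjective hf
  have h2 := Finset.card_eq_sum_card_fiberwise (f := ZMod.unitsMap hf) (s := Finset.univ) (t := Finset.univ)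
    (fun _ _ => Finset.mem_coe.2 (Finset.mem_univ _))
  have hk : ∀ w, (Finset.univ.filter fun u : (ZMod q)ˣ => ZMod.unitsMap hf u = w).card =
      (Finset.univ.filter fun u : (ZMod q)ˣ => ZMod.unitsMap hf u = v).card := fun w => by
    have := MonoidHom.card_fiber_eq_of_mem_range (ZMod.unitsMap hf) (hs w) (hs v)
    convert this
  rw [Finset.sum_congr rfl fun w _ => hk w, Finset.sum_const, Finset.card_univ, Finset.card_univ, smul_eq_mul,
    ZMod.card_units_eq_totient, ZMod.card_units_eq_totient] at h2
  rw [h2, mul_comm]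

theorem card_units_sq_cong_le {q f : ℕ} [NeZero q] (hf : f ∣ q) (c : ZMod q) :
    (Finset.univ.filter fun u : (ZMod q)ˣ => (f : ZMod q) ∣ (u : ZMod q) ^ 2 - c).card * f.totient
      ≤ 2 * f.divisors.card * q.totient := by
  have : NeZero f := ⟨fun h0 => NeZero.ne q (by subst h0; exact zero_dvd_iff.1 hf)⟩
  set s := Finset.univ.filter fun u : (ZMod q)ˣ => (f : ZMod q) ∣ (u : ZMod q) ^ 2 - c
  set t := Finset.univ.filter fun v : (ZMod f)ˣ => (v : ZMod f) ^ 2 = ZMod.castHom hf (ZMod f) c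
  have ht : t.card ≤ 2 * f.divisors.card := card_unit_sq_eq_le _
  have hs : s.card = ∑ v ∈ t, (s.filter fun u => ZMod.unitsMap hf u = v).card := by
    refine Finset.card_eq_sum_card_fiberwise fun u hu => ?_
    have hu' := (Finset.mem_filter.1 (Finset.mem_coe.1 hu)).2
    refine Finset.mem_coe.2 (Finset.mem_filter.2 ⟨Finset.mem_univ _, ?_⟩)
    rw [← (castHom_eq_iff hf _ _).2 hu', map_pow]
    rfl
  rw [hs, Finset.sum_mul]
  calc _ ≤ ∑ v ∈ t, q.totient := by
        refine Finset.sum_le_sum fun v _ => ?_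
        rw [← card_units_fiber hf v]
        exact Nat.mul_le_mul_right _ (Finset.card_le_card (Finset.filter_subset_filter _ (Finset.subset_univ _)))
    _ = t.card * q.totient := by rw [Finset.sum_const, smul_eq_mul]
    _ ≤ _ := Nat.mul_le_mul_right _ ht

/-- A class modulo f has at most q/f members, while the extremal one has at least δ q f^(-5/6), so
f^(1/6) ≤ δ⁻¹. -/
theorem modulus_bound_one {δ f q N : ℝ} (hδ : 0 < δ) (hf0 : 0 < f) (hq : 0 < q)
    (h2 : δ * q ≤ N * f ^ (5 / 6 : ℝ)) (h1 : N * f ≤ q) : f ≤ (δ⁻¹) ^ 6 := by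
  have h4 : δ * f ^ (1 / 6 : ℝ) ≤ 1 := by
    have h5 : f = f ^ (5 / 6 : ℝ) * f ^ (1 / 6 : ℝ) := by
      rw [← Real.rpow_add hf0]; norm_num
    have h6 : δ * q * f ^ (1 / 6 : ℝ) ≤ q := by
      calc δ * q * f ^ (1 / 6 : ℝ) ≤ (N * f ^ (5 / 6 : ℝ)) * f ^ (1 / 6 : ℝ) := by
            gcongr
        _ = N * f := by rw [mul_assoc, ← h5]
        _ ≤ q := h1
    refine le_of_mul_le_mul_right ?_ hq
    linarith
  have h7 : f ^ (1 / 6 : ℝ) ≤ δ⁻¹ := by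
    rw [← one_div, le_div_iff₀ hδ]; linarith
  calc f = (f ^ (1 / 6 : ℝ)) ^ 6 := by
        rw [← Real.rpow_natCast, ← Real.rpow_mul hf0.le]; norm_num
    _ ≤ (δ⁻¹) ^ 6 := by gcongr

/-- The analogue for squares of units, where t stands for a power of the divisor function: of the
available f^(1/6), a part f^(1/24) pays for t and f^(1/8) remains. -/
theorem modulus_bound_two {δ f q N t C : ℝ} (hδ : 0 < δ) (hf0 : 0 < f) (hq : 0 < q)
    (h2 : δ * q ≤ N * f ^ (5 / 6 : ℝ)) (h1 : N * f ≤ 2 * t * q) (hτ2 : t ≤ C * f ^ (1 / 24 : ℝ)) :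
    f ≤ (2 * C) ^ 8 * (δ⁻¹) ^ 8 := by
  have h4 : δ * f ^ (1 / 8 : ℝ) ≤ 2 * C := by
    have h5 : f = f ^ (5 / 6 : ℝ) * f ^ (1 / 8 : ℝ) * f ^ (1 / 24 : ℝ) := by
      rw [← Real.rpow_add hf0, ← Real.rpow_add hf0]; norm_num
    have h6 : δ * q * f ^ (1 / 8 : ℝ) * f ^ (1 / 24 : ℝ) ≤ 2 * (C * f ^ (1 / 24 : ℝ)) * q := by
      calc _ ≤ (N * f ^ (5 / 6 : ℝ)) * f ^ (1 / 8 : ℝ) * f ^ (1 / 24 : ℝ) := by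
            gcongr
        _ = N * f := by
            nth_rewrite 4 [h5]; ring
        _ ≤ 2 * t * q := h1
        _ ≤ _ := by gcongr
    have hp : 0 < f ^ (1 / 24 : ℝ) * q := by positivity
    refine le_of_mul_le_mul_right ?_ hp
    linarith
  have h7 : f ^ (1 / 8 : ℝ) ≤ 2 * C * δ⁻¹ := by
    rw [← div_eq_mul_inv, le_div_iff₀ hδ]; linarith
  calc f = (f ^ (1 / 8 : ℝ)) ^ 8 := by
        rw [← Real.rpow_natCast, ← Real.rpow_mul hf0.le]; norm_num
    _ ≤ (2 * C * δ⁻¹) ^ 8 := by gcongr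
    _ = _ := by rw [mul_pow]

set_option maxHeartbeats 1000000 in
/-- A dense symmetric set covers, in boundedly many steps, a large group of unipotents exactly. -/
theorem exists_uU_coverage : ∃ C : ℝ, 1 ≤ C ∧ ∀ (q : ℕ) [NeZero q] {G : Type} [Group G]
    (π : G →* SL(2, ZMod q)) (S : Set G), S⁻¹ = S → ∀ δ : ℝ, 0 < δ →
    δ * Fintype.card SL(2, ZMod q) ≤ (π '' S).ncard →
    ∃ f : ℕ, 0 < f ∧ (f : ℝ) ≤ C * (δ⁻¹) ^ 14 ∧ ∀ y : ZMod q, ∃ ρ ∈ S ^ 72, π ρ = uU ((f : ZMod q) * y) := by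
  obtain ⟨C₀, hC₀, hτ⟩ := exists_card_divisors_le 1 2 (1 / 24) le_rfl (by norm_num)
  refine ⟨(2 * C₀) ^ 8, one_le_pow₀ (by linarith), ?_⟩
  intro q hq G _ π S hS δ hδ hdens
  set B : Finset SL(2, ZMod q) := Finset.univ.filter fun x => x ∈ π '' S
  have hB : δ * Fintype.card SL(2, ZMod q) ≤ B.card := by
    refine hdens.trans (le_of_eq ?_)
    rw [← Set.ncard_coe_finset]
    congr 2
    ext x; simp [B]
  -- Some translates of the unipotent and of the diagonal subgroup meet the image of S in density at
  -- least δ. The unknown translating elements g and h cancel once quotients are taken.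
  obtain ⟨g, hg⟩ := exists_translate_card (fun t : ZMod q => uU t) B δ hB
  obtain ⟨h, hh⟩ := exists_translate_card (fun u : (ZMod q)ˣ => dD u) B δ hB
  set T := Finset.univ.filter fun t : ZMod q => g * uU t ∈ B
  set Λ := Finset.univ.filter fun u : (ZMod q)ˣ => h * dD u ∈ B
  rw [ZMod.card] at hg
  rw [ZMod.card_units_eq_totient] at hh
  replace hg : δ * q ≤ T.card := hg.trans (le_of_eq (by congr!))
  replace hh : δ * q.totient ≤ Λ.card := hh.trans (le_of_eq (by congr!))
  have hq0 : 0 < q := Nat.pos_of_ne_zero (NeZero.ne q)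
  have hq0' : (0 : ℝ) < q := by exact_mod_cast hq0
  have hφ0 : (0 : ℝ) < q.totient := by exact_mod_cast Nat.totient_pos.2 hq0
  have hT : T.Nonempty := Finset.card_pos.1 (by
    have : (0 : ℝ) < T.card := lt_of_lt_of_le (mul_pos hδ hq0') hg
    exact_mod_cast this)
  have hΛ : Λ.Nonempty := Finset.card_pos.1 (by
    have : (0 : ℝ) < Λ.card := lt_of_lt_of_le (mul_pos hδ hφ0) hh
    exact_mod_cast this)
  have : Nonempty T := hT.to_subtype
  have : Nonempty Λ := hΛ.to_subtype
  obtain ⟨f₁, c₁, T', u, hf₁, hT', hu, hT'c, hT's⟩ := exists_spread (fun t : T => (t : ZMod q))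
  obtain ⟨f₂, c₂, Λ', x, hf₂, hΛ', hx, hΛ'c, hΛ's⟩ := exists_spread (fun l : Λ => ((l : (ZMod q)ˣ) : ZMod q) ^ 2)
  rw [Fintype.card_coe] at hT'c hΛ'c
  have hf₁0 : 0 < f₁ := Nat.pos_of_dvd_of_pos hf₁ hq0
  have hf₂0 : 0 < f₂ := Nat.pos_of_dvd_of_pos hf₂ hq0
  have hf₁0' : (0 : ℝ) < f₁ := by exact_mod_cast hf₁0
  have hf₂0' : (0 : ℝ) < f₂ := by exact_mod_cast hf₂0
  -- bounds for the two moduli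
  have hb₁ : (f₁ : ℝ) ≤ (δ⁻¹) ^ 6 := by
    have h1 : (T'.card : ℝ) * f₁ ≤ q := by
      have h2 : T'.card ≤ (Finset.univ.filter fun t : ZMod q => (f₁ : ZMod q) ∣ t - c₁).card := by
        refine Finset.card_le_card_of_injOn (fun t => (t : ZMod q)) ?_ fun a _ b _ hab => Subtype.ext hab
        intro t ht
        refine Finset.mem_coe.2 (Finset.mem_filter.2 ⟨Finset.mem_univ _, u t, ?_⟩)
        have := hu t (Finset.mem_coe.1 ht)
        simp only at this ⊢
        rw [this]; ring
      rw [card_dvd_sub hf₁] at h2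
      have h3 : T'.card * f₁ ≤ q := (Nat.mul_le_mul_right _ h2).trans (Nat.div_mul_le_self q f₁)
      exact_mod_cast h3
    exact modulus_bound_one hδ hf₁0' hq0' (hg.trans hT'c) h1
  have hb₂ : (f₂ : ℝ) ≤ (2 * C₀) ^ 8 * (δ⁻¹) ^ 8 := by
    have h1 : (Λ'.card : ℝ) * f₂ ≤ 2 * (f₂.divisors.card : ℝ) ^ 2 * q.totient := by
      have h2 : Λ'.card ≤ (Finset.univ.filter fun t : (ZMod q)ˣ => (f₂ : ZMod q) ∣ (t : ZMod q) ^ 2 - c₂).card := by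
        refine Finset.card_le_card_of_injOn (fun t => (t : (ZMod q)ˣ)) ?_ fun a _ b _ hab => Subtype.ext hab
        intro t ht
        refine Finset.mem_coe.2 (Finset.mem_filter.2 ⟨Finset.mem_univ _, x t, ?_⟩)
        have := hx t (Finset.mem_coe.1 ht)
        simp only at this ⊢
        rw [this]; ring
      have h3 : Λ'.card * f₂ ≤ 2 * f₂.divisors.card ^ 2 * q.totient := by
        calc Λ'.card * f₂ ≤ Λ'.card * (f₂.totient * f₂.divisors.card) :=
              Nat.mul_le_mul_left _ (le_totient_mul_card_divisors f₂)
          _ = (Λ'.card * f₂.totient) * f₂.divisors.card := by ring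
          _ ≤ (2 * f₂.divisors.card * q.totient) * f₂.divisors.card :=
              Nat.mul_le_mul_right _ ((Nat.mul_le_mul_right _ h2).trans (card_units_sq_cong_le hf₂ c₂))
          _ = _ := by ring
      exact_mod_cast h3
    have hτ2 : (f₂.divisors.card : ℝ) ^ 2 ≤ C₀ * (f₂ : ℝ) ^ (1 / 24 : ℝ) := by
      simpa using hτ f₂ hf₂0.ne'
    exact modulus_bound_two hδ hf₂0' hφ0 (hh.trans hΛ'c) h1 hτ2
  refine ⟨f₁ * f₂, Nat.mul_pos hf₁0 hf₂0, ?_, ?_⟩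
  · push_cast
    calc (f₁ : ℝ) * f₂ ≤ (δ⁻¹) ^ 6 * ((2 * C₀) ^ 8 * (δ⁻¹) ^ 8) := by gcongr
      _ = _ := by ring
  intro y
  have : Nonempty T' := hT'.to_subtype
  have : Nonempty Λ' := hΛ'.to_subtype
  obtain ⟨l₀, hl₀⟩ := hΛ'
  -- The target is l₀² y, because conjugation below is by the quotients l₀⁻¹l and therefore carries
  -- a factor l₀⁻².
  obtain ⟨w, hw⟩ := exists_bilinear_rep (fun l : Λ' => x l) (fun t : T' => u t) ((f₁ : ZMod q) * f₂)
    (fun a ξ => by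
      have := hΛ's (f₁ * a) ξ
      rw [show (f₂ : ZMod q) * (f₁ * a) = f₁ * f₂ * a by ring] at this
      rw [Fintype.card_coe]
      refine le_trans (le_of_eq ?_) this
      have e := card_filter_subtype Λ' (fun l => (f₁ : ZMod q) * f₂ * a * x l = ξ)
      congr! 2
      convert e)
    (fun a ξ => by
      have := hT's (f₂ * a) ξ
      rw [show (f₁ : ZMod q) * (f₂ * a) = f₁ * f₂ * a by ring] at this
      rw [Fintype.card_coe]
      refine le_trans (le_of_eq ?_) this
      have e := card_filter_subtype T' (fun t => (f₁ : ZMod q) * f₂ * a * u t = ξ)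
      congr! 2
      convert e)
    (((l₀ : (ZMod q)ˣ) : ZMod q) ^ 2 * y)
  -- lifts
  have hlT : ∀ t : T, ∃ s ∈ S, π s = g * uU (t : ZMod q) := fun t =>
    (Finset.mem_filter.1 (Finset.mem_filter.1 t.2).2).2
  have hlΛ : ∀ l : Λ, ∃ s ∈ S, π s = h * dD (l : (ZMod q)ˣ) := fun l =>
    (Finset.mem_filter.1 (Finset.mem_filter.1 l.2).2).2
  choose b hbS hbπ using hlT
  choose a haS haπ using hlΛ
  set E : Λ → G := fun l => (a l₀)⁻¹ * a l
  set N : T → T → G := fun t t' => (b t')⁻¹ * b t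
  have hE : ∀ l, E l ∈ S ^ 2 := fun l => by
    rw [pow_two]
    exact Set.mul_mem_mul (by rw [← hS]; exact Set.inv_mem_inv.2 (haS l₀)) (haS l)
  have hN : ∀ t t', N t t' ∈ S ^ 2 := fun t t' => by
    rw [pow_two]
    exact Set.mul_mem_mul (by rw [← hS]; exact Set.inv_mem_inv.2 (hbS t')) (hbS t)
  have hEπ : ∀ l, π (E l) = dD ((l₀ : (ZMod q)ˣ)⁻¹ * (l : (ZMod q)ˣ)) := fun l => by
    simp only [E]
    rw [map_mul, map_inv, haπ, haπ, dD_mul, dD_inv]; group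
  have hNπ : ∀ t t', π (N t t') = uU ((t : ZMod q) - t') := fun t t' => by
    simp only [N]
    rw [map_mul, map_inv, hbπ, hbπ, sub_eq_neg_add, uU_add, uU_neg]; group
  -- A conjugate of a unipotent by one diagonal element times the inverse conjugate by another: the
  -- parameter is l₀⁻²(l² - l'²)(t - t'), one bilinear term. It has length 2·(2 + 2 + 2) = 12, and
  -- six of them give 72.
  set W : (Λ' × Λ') × (T' × T') → G := fun w =>
    E w.1.1 * N w.2.1 w.2.2 * (E w.1.1)⁻¹ * (E w.1.2 * (N w.2.1 w.2.2)⁻¹ * (E w.1.2)⁻¹)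
  have hW : ∀ w, W w ∈ S ^ 12 := fun w =>
    mul_mem_pow_add rfl
      (mul_mem_pow_add (n := 2) (m := 4) rfl (mul_mem_pow_add rfl (hE _) (hN _ _)) (inv_mem_pow hS (hE _)))
      (mul_mem_pow_add (n := 2) (m := 4) rfl (mul_mem_pow_add rfl (hE _) (inv_mem_pow hS (hN _ _)))
        (inv_mem_pow hS (hE _)))
  have hl₀u : (((l₀ : (ZMod q)ˣ)⁻¹ : (ZMod q)ˣ) : ZMod q) ^ 2 * ((l₀ : (ZMod q)ˣ) : ZMod q) ^ 2 = 1 := by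
    rw [← mul_pow, Units.inv_mul, one_pow]
  have hWπ : ∀ w, π (W w) = uU ((((l₀ : (ZMod q)ˣ)⁻¹ : (ZMod q)ˣ) : ZMod q) ^ 2 *
      (f₁ * f₂ * ((x w.1.1 - x w.1.2) * (u w.2.1 - u w.2.2)))) := by
    intro w
    change π (E w.1.1 * N w.2.1 w.2.2 * (E w.1.1)⁻¹ * (E w.1.2 * (N w.2.1 w.2.2)⁻¹ * (E w.1.2)⁻¹)) = _
    simp only [map_mul, map_inv]
    rw [hEπ, hEπ, hNπ, ← uU_neg, dD_conj_uU, dD_conj_uU, ← uU_add]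
    congr 1
    have e1 := hx _ w.1.1.2
    have e2 := hx _ w.1.2.2
    have e3 := hu _ w.2.1.2
    have e4 := hu _ w.2.2.2
    push_cast
    rw [mul_pow, mul_pow, e1, e2, e3, e4]
    ring
  refine ⟨W (w 0) * W (w 1) * W (w 2) * W (w 3) * W (w 4) * W (w 5), ?_, ?_⟩
  · exact mul_mem_pow_add (m := 60) rfl (mul_mem_pow_add (m := 48) rfl (mul_mem_pow_add (m := 36) rfl
      (mul_mem_pow_add (m := 24) rfl (mul_mem_pow_add rfl (hW _) (hW _)) (hW _)) (hW _)) (hW _)) (hW _)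
  · simp only [map_mul, hWπ, ← uU_add]
    congr 1
    rw [Fin.sum_univ_six] at hw
    push_cast
    linear_combination ((f₁ : ZMod q) * f₂ * y) * hl₀u -
      (((l₀ : (ZMod q)ˣ)⁻¹ : (ZMod q)ˣ) : ZMod q) ^ 2 * hw

end Coverage

/-! ### Elementary generation of deep congruence subgroups. -/

section Generation

/-- The element conjugating upper unipotents into lower unipotents. -/
def weyl {R : Type*} [CommRing R] : SL(2, R) := uU 1 * uV (-1) * uU 1

theorem weyl_conj {R : Type*} [CommRing R] (t : R) : (weyl * uU t * weyl⁻¹ : SL(2, R)) = uV (-t) := conj_uU t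

/-- The upper unipotent case is applied to π and to π followed by conjugation by the inverse Weyl
element; the product of the two moduli serves both. -/
theorem exists_uU_uV_coverage : ∃ C : ℝ, 1 ≤ C ∧ ∀ (q : ℕ) [NeZero q] {G : Type} [Group G]
    (π : G →* SL(2, ZMod q)) (S : Set G), S⁻¹ = S → ∀ δ : ℝ, 0 < δ →
    δ * Fintype.card SL(2, ZMod q) ≤ (π '' S).ncard →
    ∃ f : ℕ, 0 < f ∧ (f : ℝ) ≤ C * (δ⁻¹) ^ 28 ∧ ∀ y : ZMod q,
      (∃ ρ ∈ S ^ 72, π ρ = uU ((f : ZMod q) * y)) ∧ ∃ ρ ∈ S ^ 72, π ρ = uV ((f : ZMod q) * y) := by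
  obtain ⟨C, hC, H⟩ := exists_uU_coverage
  refine ⟨C ^ 2, one_le_pow₀ hC, ?_⟩
  intro q _ G _ π S hS δ hδ hd
  obtain ⟨f₁, hf₁, hb₁, h₁⟩ := H q π S hS δ hδ hd
  set κ : SL(2, ZMod q) →* SL(2, ZMod q) := (MulAut.conj (weyl : SL(2, ZMod q))⁻¹).toMonoidHom
  have hκ : Function.Injective κ := (MulAut.conj (weyl : SL(2, ZMod q))⁻¹).injective
  have hd' : δ * Fintype.card SL(2, ZMod q) ≤ ((κ.comp π) '' S).ncard := by
    rw [MonoidHom.coe_comp, Set.image_comp, Set.ncard_image_of_injective _ hκ]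
    exact hd
  obtain ⟨f₂, hf₂, hb₂, h₂⟩ := H q (κ.comp π) S hS δ hδ hd'
  refine ⟨f₁ * f₂, Nat.mul_pos hf₁ hf₂, ?_, fun y => ⟨?_, ?_⟩⟩
  · push_cast
    calc (f₁ : ℝ) * f₂ ≤ (C * (δ⁻¹) ^ 14) * (C * (δ⁻¹) ^ 14) := by gcongr
      _ = _ := by ring
  · obtain ⟨ρ, hρ, e⟩ := h₁ (f₂ * y)
    refine ⟨ρ, hρ, ?_⟩
    rw [e]; push_cast; congr 1; ring
  · obtain ⟨ρ, hρ, e⟩ := h₂ (-(f₁ * y))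
    refine ⟨ρ, hρ, ?_⟩
    have e2 : (weyl : SL(2, ZMod q))⁻¹ * π ρ * weyl = uU (f₂ * -(f₁ * y)) := by
      rw [← e]
      simp [κ]
    have e3 : π ρ = weyl * (uU (f₂ * -(f₁ * y))) * weyl⁻¹ := by rw [← e2]; group
    rw [e3, weyl_conj]; push_cast; congr 1; ring

theorem isUnit_zmod_of_forall_prime {q : ℕ} [NeZero q] (x : ZMod q)
    (h : ∀ p : ℕ, p.Prime → p ∣ q → ¬ (p : ZMod q) ∣ x) : IsUnit x := by
  rw [← ZMod.natCast_zmod_val x, ZMod.isUnit_iff_coprime]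
  refine Nat.Coprime.symm (Nat.coprime_of_dvd fun p hp h1 h2 => ?_)
  exact h p hp h1 ((natCast_dvd_iff h1 x).2 h2)

/-- Take t to be the product of the primes of q not dividing a. At such a prime the added term
vanishes and a survives. At a prime dividing a, none of F, t, c vanishes: F because a ≡ 1 modulo F,
and c because of the determinant. -/
theorem exists_isUnit_add {q : ℕ} [NeZero q] (F : ℕ) (a b c d : ZMod q) (hdet : a * d - b * c = 1)
    (ha : (F : ZMod q) ∣ a - 1) : ∃ t : ZMod q, IsUnit (a + F * t * c) := by
  set s : Finset ℕ := q.primeFactors.filter fun p : ℕ => ¬ (p : ZMod q) ∣ a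
  refine ⟨((∏ r ∈ s, r : ℕ) : ZMod q), isUnit_zmod_of_forall_prime _ fun p hp hpq hdvd => ?_⟩
  have hprime : ∀ x y : ZMod q, (p : ZMod q) ∣ x * y → (p : ZMod q) ∣ x ∨ (p : ZMod q) ∣ y := by
    intro x y hxy
    have : Fact p.Prime := ⟨hp⟩
    rw [← castHom_eq_zero_iff hpq] at hxy ⊢
    rw [← castHom_eq_zero_iff hpq]
    rw [map_mul] at hxy
    exact mul_eq_zero.1 hxy
  have hone : ¬ (p : ZMod q) ∣ 1 := by
    have : Fact p.Prime := ⟨hp⟩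
    rw [← castHom_eq_zero_iff hpq, map_one]
    exact one_ne_zero
  by_cases hpa : (p : ZMod q) ∣ a
  · have h1 : (p : ZMod q) ∣ F * ((∏ r ∈ s, r : ℕ) : ZMod q) * c := (dvd_add_right hpa).1 hdvd
    rcases hprime _ _ h1 with h2 | h2
    · rcases hprime _ _ h2 with h3 | h3
      · refine hone ?_
        have := dvd_sub hpa (h3.trans ha)
        simpa using this
      · have h4 : (p : ZMod q) ∣ ((∏ r ∈ s, r : ℕ) : ZMod q) := h3
        have h5 : p ∣ ∏ r ∈ s, r := by
          rw [← castHom_eq_zero_iff hpq, map_natCast, ZMod.natCast_eq_zero_iff] at h4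
          exact h4
        obtain ⟨r, hr, hpr⟩ := (Prime.dvd_finsetProd_iff hp.prime _).1 h5
        have hr' := Finset.mem_filter.1 hr
        rw [(Nat.prime_dvd_prime_iff_eq hp (Nat.prime_of_mem_primeFactors hr'.1)).1 hpr] at hpa
        exact hr'.2 hpa
    · refine hone ?_
      rw [← hdet]
      exact dvd_sub (hpa.mul_right _) (h2.mul_left _)
  · refine hpa ?_
    refine (dvd_add_left ?_).1 hdvd
    have hps : p ∈ s := Finset.mem_filter.2 ⟨Nat.mem_primeFactors.2 ⟨hp, hpq, NeZero.ne q⟩, hpa⟩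
    have : (p : ZMod q) ∣ ((∏ r ∈ s, r : ℕ) : ZMod q) := Nat.cast_dvd_cast (Finset.dvd_prod_of_mem _ hps)
    exact (this.mul_left _).mul_right _

/-- Elements of a deep congruence subgroup are words of length five in elementary matrices. -/
theorem exists_five_word {q : ℕ} [NeZero q] (F : ℕ) (M : SL(2, ZMod q)) (hM : Cong (F ^ 2) M 1) :
    ∃ t₁ t₂ t₃ t₄ t₅ : ZMod q,
      M = uU (F * t₁) * uV (F * t₂) * uU (F * t₃) * uV (F * t₄) * uU (F * t₅) := by
  obtain ⟨α, hα⟩ : ((F ^ 2 : ℕ) : ZMod q) ∣ M 0 0 - 1 := by simpa using hM 0 0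
  obtain ⟨β, hβ⟩ : ((F ^ 2 : ℕ) : ZMod q) ∣ M 0 1 := by simpa using hM 0 1
  obtain ⟨γ, hγ⟩ : ((F ^ 2 : ℕ) : ZMod q) ∣ M 1 0 := by simpa using hM 1 0
  push_cast at hα hβ hγ
  have hdet := SL2_det M
  obtain ⟨t, u, hu⟩ := exists_isUnit_add F (M 0 0) (M 0 1) (M 1 0) (M 1 1) hdet
    ⟨F * α, by rw [hα]; ring⟩
  have hi := u.mul_inv
  set v : ZMod q := ((u⁻¹ : (ZMod q)ˣ) : ZMod q)
  rw [hu] at hi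
  have hα' : M 0 0 + F * t * M 1 0 - 1 = F ^ 2 * (α + F * t * γ) := by rw [hγ]; linear_combination hα
  set a := M 0 0 + F * t * M 1 0
  -- The product `uU F * uV y` has upper left entry 1 + F y, which matches a = 1 + F²(α + F t γ)
  -- when y = F(α + F t γ). The outer factors adjust the off-diagonal entries by dividing by the
  -- unit a, and the determinant fixes the last entry.
  refine ⟨-t, (F * γ - (α + F * t * γ)) * v, 1, α + F * t * γ, (F * β + t * M 1 1 - 1) * v, ?_⟩
  have key : uU (F * t) * M = uV (F * ((F * γ - (α + F * t * γ)) * v)) * uU ((F : ZMod q) * 1) *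
      uV (F * (α + F * t * γ)) * uU (F * ((F * β + t * M 1 1 - 1) * v)) := by
    have ha : a = M 0 0 + F * t * M 1 0 := rfl
    refine SL2_ext ?_ ?_ ?_ ?_
    · simp [SL2_mul_apply]
      linear_combination hα' - ha
    · simp [SL2_mul_apply]
      linear_combination hβ - F * (F * β + t * M 1 1 - 1) * hi + F * (F * β + t * M 1 1 - 1) * v * hα'
    · simp [SL2_mul_apply]
      linear_combination hγ - F * (F * γ - (α + F * t * γ)) * hi + F * (F * γ - (α + F * t * γ)) * v * hα'
    · simp [SL2_mul_apply]
      refine u.isUnit.mul_left_cancel ?_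
      rw [hu]
      set y : ZMod q := F * (α + F * t * γ)
      set X : ZMod q := F * ((F * β + t * M 1 1 - 1) * v) with hXd
      set Y : ZMod q := F * ((F * γ - (α + F * t * γ)) * v) with hYd
      have hX : a * X = M 0 1 + F * t * M 1 1 - F := by
        rw [hXd]; linear_combination F * (F * β + t * M 1 1 - 1) * hi - hβ
      have hY : a * Y = M 1 0 - y := by
        rw [hYd]; linear_combination F * (F * γ - (α + F * t * γ)) * hi - hγ
      have e1 : a = 1 + F * y := by linear_combination hα'
      have hd : a * M 1 1 - (M 0 1 + F * t * M 1 1) * M 1 0 = 1 := by rw [ha]; linear_combination hdet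
      linear_combination hd - (a * X + F) * hY - M 1 0 * hX + (a * Y * X - 1) * e1
  have h1 : M = uU (F * -t) * (uU (F * t) * M) := by
    rw [← mul_assoc, ← uU_add, show (F : ZMod q) * -t + F * t = 0 by ring, uU_zero, one_mul]
  calc M = _ := h1
    _ = _ := by rw [key]; simp only [mul_assoc]

end Generation

/-! ### Approximate homomorphisms and majority vote. -/

section Majority

/-- A map between groups that is multiplicative on most pairs agrees with a homomorphism, given by majority vote. -/
theorem exists_hom_of_approx {N Q : Type*} [Group N] [Fintype N] [Group Q] [DecidableEq Q] (f : N → Q) (η : ℝ) (hη : 6 * η < 1)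
    (hf : ((Finset.univ.filter fun z : N × N => f z.1 * f z.2 ≠ f (z.1 * z.2)).card : ℝ) ≤ η * (Fintype.card N) ^ 2) :
    ∃ Φ : N →* Q, ∀ x, ((Finset.univ.filter fun y => f (x * y) ≠ Φ x * f y).card : ℝ) ≤ 2 * η * Fintype.card N := by
  set n := Fintype.card N
  have hn : (0 : ℝ) < n := by exact_mod_cast Fintype.card_pos
  have hloc : ∀ x, ∃ v, ((Finset.univ.filter fun y => f (x * y) ≠ v * f y).card : ℝ) ≤ 2 * η * n := by
    intro x
    set B := Finset.univ.filter fun z : N × N => f z.1 * f z.2 ≠ f (z.1 * z.2)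
    -- For most pairs both f(z₂) = f(z₁) f(z₁⁻¹z₂) and f(x z₂) = f(x z₁) f(z₁⁻¹z₂) hold. Eliminating
    -- the common factor shows that f(x z) f(z)⁻¹ hardly depends on z; its popular value is Φ(x).
    have h1 : (Finset.univ.filter fun z : N × N => f z.1 * f (z.1⁻¹ * z.2) ≠ f z.2).card ≤ B.card := by
      refine Finset.card_le_card_of_injOn (fun z => (z.1, z.1⁻¹ * z.2)) (fun z hz => ?_) ?_
      · simpa [B] using hz
      · rintro ⟨a, b⟩ _ ⟨a', b'⟩ _ h
        simp only [Prod.mk.injEq] at h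
        obtain ⟨rfl, h⟩ := h
        rw [mul_right_inj] at h
        rw [h]
    have h2 : (Finset.univ.filter fun z : N × N => f (x * z.1) * f (z.1⁻¹ * z.2) ≠ f (x * z.2)).card ≤ B.card := by
      refine Finset.card_le_card_of_injOn (fun z => (x * z.1, z.1⁻¹ * z.2)) (fun z hz => ?_) ?_
      · simpa [B, mul_assoc] using hz
      · rintro ⟨a, b⟩ _ ⟨a', b'⟩ _ h
        simp only [Prod.mk.injEq, mul_right_inj] at h
        obtain ⟨rfl, h⟩ := h
        rw [mul_right_inj] at h
        rw [h]
    have h3 : (Finset.univ.filter fun z : N × N => f (x * z.2) ≠ f (x * z.1) * (f z.1)⁻¹ * f z.2).card ≤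
        B.card + B.card := by
      refine le_trans (le_trans (Finset.card_le_card ?_) (Finset.card_union_le _ _)) (add_le_add h1 h2)
      intro z hz
      simp only [Finset.mem_union, Finset.mem_filter, Finset.mem_univ, true_and] at hz ⊢
      by_contra! hcon
      refine hz ?_
      rw [← hcon.1, ← hcon.2]; group
    have h4 : (Finset.univ.filter fun z : N × N => f (x * z.2) ≠ f (x * z.1) * (f z.1)⁻¹ * f z.2).card =
        ∑ y : N, (Finset.univ.filter fun z => f (x * z) ≠ f (x * y) * (f y)⁻¹ * f z).card := by
      simp only [Finset.card_filter]
      rw [← Finset.univ_product_univ, Finset.sum_product]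
    have h5 : ∑ y : N, ((Finset.univ.filter fun z => f (x * z) ≠ f (x * y) * (f y)⁻¹ * f z).card : ℝ) ≤
        ∑ _y : N, 2 * η * n := by
      rw [Finset.sum_const, Finset.card_univ, nsmul_eq_mul]
      have h6 : ((∑ y : N, (Finset.univ.filter fun z => f (x * z) ≠ f (x * y) * (f y)⁻¹ * f z).card : ℕ) : ℝ) ≤
          B.card + B.card := by
        rw [← h4]; exact_mod_cast h3
      push_cast at h6
      refine h6.trans ?_
      calc (B.card : ℝ) + B.card ≤ η * n ^ 2 + η * n ^ 2 := add_le_add hf hf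
        _ = n * (2 * η * n) := by ring
    obtain ⟨y, _, hy⟩ := Finset.exists_le_of_sum_le Finset.univ_nonempty h5
    exact ⟨_, hy⟩
  choose Φ hΦ using hloc
  refine ⟨MonoidHom.mk' Φ fun x y => ?_, hΦ⟩
  by_contra hne
  -- If Φ(xy) ≠ Φ(x)Φ(y), three exceptional sets of density at most 2η would cover N, which 6η < 1
  -- forbids.
  have hcov : (Finset.univ : Finset N) ⊆ (Finset.univ.filter fun z => f (y * z) ≠ Φ y * f z) ∪
      ((Finset.univ.filter fun z => f (x * (y * z)) ≠ Φ x * f (y * z)) ∪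
        Finset.univ.filter fun z => f (x * y * z) ≠ Φ (x * y) * f z) := by
    intro z _
    simp only [Finset.mem_union, Finset.mem_filter, Finset.mem_univ, true_and]
    by_contra! hcon
    refine hne (mul_right_cancel (b := f z) ?_)
    rw [← hcon.2.2, mul_assoc, hcon.2.1, hcon.1, mul_assoc]
  have h2 : (Finset.univ.filter fun z => f (x * (y * z)) ≠ Φ x * f (y * z)).card ≤
      (Finset.univ.filter fun z => f (x * z) ≠ Φ x * f z).card := by
    refine Finset.card_le_card_of_injOn (fun z => y * z) (fun z hz => ?_) fun a _ b _ h => mul_left_cancel h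
    simpa using hz
  have h3 := (Finset.card_le_card hcov).trans ((Finset.card_union_le _ _).trans
    (Nat.add_le_add_left ((Finset.card_union_le _ _).trans (Nat.add_le_add_right h2 _)) _))
  rw [Finset.card_univ] at h3
  have h4 : (n : ℝ) ≤ 2 * η * n + (2 * η * n + 2 * η * n) :=
    le_trans (by exact_mod_cast h3) (add_le_add (hΦ y) (add_le_add (hΦ x) (hΦ (x * y))))
  have h5 : (6 * η) * n < 1 * n := mul_lt_mul_of_pos_right hη hn
  linarith

end Majority

/-! ### Eigenvalue constraints on elements conjugate to their powers. -/

section HomTriviality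

theorem sq_eq_one_of_mem_center {R : Type*} [CommRing R] {c : SL(2, R)} (hc : c ∈ Subgroup.center SL(2, R)) :
    c ^ 2 = 1 := by
  obtain ⟨r, hr, h⟩ := Matrix.SpecialLinearGroup.mem_center_iff.1 hc
  rw [Fintype.card_fin] at hr
  have h00 : c 0 0 = r := by rw [← h]; simp
  have h01 : c 0 1 = 0 := by rw [← h]; simp
  have h10 : c 1 0 = 0 := by rw [← h]; simp
  have h11 : c 1 1 = r := by rw [← h]; simp
  rw [pow_two]
  refine SL2_ext ?_ ?_ ?_ ?_ <;> simp [SL2_mul_apply, h00, h01, h10, h11]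
  all_goals linear_combination hr

theorem mem_center_iff_scalarMod {e : ℕ} (c : SL(2, ZMod e)) :
    c ∈ Subgroup.center SL(2, ZMod e) ↔ c 0 1 = 0 ∧ c 1 0 = 0 ∧ c 0 0 = c 1 1 := by
  rw [Matrix.SpecialLinearGroup.mem_center_iff]
  constructor
  · rintro ⟨r, -, h⟩
    rw [← h]; simp
  · rintro ⟨h1, h2, h3⟩
    refine ⟨c 0 0, ?_, ?_⟩
    · have := SL2_det c
      rw [Fintype.card_fin]
      rw [h1, ← h3] at this
      linear_combination this
    · ext i j
      fin_cases i <;> fin_cases j <;> simp [h1, h2, h3]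

theorem reduction_mem_center_iff {e d : ℕ} [NeZero d] (h : e ∣ d) (z : SL(2, ZMod d)) :
    reduction h z ∈ Subgroup.center SL(2, ZMod e) ↔ e ∣ lvl z := by
  rw [dvd_lvl_iff h, mem_center_iff_scalarMod]
  unfold ScalarMod
  rw [← castHom_eq_iff h, ← castHom_eq_zero_iff h, ← castHom_eq_zero_iff h]
  rfl

theorem SL2_det_eq_one {R : Type*} [CommRing R] (w : SL(2, R)) : w 0 0 * w 1 1 - w 0 1 * w 1 0 = 1 := by
  rw [← Matrix.det_fin_two]; exact w.2

theorem SL2_trace_mul_comm {R : Type*} [CommRing R] (z w : SL(2, R)) :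
    (z * w) 0 0 + (z * w) 1 1 = (w * z) 0 0 + (w * z) 1 1 := by
  simp only [SL2_mul_apply]; ring

theorem SL2_sq {R : Type*} [CommRing R] (w : SL(2, R)) :
    w.1 * w.1 = (w 0 0 + w 1 1) • w.1 - 1 := by
  have := SL2_det_eq_one w
  ext i j
  fin_cases i <;> fin_cases j <;> simp [Matrix.mul_apply, Fin.sum_univ_two]
  · linear_combination -this
  · ring
  · ring
  · linear_combination -this

theorem SL2_trace_pow {K : Type*} [Field K] (w : SL(2, K)) (μ : K) (hμ : μ ≠ 0)
    (ht : w 0 0 + w 1 1 = μ + μ⁻¹) (n : ℕ) : (w ^ n) 0 0 + (w ^ n) 1 1 = μ ^ n + μ⁻¹ ^ n := by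
  have hrec : ∀ n, (w ^ (n + 2)) 0 0 + (w ^ (n + 2)) 1 1 =
      (μ + μ⁻¹) * ((w ^ (n + 1)) 0 0 + (w ^ (n + 1)) 1 1) - ((w ^ n) 0 0 + (w ^ n) 1 1) := by
    intro n
    have hd := SL2_det_eq_one w
    rw [← ht, show w ^ (n + 2) = w ^ n * w * w by rw [pow_succ, pow_succ], pow_succ]
    simp only [SL2_mul_apply]
    linear_combination -((w ^ n) 0 0 + (w ^ n) 1 1) * hd
  have hmu : μ * μ⁻¹ = 1 := mul_inv_cancel₀ hμ
  induction n using Nat.strong_induction_on with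
  | _ n ih =>
    match n with
    | 0 => simp
    | 1 => simpa using ht
    | n + 2 =>
      rw [hrec, ih (n + 1) (by omega), ih n (by omega)]
      linear_combination (μ ^ n + μ⁻¹ ^ n) * hmu

/-- If μ and μ⁻¹ are the eigenvalues of w, equality of traces forces the n-th power of μ to be μ or
μ⁻¹. In both cases μ^(n² - 1) = 1. -/
theorem trace_eq_two_of_conj_pow {K : Type*} [Field K] [IsAlgClosed K] (w : SL(2, K)) {n : ℕ} (hn : 1 ≤ n)
    (h : (w ^ n) 0 0 + (w ^ n) 1 1 = w 0 0 + w 1 1) :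
    (w ^ (n ^ 2 - 1)) 0 0 + (w ^ (n ^ 2 - 1)) 1 1 = 2 := by
  obtain ⟨μ, hμ⟩ : ∃ μ : K, μ * μ - (w 0 0 + w 1 1) * μ + 1 = 0 := by
    obtain ⟨μ, hμ⟩ := IsAlgClosed.exists_root
      (Polynomial.C 1 * Polynomial.X ^ 2 + Polynomial.C (-(w 0 0 + w 1 1)) * Polynomial.X + Polynomial.C 1)
      (by rw [Polynomial.degree_quadratic one_ne_zero]; norm_num)
    refine ⟨μ, ?_⟩
    simp only [Polynomial.IsRoot, Polynomial.eval_add, Polynomial.eval_mul, Polynomial.eval_C,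
      Polynomial.eval_pow, Polynomial.eval_X] at hμ
    linear_combination hμ
  have hμ0 : μ ≠ 0 := by rintro rfl; simp at hμ
  have hmu : μ * μ⁻¹ = 1 := mul_inv_cancel₀ hμ0
  have ht : w 0 0 + w 1 1 = μ + μ⁻¹ := by
    refine mul_left_cancel₀ hμ0 ?_
    linear_combination -hμ - hmu
  rw [SL2_trace_pow w μ hμ0 ht] at h ⊢
  rw [ht] at h
  have h1 : (μ ^ n - μ) * (μ ^ n * μ - 1) = 0 := by
    have hm2 : μ ^ n * μ⁻¹ ^ n = 1 := by rw [← mul_pow, hmu, one_pow]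
    linear_combination μ ^ n * μ * h - μ * hm2 + μ ^ n * hmu
  have h2 : μ ^ (n ^ 2 - 1) = 1 := by
    have h3 : n ^ 2 - 1 = (n + 1) * (n - 1) := by
      obtain ⟨k, rfl⟩ := Nat.exists_eq_add_of_le' hn
      simp; ring_nf; omega
    rcases mul_eq_zero.1 h1 with h4 | h4
    · have : μ ^ (n - 1) = 1 := by
        refine mul_left_cancel₀ hμ0 ?_
        rw [← pow_succ', Nat.sub_add_cancel hn]
        linear_combination h4
      rw [h3, mul_comm, pow_mul, this, one_pow]
    · have : μ ^ (n + 1) = 1 := by rw [pow_succ]; linear_combination h4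
      rw [h3, pow_mul, this, one_pow]
  rw [inv_pow, h2]; norm_num

/-- By Cayley–Hamilton (Y - 1)² = (tr Y - 2) Y, so Y - 1 is nilpotent. In (Y - 1)(1 + Y + ⋯ +
Y^(m-1)) = 0 the second factor is the unit m plus a commuting nilpotent, hence a unit. -/
theorem eq_one_of_unipotent_of_pow {p i : ℕ} (Y : SL(2, ZMod (p ^ i)))
    (ht : (p : ZMod (p ^ i)) ∣ Y 0 0 + Y 1 1 - 2) {m : ℕ} (hm : Nat.Coprime m p) (hY : Y ^ m = 1) : Y = 1 := by
  set M : Matrix (Fin 2) (Fin 2) (ZMod (p ^ i)) := Y.1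
  have hM : M ^ m = 1 := by
    have := congrArg (fun z : SL(2, ZMod (p ^ i)) => z.1) hY
    simpa using this
  have hnil : IsNilpotent (M - 1) := by
    obtain ⟨c, hc⟩ := ht
    have h1 : (M - 1) ^ 2 = (p : ZMod (p ^ i)) • (c • M) := by
      rw [smul_smul, ← hc]
      have := SL2_sq Y
      rw [pow_two, sub_mul, mul_sub, mul_one, one_mul, this, sub_smul]
      simp only [M, two_smul]
      abel
    refine ⟨2 * i, ?_⟩
    rw [pow_mul, h1, smul_pow]
    have : ((p : ZMod (p ^ i)) ^ i) = 0 := by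
      rw [← Nat.cast_pow]; exact ZMod.natCast_self _
    rw [this, zero_smul]
  have hS : (M - 1) * ∑ k ∈ Finset.range m, M ^ k = 0 := by
    rw [mul_geom_sum, hM, sub_self]
  have hmu : IsUnit (m : Matrix (Fin 2) (Fin 2) (ZMod (p ^ i))) := by
    have : IsUnit (m : ZMod (p ^ i)) := (ZMod.isUnit_iff_coprime _ _).2 (Nat.Coprime.pow_right _ hm)
    have h2 := this.map (algebraMap (ZMod (p ^ i)) (Matrix (Fin 2) (Fin 2) (ZMod (p ^ i))))
    rwa [map_natCast] at h2
  have hdiff : ∃ T, Commute (M - 1) T ∧ ∑ k ∈ Finset.range m, M ^ k = (m : Matrix (Fin 2) (Fin 2) (ZMod (p ^ i))) + (M - 1) * T := by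
    refine ⟨∑ k ∈ Finset.range m, ∑ j ∈ Finset.range k, M ^ j, ?_, ?_⟩
    · refine Commute.sum_right _ _ _ fun k _ => Commute.sum_right _ _ _ fun j _ => ?_
      exact ((Commute.refl M).sub_left (Commute.one_left M)).pow_right j
    · rw [Finset.mul_sum]
      simp_rw [mul_geom_sum]
      rw [Finset.sum_sub_distrib]
      simp
  obtain ⟨T, hcomm, hT⟩ := hdiff
  have hunit : IsUnit (∑ k ∈ Finset.range m, M ^ k) := by
    rw [hT]
    refine IsNilpotent.isUnit_add_left_of_commute (hcomm.isNilpotent_mul_right hnil) hmu ?_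
    exact (Nat.cast_commute m _).symm
  have h0 : M - 1 = 0 := by
    obtain ⟨u, hu⟩ := hunit
    rw [← hu] at hS
    simpa using (Units.mul_left_eq_zero u).1 hS
  refine Subtype.ext ?_
  exact sub_eq_zero.1 h0

/-- Over the algebraic closure of 𝔽_p the trace of W^(n² - 1) is 2, so W^(n² - 1) is unipotent
modulo p. Its order is prime to p, hence it is trivial. -/
theorem pow_gcd_eq_one_of_conj {p i : ℕ} (hp : p.Prime) (W g : SL(2, ZMod (p ^ i))) {m n : ℕ}
    (hm : Nat.Coprime m p) (hn : 1 ≤ n) (hW : W ^ m = 1) (hg : g * W * g⁻¹ = W ^ n) :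
    W ^ (Nat.gcd m (n ^ 2 - 1)) = 1 := by
  rcases Nat.eq_zero_or_pos i with rfl | hi
  · have : Subsingleton (ZMod (p ^ 0)) := by rw [pow_zero]; infer_instance
    refine Subtype.ext (Matrix.ext fun a b => Subsingleton.elim _ _)
  have : Fact p.Prime := ⟨hp⟩
  have : NeZero (p ^ i) := ⟨(pow_pos hp.pos i).ne'⟩
  have hpd : p ∣ p ^ i := dvd_pow_self p hi.ne'
  refine pow_gcd_eq_one.2 ⟨hW, ?_⟩
  refine eq_one_of_unipotent_of_pow _ ?_ hm (by rw [← pow_mul, mul_comm, pow_mul, hW, one_pow])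
  set F : ZMod (p ^ i) →+* AlgebraicClosure (ZMod p) :=
    (algebraMap (ZMod p) (AlgebraicClosure (ZMod p))).comp (ZMod.castHom hpd (ZMod p))
  set μ : SL(2, ZMod (p ^ i)) →* SL(2, AlgebraicClosure (ZMod p)) := Matrix.SpecialLinearGroup.map F
  have hμ : ∀ z a b, (μ z) a b = F (z a b) := fun z a b => rfl
  have hconj : ∀ z w : SL(2, AlgebraicClosure (ZMod p)), (z * w * z⁻¹) 0 0 + (z * w * z⁻¹) 1 1 = w 0 0 + w 1 1 := by
    intro z w
    rw [SL2_trace_mul_comm, inv_mul_cancel_left]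
  have h2 := trace_eq_two_of_conj_pow (μ W) hn (by rw [← map_pow, ← hg, map_mul, map_mul, map_inv]; exact hconj _ _)
  rw [← map_pow, hμ, hμ] at h2
  rw [← castHom_eq_zero_iff hpd]
  refine (algebraMap (ZMod p) (AlgebraicClosure (ZMod p))).injective ?_
  change F _ = _
  rw [map_sub, map_add, h2, map_zero, map_ofNat, sub_self]

end HomTriviality

/-! ### Homomorphisms from congruence subgroups to PSL₂ at a coprime prime. -/

section CongruenceSubgroup

theorem natCast_gcd_dvd_iff {q : ℕ} (h : ℕ) (x : ZMod q) : ((Nat.gcd h q : ℕ) : ZMod q) ∣ x ↔ (h : ZMod q) ∣ x := by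
  constructor
  · intro hx
    refine dvd_trans ?_ hx
    have h1 := congrArg (fun z : ℤ => (z : ZMod q)) (Nat.gcd_eq_gcd_ab h q)
    push_cast at h1
    rw [ZMod.natCast_self, zero_mul, add_zero] at h1
    exact ⟨_, h1⟩
  · exact fun hx => (Nat.cast_dvd_cast (Nat.gcd_dvd_left h q)).trans hx

/-- The principal congruence subgroup of level `h`. -/
def congSub (q h : ℕ) : Subgroup SL(2, ZMod q) := (reduction (Nat.gcd_dvd_right h q)).ker

instance (q h : ℕ) : (congSub q h).Normal := MonoidHom.normal_ker _

theorem mem_congSub {q : ℕ} [NeZero q] {h : ℕ} {M : SL(2, ZMod q)} : M ∈ congSub q h ↔ Cong h M 1 := by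
  unfold congSub
  rw [MonoidHom.mem_ker, ← map_one (reduction (Nat.gcd_dvd_right h q)), reduction_eq_iff]
  unfold Cong
  simp_rw [natCast_gcd_dvd_iff]

theorem congSub_mono {q : ℕ} [NeZero q] {h k : ℕ} (hk : h ∣ k) : congSub q k ≤ congSub q h := fun M hM => by
  rw [mem_congSub] at hM ⊢
  exact fun i j => (Nat.cast_dvd_cast hk).trans (hM i j)

theorem uU_mem_congSub {q : ℕ} [NeZero q] {h : ℕ} {t : ZMod q} (ht : (h : ZMod q) ∣ t) : uU t ∈ congSub q h := by
  rw [mem_congSub]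
  intro i j
  fin_cases i <;> fin_cases j <;> simp [ht]

theorem uV_mem_congSub {q : ℕ} [NeZero q] {h : ℕ} {t : ZMod q} (ht : (h : ZMod q) ∣ t) : uV t ∈ congSub q h := by
  rw [mem_congSub]
  intro i j
  fin_cases i <;> fin_cases j <;> simp [ht]

/-- Take l = 1 + h z with z ≡ 1 modulo h and h z ≡ 1 modulo the primes of q not dividing h. At the
latter primes l ≡ 2 and l⁴ - 1 ≡ 15, both invertible because 60 ∣ h. At the primes of h, l⁴ - 1 is
4h times a number prime to h. The fourth power appears because conjugation by a diagonal matrix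
raises a unipotent to the power l², and the eigenvalue lemma squares this exponent again. -/
theorem exists_multiplier {q h : ℕ} (hq : 0 < q) (hh : 60 ∣ h) (hh0 : 0 < h) : ∃ l : ℕ, 1 ≤ l ∧ Nat.Coprime l q ∧ h ∣ (l - 1) ∧
    Nat.gcd q ((l ^ 2) ^ 2 - 1) ∣ 4 * h := by
  set P := ∏ p ∈ q.primeFactors.filter fun p => ¬ p ∣ h, p
  have hPh : Nat.Coprime h P := by
    refine Nat.Coprime.prod_right fun p hp => ?_
    have := Finset.mem_filter.1 hp
    exact ((Nat.Prime.coprime_iff_not_dvd (Nat.prime_of_mem_primeFactors this.1)).2 this.2).symm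
  obtain ⟨z₀, hz₀⟩ : ∃ z₀, h * z₀ ≡ 1 [MOD P] := by
    have hP0 : NeZero P := ⟨Finset.prod_ne_zero_iff.2 fun p hp =>
      (Nat.prime_of_mem_primeFactors (Finset.mem_filter.1 hp).1).ne_zero⟩
    refine ⟨((h : ZMod P)⁻¹).val, (ZMod.natCast_eq_natCast_iff _ _ _).1 ?_⟩
    push_cast
    rw [ZMod.natCast_zmod_val, ZMod.coe_mul_inv_eq_one h hPh]
  obtain ⟨z, hz1, hz2⟩ := Nat.chineseRemainder hPh 1 z₀
  have hz3 : h * z ≡ 1 [MOD P] := (Nat.ModEq.mul_left h hz2).trans hz₀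
  have hprime : ∀ p : ℕ, p.Prime → p ∣ q → ¬ p ∣ h → h * z ≡ 1 [MOD p] := fun p hp hpq hph =>
    hz3.of_dvd (Finset.dvd_prod_of_mem (fun p => p) (Finset.mem_filter.2
      ⟨Nat.mem_primeFactors.2 ⟨hp, hpq, hq.ne'⟩, hph⟩))
  have hsmall : ∀ p : ℕ, p.Prime → ¬ p ∣ h → ¬ p ∣ 2 ∧ ¬ p ∣ 15 := fun p hp hph =>
    ⟨fun h2 => hph (h2.trans (by omega)), fun h2 => hph (h2.trans (by omega))⟩
  obtain ⟨h', rfl⟩ : 4 ∣ h := by omega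
  have h2' : 2 * h' ∣ 4 * h' := ⟨2, by ring⟩
  set E := 1 + 6 * h' * z + 16 * (h' * z) ^ 2 + 16 * (h' * z) ^ 3
  have hE : ((1 + 4 * h' * z) ^ 2) ^ 2 - 1 = 4 * (4 * h') * (z * E) := by
    rw [Nat.sub_eq_iff_eq_add (Nat.one_le_pow _ _ (by positivity))]
    simp only [E]; ring
  refine ⟨1 + 4 * h' * z, by omega, ?_, ⟨z, by simp⟩, ?_⟩
  · refine Nat.coprime_of_dvd fun p hp h1 h2 => ?_
    by_cases hph : p ∣ 4 * h'
    · exact hp.one_lt.ne' (Nat.dvd_one.1 ((Nat.dvd_add_left (hph.mul_right z)).1 h1))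
    · have h3 : 1 + 4 * h' * z ≡ 2 [MOD p] := Nat.ModEq.add_left 1 (hprime p hp h2 hph)
      exact (hsmall p hp hph).1 ((Nat.ModEq.dvd_iff h3 dvd_rfl).1 h1)
  · rw [hE]
    refine Nat.Coprime.dvd_of_dvd_mul_right (n := z * E) ?_ ?_
    · refine Nat.coprime_of_dvd fun p hp h1 h2 => ?_
      have hpq := h1.trans (Nat.gcd_dvd_left _ _)
      by_cases hph : p ∣ 4 * h'
      · rcases (Nat.Prime.dvd_mul hp).1 h2 with h3 | h3
        · have : z ≡ 1 [MOD p] := hz1.of_dvd hph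
          exact hp.one_lt.ne' (Nat.dvd_one.1 ((Nat.ModEq.dvd_iff this dvd_rfl).1 h3))
        · have hp2 : p ∣ 2 * h' := by
            have : p ∣ 2 * (2 * h') := by rwa [← mul_assoc]
            rcases (Nat.Prime.dvd_mul hp).1 this with h4 | h4
            · exact h4.mul_right _
            · exact h4
          have h4 : E = 1 + 2 * h' * (3 * z + 8 * h' * z ^ 2 + 8 * h' ^ 2 * z ^ 3) := by simp only [E]; ring
          rw [h4] at h3
          exact hp.one_lt.ne' (Nat.dvd_one.1 ((Nat.dvd_add_left (hp2.mul_right _)).1 h3))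
      · have h3 : 1 + 4 * h' * z ≡ 2 [MOD p] := Nat.ModEq.add_left 1 (hprime p hp hpq hph)
        have h4 : ((1 + 4 * h' * z) ^ 2) ^ 2 ≡ 16 [MOD p] := (h3.pow 2).pow 2
        have h5 : p ∣ ((1 + 4 * h' * z) ^ 2) ^ 2 - 1 := by rw [hE]; exact h2.mul_left _
        have h6 : 1 ≡ ((1 + 4 * h' * z) ^ 2) ^ 2 [MOD p] :=
          (Nat.modEq_iff_dvd' (Nat.one_le_pow _ _ (by positivity))).2 h5
        have h7 : p ∣ 16 - 1 := (Nat.modEq_iff_dvd' (by norm_num)).1 (h6.trans h4)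
        exact (hsmall p hp hph).2 h7
    · exact Nat.gcd_dvd_right _ _

/-- A homomorphism from a congruence subgroup modulo `q` to `PSL₂` of a `p`-group ring, with `p ∤ q`, kills deep unipotents. -/
theorem hom_uU_trivial {q p i h : ℕ} [NeZero q] (hp : p.Prime) (hpq : Nat.Coprime q p) (hh : 60 ∣ h) (hh0 : 0 < h)
    (Φ : congSub q h →* SL(2, ZMod (p ^ i)) ⧸ Subgroup.center SL(2, ZMod (p ^ i))) (y : ZMod q)
    (hy : uU (((8 * h ^ 2 : ℕ) : ZMod q) * y) ∈ congSub q h) : Φ ⟨_, hy⟩ = 1 := by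
  obtain ⟨l, hl1, hlq, hlh, hgcd⟩ := exists_multiplier (Nat.pos_of_ne_zero (NeZero.ne q)) hh hh0
  set u : congSub q h := ⟨uU ((h : ZMod q) * 1), uU_mem_congSub ⟨1, rfl⟩⟩
  have hpow : ∀ n : ℕ, (u ^ n : congSub q h).1 = uU ((n : ZMod q) * h) := by
    intro n
    induction n with
    | zero => simp [uU_zero]
    | succ n ih => rw [pow_succ, Subgroup.coe_mul, ih, ← uU_add]; congr 1; push_cast; ring
  set v := ZMod.unitOfCoprime l hlq
  have hv : (v : ZMod q) = l := ZMod.coe_unitOfCoprime _ _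
  have hv1 : (h : ZMod q) ∣ (v : ZMod q) - 1 := by
    rw [hv]
    have : ((l - 1 : ℕ) : ZMod q) = l - 1 := by rw [Nat.cast_sub hl1, Nat.cast_one]
    rw [← this]; exact Nat.cast_dvd_cast hlh
  have hD : dD v ∈ congSub q h := by
    rw [mem_congSub]
    intro i j
    fin_cases i <;> fin_cases j <;> simp [hv1]
    have : ((v⁻¹ : (ZMod q)ˣ) : ZMod q) - 1 = -(v⁻¹ : (ZMod q)ˣ) * ((v : ZMod q) - 1) := by
      linear_combination v.inv_mul
    rw [this]; exact hv1.mul_left _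
  set D : congSub q h := ⟨dD v, hD⟩
  have hrel : D * u * D⁻¹ = u ^ (l ^ 2) := by
    refine Subtype.ext ?_
    rw [hpow]
    change dD v * uU _ * (dD v)⁻¹ = _
    rw [dD_conj_uU, hv]
    congr 1; push_cast; ring
  have huq : u ^ q = 1 := by
    refine Subtype.ext ?_
    rw [hpow, ZMod.natCast_self, zero_mul, uU_zero]; rfl
  obtain ⟨w, hw⟩ := QuotientGroup.mk_surjective (Φ u)
  obtain ⟨g, hg⟩ := QuotientGroup.mk_surjective (Φ D)
  have hrel' : (QuotientGroup.mk (g * w * g⁻¹) : SL(2, ZMod (p ^ i)) ⧸ Subgroup.center SL(2, ZMod (p ^ i))) =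
      QuotientGroup.mk (w ^ (l ^ 2)) := by
    rw [QuotientGroup.mk_mul, QuotientGroup.mk_mul, QuotientGroup.mk_inv, QuotientGroup.mk_pow, hw, hg, ← map_mul,
      ← map_inv, ← map_mul, hrel, map_pow]
  have hkill : ∀ z : SL(2, ZMod (p ^ i)), (QuotientGroup.mk z : SL(2, ZMod (p ^ i)) ⧸ Subgroup.center SL(2, ZMod (p ^ i))) = 1 →
      z ^ 2 = 1 := fun z hz => sq_eq_one_of_mem_center ((QuotientGroup.eq_one_iff z).1 hz)
  have hW1 : (w ^ 2) ^ q = 1 := by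
    rw [← pow_mul, mul_comm, pow_mul]
    refine hkill _ ?_
    rw [QuotientGroup.mk_pow, hw, ← map_pow, huq, map_one]
  -- The lift w satisfies the relation only up to the centre, whose elements have square 1; passing
  -- to w² makes it exact.
  have hW2 : g * w ^ 2 * g⁻¹ = (w ^ 2) ^ (l ^ 2) := by
    have hc := QuotientGroup.eq.1 hrel'.symm
    set c := (w ^ (l ^ 2))⁻¹ * (g * w * g⁻¹)
    have h1 : g * w * g⁻¹ = w ^ (l ^ 2) * c := by simp [c]
    have h2 : g * w ^ 2 * g⁻¹ = (g * w * g⁻¹) ^ 2 := by rw [conj_pow]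
    have h3 : Commute (w ^ (l ^ 2)) c := (Subgroup.mem_center_iff.1 hc _)
    rw [h2, h1, h3.mul_pow, sq_eq_one_of_mem_center hc, mul_one, ← pow_mul, ← pow_mul, mul_comm]
  have hW3 := pow_gcd_eq_one_of_conj hp (w ^ 2) g hpq (Nat.one_le_pow _ _ hl1) hW1 hW2
  -- The order of w² divides gcd(q, l⁴ - 1), which divides 4h; this is the origin of the level 8h² =
  -- 8h·h in the statement.
  have hW4 : w ^ (8 * h) = 1 := by
    obtain ⟨k, hk⟩ := hgcd
    rw [show 8 * h = 2 * (4 * h) by ring, hk, pow_mul, pow_mul, hW3, one_pow]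
  have hfin : (⟨_, hy⟩ : congSub q h) = (u ^ (8 * h)) ^ y.val := by
    refine Subtype.ext ?_
    rw [← pow_mul, hpow]
    push_cast
    rw [ZMod.natCast_zmod_val]
    congr 1; ring
  rw [hfin, map_pow, map_pow, ← hw, ← QuotientGroup.mk_pow, hW4, QuotientGroup.mk_one, one_pow]

theorem hom_uV_trivial {q p i h : ℕ} [NeZero q] (hp : p.Prime) (hpq : Nat.Coprime q p) (hh : 60 ∣ h) (hh0 : 0 < h)
    (Φ : congSub q h →* SL(2, ZMod (p ^ i)) ⧸ Subgroup.center SL(2, ZMod (p ^ i))) (y : ZMod q)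
    (hy : uV (((8 * h ^ 2 : ℕ) : ZMod q) * y) ∈ congSub q h) : Φ ⟨_, hy⟩ = 1 := by
  have hmem : uU (((8 * h ^ 2 : ℕ) : ZMod q) * -y) ∈ congSub q h :=
    uU_mem_congSub ⟨8 * h * -y, by push_cast; ring⟩
  have := hom_uU_trivial hp hpq hh hh0 (Φ.comp (MulAut.conjNormal (weyl : SL(2, ZMod q))).toMonoidHom) (-y) hmem
  rw [← this]
  refine congrArg Φ (Subtype.ext ?_)
  change _ = ((MulAut.conjNormal (weyl : SL(2, ZMod q)) ⟨_, hmem⟩ : congSub q h) : SL(2, ZMod q))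
  rw [MulAut.conjNormal_apply, weyl_conj, mul_neg, neg_neg]

/-- The five-letter factorization with F = 8h² writes M in unipotents that Φ kills, at the price of
squaring the level. -/
theorem hom_trivial {q p i h : ℕ} [NeZero q] (hp : p.Prime) (hpq : Nat.Coprime q p) (hh : 60 ∣ h) (hh0 : 0 < h)
    (Φ : congSub q h →* SL(2, ZMod (p ^ i)) ⧸ Subgroup.center SL(2, ZMod (p ^ i))) (M : congSub q h)
    (hM : M.1 ∈ congSub q ((8 * h ^ 2) ^ 2)) : Φ M = 1 := by
  obtain ⟨t₁, t₂, t₃, t₄, t₅, e⟩ := exists_five_word (8 * h ^ 2) M.1 (mem_congSub.1 hM)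
  have hd : ∀ t : ZMod q, (h : ZMod q) ∣ ((8 * h ^ 2 : ℕ) : ZMod q) * t := fun t => ⟨8 * h * t, by push_cast; ring⟩
  have hU : ∀ t : ZMod q, uU (((8 * h ^ 2 : ℕ) : ZMod q) * t) ∈ congSub q h := fun t => uU_mem_congSub (hd t)
  have hV : ∀ t : ZMod q, uV (((8 * h ^ 2 : ℕ) : ZMod q) * t) ∈ congSub q h := fun t => uV_mem_congSub (hd t)
  have hM' : M = ⟨_, hU t₁⟩ * ⟨_, hV t₂⟩ * ⟨_, hU t₃⟩ * ⟨_, hV t₄⟩ * ⟨_, hU t₅⟩ := Subtype.ext e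
  rw [hM', map_mul, map_mul, map_mul, map_mul]
  simp only [hom_uU_trivial hp hpq hh hh0 Φ, hom_uV_trivial hp hpq hh hh0 Φ, mul_one]

end CongruenceSubgroup

/-! ### Small tripling and sizes of fibres. -/

section Tripling

/-- The cube of A ∪ A⁻¹ is the union of eight products with signs, each controlled by the Ruzsa-type
bound for alternating products. -/
theorem card_union_inv_pow_three {G : Type*} [Group G] [DecidableEq G] (A : Finset G) (K : ℝ) (hK : 1 ≤ K)
    (hA : ((A ^ 3).card : ℝ) ≤ K * A.card) : (((A ∪ A⁻¹) ^ 3).card : ℝ) ≤ 8 * K ^ 3 * (A ∪ A⁻¹).card := by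
  have halt : ∀ e₁ e₂ e₃ : ℤ, |e₁| = 1 → |e₂| = 1 → |e₃| = 1 →
      ((A ^ e₁ * A ^ e₂ * A ^ e₃).card : ℝ) ≤ K ^ 3 * A.card := by
    intro e₁ e₂ e₃ h₁ h₂ h₃
    have := Finset.small_alternating_pow_of_small_tripling (m := 3) le_rfl hA ![e₁, e₂, e₃]
      (by intro i; fin_cases i <;> simpa)
    simpa [List.finRange_succ, mul_assoc] using this
  have hp : |(1 : ℤ)| = 1 := rfl
  have hm : |(-1 : ℤ)| = 1 := rfl
  have e : ((A ∪ A⁻¹) ^ 3) = (A * A * A ∪ A * A * A⁻¹) ∪ (A * A⁻¹ * A ∪ A * A⁻¹ * A⁻¹) ∪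
      ((A⁻¹ * A * A ∪ A⁻¹ * A * A⁻¹) ∪ (A⁻¹ * A⁻¹ * A ∪ A⁻¹ * A⁻¹ * A⁻¹)) := by
    rw [pow_succ, pow_two]
    simp only [Finset.mul_union, Finset.union_mul]
    ext x; simp only [Finset.mem_union]; tauto
  have hle : ((A ∪ A⁻¹) ^ 3).card ≤ ((A * A * A).card + (A * A * A⁻¹).card) +
      ((A * A⁻¹ * A).card + (A * A⁻¹ * A⁻¹).card) +
      (((A⁻¹ * A * A).card + (A⁻¹ * A * A⁻¹).card) + ((A⁻¹ * A⁻¹ * A).card + (A⁻¹ * A⁻¹ * A⁻¹).card)) := by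
    rw [e]
    refine (Finset.card_union_le _ _).trans (add_le_add ?_ ?_) <;>
    refine (Finset.card_union_le _ _).trans (add_le_add ?_ ?_) <;> exact Finset.card_union_le _ _
  have h1 := halt 1 1 1 hp hp hp
  have h2 := halt 1 1 (-1) hp hp hm
  have h3 := halt 1 (-1) 1 hp hm hp
  have h4 := halt 1 (-1) (-1) hp hm hm
  have h5 := halt (-1) 1 1 hm hp hp
  have h6 := halt (-1) 1 (-1) hm hp hm
  have h7 := halt (-1) (-1) 1 hm hm hp
  have h8 := halt (-1) (-1) (-1) hm hm hm
  simp only [zpow_one, zpow_neg_one] at h1 h2 h3 h4 h5 h6 h7 h8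
  have hle' : (((A ∪ A⁻¹) ^ 3).card : ℝ) ≤ 8 * (K ^ 3 * A.card) := by
    refine (Nat.cast_le (α := ℝ).2 hle).trans ?_
    push_cast
    linarith
  refine hle'.trans ?_
  rw [mul_assoc]
  have : (A.card : ℝ) ≤ (A ∪ A⁻¹).card := by exact_mod_cast Finset.card_le_card Finset.subset_union_left
  gcongr

theorem card_union_inv_pow_le {G : Type*} [Group G] [DecidableEq G] (A : Finset G) (K : ℝ) (hK : 1 ≤ K)
    (hA : ((A ^ 3).card : ℝ) ≤ K * A.card) {m : ℕ} (hm : 1 ≤ m) :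
    (((A ∪ A⁻¹) ^ (m + 1)).card : ℝ) ≤ (8 * K ^ 3) ^ m * (A ∪ A⁻¹).card := by
  have hsymm : (A ∪ A⁻¹)⁻¹ = A ∪ A⁻¹ := by
    ext x; simp only [Finset.mem_inv', Finset.mem_union, inv_inv]; exact or_comm
  have h3 := card_union_inv_pow_three A K hK hA
  have hK3 : 1 ≤ 8 * K ^ 3 := by have := one_le_pow₀ hK (n := 3); linarith
  rcases Nat.lt_or_ge m 2 with h | h
  · obtain rfl : m = 1 := by omega
    have hsub : ((A ∪ A⁻¹) ^ 2).card ≤ ((A ∪ A⁻¹) ^ 3).card := by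
      rcases (A ∪ A⁻¹).eq_empty_or_nonempty with h0 | h0
      · rw [h0]; simp
      · rw [pow_succ _ 2]; exact Finset.card_le_card_mul_right h0
    rw [pow_one]
    exact le_trans (by exact_mod_cast hsub) h3
  · refine (Finset.small_pow_of_small_tripling (by omega) h3 hsymm).trans ?_
    gcongr
    omega

/-- One element of A over each point of its first projection translates the fibre into disjoint
fibres of the next power. -/
theorem card_image_fst_mul_card_fiber_le {G₁ G₂ : Type*} [DecidableEq G₁] [DecidableEq G₂] [Group G₁] [Group G₂] (A T : Finset (G₁ × G₂))
    (hAT : A ⊆ T) (m : ℕ) (g : G₁) :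
    (A.image Prod.fst).card * ((T ^ m).filter fun x => x.1 = g).card ≤ (T ^ (m + 1)).card := by
  have hsec : ∀ b ∈ A.image Prod.fst, ∃ a ∈ A, a.1 = b := fun b hb => by simpa using Finset.mem_image.1 hb
  choose! σ hσA hσ using hsec
  rw [← Finset.card_product]
  refine Finset.card_le_card_of_injOn (fun z => σ z.1 * z.2) ?_ ?_
  · rintro ⟨b, x⟩ hz
    have hz' := Finset.mem_product.1 (Finset.mem_coe.1 hz)
    refine Finset.mem_coe.2 ?_
    rw [pow_succ']
    exact Finset.mul_mem_mul (hAT (hσA _ hz'.1)) (Finset.mem_filter.1 hz'.2).1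
  · rintro ⟨b, x⟩ hz ⟨b', x'⟩ hz' h
    have h1 := Finset.mem_product.1 (Finset.mem_coe.1 hz)
    have h2 := Finset.mem_product.1 (Finset.mem_coe.1 hz')
    simp only at h h1 h2
    have h3 := congrArg Prod.fst h
    rw [Prod.fst_mul, Prod.fst_mul, (Finset.mem_filter.1 h1.2).2, (Finset.mem_filter.1 h2.2).2, hσ _ h1.1, hσ _ h2.1,
      mul_left_inj] at h3
    subst h3
    rw [mul_right_inj] at h
    rw [h]

/-- If `A³` has small fibres and `A` is dense in the first factor then all word sets have small fibres. -/
theorem card_fiber_pow_le {G₁ G₂ : Type*} [DecidableEq G₁] [DecidableEq G₂] [Group G₁] [Fintype G₁] [Group G₂] (A : Finset (G₁ × G₂))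
    (hne : A.Nonempty) (N D : ℝ) (hN : 1 ≤ N) (hD : 1 ≤ D)
    (hfib : ∀ g, (((A ^ 3).filter fun x => x.1 = g).card : ℝ) ≤ N)
    (hdens : (Fintype.card G₁ : ℝ) ≤ D * (A.image Prod.fst).card) {m : ℕ} (hm : 1 ≤ m) (g : G₁) :
    ((((A ∪ A⁻¹) ^ m).filter fun x => x.1 = g).card : ℝ) ≤ (2 * (N * D)) ^ (3 * m + 1) := by
  have hA3 : ((A ^ 3).card : ℝ) ≤ N * Fintype.card G₁ := by
    rw [Finset.card_eq_sum_card_fiberwise (f := Prod.fst) (t := Finset.univ) (fun _ _ => Finset.mem_coe.2 (Finset.mem_univ _))]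
    push_cast
    calc _ ≤ ∑ _g : G₁, N := Finset.sum_le_sum fun g _ => hfib g
      _ = _ := by rw [Finset.sum_const, Finset.card_univ, nsmul_eq_mul, mul_comm]
  have himg : ((A.image Prod.fst).card : ℝ) ≤ A.card := by exact_mod_cast Finset.card_image_le
  have hK : 1 ≤ N * D := one_le_mul_of_one_le_of_one_le hN hD
  have htrip : ((A ^ 3).card : ℝ) ≤ N * D * A.card := by
    calc _ ≤ N * Fintype.card G₁ := hA3
      _ ≤ N * (D * (A.image Prod.fst).card) := by gcongr
      _ ≤ N * (D * A.card) := by gcongr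
      _ = _ := by ring
  have hpow := card_union_inv_pow_le A (N * D) hK htrip hm
  set T := A ∪ A⁻¹
  have hT : (T.card : ℝ) ≤ 2 * (N * D) * (A.image Prod.fst).card := by
    have h1 : T.card ≤ A.card + A.card := (Finset.card_union_le _ _).trans (by rw [Finset.card_inv])
    have h2 : A.card ≤ (A ^ 3).card := by
      rw [pow_succ]
      exact Finset.card_le_card_mul_left (hne.pow)
    calc (T.card : ℝ) ≤ A.card + A.card := by exact_mod_cast h1
      _ ≤ (A ^ 3).card + (A ^ 3).card := by
        have : (A.card : ℝ) ≤ (A ^ 3).card := by exact_mod_cast h2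
        linarith
      _ ≤ N * (D * (A.image Prod.fst).card) + N * (D * (A.image Prod.fst).card) := by
        have := hA3.trans (mul_le_mul_of_nonneg_left hdens (by linarith))
        linarith
      _ = _ := by ring
  have hinj := card_image_fst_mul_card_fiber_le A (A ∪ A⁻¹) Finset.subset_union_left m g
  set F := ((A ∪ A⁻¹) ^ m).filter fun x => x.1 = g
  have hpos : (0 : ℝ) < (A.image Prod.fst).card := by exact_mod_cast (hne.image _).card_pos
  refine le_of_mul_le_mul_left ?_ hpos
  calc ((A.image Prod.fst).card : ℝ) * F.card ≤ (T ^ (m + 1)).card := by exact_mod_cast hinj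
    _ ≤ (8 * (N * D) ^ 3) ^ m * (2 * (N * D) * (A.image Prod.fst).card) := hpow.trans (by gcongr)
    _ = _ := by
      rw [pow_succ _ (3 * m), pow_mul]; ring

/-- An element all of whose conjugates lie in a small set has a large centralizer. -/
theorem card_image_snd_le {G₁ G₂ : Type*} [DecidableEq G₁] [DecidableEq G₂] [Group G₁] [Group G₂] [Fintype G₂] (A : Finset (G₁ × G₂))
    {m : ℕ} (ζ : G₁ × G₂) (hζ : ζ ∈ (A ∪ A⁻¹) ^ m) (hζ1 : ζ.1 = 1) :
    (A.image Prod.snd).card ≤ (((A ∪ A⁻¹) ^ (m + 2)).filter fun x => x.1 = 1).card *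
      (Finset.univ.filter fun y : G₂ => y * ζ.2 = ζ.2 * y).card := by
  set T := A ∪ A⁻¹
  set Cn := Finset.univ.filter fun y : G₂ => y * ζ.2 = ζ.2 * y
  set F := (T ^ (m + 2)).filter fun x => x.1 = 1
  have hmap : ∀ c ∈ A.image Prod.snd, c * ζ.2 * c⁻¹ ∈ F.image Prod.snd := by
    intro c hc
    obtain ⟨a, ha, rfl⟩ := Finset.mem_image.1 hc
    refine Finset.mem_image.2 ⟨a * ζ * a⁻¹, Finset.mem_filter.2 ⟨?_, ?_⟩, rfl⟩
    · rw [show m + 2 = 1 + m + 1 by ring, pow_add, pow_add, pow_one]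
      exact Finset.mul_mem_mul (Finset.mul_mem_mul (Finset.mem_union_left _ ha) hζ)
        (Finset.mem_union_right _ (Finset.inv_mem_inv ha))
    · rw [Prod.fst_mul, Prod.fst_mul, hζ1, mul_one, Prod.fst_inv, mul_inv_cancel]
  have h1 := Finset.card_le_mul_card_image_of_maps_to (f := fun c => c * ζ.2 * c⁻¹) hmap Cn.card ?_
  · rw [mul_comm]
    exact h1.trans (Nat.mul_le_mul_left _ Finset.card_image_le)
  · intro c _
    rcases ((A.image Prod.snd).filter fun x => x * ζ.2 * x⁻¹ = c).eq_empty_or_nonempty with h0 | ⟨c₀, hc₀⟩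
    · rw [h0]; simp
    · refine Finset.card_le_card_of_injOn (fun x => c₀⁻¹ * x) (fun x hx => ?_) fun a _ b _ h => mul_left_cancel h
      have e1 := (Finset.mem_filter.1 hc₀).2
      have e2 := (Finset.mem_filter.1 (Finset.mem_coe.1 hx)).2
      rw [← e2, mul_inv_eq_iff_eq_mul] at e1
      refine Finset.mem_coe.2 (Finset.mem_filter.2 ⟨Finset.mem_univ _, ?_⟩)
      rw [mul_assoc, inv_mul_eq_iff_eq_mul, ← mul_assoc, ← mul_assoc, e1]
      group
end Tripling

/-! ### Logarithmic weights of primes and nearly scalar elements. -/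

section Weights

/-- The weight of the prime `p` in `d`. -/
noncomputable def wt (d p : ℕ) : ℝ := d.factorization p * Real.log p

/-- Half of the exponent of `p` in `d`, rounded up. -/
def halfExp (d p : ℕ) : ℕ := (d.factorization p + 1) / 2

theorem wt_nonneg (d p : ℕ) : 0 ≤ wt d p := mul_nonneg (Nat.cast_nonneg _) (Real.log_natCast_nonneg _)

theorem log_eq_sum_wt {d l : ℕ} (hd : d ≠ 0) (hl : l ∣ d) : Real.log l = ∑ p ∈ d.primeFactors, wt l p := by
  have hl0 : l ≠ 0 := ne_zero_of_dvd_ne_zero hd hl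
  conv_lhs => rw [← Nat.prod_factorization_pow_eq_self hl0]
  rw [Finsupp.prod, Nat.support_factorization]
  push_cast
  rw [Real.log_prod fun p hp => by
    have := (Nat.prime_of_mem_primeFactors hp).pos
    positivity]
  rw [← Finset.sum_subset (Nat.primeFactors_mono hl hd)]
  · refine Finset.sum_congr rfl fun p _ => ?_
    rw [Real.log_pow, wt]
  · intro p _ hp
    simp [wt, Finsupp.notMem_support_iff.1 (show p ∉ l.factorization.support by rwa [Nat.support_factorization])]

/-- The primes at which `l` carries less than half of the exponent of `d`. -/
noncomputable def deficient (d l : ℕ) : Finset ℕ := d.primeFactors.filter fun p => ¬ p ^ halfExp d p ∣ l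

/-- At a deficient prime at least half of the exponent of d is missing from l, so its weight is at
most twice the contribution of that prime to log(d/l). Large level thus means small deficient
weight; the next lemma goes back. -/
theorem sum_wt_deficient_le {d l : ℕ} (hd : d ≠ 0) (hl : l ∣ d) :
    ∑ p ∈ deficient d l, wt d p ≤ 2 * (Real.log d - Real.log l) := by
  have hl0 : l ≠ 0 := ne_zero_of_dvd_ne_zero hd hl
  rw [log_eq_sum_wt hd dvd_rfl, log_eq_sum_wt hd hl, ← Finset.sum_sub_distrib, Finset.mul_sum]
  have hle : ∀ p, l.factorization p ≤ d.factorization p := fun p => (Nat.factorization_le_iff_dvd hl0 hd).2 hl p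
  refine (Finset.sum_le_sum fun p hp => ?_).trans
    (Finset.sum_le_sum_of_subset_of_nonneg (Finset.filter_subset _ _) fun p _ _ => ?_)
  · have hp' := Finset.mem_filter.1 hp
    have hprime := Nat.prime_of_mem_primeFactors hp'.1
    rw [hprime.pow_dvd_iff_le_factorization hl0, halfExp] at hp'
    have h1 : d.factorization p + 2 * l.factorization p ≤ 2 * d.factorization p := by omega
    have h2 : (d.factorization p : ℝ) + 2 * l.factorization p ≤ 2 * d.factorization p := by exact_mod_cast h1
    have h3 : 0 ≤ Real.log p := Real.log_natCast_nonneg _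
    simp only [wt]
    nlinarith
  · have h2 : (l.factorization p : ℝ) ≤ d.factorization p := by exact_mod_cast hle p
    have h3 : 0 ≤ Real.log p := Real.log_natCast_nonneg _
    simp only [wt]
    nlinarith

theorem le_log_of_deficient {d l : ℕ} (hd : d ≠ 0) (hl : l ∣ d) :
    Real.log d - ∑ p ∈ deficient d l, wt d p ≤ 2 * Real.log l := by
  have hl0 : l ≠ 0 := ne_zero_of_dvd_ne_zero hd hl
  have hsplit := Finset.sum_filter_add_sum_filter_not d.primeFactors (fun p => p ^ halfExp d p ∣ l) (wt d)
  rw [← log_eq_sum_wt hd dvd_rfl] at hsplit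
  have h1 : Real.log d - ∑ p ∈ deficient d l, wt d p = ∑ p ∈ d.primeFactors.filter (fun p => p ^ halfExp d p ∣ l), wt d p := by
    rw [deficient]; linarith
  rw [h1, log_eq_sum_wt hd hl, Finset.mul_sum]
  refine (Finset.sum_le_sum fun p hp => ?_).trans
    (Finset.sum_le_sum_of_subset_of_nonneg (Finset.filter_subset _ _) fun p _ _ => by
      have := wt_nonneg l p; linarith)
  have hp' := Finset.mem_filter.1 hp
  have hprime := Nat.prime_of_mem_primeFactors hp'.1
  rw [hprime.pow_dvd_iff_le_factorization hl0, halfExp] at hp'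
  have h1 : d.factorization p ≤ 2 * l.factorization p := by omega
  have h2 : (d.factorization p : ℝ) ≤ 2 * l.factorization p := by exact_mod_cast h1
  have h3 : 0 ≤ Real.log p := Real.log_natCast_nonneg _
  simp only [wt]
  nlinarith

theorem exists_const_mul_card_divisors_le (C : ℝ) (m : ℕ) {η : ℝ} (hη : 0 < η) :
    ∃ D : ℕ, ∀ d : ℕ, D ≤ d → C * (d.divisors.card : ℝ) ^ m ≤ (d : ℝ) ^ η := by
  obtain ⟨C₁, hC₁, h⟩ := exists_card_divisors_le 1 m (η / 2) le_rfl (by positivity)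
  have h2 : Filter.Tendsto (fun d : ℕ => (d : ℝ) ^ (η / 2)) Filter.atTop Filter.atTop :=
    (tendsto_rpow_atTop (by positivity)).comp tendsto_natCast_atTop_atTop
  obtain ⟨D, hD⟩ := Filter.eventually_atTop.1 (h2.eventually_ge_atTop (|C| * C₁))
  refine ⟨max D 1, fun d hd => ?_⟩
  have hd0 : d ≠ 0 := by have := le_of_max_le_right hd; omega
  have h3 := h d hd0
  rw [one_pow, one_mul] at h3
  have h4 := hD d (le_of_max_le_left hd)
  have hpos : (0 : ℝ) < d := by positivity
  calc C * (d.divisors.card : ℝ) ^ m ≤ |C| * (C₁ * (d : ℝ) ^ (η / 2)) := by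
        gcongr
        exact le_abs_self C
    _ = (|C| * C₁) * (d : ℝ) ^ (η / 2) := by ring
    _ ≤ (d : ℝ) ^ (η / 2) * (d : ℝ) ^ (η / 2) := by gcongr
    _ = (d : ℝ) ^ η := by rw [← Real.rpow_add hpos]; congr 1; ring

theorem card_le_of_lvl {d : ℕ} [NeZero d] {c : ℝ} (s : Finset SL(2, ZMod d)) (hs : ∀ z ∈ s, (d : ℝ) ^ c ≤ lvl z) :
    (s.card : ℝ) ≤ 2 * (d.divisors.card : ℝ) ^ 2 * (d : ℝ) ^ (3 - 3 * c) := by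
  have hd0 : d ≠ 0 := NeZero.ne d
  have hdp : (0 : ℝ) < d := by positivity
  set E := d.divisors.filter fun e : ℕ => (d : ℝ) ^ c ≤ e
  have h1 : s.card = ∑ e ∈ E, (s.filter fun z => lvl z = e).card := by
    refine Finset.card_eq_sum_card_fiberwise fun z hz => ?_
    exact Finset.mem_coe.2 (Finset.mem_filter.2 ⟨Nat.mem_divisors.2 ⟨lvl_dvd z, hd0⟩, hs z (Finset.mem_coe.1 hz)⟩)
  have h2 : ∀ e ∈ E, ((s.filter fun z => lvl z = e).card : ℝ) ≤ 2 * d.divisors.card * (d : ℝ) ^ (3 - 3 * c) := by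
    intro e he
    have he' := Finset.mem_filter.1 he
    have hed := (Nat.mem_divisors.1 he'.1).1
    have h3 : (s.filter fun z => lvl z = e).card ≤ 2 * e.divisors.card * (d / e) ^ 3 := by
      refine (Finset.card_le_card ?_).trans (card_scalarMod_le hed)
      intro z hz
      have := (Finset.mem_filter.1 hz).2
      exact Finset.mem_filter.2 ⟨Finset.mem_univ _, (dvd_lvl_iff hed z).1 (by rw [this])⟩
    have h4 : e.divisors.card ≤ d.divisors.card := Finset.card_le_card (Nat.divisors_subset_of_dvd hd0 hed)
    have he0 : (0 : ℝ) < e := lt_of_lt_of_le (by positivity) he'.2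
    have h5 : ((d / e : ℕ) : ℝ) ≤ (d : ℝ) ^ (1 - c) := by
      rw [Nat.cast_div hed he0.ne', Real.rpow_sub hdp, Real.rpow_one]
      have := he'.2
      gcongr
    calc ((s.filter fun z => lvl z = e).card : ℝ) ≤ 2 * e.divisors.card * ((d / e : ℕ) : ℝ) ^ 3 := by exact_mod_cast h3
      _ ≤ 2 * d.divisors.card * ((d : ℝ) ^ (1 - c)) ^ 3 := by gcongr
      _ = _ := by
        rw [← Real.rpow_natCast, ← Real.rpow_mul hdp.le]; congr 2; push_cast; ring
  rw [h1]
  push_cast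
  refine (Finset.sum_le_sum h2).trans ?_
  rw [Finset.sum_const, nsmul_eq_mul]
  have h6 : (E.card : ℝ) ≤ d.divisors.card := by exact_mod_cast Finset.card_le_card (Finset.filter_subset _ _)
  calc (E.card : ℝ) * (2 * d.divisors.card * (d : ℝ) ^ (3 - 3 * c)) ≤
      d.divisors.card * (2 * d.divisors.card * (d : ℝ) ^ (3 - 3 * c)) := by gcongr
    _ = _ := by ring

end Weights

/-! ### Near triviality of approximate homomorphisms, on average over primes. -/

section ApproximateHomomorphism

theorem pow_halfExp_dvd (d p : ℕ) : p ^ halfExp d p ∣ d :=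
  (pow_dvd_pow p (by unfold halfExp; omega)).trans (Nat.ordProj_dvd d p)

theorem sum_mul_card_filter {P Z : Type*} [Fintype Z] (s : Finset P) (w : P → ℝ) (R : P → Z → Prop)
    [∀ p z, Decidable (R p z)] :
    ∑ p ∈ s, w p * ((Finset.univ.filter (R p)).card : ℝ) = ∑ z, ∑ p ∈ s.filter fun p => R p z, w p := by
  simp_rw [Finset.sum_filter]
  rw [Finset.sum_comm]
  refine Finset.sum_congr rfl fun p _ => ?_
  rw [Finset.card_filter, Nat.cast_sum, Finset.mul_sum]
  refine Finset.sum_congr rfl fun z _ => ?_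
  split_ifs <;> simp

/-- The projective reduction of `z` modulo half of the `p`-part of `d`. -/
def projRed (d p : ℕ) (z : SL(2, ZMod d)) :
    SL(2, ZMod (p ^ halfExp d p)) ⧸ Subgroup.center SL(2, ZMod (p ^ halfExp d p)) :=
  QuotientGroup.mk (reduction (pow_halfExp_dvd d p) z)

theorem projRed_mul (d p : ℕ) (z w : SL(2, ZMod d)) : projRed d p (z * w) = projRed d p z * projRed d p w := by
  rw [projRed, map_mul, QuotientGroup.mk_mul]; rfl

theorem projRed_inv (d p : ℕ) (z : SL(2, ZMod d)) : projRed d p z⁻¹ = (projRed d p z)⁻¹ := by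
  rw [projRed, map_inv, QuotientGroup.mk_inv]; rfl

theorem projRed_eq_one_iff {d p : ℕ} [NeZero d] (z : SL(2, ZMod d)) :
    projRed d p z = 1 ↔ p ^ halfExp d p ∣ lvl z := by
  rw [projRed, QuotientGroup.eq_one_iff, reduction_mem_center_iff]

theorem mem_deficient_lvl {d p : ℕ} [NeZero d] (z : SL(2, ZMod d)) :
    p ∈ deficient d (lvl z) ↔ p ∈ d.primeFactors ∧ projRed d p z ≠ 1 := by
  rw [deficient, Finset.mem_filter, Ne, projRed_eq_one_iff]

theorem sum_wt_deficient_mul_le {d : ℕ} [NeZero d] (z w : SL(2, ZMod d)) :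
    ∑ p ∈ deficient d (lvl (z * w)), wt d p ≤
      ∑ p ∈ deficient d (lvl z), wt d p + ∑ p ∈ deficient d (lvl w), wt d p := by
  have hsub : deficient d (lvl (z * w)) ⊆ deficient d (lvl z) ∪ deficient d (lvl w) := by
    intro p hp
    rw [Finset.mem_union]
    simp only [mem_deficient_lvl, projRed_mul] at hp ⊢
    by_contra! hcon
    refine hp.2 ?_
    rw [hcon.1 hp.1, hcon.2 hp.1, one_mul]
  refine (Finset.sum_le_sum_of_subset_of_nonneg hsub fun p _ _ => wt_nonneg d p).trans ?_
  have := Finset.sum_union_inter (s₁ := deficient d (lvl z)) (s₂ := deficient d (lvl w)) (f := wt d)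
  have h0 : 0 ≤ ∑ p ∈ deficient d (lvl z) ∩ deficient d (lvl w), wt d p := Finset.sum_nonneg fun p _ => wt_nonneg d p
  linarith

/-- A family of approximate homomorphisms is nearly trivial, in weighted average, at every element killed by all
true homomorphisms. -/
theorem sum_weight_ne_one_le {N : Type*} [Group N] [Fintype N] {Q : ℕ → Type*} [∀ p, Group (Q p)] [∀ p, DecidableEq (Q p)]
    (f : ∀ p, N → Q p) (PF : Finset ℕ) (w : ℕ → ℝ) (hw : ∀ p, 0 ≤ w p)
    (hs : ∀ a b, ∑ p ∈ PF.filter (fun p => f p a * f p b ≠ f p (a * b)), w p ≤ (1 / 500) * ∑ p ∈ PF, w p)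
    (x : N) (hx : ∀ p ∈ PF, ∀ Φ : N →* Q p, Φ x = 1) :
    ∑ p ∈ PF.filter (fun p => f p x ≠ 1), w p ≤ (142 / 1000) * ∑ p ∈ PF, w p := by
  set W := ∑ p ∈ PF, w p
  set n : ℝ := ((Fintype.card N : ℕ) : ℝ) with hndef
  have hn : 0 < n := Nat.cast_pos.2 Fintype.card_pos
  set cnt : ℕ → ℝ := fun p => ((Finset.univ.filter fun z : N × N => f p z.1 * f p z.2 ≠ f p (z.1 * z.2)).card : ℝ) with hcnt
  set Good := PF.filter fun p => cnt p ≤ (1 / 50) * n ^ 2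
  set Bad := PF.filter fun p => ¬ cnt p ≤ (1 / 50) * n ^ 2
  -- Markov's inequality: the average defect is 1/500, and a bad prime has defect above 1/50.
  have hBad : ∑ p ∈ Bad, w p ≤ (1 / 10) * W := by
    have h1 : ∑ p ∈ PF, w p * cnt p ≤ n ^ 2 * ((1 / 500) * W) := by
      have := sum_mul_card_filter PF w fun p (z : N × N) => f p z.1 * f p z.2 ≠ f p (z.1 * z.2)
      simp only [hcnt]
      rw [this]
      calc _ ≤ ∑ _z : N × N, (1 / 500) * W := Finset.sum_le_sum fun z _ => hs z.1 z.2
        _ = _ := by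
            rw [Finset.sum_const, Finset.card_univ, Fintype.card_prod, nsmul_eq_mul, hndef]; push_cast; ring
    have h2 : ∑ p ∈ Bad, w p * ((1 / 50) * n ^ 2) ≤ ∑ p ∈ PF, w p * cnt p := by
      refine (Finset.sum_le_sum fun p hp => ?_).trans
        (Finset.sum_le_sum_of_subset_of_nonneg (Finset.filter_subset _ _) fun p _ _ =>
          mul_nonneg (hw p) (Nat.cast_nonneg _))
      exact mul_le_mul_of_nonneg_left (not_le.1 (Finset.mem_filter.1 hp).2).le (hw p)
    rw [← Finset.sum_mul] at h2
    have h3 : n ^ 2 * ∑ p ∈ Bad, w p ≤ n ^ 2 * ((1 / 10) * W) := by linarith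
    exact le_of_mul_le_mul_left h3 (by positivity)
  have hGood : ∀ p ∈ Good, ((Finset.univ.filter fun y => f p (x * y) ≠ f p y).card : ℝ) ≤ 2 * (1 / 50) * n := by
    intro p hp
    have hp' := Finset.mem_filter.1 hp
    obtain ⟨Φ, hΦ⟩ := exists_hom_of_approx (f p) (1 / 50) (by norm_num) hp'.2
    have h1 := hΦ x
    rw [hx p hp'.1 Φ] at h1
    simpa only [one_mul] using h1
  have hun : ∀ a b : Finset ℕ, ∑ p ∈ a ∪ b, w p ≤ ∑ p ∈ a, w p + ∑ p ∈ b, w p := fun a b => by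
    have := Finset.sum_union_inter (s₁ := a) (s₂ := b) (f := w)
    have h0 : 0 ≤ ∑ p ∈ a ∩ b, w p := Finset.sum_nonneg fun p _ => hw p
    linarith
  -- If f(xy) = f(y) and f(x)f(y) = f(xy) then f(x) = 1. Averaged over y, the three exceptions weigh
  -- 1/10, 2/50 and 1/500, in total 142/1000.
  have hcover : ∀ y, ∑ p ∈ PF.filter (fun p => f p x ≠ 1), w p ≤ ∑ p ∈ Bad, w p +
      ∑ p ∈ Good.filter (fun p => f p (x * y) ≠ f p y), w p + (1 / 500) * W := by
    intro y
    have hsub : PF.filter (fun p => f p x ≠ 1) ⊆ (Bad ∪ Good.filter (fun p => f p (x * y) ≠ f p y)) ∪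
        PF.filter (fun p => f p x * f p y ≠ f p (x * y)) := by
      intro p hp
      have hp' := Finset.mem_filter.1 hp
      by_contra hcon
      rw [Finset.mem_union, Finset.mem_union, not_or, not_or] at hcon
      have hg : p ∈ Good := by
        by_contra hng
        exact hcon.1.1 (Finset.mem_filter.2 ⟨hp'.1, fun hle => hng (Finset.mem_filter.2 ⟨hp'.1, hle⟩)⟩)
      have e1 : f p (x * y) = f p y := by
        by_contra hne
        exact hcon.1.2 (Finset.mem_filter.2 ⟨hg, hne⟩)
      have e2 : f p x * f p y = f p (x * y) := by
        by_contra hne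
        exact hcon.2 (Finset.mem_filter.2 ⟨hp'.1, hne⟩)
      rw [e1] at e2
      exact hp'.2 (mul_eq_right.1 e2)
    refine (Finset.sum_le_sum_of_subset_of_nonneg hsub fun p _ _ => hw p).trans ?_
    have h1 := hun (Bad ∪ Good.filter (fun p => f p (x * y) ≠ f p y)) (PF.filter (fun p => f p x * f p y ≠ f p (x * y)))
    have h2 := hun Bad (Good.filter (fun p => f p (x * y) ≠ f p y))
    have h3 := hs x y
    linarith
  have hsum := Finset.sum_le_sum fun (y : N) (_ : y ∈ Finset.univ) => hcover y
  rw [Finset.sum_add_distrib, Finset.sum_add_distrib, Finset.sum_const, Finset.sum_const, Finset.sum_const,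
    ← sum_mul_card_filter Good w fun p y => f p (x * y) ≠ f p y, Finset.card_univ] at hsum
  simp only [nsmul_eq_mul] at hsum
  have h5 : ∑ p ∈ Good, w p * ((Finset.univ.filter fun y => f p (x * y) ≠ f p y).card : ℝ) ≤ W * (2 * (1 / 50) * n) := by
    refine (Finset.sum_le_sum fun p hp => mul_le_mul_of_nonneg_left (hGood p hp) (hw p)).trans ?_
    rw [← Finset.sum_mul]
    exact mul_le_mul_of_nonneg_right
      (Finset.sum_le_sum_of_subset_of_nonneg (Finset.filter_subset _ _) fun p _ _ => hw p) (by positivity)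
  refine le_of_mul_le_mul_left ?_ hn
  have h6 : n * ∑ p ∈ Bad, w p ≤ n * ((1 / 10) * W) := mul_le_mul_of_nonneg_left hBad hn.le
  rw [← hndef] at hsum
  linarith

/-- An approximate homomorphism between special linear groups of coprime moduli is nearly trivial deep down. -/
theorem approx_hom_nearly_trivial {q d h : ℕ} [NeZero q] [NeZero d] (hqd : Nat.Coprime q d) (hh : 60 ∣ h) (hh0 : 0 < h)
    (s : congSub q h → SL(2, ZMod d))
    (hs : ∀ x y, ∑ p ∈ deficient d (lvl (s x * s y * (s (x * y))⁻¹)), wt d p ≤ (1 / 500) * Real.log d)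
    (x : congSub q h) (hx : x.1 ∈ congSub q ((8 * h ^ 2) ^ 2)) :
    ∑ p ∈ deficient d (lvl (s x)), wt d p ≤ (142 / 1000) * Real.log d := by
  have hdef : ∀ z : SL(2, ZMod d), deficient d (lvl z) = d.primeFactors.filter fun p => projRed d p z ≠ 1 := by
    intro z; ext p
    rw [mem_deficient_lvl, Finset.mem_filter]
  rw [log_eq_sum_wt (NeZero.ne d) dvd_rfl] at hs ⊢
  rw [hdef]
  refine sum_weight_ne_one_le (fun p y => projRed d p (s y)) d.primeFactors (wt d) (wt_nonneg d) (fun a b => ?_) x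
    fun p hp Φ => hom_trivial (Nat.prime_of_mem_primeFactors hp)
      (hqd.coprime_dvd_right (Nat.dvd_of_mem_primeFactors hp)) hh hh0 Φ x hx
  refine le_trans (le_of_eq ?_) (hs a b)
  rw [hdef]
  refine Finset.sum_congr (Finset.filter_congr fun p _ => not_congr ?_) fun _ _ => rfl
  rw [projRed_mul, projRed_mul, projRed_inv, mul_inv_eq_one]

end ApproximateHomomorphism

/-! ### The gluing step: a large fibre in the threefold product. -/

section LargeFiber

set_option exponentiation.threshold 4000 in
-- Exponent bookkeeping for x = d, t = τ(d) and a level l. The power 3253 is 3·(1082 + 2) + 1, the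
-- fibre bound for conjugates of words of length at most 1082.
theorem level_lower_bound {x t l : ℝ} (hx : 1 < x) (ht : 0 ≤ t) (hl : 0 ≤ l)
    (hC : 2 ^ 3254 * t ^ 3 ≤ x ^ (1 / 1000 : ℝ))
    (h : x ^ 3 ≤ x ^ (1e-7 : ℝ) * (((2 * (x ^ (1e-7 : ℝ) * x ^ (1e-7 : ℝ))) ^ 3253) * (2 * t ^ 2 * x * l ^ 2)) * t) :
    x ^ (999 / 1000 : ℝ) ≤ l := by
  have hx0 : 0 < x := by linarith
  by_contra! hlt
  have h1 : (2 * (x ^ (1e-7 : ℝ) * x ^ (1e-7 : ℝ))) ^ 3253 = 2 ^ 3253 * x ^ (2e-7 * 3253 : ℝ) := by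
    rw [mul_pow, ← Real.rpow_add hx0, ← Real.rpow_natCast (x ^ _) 3253, ← Real.rpow_mul hx0.le]
    congr 2
    norm_num
  have h2 : l ^ 2 ≤ x ^ (1998 / 1000 : ℝ) := by
    calc l ^ 2 ≤ (x ^ (999 / 1000 : ℝ)) ^ 2 := by gcongr
      _ = _ := by rw [← Real.rpow_natCast, ← Real.rpow_mul hx0.le]; norm_num
  rw [h1] at h
  have h3 : x ^ 3 ≤ x ^ (2.9999 : ℝ) := by
    calc x ^ 3 ≤ x ^ (1e-7 : ℝ) * ((2 ^ 3253 * x ^ (2e-7 * 3253 : ℝ)) * (2 * t ^ 2 * x * l ^ 2)) * t := h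
      _ ≤ x ^ (1e-7 : ℝ) * ((2 ^ 3253 * x ^ (2e-7 * 3253 : ℝ)) * (2 * t ^ 2 * x * x ^ (1998 / 1000 : ℝ))) * t := by gcongr
      _ = (2 ^ 3254 * t ^ 3) * (x ^ (1e-7 : ℝ) * x ^ (2e-7 * 3253 : ℝ) * x * x ^ (1998 / 1000 : ℝ)) := by
        rw [pow_succ 2 3253]; ring
      _ ≤ x ^ (1 / 1000 : ℝ) * (x ^ (1e-7 : ℝ) * x ^ (2e-7 * 3253 : ℝ) * x * x ^ (1998 / 1000 : ℝ)) := by gcongr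
      _ = x ^ (1 / 1000 + (1e-7 + 2e-7 * 3253 + 1 + 1998 / 1000) : ℝ) := by
        nth_rewrite 4 [← Real.rpow_one x]
        rw [← Real.rpow_add hx0, ← Real.rpow_add hx0, ← Real.rpow_add hx0, ← Real.rpow_add hx0]
      _ ≤ _ := Real.rpow_le_rpow_of_exponent_le hx.le (by norm_num)
  rw [← Real.rpow_natCast] at h3
  have := (Real.rpow_le_rpow_left_iff hx).1 h3
  norm_num at this

theorem density_contradiction {x t F c C : ℝ} (hx : 1 < x) (ht : 0 ≤ t) (hF : 0 ≤ F) (hc : 0 ≤ c)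
    (hFx : F ≤ C * x ^ (28e-7 : ℝ)) (hC : (c * C ^ 24 * 2) * t ^ 3 ≤ x ^ (1 / 100 : ℝ))
    (h : x ^ 3 ≤ x ^ (1e-7 : ℝ) * ((2 * t ^ 2 * x ^ (3 - 3 * (35 / 100) : ℝ)) * (c * F ^ 24)) * t) : False := by
  have hx0 : 0 < x := by linarith
  have h1 : F ^ 24 ≤ C ^ 24 * x ^ (28e-7 * 24 : ℝ) := by
    calc F ^ 24 ≤ (C * x ^ (28e-7 : ℝ)) ^ 24 := by gcongr
      _ = _ := by
        rw [mul_pow, ← Real.rpow_natCast (x ^ _) 24, ← Real.rpow_mul hx0.le]; norm_num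
  have h3 : x ^ 3 ≤ x ^ (2.9 : ℝ) := by
    calc x ^ 3 ≤ _ := h
      _ ≤ x ^ (1e-7 : ℝ) * ((2 * t ^ 2 * x ^ (3 - 3 * (35 / 100) : ℝ)) * (c * (C ^ 24 * x ^ (28e-7 * 24 : ℝ)))) * t := by gcongr
      _ = ((c * C ^ 24 * 2) * t ^ 3) * (x ^ (1e-7 : ℝ) * x ^ (3 - 3 * (35 / 100) : ℝ) * x ^ (28e-7 * 24 : ℝ)) := by ring
      _ ≤ x ^ (1 / 100 : ℝ) * (x ^ (1e-7 : ℝ) * x ^ (3 - 3 * (35 / 100) : ℝ) * x ^ (28e-7 * 24 : ℝ)) := by gcongr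
      _ = x ^ (1 / 100 + (1e-7 + (3 - 3 * (35 / 100)) + 28e-7 * 24) : ℝ) := by
        rw [← Real.rpow_add hx0, ← Real.rpow_add hx0, ← Real.rpow_add hx0]
      _ ≤ _ := Real.rpow_le_rpow_of_exponent_le hx.le (by norm_num)
  rw [← Real.rpow_natCast] at h3
  have := (Real.rpow_le_rpow_left_iff hx).1 h3
  norm_num at this

/-- If `f`-multiples of the elementary generators are reached, a congruence subgroup is reached. -/
theorem exists_word_of_coverage {q f : ℕ} [NeZero q] {G : Type*} [Group G] (π : G →* SL(2, ZMod q)) (S : Set G)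
    (h : ∀ y : ZMod q, (∃ ρ ∈ S ^ 72, π ρ = uU ((f : ZMod q) * y)) ∧ ∃ ρ ∈ S ^ 72, π ρ = uV ((f : ZMod q) * y))
    (M : SL(2, ZMod q)) (hM : M ∈ congSub q (f ^ 2)) : ∃ ρ ∈ S ^ 360, π ρ = M := by
  obtain ⟨t₁, t₂, t₃, t₄, t₅, e⟩ := exists_five_word f M (mem_congSub.1 hM)
  obtain ⟨ρ₁, h₁, e₁⟩ := (h t₁).1
  obtain ⟨ρ₂, h₂, e₂⟩ := (h t₂).2
  obtain ⟨ρ₃, h₃, e₃⟩ := (h t₃).1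
  obtain ⟨ρ₄, h₄, e₄⟩ := (h t₄).2
  obtain ⟨ρ₅, h₅, e₅⟩ := (h t₅).1
  refine ⟨ρ₁ * ρ₂ * ρ₃ * ρ₄ * ρ₅, ?_, ?_⟩
  · exact mul_mem_pow_add (m := 288) rfl (mul_mem_pow_add (m := 216) rfl (mul_mem_pow_add (m := 144) rfl
      (mul_mem_pow_add rfl h₁ h₂) h₃) h₄) h₅
  · rw [map_mul, map_mul, map_mul, map_mul, e₁, e₂, e₃, e₄, e₅, ← e]

theorem card_le_of_density {d : ℕ} [NeZero d] {n : ℕ} {x : ℝ}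
    (h : (Fintype.card SL(2, ZMod d) : ℝ) ≤ x * n) : (d : ℝ) ^ 3 ≤ x * n * d.divisors.card := by
  calc (d : ℝ) ^ 3 ≤ Fintype.card SL(2, ZMod d) * d.divisors.card := by exact_mod_cast pow_three_le_card_SL2
    _ ≤ _ := by gcongr

set_option maxHeartbeats 1000000 in
/-- **Large fibres.** A set dense in both factors of `SL₂(ℤ/q) × SL₂(ℤ/d)`, with `q` and `d` coprime, has a
threefold product with a large fibre over the first factor. -/
theorem exists_large_fiber : ∃ D : ℕ, ∀ (q d : ℕ) [NeZero q] [NeZero d], Nat.Coprime q d → D ≤ d →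
    ∀ A : Finset (SL(2, ZMod q) × SL(2, ZMod d)),
    (Fintype.card SL(2, ZMod q) : ℝ) ≤ (d : ℝ) ^ (1e-7 : ℝ) * (A.image Prod.fst).card →
    (Fintype.card SL(2, ZMod d) : ℝ) ≤ (d : ℝ) ^ (1e-7 : ℝ) * (A.image Prod.snd).card →
    ∃ g, (d : ℝ) ^ (1e-7 : ℝ) < ((A ^ 3).filter fun x => x.1 = g).card := by
  obtain ⟨C, hC, hcov⟩ := exists_uU_uV_coverage
  obtain ⟨D₁, hD₁⟩ := exists_const_mul_card_divisors_le (2 ^ 3254) 3 (η := 1 / 1000) (by norm_num)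
  obtain ⟨D₂, hD₂⟩ := exists_const_mul_card_divisors_le ((64 * 60 ^ 4) ^ 3 * C ^ 24 * 2) 3 (η := 1 / 100) (by norm_num)
  refine ⟨max 2 (max D₁ D₂), ?_⟩
  intro q d _ _ hqd hd A hA₁ hA₂
  by_contra! hfib
  have hd2 : 2 ≤ d := le_of_max_le_left hd
  have hb₁ := hD₁ d (le_of_max_le_left (le_of_max_le_right hd))
  have hb₂ := hD₂ d (le_of_max_le_right (le_of_max_le_right hd))
  have hx : (1 : ℝ) < d := by exact_mod_cast hd2
  have hx0 : (0 : ℝ) < d := by linarith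
  have hlog : 0 < Real.log d := Real.log_pos hx
  have hN : (1 : ℝ) ≤ (d : ℝ) ^ (1e-7 : ℝ) := Real.one_le_rpow hx.le (by norm_num)
  have hne : A.Nonempty := by
    rw [Finset.nonempty_iff_ne_empty]
    rintro rfl
    have : (0 : ℝ) < Fintype.card SL(2, ZMod q) := Nat.cast_pos.2 Fintype.card_pos
    simp at hA₁
  set T := A ∪ A⁻¹ with hT
  have hTsymm : (T : Set (SL(2, ZMod q) × SL(2, ZMod d)))⁻¹ = T := by
    ext x
    simp only [hT, Finset.coe_union, Finset.coe_inv, Set.mem_inv, Set.mem_union, inv_inv]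
    exact or_comm
  have hA2 := card_le_of_density hA₂
  have hP : ∀ s : ℝ, 0 ≤ 2 * (d.divisors.card : ℝ) ^ 2 * (d : ℝ) ^ s := fun s => by positivity
  have hQ : ∀ n X : ℝ, n ≤ X → (d : ℝ) ^ (1e-7 : ℝ) * n * d.divisors.card ≤
      (d : ℝ) ^ (1e-7 : ℝ) * X * d.divisors.card := fun n X h => by gcongr
  obtain ⟨Wd, hWd⟩ : ∃ Wd : ℕ → SL(2, ZMod q) × SL(2, ZMod d) → Prop, ∀ m x, Wd m x ↔ x ∈ T ^ m :=
    ⟨_, fun _ _ => Iff.rfl⟩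
  have hTmem : ∀ a ∈ A, Wd 1 a := fun a ha => by
    rw [hWd, pow_one]; exact Finset.mem_union_left _ ha
  -- All conjugates of ζ by A lie in a small fibre over 1, so ζ.2 has a large centralizer and level
  -- at least d^(0.999). The deficient weight is then at most 2/1000 of log d.
  have hlvl : ∀ m, 1 ≤ m → m ≤ 1082 → ∀ ζ, Wd m ζ → ζ.1 = 1 →
      ∑ p ∈ deficient d (lvl ζ.2), wt d p ≤ (1 / 500) * Real.log d := by
    intro m hm1 hm2 ζ hζ hζ1
    rw [hWd] at hζ
    have h1 := card_image_snd_le A ζ hζ hζ1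
    have h2 := card_fiber_pow_le A hne _ _ hN hN hfib hA₁ (m := m + 2) (by omega) 1
    have h3 := card_centralizer_le ζ.2
    have hbase : 1 ≤ 2 * ((d : ℝ) ^ (1e-7 : ℝ) * (d : ℝ) ^ (1e-7 : ℝ)) := by
      have := one_le_mul_of_one_le_of_one_le hN hN
      linarith
    have h4 := h2.trans (pow_le_pow_right₀ hbase (show 3 * (m + 2) + 1 ≤ 3253 by omega))
    have h5 : ((A.image Prod.snd).card : ℝ) ≤ ((2 * ((d : ℝ) ^ (1e-7 : ℝ) * (d : ℝ) ^ (1e-7 : ℝ))) ^ 3253) *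
        (2 * (d.divisors.card : ℝ) ^ 2 * d * (lvl ζ.2 : ℝ) ^ 2) := by
      refine (Nat.cast_le (α := ℝ).2 h1).trans ?_
      push_cast
      refine mul_le_mul h4 ?_ (Nat.cast_nonneg _) (by positivity)
      exact_mod_cast h3
    have h6 := level_lower_bound hx (Nat.cast_nonneg d.divisors.card) (Nat.cast_nonneg (lvl ζ.2)) hb₁
      (hA2.trans (by gcongr))
    have h7 := Real.log_le_log (by positivity) h6
    rw [Real.log_rpow hx0] at h7
    have h8 := sum_wt_deficient_le (NeZero.ne d) (lvl_dvd ζ.2)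
    linarith
  obtain ⟨f, hf, hfC, hword⟩ := hcov q (MonoidHom.fst SL(2, ZMod q) SL(2, ZMod d)) (T : Set _) hTsymm
    ((d : ℝ) ^ (1e-7 : ℝ))⁻¹ (by positivity) (by
      rw [inv_mul_le_iff₀ (by positivity)]
      refine hA₁.trans ?_
      gcongr
      rw [← Set.ncard_coe_finset]
      refine Set.ncard_le_ncard ?_ (Set.toFinite _)
      intro z hz
      obtain ⟨a, ha, rfl⟩ := Finset.mem_image.1 (Finset.mem_coe.1 hz)
      exact ⟨a, Finset.mem_coe.2 (Finset.mem_union_left _ ha), rfl⟩)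
  -- The factor f² is the level reached by words of length 5·72 = 360; the factor 60 is required by
  -- the homomorphism lemma.
  set h := 60 * f ^ 2 with hh
  have hh0 : 0 < h := by positivity
  have hwordh : ∀ x : congSub q h, ∃ ρ, Wd 360 ρ ∧ ρ.1 = x.1 := by
    intro x
    have hx' : x.1 ∈ congSub q (f ^ 2) := congSub_mono ⟨60, by rw [hh, mul_comm]⟩ x.2
    obtain ⟨ρ, h1, h2⟩ := exists_word_of_coverage _ _ hword x.1 hx'
    refine ⟨ρ, ?_, h2⟩
    rw [hWd, ← Finset.mem_coe, Finset.coe_pow]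
    exact h1
  choose ρ hρT hρ using hwordh
  have hTpow : ∀ (m n k : ℕ) (_ : m + n = k) {x y}, Wd m x → Wd n y → Wd k (x * y) := by
    intro m n k hk x y hx hy
    rw [hWd] at hx hy ⊢
    rw [← hk, pow_add]; exact Finset.mul_mem_mul hx hy
  have hTinv : ∀ (m : ℕ) {x}, Wd m x → Wd m x⁻¹ := by
    intro m x hx
    rw [hWd] at hx ⊢
    rw [← Finset.mem_coe, Finset.coe_pow] at hx ⊢
    exact inv_mem_pow hTsymm hx
  -- The multiplicative defect of the lift ρ is a word of length 3·360 over the identity, hence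
  -- nearly scalar: ρ is an approximate homomorphism.
  have hnear : ∀ x : congSub q h, x.1 ∈ congSub q ((8 * h ^ 2) ^ 2) →
      ∑ p ∈ deficient d (lvl (ρ x).2), wt d p ≤ (142 / 1000) * Real.log d := by
    intro x hx
    refine approx_hom_nearly_trivial hqd (Dvd.intro _ rfl) hh0 (fun x => (ρ x).2) (fun a b => ?_) x hx
    refine hlvl 1080 (by norm_num) (by norm_num) (ρ a * ρ b * (ρ (a * b))⁻¹)
      (hTpow 720 360 1080 rfl (hTpow 360 360 720 rfl (hρT a) (hρT b)) (hTinv 360 (hρT _))) ?_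
    rw [Prod.fst_mul, Prod.fst_mul, Prod.fst_inv, hρ, hρ, hρ, Subgroup.coe_mul, mul_inv_cancel]
  have hsec : ∀ c ∈ A.image Prod.snd, ∃ a ∈ A, a.2 = c := fun c hc => by simpa using Finset.mem_image.1 hc
  choose! σ hσA hσ using hsec
  set g := Nat.gcd ((8 * h ^ 2) ^ 2) q
  -- The quotient of two elements of A with equal first coordinate modulo g differs from the nearly
  -- trivial lift ρ by a word over the identity. Deficient weights add up to 0.142 + 0.002, so the
  -- level exceeds d^(0.856/2), more than d^(0.35).
  have hclose : ∀ c ∈ A.image Prod.snd, ∀ b ∈ A.image Prod.snd,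
      reduction (Nat.gcd_dvd_right ((8 * h ^ 2) ^ 2) q) (σ c).1 = reduction (Nat.gcd_dvd_right ((8 * h ^ 2) ^ 2) q) (σ b).1 →
      (d : ℝ) ^ (35 / 100 : ℝ) ≤ lvl (c * b⁻¹) := by
    intro c hc b hb hcb
    set z := σ c * (σ b)⁻¹
    have hz : Wd 2 z := hTpow 1 1 2 rfl (hTmem _ (hσA c hc)) (hTinv 1 (hTmem _ (hσA b hb)))
    have hz2 : z.2 = c * b⁻¹ := by rw [Prod.snd_mul, Prod.snd_inv, hσ c hc, hσ b hb]
    have hz1 : z.1 ∈ congSub q ((8 * h ^ 2) ^ 2) := by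
      rw [congSub, MonoidHom.mem_ker, Prod.fst_mul, Prod.fst_inv, map_mul, map_inv, hcb, mul_inv_cancel]
    have hz1' : z.1 ∈ congSub q h := congSub_mono ⟨64 * h ^ 3, by ring⟩ hz1
    have h1 := hnear ⟨z.1, hz1'⟩ hz1
    have h2 := hlvl 362 (by norm_num) (by norm_num) (z * (ρ ⟨z.1, hz1'⟩)⁻¹) (hTpow 2 360 362 rfl hz (hTinv 360 (hρT _)))
      (by rw [Prod.fst_mul, Prod.fst_inv, hρ, mul_inv_cancel])
    have h3 := sum_wt_deficient_mul_le (z * (ρ ⟨z.1, hz1'⟩)⁻¹).2 (ρ ⟨z.1, hz1'⟩).2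
    rw [← Prod.snd_mul, inv_mul_cancel_right, hz2] at h3
    have h4 := le_log_of_deficient (NeZero.ne d) (lvl_dvd (c * b⁻¹))
    have hlp : (0 : ℝ) < lvl (c * b⁻¹) := by exact_mod_cast lvl_pos _
    rw [← Real.log_le_log_iff (by positivity) hlp, Real.log_rpow hx0]
    linarith
  have hgpos : NeZero g := ⟨(Nat.gcd_pos_of_pos_right _ (Nat.pos_of_ne_zero (NeZero.ne q))).ne'⟩
  have hcount : ((A.image Prod.snd).card : ℝ) ≤
      (2 * (d.divisors.card : ℝ) ^ 2 * (d : ℝ) ^ (3 - 3 * (35 / 100) : ℝ)) * ((64 * 60 ^ 4) ^ 3 * (f : ℝ) ^ 24) := by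
    set red : SL(2, ZMod d) → SL(2, ZMod g) := fun c => reduction (Nat.gcd_dvd_right ((8 * h ^ 2) ^ 2) q) (σ c).1
    have h1 : (A.image Prod.snd).card = ∑ w : SL(2, ZMod g), ((A.image Prod.snd).filter fun c => red c = w).card :=
      Finset.card_eq_sum_card_fiberwise fun _ _ => Finset.mem_coe.2 (Finset.mem_univ _)
    have h2 : ∀ w : SL(2, ZMod g), (((A.image Prod.snd).filter fun c => red c = w).card : ℝ) ≤
        2 * (d.divisors.card : ℝ) ^ 2 * (d : ℝ) ^ (3 - 3 * (35 / 100) : ℝ) := by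
      intro w
      rcases ((A.image Prod.snd).filter fun c => red c = w).eq_empty_or_nonempty with h0 | ⟨b, hb⟩
      · rw [h0, Finset.card_empty, Nat.cast_zero]; exact hP _
      · have hb' := Finset.mem_filter.1 hb
        rw [← Finset.card_image_of_injective _ (mul_left_injective b⁻¹)]
        refine card_le_of_lvl _ fun z hz => ?_
        obtain ⟨c, hc, rfl⟩ := Finset.mem_image.1 hz
        have hc' := Finset.mem_filter.1 hc
        exact hclose c hc'.1 b hb'.1 (hc'.2.trans hb'.2.symm)
    have h3 : Fintype.card SL(2, ZMod g) ≤ (64 * 60 ^ 4) ^ 3 * f ^ 24 := by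
      refine card_SL2_le.trans ((Nat.pow_le_pow_left (Nat.gcd_le_left _ (by positivity)) 3).trans (le_of_eq ?_))
      rw [hh]; ring
    rw [h1]
    push_cast
    refine (Finset.sum_le_sum fun w _ => h2 w).trans ?_
    rw [Finset.sum_const, Finset.card_univ, nsmul_eq_mul, mul_comm]
    refine mul_le_mul_of_nonneg_left ?_ (hP _)
    exact_mod_cast h3
  refine density_contradiction hx (Nat.cast_nonneg d.divisors.card) (Nat.cast_nonneg f)
    (c := (64 * 60 ^ 4) ^ 3) (by positivity) (hfC.trans (le_of_eq ?_)) hb₂ (hA2.trans (hQ _ _ hcount))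
  rw [inv_inv, ← Real.rpow_natCast, ← Real.rpow_mul hx0.le]
  norm_num

end LargeFiber

/-! ### Spread families over one point and their refinement in stages. -/

section Stages

theorem reduction_reduction {e d m : ℕ} (h₁ : e ∣ d) (h₂ : d ∣ m) (z : SL(2, ZMod m)) :
    reduction h₁ (reduction h₂ z) = reduction (h₁.trans h₂) z := by
  have h : (ZMod.castHom h₁ (ZMod e)).comp (ZMod.castHom h₂ (ZMod d)) = ZMod.castHom (h₁.trans h₂) (ZMod e) :=
    Subsingleton.elim _ _
  refine Matrix.SpecialLinearGroup.ext _ _ fun i j => ?_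
  exact RingHom.congr_fun h (z i j)

theorem Cong.reduction_iff {e d m : ℕ} [NeZero m] [NeZero d] (h₁ : e ∣ d) (h₂ : d ∣ m) (z w : SL(2, ZMod m)) :
    Cong e (reduction h₂ z) (reduction h₂ w) ↔ Cong e z w := by
  rw [← reduction_eq_iff h₁, reduction_reduction, reduction_reduction, reduction_eq_iff]

theorem Cong.mono {e d m : ℕ} (h : e ∣ d) {z w : SL(2, ZMod m)} (hc : Cong d z w) : Cong e z w :=
  fun i j => (Nat.cast_dvd_cast h).trans (hc i j)

theorem Cong.symm {e m : ℕ} {z w : SL(2, ZMod m)} (hc : Cong e z w) : Cong e w z :=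
  fun i j => by rw [← neg_sub]; exact (hc i j).neg_right

theorem Cong.trans {e m : ℕ} {z w x : SL(2, ZMod m)} (h₁ : Cong e z w) (h₂ : Cong e w x) : Cong e z x :=
  fun i j => by rw [← sub_add_sub_cancel _ (w i j)]; exact dvd_add (h₁ i j) (h₂ i j)

theorem Cong.refl {e m : ℕ} (z : SL(2, ZMod m)) : Cong e z z := fun i j => by rw [sub_self]; exact dvd_zero _

/-- `A ^ k` contains a family over a single point of the first factor which is constant modulo `d` and
otherwise equidistributed. -/
def HasSpread {q m : ℕ} (A : Finset (SL(2, ZMod q) × SL(2, ZMod m))) (k d : ℕ) (κ : ℝ) : Prop :=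
  ∃ (ι : Type) (_ : Fintype ι) (_ : Nonempty ι) (g : SL(2, ZMod q)) (f : ι → SL(2, ZMod m)),
    (∀ i, (g, f i) ∈ A ^ k) ∧ (∀ i j, Cong d (f i) (f j)) ∧
    ∀ e, e ∣ m → ∀ w, ((Finset.univ.filter fun i => Cong e (f i) w).card : ℝ) ≤
      Fintype.card ι * ((e / Nat.gcd e d : ℕ) : ℝ) ^ (-κ)

theorem hasSpread_zero {q m : ℕ} [NeZero m] (A : Finset (SL(2, ZMod q) × SL(2, ZMod m))) (κ : ℝ) :
    HasSpread A 0 m κ := by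
  refine ⟨Unit, inferInstance, inferInstance, 1, fun _ => 1, fun _ => ?_, fun _ _ => Cong.refl _, fun e he w => ?_⟩
  · rw [pow_zero]; exact Finset.mem_one.2 rfl
  · have he0 : 0 < e := Nat.pos_of_dvd_of_pos he (Nat.pos_of_ne_zero (NeZero.ne m))
    rw [Nat.gcd_eq_left he, Nat.div_self he0, Nat.cast_one, Real.one_rpow, mul_one]
    exact_mod_cast Finset.card_le_univ _

theorem HasSpread.pad {q m : ℕ} [NeZero m] {A : Finset (SL(2, ZMod q) × SL(2, ZMod m))} (hA : A.Nonempty) {k d : ℕ} {κ : ℝ}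
    (hd : d ∣ m) (h : HasSpread A k d κ) (n : ℕ) : HasSpread A (k + n) d κ := by
  obtain ⟨ι, _, hne, g, f, h1, h2, h3⟩ := h
  obtain ⟨x, hx⟩ := hA.pow (n := n)
  refine ⟨ι, inferInstance, hne, g * x.1, fun i => f i * x.2, fun i => ?_, fun i j => ?_, fun e he w => ?_⟩
  · rw [pow_add]; exact Finset.mul_mem_mul (h1 i) hx
  · have := h2 i j
    rw [← reduction_eq_iff hd] at this ⊢
    rw [map_mul, map_mul, this]
  · refine le_trans ?_ (h3 e he (w * x.2⁻¹))
    refine Nat.cast_le.2 (Finset.card_le_card fun i hi => ?_)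
    have := (Finset.mem_filter.1 hi).2
    refine Finset.mem_filter.2 ⟨Finset.mem_univ _, ?_⟩
    rw [← reduction_eq_iff he] at this ⊢
    rw [map_mul, ← this, map_mul, map_inv, mul_inv_cancel_right]

/-- Passing to a congruence class in which a set of matrices becomes equidistributed. -/
theorem exists_spread_class {d : ℕ} [NeZero d] (X : Finset SL(2, ZMod d)) (hX : X.Nonempty) (κ : ℝ) :
    ∃ (d' : ℕ) (J : Finset SL(2, ZMod d)), d' ∣ d ∧ J ⊆ X ∧ J.Nonempty ∧ (∀ x ∈ J, ∀ y ∈ J, Cong d' x y) ∧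
      (X.card : ℝ) ≤ J.card * (d' : ℝ) ^ κ ∧
      ∀ e, e ∣ d → ∀ w, ((J.filter fun y => Cong e y w).card : ℝ) ≤ J.card * ((e / Nat.gcd e d' : ℕ) : ℝ) ^ (-κ) := by
  have hd0 : d ≠ 0 := NeZero.ne d
  set cl : ℕ × SL(2, ZMod d) → Finset SL(2, ZMod d) := fun w => X.filter fun y => Cong w.1 y w.2
  -- As for residues, the class maximizing size times modulus^κ cannot concentrate further.
  obtain ⟨⟨d', c⟩, hfc, hmax⟩ := Finset.exists_max_image (d.divisors ×ˢ (Finset.univ : Finset SL(2, ZMod d)))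
    (fun w => ((cl w).card : ℝ) * (w.1 : ℝ) ^ κ)
    ⟨(1, 1), Finset.mem_product.2 ⟨Nat.one_mem_divisors.2 hd0, Finset.mem_univ _⟩⟩
  have hd' : d' ∣ d := (Nat.mem_divisors.1 (Finset.mem_product.1 hfc).1).1
  have hd'0 : 0 < d' := Nat.pos_of_dvd_of_pos hd' (Nat.pos_of_ne_zero hd0)
  have hd'0' : (0 : ℝ) < d' := by exact_mod_cast hd'0
  have hmax' : ∀ m, m ∣ d → ∀ c', ((cl (m, c')).card : ℝ) * (m : ℝ) ^ κ ≤ (cl (d', c)).card * (d' : ℝ) ^ κ :=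
    fun m hm c' => hmax (m, c') (Finset.mem_product.2 ⟨Nat.mem_divisors.2 ⟨hm, hd0⟩, Finset.mem_univ _⟩)
  have hbig : (X.card : ℝ) ≤ (cl (d', c)).card * (d' : ℝ) ^ κ := by
    have h1 := hmax' 1 (one_dvd _) 1
    have h2 : cl (1, 1) = X := by
      refine Finset.filter_true_of_mem fun y _ i j => ?_
      simp
    rw [h2] at h1
    simpa using h1
  have hcong : ∀ x ∈ cl (d', c), ∀ y ∈ cl (d', c), Cong d' x y := fun x hx y hy =>
    (Finset.mem_filter.1 hx).2.trans (Finset.mem_filter.1 hy).2.symm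
  refine ⟨d', cl (d', c), hd', Finset.filter_subset _ _, ?_, hcong, hbig, ?_⟩
  · rw [← Finset.card_pos]
    have h0 : (0 : ℝ) < X.card := by exact_mod_cast hX.card_pos
    have h1 := lt_of_lt_of_le h0 hbig
    by_contra hc
    have h2 : (cl (d', c)).card = 0 := by omega
    rw [h2] at h1
    simp at h1
  · intro e he w
    rcases ((cl (d', c)).filter fun y => Cong e y w).eq_empty_or_nonempty with h0 | ⟨y₀, hy₀⟩
    · rw [h0, Finset.card_empty, Nat.cast_zero]; positivity
    · have hy := Finset.mem_filter.1 hy₀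
      have he0 : 0 < e := Nat.pos_of_dvd_of_pos he (Nat.pos_of_ne_zero hd0)
      have h1 := hmax' (Nat.lcm e d') (Nat.lcm_dvd he hd') y₀
      have h2 : ((cl (d', c)).filter fun y => Cong e y w).card ≤ (cl (Nat.lcm e d', y₀)).card := by
        refine Finset.card_le_card fun y hyy => ?_
        have hy' := Finset.mem_filter.1 hyy
        refine Finset.mem_filter.2 ⟨(Finset.mem_filter.1 hy'.1).1, fun i j => ?_⟩
        exact lcm_dvd_of_dvd he hd' ((hy'.2.trans hy.2.symm) i j) (hcong y hy'.1 y₀ hy.1 i j)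
      have hl : Nat.lcm e d' = (e / Nat.gcd e d') * d' := by
        rw [Nat.lcm, Nat.div_mul_right_comm (Nat.gcd_dvd_left e d')]
      have hpos : 0 < e / Nat.gcd e d' := Nat.div_pos (Nat.gcd_le_left _ he0) (Nat.gcd_pos_of_pos_left _ he0)
      have hpos' : (0 : ℝ) < ((e / Nat.gcd e d' : ℕ) : ℝ) := by exact_mod_cast hpos
      rw [hl] at h1 h2
      push_cast at h1
      rw [Real.mul_rpow hpos'.le hd'0'.le, ← mul_assoc] at h1
      have h3 := le_of_mul_le_mul_right h1 (by positivity)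
      rw [Real.rpow_neg hpos'.le, ← div_eq_mul_inv, le_div_iff₀ (by positivity)]
      exact le_trans (mul_le_mul_of_nonneg_right (Nat.cast_le.2 h2) (by positivity)) h3

/-- A congruence class modulo y has at most (x/y)³ members, whereas the extremal one keeps more than
x^(1e-7) y^(-5e-8) of them, hence y³ ≤ x^(3 - 5e-8). -/
theorem modulus_drop {x y n : ℝ} (hx : 1 < x) (hy : 0 < y) (hyx : y ≤ x) (h1 : x ^ (1e-7 : ℝ) < n * y ^ (5e-8 : ℝ))
    (h2 : n * y ^ 3 ≤ x ^ 3) : y ≤ x ^ (1 - 1e-8 : ℝ) := by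
  have hx0 : 0 < x := by linarith
  have h3 : y ^ 3 ≤ x ^ (3 - 5e-8 : ℝ) := by
    have h4 : y ^ (5e-8 : ℝ) ≤ x ^ (5e-8 : ℝ) := Real.rpow_le_rpow hy.le hyx (by norm_num)
    have hn : 0 < n := by
      by_contra! hn
      have : 0 < x ^ (1e-7 : ℝ) := by positivity
      have h5 : n * y ^ (5e-8 : ℝ) ≤ 0 := mul_nonpos_of_nonpos_of_nonneg hn (by positivity)
      linarith
    have h5 : x ^ (1e-7 : ℝ) * y ^ 3 ≤ x ^ 3 * x ^ (5e-8 : ℝ) := by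
      calc x ^ (1e-7 : ℝ) * y ^ 3 ≤ n * y ^ (5e-8 : ℝ) * y ^ 3 := by gcongr
        _ = n * y ^ 3 * y ^ (5e-8 : ℝ) := by ring
        _ ≤ _ := by gcongr
    rw [← Real.rpow_natCast x 3, ← Real.rpow_add hx0] at h5
    have h6 : x ^ ((3 : ℕ) + 5e-8 : ℝ) = x ^ (1e-7 : ℝ) * x ^ (3 - 5e-8 : ℝ) := by
      rw [← Real.rpow_add hx0]; norm_num
    rw [h6] at h5
    exact le_of_mul_le_mul_left h5 (by positivity)
  have h7 : y = (y ^ 3) ^ (1 / 3 : ℝ) := by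
    rw [← Real.rpow_natCast, ← Real.rpow_mul hy.le]; norm_num
  rw [h7]
  calc (y ^ 3) ^ (1 / 3 : ℝ) ≤ (x ^ (3 - 5e-8 : ℝ)) ^ (1 / 3 : ℝ) := by gcongr
    _ = x ^ ((3 - 5e-8) * (1 / 3) : ℝ) := by rw [← Real.rpow_mul hx0.le]
    _ ≤ _ := Real.rpow_le_rpow_of_exponent_le hx.le (by norm_num)

theorem div_eq_div_mul_div {g c e : ℕ} (h₁ : g ∣ c) (h₂ : c ∣ e) (he : 0 < e) : e / g = (c / g) * (e / c) := by
  obtain ⟨a, rfl⟩ := h₁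
  obtain ⟨b, rfl⟩ := h₂
  have hga : 0 < g * a := Nat.pos_of_mul_pos_right he
  have hg : 0 < g := Nat.pos_of_mul_pos_right hga
  rw [Nat.mul_div_cancel_left _ hg, Nat.mul_div_cancel_left _ hga, mul_assoc, Nat.mul_div_cancel_left _ hg]

/-- The image of `A` after reducing the second factor. -/
def redSnd {q m d : ℕ} (hd : d ∣ m) : SL(2, ZMod q) × SL(2, ZMod m) →* SL(2, ZMod q) × SL(2, ZMod d) :=
  (MonoidHom.id _).prodMap (reduction hd)

-- The family is multiplied by lifts of an extremal class of the large fibre modulo d. For a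
-- condition modulo e, put c = gcd(e, d). The old family is constant modulo c, so the new factor is
-- constrained modulo c; once it is fixed, the old factor is constrained modulo e. The two savings
-- multiply to the required one since e/gcd(e, d') = (c/gcd(c, d'))·(e/c).
set_option maxHeartbeats 1000000 in
theorem HasSpread.step {q m d k : ℕ} [NeZero q] [NeZero m] {A : Finset (SL(2, ZMod q) × SL(2, ZMod m))}
    (hd : d ∣ m) (hd2 : 2 ≤ d)
    (hfib : ∃ g, (d : ℝ) ^ (1e-7 : ℝ) < (((A.image (redSnd hd)) ^ 3).filter fun x => x.1 = g).card)
    (h : HasSpread A k d 5e-8) : ∃ d', d' ∣ m ∧ (d' : ℝ) ≤ (d : ℝ) ^ (1 - 1e-8 : ℝ) ∧ HasSpread A (k + 3) d' 5e-8 := by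
  have : NeZero d := ⟨by omega⟩
  obtain ⟨ι, _, hne, g₀, f, h1, h2, h3⟩ := h
  obtain ⟨g, hg⟩ := hfib
  set X := (((A.image (redSnd hd)) ^ 3).filter fun x => x.1 = g).image Prod.snd
  have hXcard : X.card = (((A.image (redSnd hd)) ^ 3).filter fun x => x.1 = g).card := by
    refine Finset.card_image_of_injOn ?_
    intro x hx y hy hxy
    have hx' := (Finset.mem_filter.1 (Finset.mem_coe.1 hx)).2
    have hy' := (Finset.mem_filter.1 (Finset.mem_coe.1 hy)).2
    exact Prod.ext (hx'.trans hy'.symm) hxy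
  rw [← hXcard] at hg
  have hx1 : (1 : ℝ) < d := by exact_mod_cast hd2
  have hXne : X.Nonempty := by
    rw [← Finset.card_pos]
    have h0 : (0 : ℝ) < (d : ℝ) ^ (1e-7 : ℝ) := by positivity
    exact_mod_cast h0.trans hg
  obtain ⟨d', J, hd', hJX, hJne, hJc, hJb, hJs⟩ := exists_spread_class X hXne 5e-8
  have hd'0 : 0 < d' := Nat.pos_of_dvd_of_pos hd' (by omega)
  have hd'm := hd'.trans hd
  have hlift : ∀ y ∈ X, ∃ l, (g, l) ∈ A ^ 3 ∧ reduction hd l = y := by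
    intro y hy
    obtain ⟨x, hx, rfl⟩ := Finset.mem_image.1 hy
    have hx' := Finset.mem_filter.1 hx
    rw [← Finset.image_pow] at hx'
    obtain ⟨⟨a, b⟩, hab, rfl⟩ := Finset.mem_image.1 hx'.1
    refine ⟨b, ?_, rfl⟩
    have : a = g := hx'.2
    rwa [← this]
  choose! l hlA hlr using hlift
  have hdrop : (d' : ℝ) ≤ (d : ℝ) ^ (1 - 1e-8 : ℝ) := by
    refine modulus_drop hx1 (by exact_mod_cast hd'0) (by exact_mod_cast Nat.le_of_dvd (by omega) hd')
      (hg.trans_le hJb) ?_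
    obtain ⟨y₀, hy₀⟩ := hJne
    have h4 : J.card ≤ (d / d') ^ 3 := by
      refine (Finset.card_le_card fun y hy => ?_).trans (card_cong_le hd' y₀)
      exact Finset.mem_filter.2 ⟨Finset.mem_univ _, hJc y hy y₀ hy₀⟩
    have h5 : J.card * d' ^ 3 ≤ d ^ 3 := by
      calc J.card * d' ^ 3 ≤ (d / d') ^ 3 * d' ^ 3 := Nat.mul_le_mul_right _ h4
        _ = (d / d' * d') ^ 3 := by rw [mul_pow]
        _ = d ^ 3 := by rw [Nat.div_mul_cancel hd']
    exact_mod_cast h5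
  have hJne' : Nonempty J := hJne.to_subtype
  refine ⟨d', hd'm, hdrop, ι × J, inferInstance, inferInstance, g₀ * g, fun z => f z.1 * l z.2, fun z => ?_,
    fun z z' => ?_, fun e he w => ?_⟩
  · rw [pow_add]; exact Finset.mul_mem_mul (h1 z.1) (hlA _ (hJX z.2.2))
  · have e1 := Cong.mono hd' (h2 z.1 z'.1)
    have e2 := hJc _ z.2.2 _ z'.2.2
    rw [← hlr _ (hJX z.2.2), ← hlr _ (hJX z'.2.2), Cong.reduction_iff hd' hd] at e2
    rw [← reduction_eq_iff hd'm] at e1 e2 ⊢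
    rw [map_mul, map_mul, e1, e2]
  · obtain ⟨i₀⟩ := hne
    set c := Nat.gcd e d
    have hcd : c ∣ d := Nat.gcd_dvd_right e d
    have hce : c ∣ e := Nat.gcd_dvd_left e d
    have he0 : 0 < e := Nat.pos_of_dvd_of_pos he (Nat.pos_of_ne_zero (NeZero.ne m))
    set Jc := J.filter fun y => Cong c y (reduction hd ((f i₀)⁻¹ * w))
    have hJcs := hJs c hcd (reduction hd ((f i₀)⁻¹ * w))
    have hsum : (Finset.univ.filter fun z : ι × J => Cong e (f z.1 * l z.2) w).card ≤
        ∑ y ∈ Jc, (Finset.univ.filter fun i => Cong e (f i) (w * (l y)⁻¹)).card := by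
      rw [← Finset.card_sigma]
      refine Finset.card_le_card_of_injOn (fun z => ⟨z.2, z.1⟩) (fun z hz => ?_) ?_
      · have hz' := (Finset.mem_filter.1 (Finset.mem_coe.1 hz)).2
        refine Finset.mem_coe.2 (Finset.mem_sigma.2 ⟨Finset.mem_filter.2 ⟨z.2.2, ?_⟩,
          Finset.mem_filter.2 ⟨Finset.mem_univ _, ?_⟩⟩)
        · have e1 := Cong.mono hcd (h2 z.1 i₀)
          have e2 := Cong.mono hce hz'
          change Cong c (z.2 : SL(2, ZMod d)) _
          rw [← hlr _ (hJX z.2.2), Cong.reduction_iff hcd hd]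
          rw [← reduction_eq_iff (hcd.trans hd)] at e1 e2 ⊢
          rw [map_mul, ← e2, map_mul, map_inv, e1, inv_mul_cancel_left]
        · change Cong e (f z.1) (w * (l z.2)⁻¹)
          rw [← reduction_eq_iff he] at hz' ⊢
          rw [map_mul, ← hz', map_mul, map_inv, mul_inv_cancel_right]
      · rintro ⟨i, j⟩ _ ⟨i', j'⟩ _ hij
        simp only [Sigma.mk.injEq, heq_eq_eq] at hij
        exact Prod.ext hij.2 (Subtype.ext hij.1)
    have hgc : Nat.gcd c d' = Nat.gcd e d' := by
      rw [Nat.gcd_assoc, Nat.gcd_eq_right hd']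
    have hpc : 0 < c := Nat.pos_of_dvd_of_pos hce he0
    have hprod : e / Nat.gcd e d' = (c / Nat.gcd c d') * (e / c) := by
      rw [hgc]
      exact div_eq_div_mul_div (hgc ▸ Nat.gcd_dvd_left c d') hce he0
    refine (Nat.cast_le.2 hsum).trans ?_
    push_cast
    refine (Finset.sum_le_sum fun y _ => h3 e he _).trans ?_
    rw [Finset.sum_const, nsmul_eq_mul, Fintype.card_prod, Fintype.card_coe, hprod]
    push_cast
    rw [Real.mul_rpow (Nat.cast_nonneg _) (Nat.cast_nonneg _)]
    calc (Jc.card : ℝ) * (Fintype.card ι * ((e / c : ℕ) : ℝ) ^ (-5e-8 : ℝ))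
        ≤ (J.card * ((c / Nat.gcd c d' : ℕ) : ℝ) ^ (-5e-8 : ℝ)) * (Fintype.card ι * ((e / c : ℕ) : ℝ) ^ (-5e-8 : ℝ)) :=
          mul_le_mul_of_nonneg_right hJcs (by positivity)
      _ = _ := by ring

/-- Iterating the stages until the modulus drops below a power of `m`. -/
theorem exists_hasSpread : ∃ D : ℕ, 2 ≤ D ∧ ∀ (q m : ℕ) [NeZero q] [NeZero m], 2 ≤ m → Nat.Coprime q m →
    ∀ (A : Finset (SL(2, ZMod q) × SL(2, ZMod m))), A.Nonempty → ∀ s : ℝ,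
    (∀ d (hd : d ∣ m), (m : ℝ) ^ s ≤ d → D ≤ d ∧
      (Fintype.card SL(2, ZMod q) : ℝ) ≤ (d : ℝ) ^ (1e-7 : ℝ) * (A.image Prod.fst).card ∧
      (Nat.card SL(2, ZMod d) : ℝ) ≤ (d : ℝ) ^ (1e-7 : ℝ) * ((A.image Prod.snd).image (reduction hd)).card) →
    ∀ J : ℕ, (1 - 1e-8 : ℝ) ^ J < s → ∃ d, d ∣ m ∧ (d : ℝ) < (m : ℝ) ^ s ∧ HasSpread A (3 * J) d 5e-8 := by
  obtain ⟨D, hD⟩ := exists_large_fiber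
  refine ⟨max D 2, le_max_right _ _, ?_⟩
  intro q m _ _ hm hqm A hA s hdens J hJ
  have hm1 : (1 : ℝ) < m := by exact_mod_cast hm
  have key : ∀ J : ℕ, ∃ d, d ∣ m ∧ ((d : ℝ) < (m : ℝ) ^ s ∨ (d : ℝ) ≤ (m : ℝ) ^ ((1 - 1e-8 : ℝ) ^ J)) ∧
      HasSpread A (3 * J) d 5e-8 := by
    intro J
    induction J with
    | zero => exact ⟨m, dvd_rfl, Or.inr (by simp), hasSpread_zero A _⟩
    | succ J ih =>
      obtain ⟨d, hd, hsize, hspread⟩ := ih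
      rcases lt_or_ge (d : ℝ) ((m : ℝ) ^ s) with hlt | hge
      · exact ⟨d, hd, Or.inl hlt, hspread.pad hA hd 3⟩
      · obtain ⟨hDd, hd1, hd2⟩ := hdens d hd hge
        have hd2' : 2 ≤ d := le_of_max_le_right hDd
        have : NeZero d := ⟨by omega⟩
        obtain ⟨d', hd', hdrop, hspread'⟩ := hspread.step hd hd2'
          (hD q d (hqm.coprime_dvd_right hd) (le_of_max_le_left hDd) _ (by
            rw [Finset.image_image]; exact hd1) (by
            rw [Finset.image_image, ← Nat.card_eq_fintype_card]
            rw [Finset.image_image] at hd2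
            exact hd2))
        refine ⟨d', hd', Or.inr (hdrop.trans ?_), hspread'⟩
        rcases hsize with h | h
        · exact absurd h (not_lt.2 hge)
        · calc (d : ℝ) ^ (1 - 1e-8 : ℝ) ≤ ((m : ℝ) ^ ((1 - 1e-8 : ℝ) ^ J)) ^ (1 - 1e-8 : ℝ) :=
                Real.rpow_le_rpow (Nat.cast_nonneg _) h (by norm_num)
            _ = _ := by rw [← Real.rpow_mul (by linarith), pow_succ]
  obtain ⟨d, hd, hsize, hspread⟩ := key J
  refine ⟨d, hd, ?_, hspread⟩
  rcases hsize with h | h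
  · exact h
  · exact h.trans_lt (Real.rpow_lt_rpow_of_exponent_lt hm1 hJ)

end Stages

/-! ### Second moment count of alternating words. -/

section Collisions

theorem sum_ofFn_succ {α M : Type*} [Fintype α] [AddCommMonoid M] (r : ℕ) (F : List α → M) :
    ∑ p : Fin (r + 1) → α, F (List.ofFn p) = ∑ a, ∑ p : Fin r → α, F (a :: List.ofFn p) := by
  rw [← Fintype.sum_prod_type' (fun a (p : Fin r → α) => F (a :: List.ofFn p))]
  refine (Fintype.sum_equiv (Fin.consEquiv fun _ => α) _ _ fun z => ?_).symm
  rw [← List.ofFn_cons]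
  rfl

variable {G : Type*} [Group G] {ι : Type*} [Fintype ι]

/-- The number of ways of writing `x` as `f i₁ a₁ ⋯ f iᵣ aᵣ`. -/
noncomputable def wordCount (f : ι → G) : List G → G → ℝ
  | [], x => if x = 1 then 1 else 0
  | a :: l, x => ∑ i, wordCount f l ((f i * a)⁻¹ * x)

/-- The number of pairs of words with quotient `z`. -/
noncomputable def pairCount (f : ι → G) : List G → G → ℝ
  | [], z => if z = 1 then 1 else 0
  | a :: l, z => ∑ w : ι × ι, pairCount f l ((f w.1 * a)⁻¹ * z * (f w.2 * a))

theorem wordCount_nonneg (f : ι → G) (l : List G) (x : G) : 0 ≤ wordCount f l x := by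
  induction l generalizing x with
  | nil => rw [wordCount]; split_ifs <;> norm_num
  | cons a l ih => rw [wordCount]; exact Finset.sum_nonneg fun i _ => ih _

theorem mem_pow_of_wordCount_ne_zero {G₁ : Type*} [Group G₁] [DecidableEq G₁] [DecidableEq G] (A : Finset (G₁ × G))
    (k : ℕ) (g : G₁) (f : ι → G) (hf : ∀ i, (g, f i) ∈ A ^ k) (l : List (G₁ × G)) (hl : ∀ b ∈ l, b ∈ A) (x : G)
    (hx : wordCount f (l.map Prod.snd) x ≠ 0) :
    ((l.map fun b => g * b.1).prod, x) ∈ A ^ ((k + 1) * l.length) := by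
  induction l generalizing x with
  | nil =>
    simp only [List.map_nil, wordCount] at hx
    have : x = 1 := by by_contra h; simp [h] at hx
    subst this
    simp
  | cons b l ih =>
    simp only [List.map_cons, wordCount] at hx
    obtain ⟨i, -, hi⟩ := Finset.exists_ne_zero_of_sum_ne_zero hx
    have h1 := ih (fun b hb => hl b (List.mem_cons_of_mem _ hb)) _ hi
    rw [List.length_cons, List.map_cons, List.prod_cons, mul_add, mul_one, add_comm, pow_add]
    have h2 : (g * b.1, f i * b.2) ∈ A ^ (k + 1) := by
      rw [pow_succ]; exact Finset.mul_mem_mul (hf i) (hl b List.mem_cons_self)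
    have h3 := Finset.mul_mem_mul h2 h1
    rwa [Prod.mk_mul_mk, mul_inv_cancel_left] at h3

variable [Fintype G]

theorem sum_wordCount (f : ι → G) (l : List G) : ∑ x, wordCount f l x = (Fintype.card ι : ℝ) ^ l.length := by
  induction l with
  | nil => simp [wordCount]
  | cons a l ih =>
    simp only [wordCount]
    rw [Finset.sum_comm, List.length_cons, pow_succ']
    have h : ∀ i, ∑ x, wordCount f l ((f i * a)⁻¹ * x) = (Fintype.card ι : ℝ) ^ l.length := fun i =>
      (Equiv.sum_comp (Equiv.mulLeft (f i * a)⁻¹) (wordCount f l)).trans ih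
    rw [Finset.sum_congr rfl fun i _ => h i]
    simp

theorem pairCount_eq (f : ι → G) (l : List G) (z : G) :
    pairCount f l z = ∑ x, wordCount f l (z * x) * wordCount f l x := by
  induction l generalizing z with
  | nil => simp [pairCount, wordCount]
  | cons a l ih =>
    simp only [pairCount, wordCount, Finset.sum_mul_sum]
    rw [Finset.sum_comm, Fintype.sum_prod_type]
    refine Finset.sum_congr rfl fun i _ => ?_
    rw [Finset.sum_comm]
    refine Finset.sum_congr rfl fun j _ => ?_
    rw [ih, ← Equiv.sum_comp (Equiv.mulLeft (f j * a)⁻¹)]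
    refine Finset.sum_congr rfl fun x _ => ?_
    simp [mul_assoc]

/-- Cauchy–Schwarz: few collisions mean many distinct products. -/
theorem sq_card_le_support_mul_pairCount (f : ι → G) (l : List G) :
    ((Fintype.card ι : ℝ) ^ l.length) ^ 2 ≤
      ((Finset.univ.filter fun x => wordCount f l x ≠ 0).card : ℝ) * pairCount f l 1 := by
  rw [← sum_wordCount f l, pairCount_eq]
  simp only [one_mul]
  have h1 : ∑ x, wordCount f l x = ∑ x ∈ Finset.univ.filter (fun x => wordCount f l x ≠ 0), wordCount f l x :=
    (Finset.sum_filter_ne_zero _).symm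
  rw [h1]
  refine (sq_sum_le_card_mul_sum_sq).trans ?_
  refine mul_le_mul_of_nonneg_left ?_ (Nat.cast_nonneg _)
  simp only [pow_two]
  exact Finset.sum_le_sum_of_subset_of_nonneg (Finset.filter_subset _ _) fun x _ _ => mul_self_nonneg _

/-- The sum over all words of the conjugation probabilities. -/
noncomputable def conjSum (f : ι → G) (r : ℕ) (z : G) : ℝ :=
  ∑ L : Fin r → ι × ι, conjProb ((List.ofFn L).map fun w => f w.2 * (f w.1)⁻¹) z

theorem conjSum_succ (f : ι → G) (r : ℕ) (z : G) : conjSum f (r + 1) z =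
    ∑ w : ι × ι, (Fintype.card G : ℝ)⁻¹ * ∑ g, conjSum f r (z * (g * (f w.2 * (f w.1)⁻¹) * g⁻¹)) := by
  unfold conjSum
  rw [sum_ofFn_succ r fun L => conjProb (L.map fun w : ι × ι => f w.2 * (f w.1)⁻¹) z]
  refine Finset.sum_congr rfl fun w _ => ?_
  simp only [List.map_cons, conjProb]
  rw [Finset.sum_comm, Finset.mul_sum]

/-- The sum over all coefficient tuples of the pair counts. -/
noncomputable def pairSum (f : ι → G) (r : ℕ) (z : G) : ℝ := ∑ a : Fin r → G, pairCount f (List.ofFn a) z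

theorem pairSum_succ (f : ι → G) (r : ℕ) (z : G) : pairSum f (r + 1) z =
    ∑ w : ι × ι, ∑ b, pairSum f r (b⁻¹ * (z * (f w.2 * (f w.1)⁻¹)) * b) := by
  unfold pairSum
  rw [sum_ofFn_succ r fun l => pairCount f l z]
  simp only [pairCount]
  rw [Finset.sum_congr rfl fun a _ => Finset.sum_comm, Finset.sum_comm]
  refine Finset.sum_congr rfl fun w _ => ?_
  refine Eq.trans ?_ (Equiv.sum_comp (Equiv.mulLeft (f w.1)) _)
  refine Finset.sum_congr rfl fun a _ => Finset.sum_congr rfl fun p _ => ?_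
  simp [mul_assoc]

/-- Summing over all coefficients a makes the successive quotients f j · (f i)⁻¹ conjugated by
independent uniform elements. The outer sum over c supplies the conjugation of the first of them. -/
theorem sum_pairSum_conj (f : ι → G) (r : ℕ) (z : G) :
    ∑ c, pairSum f r (c⁻¹ * z * c) = (Fintype.card G : ℝ) ^ (r + 1) * conjSum f r z := by
  have hN : (Fintype.card G : ℝ) ≠ 0 := Nat.cast_ne_zero.2 Fintype.card_ne_zero
  induction r generalizing z with
  | zero =>
    have : ∀ c : G, c⁻¹ * z * c = 1 ↔ z = 1 := fun c => by
      rw [mul_eq_one_iff_eq_inv, inv_mul_eq_iff_eq_mul, mul_inv_cancel]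
    simp [pairSum, conjSum, pairCount, conjProb, this]
  | succ r ih =>
    simp only [pairSum_succ]
    rw [Finset.sum_comm, conjSum_succ, Finset.mul_sum]
    refine Finset.sum_congr rfl fun w _ => ?_
    have h1 : ∀ c : G, ∑ b, pairSum f r (b⁻¹ * (c⁻¹ * z * c * (f w.2 * (f w.1)⁻¹)) * b) =
        (Fintype.card G : ℝ) ^ (r + 1) * conjSum f r (z * (c * (f w.2 * (f w.1)⁻¹) * c⁻¹)) := by
      intro c
      rw [← ih, ← Equiv.sum_comp (Equiv.mulLeft c⁻¹)]
      refine Finset.sum_congr rfl fun b _ => ?_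
      simp [mul_assoc]
    rw [Finset.sum_congr rfl fun c _ => h1 c, ← Finset.mul_sum]
    field_simp
    ring

/-- The first pair of letters only displaces the point of evaluation and is bounded trivially, so r
+ 1 letters yield r random conjugations. -/
theorem pairSum_succ_le (f : ι → G) (r : ℕ) (Y : ℝ) (hY : ∀ y, (Fintype.card G : ℝ) * conjSum f r y ≤ Y) :
    pairSum f (r + 1) 1 ≤ (Fintype.card ι : ℝ) ^ 2 * ((Fintype.card G : ℝ) ^ r * Y) := by
  rw [pairSum_succ]
  calc _ ≤ ∑ _w : ι × ι, (Fintype.card G : ℝ) ^ r * Y := by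
        refine Finset.sum_le_sum fun w _ => ?_
        rw [sum_pairSum_conj, pow_succ, mul_assoc]
        exact mul_le_mul_of_nonneg_left (hY _) (by positivity)
    _ = _ := by rw [Finset.sum_const, Finset.card_univ, Fintype.card_prod, nsmul_eq_mul]; push_cast; ring

/-- Collision counts are nonnegative, so restricting the coefficients from G to B only costs a
factor |G|/|B| per letter, which is cheap for dense B. Some tuple in B is at most average. -/
theorem exists_many_words [Nonempty ι] (f : ι → G) (B : Finset G) (hB : B.Nonempty) (r : ℕ) (X : ℝ)
    (hX : ∀ y, (Fintype.card G : ℝ) * conjSum f r y ≤ (Fintype.card ι : ℝ) ^ (2 * r) * X) :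
    ∃ a : Fin (r + 1) → G, (∀ t, a t ∈ B) ∧ (B.card : ℝ) ^ (r + 1) ≤ (Fintype.card G : ℝ) ^ r * X *
      (Finset.univ.filter fun x => wordCount f (List.ofFn a) x ≠ 0).card := by
  have hι : (0 : ℝ) < Fintype.card ι := Nat.cast_pos.2 Fintype.card_pos
  set Bt := Fintype.piFinset fun _ : Fin (r + 1) => B
  have hBt : Bt.Nonempty := Fintype.piFinset_nonempty.2 fun _ => hB
  have hcard : (Bt.card : ℝ) = (B.card : ℝ) ^ (r + 1) := by
    rw [Fintype.card_piFinset_const]; push_cast; rfl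
  have hsum : ∑ a ∈ Bt, (B.card : ℝ) ^ (r + 1) * pairCount f (List.ofFn a) 1 ≤
      ∑ _a ∈ Bt, (Fintype.card ι : ℝ) ^ 2 * ((Fintype.card G : ℝ) ^ r * ((Fintype.card ι : ℝ) ^ (2 * r) * X)) := by
    rw [← Finset.mul_sum, Finset.sum_const, nsmul_eq_mul, hcard]
    refine mul_le_mul_of_nonneg_left (le_trans ?_ (pairSum_succ_le f r _ hX)) (by positivity)
    refine Finset.sum_le_sum_of_subset_of_nonneg (Finset.subset_univ _) fun a _ _ => ?_
    rw [pairCount_eq]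
    exact Finset.sum_nonneg fun x _ => mul_nonneg (wordCount_nonneg _ _ _) (wordCount_nonneg _ _ _)
  obtain ⟨a, ha, hle⟩ := Finset.exists_le_of_sum_le hBt hsum
  refine ⟨a, fun t => Fintype.mem_piFinset.1 ha t, ?_⟩
  have h1 := sq_card_le_support_mul_pairCount f (List.ofFn a)
  rw [List.length_ofFn] at h1
  set S := ((Finset.univ.filter fun x => wordCount f (List.ofFn a) x ≠ 0).card : ℝ)
  have hS : 0 ≤ S := Nat.cast_nonneg _
  have hpos : (0 : ℝ) < ((Fintype.card ι : ℝ) ^ (r + 1)) ^ 2 := by positivity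
  refine le_of_mul_le_mul_left ?_ hpos
  calc ((Fintype.card ι : ℝ) ^ (r + 1)) ^ 2 * (B.card : ℝ) ^ (r + 1)
      ≤ (S * pairCount f (List.ofFn a) 1) * (B.card : ℝ) ^ (r + 1) := by gcongr
    _ = S * ((B.card : ℝ) ^ (r + 1) * pairCount f (List.ofFn a) 1) := by ring
    _ ≤ S * ((Fintype.card ι : ℝ) ^ 2 * ((Fintype.card G : ℝ) ^ r * ((Fintype.card ι : ℝ) ^ (2 * r) * X))) := by gcongr
    _ = _ := by ring

/-- Expansion of a family over a point by multiplication with a dense set. -/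
theorem card_pow_ge_of_family {G₁ : Type*} [Group G₁] [DecidableEq G₁] [DecidableEq G] [Nonempty ι] (A : Finset (G₁ × G))
    (hA : A.Nonempty) (k : ℕ) (g : G₁) (f : ι → G) (hf : ∀ i, (g, f i) ∈ A ^ k) (r : ℕ) (X : ℝ) (hX0 : 0 ≤ X)
    (hX : ∀ y, (Fintype.card G : ℝ) * conjSum f r y ≤ (Fintype.card ι : ℝ) ^ (2 * r) * X) :
    ((A.image Prod.fst).card : ℝ) * ((A.image Prod.snd).card : ℝ) ^ (r + 1) ≤
      (Fintype.card G : ℝ) ^ r * X * (A ^ ((k + 1) * (r + 1) + 1)).card := by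
  obtain ⟨a, haB, ha⟩ := exists_many_words f (A.image Prod.snd) (hA.image _) r X hX
  have hsec : ∀ c ∈ A.image Prod.snd, ∃ a ∈ A, a.2 = c := fun c hc => by simpa using Finset.mem_image.1 hc
  choose! σ hσA hσ using hsec
  set l := (List.ofFn a).map σ
  have hl : ∀ b ∈ l, b ∈ A := by
    intro b hb
    obtain ⟨c, hc, rfl⟩ := List.mem_map.1 hb
    obtain ⟨t, rfl⟩ := (List.mem_ofFn' a c).1 hc
    exact hσA _ (haB t)
  have hl2 : l.map Prod.snd = List.ofFn a := by
    rw [List.map_map]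
    conv_rhs => rw [← List.map_id (List.ofFn a)]
    refine List.map_congr_left fun c hc => ?_
    obtain ⟨t, rfl⟩ := (List.mem_ofFn' a c).1 hc
    exact hσ _ (haB t)
  have hlen : l.length = r + 1 := by simp [l]
  set Sx := Finset.univ.filter fun x => wordCount f (List.ofFn a) x ≠ 0
  have hSx : Sx.card ≤ ((A ^ ((k + 1) * (r + 1))).filter fun x => x.1 = (l.map fun b => g * b.1).prod).card := by
    refine Finset.card_le_card_of_injOn (fun x => ((l.map fun b => g * b.1).prod, x)) (fun x hx => ?_)
      fun x _ y _ h => (Prod.mk.inj h).2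
    have hx' := (Finset.mem_filter.1 (Finset.mem_coe.1 hx)).2
    refine Finset.mem_coe.2 (Finset.mem_filter.2 ⟨?_, rfl⟩)
    rw [← hlen]
    exact mem_pow_of_wordCount_ne_zero A k g f hf l hl x (by rwa [hl2])
  have h2 := card_image_fst_mul_card_fiber_le A A subset_rfl ((k + 1) * (r + 1)) ((l.map fun b => g * b.1).prod)
  have h3 : ((A.image Prod.fst).card : ℝ) * Sx.card ≤ (A ^ ((k + 1) * (r + 1) + 1)).card := by
    exact_mod_cast (Nat.mul_le_mul_left _ hSx).trans h2
  calc ((A.image Prod.fst).card : ℝ) * ((A.image Prod.snd).card : ℝ) ^ (r + 1)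
      ≤ (A.image Prod.fst).card * ((Fintype.card G : ℝ) ^ r * X * Sx.card) := by gcongr
    _ = (Fintype.card G : ℝ) ^ r * X * ((A.image Prod.fst).card * Sx.card) := by ring
    _ ≤ _ := by gcongr

end Collisions

/-! ### Collision bound for spread families. -/

section SpreadCollisions

theorem card_center_le {v : ℕ} [NeZero v] :
    (Finset.univ.filter fun c : SL(2, ZMod v) => c ∈ Subgroup.center SL(2, ZMod v)).card ≤ 2 * v.divisors.card := by
  refine le_trans ?_ (card_sq_eq_one_le (d := v))
  refine Finset.card_le_card_of_injOn (fun c => c 0 0) (fun c hc => ?_) ?_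
  · have hc' := (Finset.mem_filter.1 (Finset.mem_coe.1 hc)).2
    have h1 := (mem_center_iff_scalarMod c).1 hc'
    have hd := SL2_det_eq_one c
    refine Finset.mem_coe.2 (Finset.mem_filter.2 ⟨Finset.mem_univ _, ?_⟩)
    change c 0 0 ^ 2 = 1
    rw [h1.1, ← h1.2.2] at hd
    linear_combination hd
  · intro a ha b hb hab
    have h1 := (mem_center_iff_scalarMod a).1 (Finset.mem_filter.1 (Finset.mem_coe.1 ha)).2
    have h2 := (mem_center_iff_scalarMod b).1 (Finset.mem_filter.1 (Finset.mem_coe.1 hb)).2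
    refine SL2_ext hab (by rw [h1.1, h2.1]) (by rw [h1.2.1, h2.2.1]) (by rw [← h1.2.2, ← h2.2.2]; exact hab)

/-- For fixed i, the member f j must agree modulo v with one of the at most 2τ(v) central multiples
of f i. -/
theorem card_level_pairs_le {m v : ℕ} [NeZero m] (hv : v ∣ m) {ι : Type*} [Fintype ι] (f : ι → SL(2, ZMod m)) (K : ℝ)
    (hK : 0 ≤ K) (h : ∀ w, ((Finset.univ.filter fun i => Cong v (f i) w).card : ℝ) ≤ K) :
    ((Finset.univ.filter fun w : ι × ι => v ∣ lvl (f w.2 * (f w.1)⁻¹)).card : ℝ) ≤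
      Fintype.card ι * (2 * v.divisors.card * K) := by
  have : NeZero v := ⟨fun h0 => NeZero.ne m (by subst h0; exact zero_dvd_iff.1 hv)⟩
  have hone : ∀ i, ((Finset.univ.filter fun j => v ∣ lvl (f j * (f i)⁻¹)).card : ℝ) ≤ 2 * v.divisors.card * K := by
    intro i
    set Z := Finset.univ.filter fun c : SL(2, ZMod v) => c ∈ Subgroup.center SL(2, ZMod v)
    have h1 : (Finset.univ.filter fun j => v ∣ lvl (f j * (f i)⁻¹)).card =
        ∑ c ∈ Z, ((Finset.univ.filter fun j => v ∣ lvl (f j * (f i)⁻¹)).filter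
          fun j => reduction hv (f j * (f i)⁻¹) = c).card := by
      refine Finset.card_eq_sum_card_fiberwise fun j hj => ?_
      have hj' := (Finset.mem_filter.1 (Finset.mem_coe.1 hj)).2
      exact Finset.mem_coe.2 (Finset.mem_filter.2 ⟨Finset.mem_univ _, (reduction_mem_center_iff hv _).2 hj'⟩)
    have h2 : ∀ c ∈ Z, (((Finset.univ.filter fun j => v ∣ lvl (f j * (f i)⁻¹)).filter
          fun j => reduction hv (f j * (f i)⁻¹) = c).card : ℝ) ≤ K := by
      intro c _
      rcases ((Finset.univ.filter fun j => v ∣ lvl (f j * (f i)⁻¹)).filter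
          fun j => reduction hv (f j * (f i)⁻¹) = c).eq_empty_or_nonempty with h0 | ⟨j₀, hj₀⟩
      · rw [h0, Finset.card_empty, Nat.cast_zero]; exact hK
      · refine le_trans (Nat.cast_le.2 (Finset.card_le_card fun j hj => ?_)) (h (f j₀))
        have e1 := (Finset.mem_filter.1 hj₀).2
        have e2 := (Finset.mem_filter.1 hj).2
        refine Finset.mem_filter.2 ⟨Finset.mem_univ _, ?_⟩
        rw [← reduction_eq_iff hv]
        rw [← e1, map_mul, map_mul, mul_left_inj] at e2
        exact e2
    rw [h1]
    push_cast
    refine (Finset.sum_le_sum h2).trans ?_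
    rw [Finset.sum_const, nsmul_eq_mul]
    refine mul_le_mul_of_nonneg_right ?_ hK
    exact_mod_cast card_center_le
  have hsum : (Finset.univ.filter fun w : ι × ι => v ∣ lvl (f w.2 * (f w.1)⁻¹)).card =
      ∑ i, (Finset.univ.filter fun j => v ∣ lvl (f j * (f i)⁻¹)).card := by
    simp only [Finset.card_filter]
    rw [Fintype.sum_prod_type]
  rw [hsum]
  push_cast
  refine (Finset.sum_le_sum fun i _ => hone i).trans ?_
  rw [Finset.sum_const, Finset.card_univ, nsmul_eq_mul]

/-- Either v ≤ l^(1/4) and the spectral factor is small, or v is larger, v/gcd(v, d) ≥ l^(1/4)/d,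
and the spread of the family makes such levels rare. -/
theorem muBound_mul_spread_le {l v d : ℕ} (hl : 0 < l) (hv : v ∣ l) (hd : 0 < d) :
    muBound l v * ((v / Nat.gcd v d : ℕ) : ℝ) ^ (-5e-8 : ℝ) ≤
      (8 ^ l.primeFactors.card * (l.divisors.card : ℝ) ^ 6) * ((d : ℝ) ^ (5e-8 : ℝ) * (l : ℝ) ^ (-1.25e-8 : ℝ)) := by
  have hl1 : (1 : ℝ) ≤ l := by exact_mod_cast hl
  have hl0 : (0 : ℝ) < l := by linarith
  have hd1 : (1 : ℝ) ≤ d := by exact_mod_cast hd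
  have hv0 : 0 < v := Nat.pos_of_dvd_of_pos hv hl
  have hτ : (1 : ℝ) ≤ l.divisors.card := by
    exact_mod_cast Finset.card_pos.2 ⟨1, Nat.one_mem_divisors.2 hl.ne'⟩
  set B : ℝ := 8 ^ l.primeFactors.card * (l.divisors.card : ℝ) ^ 6
  have hB : 1 ≤ B := one_le_mul_of_one_le_of_one_le (one_le_pow₀ (by norm_num)) (one_le_pow₀ hτ)
  have hquot : 1 ≤ ((v / Nat.gcd v d : ℕ) : ℝ) := by
    exact_mod_cast Nat.div_pos (Nat.gcd_le_left _ hv0) (Nat.gcd_pos_of_pos_left _ hv0)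
  have hdκ : 1 ≤ (d : ℝ) ^ (5e-8 : ℝ) := Real.one_le_rpow hd1 (by norm_num)
  rcases le_or_gt (v : ℝ) ((l : ℝ) ^ (1 / 4 : ℝ)) with h | h
  · have h1 : muBound l v ≤ B * (l : ℝ) ^ (-(1 / 4) : ℝ) := by
      refine (min_le_right _ _).trans (Real.sqrt_le_iff.2 ⟨by positivity, ?_⟩)
      have h2 : (v : ℝ) ^ 2 ≤ (l : ℝ) ^ (1 / 2 : ℝ) := by
        calc (v : ℝ) ^ 2 ≤ ((l : ℝ) ^ (1 / 4 : ℝ)) ^ 2 := by gcongr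
          _ = _ := by rw [← Real.rpow_natCast, ← Real.rpow_mul hl0.le]; norm_num
      have h3 : (l : ℝ) ^ (1 / 2 : ℝ) / l = ((l : ℝ) ^ (-(1 / 4) : ℝ)) ^ 2 := by
        rw [← Real.rpow_natCast, ← Real.rpow_mul hl0.le]
        nth_rewrite 2 [← Real.rpow_one (l : ℝ)]
        rw [← Real.rpow_sub hl0]
        norm_num
      calc B * (v : ℝ) ^ 2 / l ≤ B * (l : ℝ) ^ (1 / 2 : ℝ) / l := by gcongr
        _ = B * ((l : ℝ) ^ (-(1 / 4) : ℝ)) ^ 2 := by rw [mul_div_assoc, h3]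
        _ ≤ B ^ 2 * ((l : ℝ) ^ (-(1 / 4) : ℝ)) ^ 2 := by
          gcongr
          nlinarith
        _ = _ := (mul_pow _ _ _).symm
    have h4 : ((v / Nat.gcd v d : ℕ) : ℝ) ^ (-5e-8 : ℝ) ≤ 1 :=
      Real.rpow_le_one_of_one_le_of_nonpos hquot (by norm_num)
    have h5 : (l : ℝ) ^ (-(1 / 4) : ℝ) ≤ (l : ℝ) ^ (-1.25e-8 : ℝ) :=
      Real.rpow_le_rpow_of_exponent_le hl1 (by norm_num)
    calc _ ≤ (B * (l : ℝ) ^ (-(1 / 4) : ℝ)) * 1 := mul_le_mul h1 h4 (by positivity) (by positivity)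
      _ = B * (1 * (l : ℝ) ^ (-(1 / 4) : ℝ)) := by ring
      _ ≤ _ := by gcongr
  · have h1 : (l : ℝ) ^ (1 / 4 : ℝ) / d ≤ ((v / Nat.gcd v d : ℕ) : ℝ) := by
      have hg : 0 < Nat.gcd v d := Nat.gcd_pos_of_pos_left _ hv0
      rw [Nat.cast_div (Nat.gcd_dvd_left v d) (by positivity)]
      have : (Nat.gcd v d : ℝ) ≤ d := by exact_mod_cast Nat.gcd_le_right _ hd
      gcongr
    have h2 : ((v / Nat.gcd v d : ℕ) : ℝ) ^ (-5e-8 : ℝ) ≤ (d : ℝ) ^ (5e-8 : ℝ) * (l : ℝ) ^ (-1.25e-8 : ℝ) := by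
      calc _ ≤ ((l : ℝ) ^ (1 / 4 : ℝ) / d) ^ (-5e-8 : ℝ) :=
            Real.rpow_le_rpow_of_nonpos (by positivity) h1 (by norm_num)
        _ = _ := by
            rw [Real.div_rpow (by positivity) (by positivity), ← Real.rpow_mul hl0.le, div_eq_mul_inv,
              ← Real.rpow_neg (by positivity), mul_comm]
            norm_num
    calc _ ≤ 1 * ((d : ℝ) ^ (5e-8 : ℝ) * (l : ℝ) ^ (-1.25e-8 : ℝ)) :=
          mul_le_mul (muBound_le_one _ _) h2 (by positivity) zero_le_one
      _ ≤ _ := by gcongr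

/-- The possible common levels v with l are summed over. The divisor-type factors eat half of the
exponent 1.25e-8, leaving 0.625e-8. -/
theorem sum_muBound_le : ∃ C : ℝ, 1 ≤ C ∧ ∀ (m d : ℕ) [NeZero m] (_ : 0 < d) {ι : Type} [Fintype ι]
    (f : ι → SL(2, ZMod m)),
    (∀ e, e ∣ m → ∀ w, ((Finset.univ.filter fun i => Cong e (f i) w).card : ℝ) ≤
      Fintype.card ι * ((e / Nat.gcd e d : ℕ) : ℝ) ^ (-5e-8 : ℝ)) → ∀ l, l ∣ m →
    ∑ w : ι × ι, muBound l (Nat.gcd (lvl (f w.2 * (f w.1)⁻¹)) l) ≤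
      (Fintype.card ι : ℝ) ^ 2 * min 1 (C * ((d : ℝ) ^ (5e-8 : ℝ) * (l : ℝ) ^ (-0.625e-8 : ℝ))) := by
  obtain ⟨C, hC, hτ⟩ := exists_card_divisors_le 8 8 0.625e-8 (by norm_num) (by norm_num)
  refine ⟨2 * C, by linarith, ?_⟩
  intro m d _ hd ι _ f hf l hl
  have hl0 : 0 < l := Nat.pos_of_dvd_of_pos hl (Nat.pos_of_ne_zero (NeZero.ne m))
  have hl0' : (0 : ℝ) < l := by exact_mod_cast hl0
  rw [mul_min_of_nonneg _ _ (by positivity)]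
  refine le_min ?_ ?_
  · refine (Finset.sum_le_sum fun w _ => muBound_le_one _ _).trans (le_of_eq ?_)
    rw [Finset.sum_const, Finset.card_univ, Fintype.card_prod, nsmul_eq_mul]; push_cast; ring
  · have h1 : ∑ w : ι × ι, muBound l (Nat.gcd (lvl (f w.2 * (f w.1)⁻¹)) l) ≤
        ∑ v ∈ l.divisors, muBound l v * ((Finset.univ.filter fun w : ι × ι => v ∣ lvl (f w.2 * (f w.1)⁻¹)).card : ℝ) := by
      have h2 : ∀ v, muBound l v * ((Finset.univ.filter fun w : ι × ι => v ∣ lvl (f w.2 * (f w.1)⁻¹)).card : ℝ) =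
          ∑ w : ι × ι, if v ∣ lvl (f w.2 * (f w.1)⁻¹) then muBound l v else 0 := by
        intro v
        rw [← Finset.sum_filter, Finset.sum_const, nsmul_eq_mul, mul_comm]
      simp_rw [h2]
      rw [Finset.sum_comm]
      refine Finset.sum_le_sum fun w _ => ?_
      have h3 := Finset.single_le_sum
        (f := fun v => if v ∣ lvl (f w.2 * (f w.1)⁻¹) then muBound l v else 0)
        (fun v _ => by split_ifs; exacts [muBound_nonneg _ _, le_rfl])
        (Nat.mem_divisors.2 ⟨Nat.gcd_dvd_right (lvl (f w.2 * (f w.1)⁻¹)) l, hl0.ne'⟩)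
      simp only [Nat.gcd_dvd_left, if_true] at h3
      exact h3
    refine h1.trans ?_
    set N : ℝ := ((Fintype.card ι : ℕ) : ℝ)
    set τ : ℝ := ((l.divisors.card : ℕ) : ℝ)
    set D : ℝ := (d : ℝ) ^ (5e-8 : ℝ)
    have hD : 0 ≤ D := by positivity
    have h4 : ∀ v ∈ l.divisors, muBound l v * ((Finset.univ.filter fun w : ι × ι => v ∣ lvl (f w.2 * (f w.1)⁻¹)).card : ℝ) ≤
        N ^ 2 * (2 * τ * ((8 ^ l.primeFactors.card * τ ^ 6) * (D * (l : ℝ) ^ (-1.25e-8 : ℝ)))) := by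
      intro v hv
      have hvl := (Nat.mem_divisors.1 hv).1
      have h5 := card_level_pairs_le (hvl.trans hl) f _ (by positivity) (hf v (hvl.trans hl))
      have h6 := muBound_mul_spread_le hl0 hvl hd
      have h7 : (v.divisors.card : ℝ) ≤ τ :=
        Nat.cast_le.2 (Finset.card_le_card (Nat.divisors_subset_of_dvd hl0.ne' hvl))
      have hmu := muBound_nonneg l v
      have hp : 0 ≤ ((v / Nat.gcd v d : ℕ) : ℝ) ^ (-5e-8 : ℝ) := by positivity
      calc _ ≤ muBound l v * (N * (2 * v.divisors.card * (N * ((v / Nat.gcd v d : ℕ) : ℝ) ^ (-5e-8 : ℝ)))) :=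
            mul_le_mul_of_nonneg_left h5 hmu
        _ = N ^ 2 * (2 * v.divisors.card * (muBound l v * ((v / Nat.gcd v d : ℕ) : ℝ) ^ (-5e-8 : ℝ))) := by ring
        _ ≤ _ := by gcongr
    refine (Finset.sum_le_sum h4).trans ?_
    rw [Finset.sum_const, nsmul_eq_mul]
    have h8 := hτ l hl0.ne'
    have h9 : (l : ℝ) ^ (0.625e-8 : ℝ) * (l : ℝ) ^ (-1.25e-8 : ℝ) = (l : ℝ) ^ (-0.625e-8 : ℝ) := by
      rw [← Real.rpow_add hl0']; norm_num
    calc τ * (N ^ 2 * (2 * τ * ((8 ^ l.primeFactors.card * τ ^ 6) * (D * (l : ℝ) ^ (-1.25e-8 : ℝ)))))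
        = N ^ 2 * (2 * (8 ^ l.primeFactors.card * τ ^ 8) * (D * (l : ℝ) ^ (-1.25e-8 : ℝ))) := by ring
      _ ≤ N ^ 2 * (2 * (C * (l : ℝ) ^ (0.625e-8 : ℝ)) * (D * (l : ℝ) ^ (-1.25e-8 : ℝ))) := by gcongr
      _ = N ^ 2 * (2 * C * (D * ((l : ℝ) ^ (0.625e-8 : ℝ) * (l : ℝ) ^ (-1.25e-8 : ℝ)))) := by ring
      _ = _ := by rw [h9]

/-- Collision bound for words in a spread family. -/
theorem conjSum_le_of_spread : ∃ C : ℝ, 1 ≤ C ∧ ∀ (m d : ℕ) [NeZero m] (_ : 0 < d) {ι : Type} [Fintype ι]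
    (f : ι → SL(2, ZMod m)),
    (∀ e, e ∣ m → ∀ w, ((Finset.univ.filter fun i => Cong e (f i) w).card : ℝ) ≤
      Fintype.card ι * ((e / Nat.gcd e d : ℕ) : ℝ) ^ (-5e-8 : ℝ)) → ∀ (r : ℕ) (y : SL(2, ZMod m)),
    (Fintype.card SL(2, ZMod m) : ℝ) * conjSum f r y ≤ (Fintype.card ι : ℝ) ^ (2 * r) *
      ∑ l ∈ m.divisors, (l : ℝ) ^ 3 * (min 1 (C * ((d : ℝ) ^ (5e-8 : ℝ) * (l : ℝ) ^ (-0.625e-8 : ℝ)))) ^ r := by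
  obtain ⟨C, hC, H⟩ := sum_muBound_le
  refine ⟨C, hC, ?_⟩
  intro m d _ hd ι _ f hf r y
  have h1 : (Fintype.card SL(2, ZMod m) : ℝ) * conjSum f r y ≤ ∑ l ∈ m.divisors,
      (l : ℝ) ^ 3 * (∑ w : ι × ι, muBound l (Nat.gcd (lvl (f w.2 * (f w.1)⁻¹)) l)) ^ r := by
    rw [conjSum, Finset.mul_sum]
    calc _ ≤ ∑ L : Fin r → ι × ι, ∑ l ∈ m.divisors,
          (l : ℝ) ^ 3 * ∏ t, muBound l (Nat.gcd (lvl (f (L t).2 * (f (L t).1)⁻¹)) l) := by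
          refine Finset.sum_le_sum fun L _ => (card_mul_conjProb_le m _ y).trans (le_of_eq ?_)
          refine Finset.sum_congr rfl fun l _ => ?_
          rw [List.map_map, List.map_ofFn, List.prod_ofFn]
          rfl
      _ = _ := by
          rw [Finset.sum_comm]
          refine Finset.sum_congr rfl fun l _ => ?_
          rw [← Finset.mul_sum, Fintype.sum_pow]
  refine h1.trans ?_
  rw [Finset.mul_sum]
  refine Finset.sum_le_sum fun l hl => ?_
  have h2 := H m d hd f hf l (Nat.mem_divisors.1 hl).1
  calc _ ≤ (l : ℝ) ^ 3 * ((Fintype.card ι : ℝ) ^ 2 *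
        min 1 (C * ((d : ℝ) ^ (5e-8 : ℝ) * (l : ℝ) ^ (-0.625e-8 : ℝ)))) ^ r := by
        refine mul_le_mul_of_nonneg_left (pow_le_pow_left₀ (Finset.sum_nonneg fun w _ => muBound_nonneg _ _) h2 r)
          (by positivity)
    _ = _ := by rw [mul_pow, ← pow_mul]; ring

end SpreadCollisions

/-! ### Summing the collision bound over divisors. -/

section CollisionSum

theorem sum_inv_sq_le (n : ℕ) : ∑ i ∈ Finset.Icc 2 n, ((i : ℝ) ^ 2)⁻¹ ≤ 1 := by
  have h : ∀ n : ℕ, ∑ i ∈ Finset.Icc 2 (n + 1), ((i : ℝ) ^ 2)⁻¹ ≤ 1 - ((n : ℝ) + 1)⁻¹ := by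
    intro n
    induction n with
    | zero => simp
    | succ n ih =>
      rw [Finset.sum_Icc_succ_top (by omega)]
      have h1 : (((n + 1 + 1 : ℕ) : ℝ) ^ 2)⁻¹ ≤ ((n : ℝ) + 1)⁻¹ - ((n : ℝ) + 1 + 1)⁻¹ := by
        push_cast
        rw [inv_sub_inv (by positivity) (by positivity), inv_eq_one_div]
        rw [div_le_div_iff₀ (by positivity) (by positivity)]
        nlinarith
      push_cast at h1 ⊢
      linarith
  rcases n with _ | n
  · simp
  · refine (h n).trans ?_
    have : (0 : ℝ) ≤ ((n : ℝ) + 1)⁻¹ := by positivity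
    linarith

theorem sum_divisors_inv_sq_le {m : ℕ} (hm : 0 < m) (F : ℕ → ℝ) (c : ℝ) (hc : 0 ≤ c) (h1 : F 1 ≤ 1)
    (h : ∀ l, l ∣ m → 2 ≤ l → F l ≤ c * ((l : ℝ) ^ 2)⁻¹) : ∑ l ∈ m.divisors, F l ≤ 1 + c := by
  rw [← Finset.add_sum_erase _ _ (Nat.one_mem_divisors.2 hm.ne')]
  refine add_le_add h1 ?_
  calc ∑ l ∈ m.divisors.erase 1, F l ≤ ∑ l ∈ m.divisors.erase 1, c * ((l : ℝ) ^ 2)⁻¹ := by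
        refine Finset.sum_le_sum fun l hl => ?_
        have hl' := Finset.mem_erase.1 hl
        have hlm := (Nat.mem_divisors.1 hl'.2).1
        have : 0 < l := Nat.pos_of_dvd_of_pos hlm hm
        exact h l hlm (by have := hl'.1; omega)
    _ ≤ ∑ l ∈ Finset.Icc 2 m, c * ((l : ℝ) ^ 2)⁻¹ := by
        refine Finset.sum_le_sum_of_subset_of_nonneg (fun l hl => ?_) fun l _ _ => by positivity
        have hl' := Finset.mem_erase.1 hl
        have hlm := (Nat.mem_divisors.1 hl'.2).1
        have : 0 < l := Nat.pos_of_dvd_of_pos hlm hm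
        exact Finset.mem_Icc.2 ⟨by have := hl'.1; omega, Nat.le_of_dvd hm hlm⟩
    _ ≤ c * 1 := by
        rw [← Finset.mul_sum]; exact mul_le_mul_of_nonneg_left (sum_inv_sq_le m) hc
    _ = c := mul_one c

/-- A large modulus contributes little to the collision sum. -/
theorem collision_term_le {l E u : ℝ} (hl : 2 ≤ l) (hE : 0 ≤ E) (h : E ≤ l ^ (0.3125e-8 : ℝ)) {r : ℕ} (hu : 0 ≤ u)
    (hr : 3.2e8 * (5 + u) ≤ (r : ℝ)) :
    l ^ 3 * (min 1 (E * l ^ (-0.625e-8 : ℝ))) ^ r ≤ 2 ^ (-u) * (l ^ 2)⁻¹ := by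
  have hl0 : 0 < l := by linarith
  have h1 : min 1 (E * l ^ (-0.625e-8 : ℝ)) ≤ l ^ (-0.3125e-8 : ℝ) := by
    refine (min_le_right _ _).trans ?_
    calc E * l ^ (-0.625e-8 : ℝ) ≤ l ^ (0.3125e-8 : ℝ) * l ^ (-0.625e-8 : ℝ) := by gcongr
      _ = _ := by rw [← Real.rpow_add hl0]; norm_num
  have h0 : 0 ≤ min 1 (E * l ^ (-0.625e-8 : ℝ)) := le_min zero_le_one (by positivity)
  calc l ^ 3 * (min 1 (E * l ^ (-0.625e-8 : ℝ))) ^ r ≤ l ^ 3 * (l ^ (-0.3125e-8 : ℝ)) ^ r := by gcongr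
    _ = l ^ (3 + -0.3125e-8 * (r : ℝ)) := by
        rw [← Real.rpow_natCast (l ^ _) r, ← Real.rpow_mul hl0.le, ← Real.rpow_natCast l 3, ← Real.rpow_add hl0]
        norm_num
    -- Since 0.3125e-8 · 3.2e8 = 1, the r factors save at least l^(5 + u) against the weight l³.
    _ ≤ l ^ (-u + -2) := Real.rpow_le_rpow_of_exponent_le (by linarith) (by linarith)
    _ = l ^ (-u) * (l ^ 2)⁻¹ := by
        rw [Real.rpow_add hl0, Real.rpow_neg hl0.le 2, ← Real.rpow_natCast l 2]; norm_num
    _ ≤ 2 ^ (-u) * (l ^ 2)⁻¹ := by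
        have := Real.rpow_le_rpow_of_nonpos (by norm_num) hl (by linarith : -u ≤ 0)
        gcongr

/-- Divisors l too small to benefit from the saving satisfy l⁵ ≤ E^(1.6e9), where 1.6e9 =
5/0.3125e-8, and are estimated trivially. The power d^80 comes from 5e-8 · 1.6e9. -/
theorem collision_sum_le_of_large {m d : ℕ} (hm : 0 < m) (hd : 0 < d) {C : ℝ} (hC : 1 ≤ C) {r : ℕ}
    (hr : 3.2e8 * 5 ≤ (r : ℝ)) :
    ∑ l ∈ m.divisors, (l : ℝ) ^ 3 * (min 1 (C * ((d : ℝ) ^ (5e-8 : ℝ) * (l : ℝ) ^ (-0.625e-8 : ℝ)))) ^ r ≤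
      2 * (C ^ (1.6e9 : ℝ) * (d : ℝ) ^ (80 : ℝ)) := by
  have hd1 : (1 : ℝ) ≤ d := by exact_mod_cast hd
  set E := C * (d : ℝ) ^ (5e-8 : ℝ)
  have hE : 1 ≤ E := one_le_mul_of_one_le_of_one_le hC (Real.one_le_rpow hd1 (by norm_num))
  have hE5 : E ^ (1.6e9 : ℝ) = C ^ (1.6e9 : ℝ) * (d : ℝ) ^ (80 : ℝ) := by
    rw [Real.mul_rpow (by linarith) (by positivity), ← Real.rpow_mul (by positivity)]; norm_num
  have hE51 : 1 ≤ E ^ (1.6e9 : ℝ) := Real.one_le_rpow hE (by norm_num)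
  rw [← hE5]
  refine (sum_divisors_inv_sq_le hm _ (E ^ (1.6e9 : ℝ)) (by positivity) ?_ fun l _ hl => ?_).trans (by linarith)
  · rw [Nat.cast_one, one_pow, one_mul]
    exact pow_le_one₀ (le_min zero_le_one (by positivity)) (min_le_left _ _)
  · have hl2 : (2 : ℝ) ≤ l := by exact_mod_cast hl
    have hl0 : (0 : ℝ) < l := by linarith
    rw [← mul_assoc C]
    rcases le_or_gt E ((l : ℝ) ^ (0.3125e-8 : ℝ)) with h | h
    · refine (collision_term_le hl2 (by linarith) h (u := 0) le_rfl (by linarith)).trans ?_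
      rw [neg_zero, Real.rpow_zero]
      gcongr
    · have h1 : (l : ℝ) ^ 5 ≤ E ^ (1.6e9 : ℝ) := by
        calc (l : ℝ) ^ 5 = ((l : ℝ) ^ (0.3125e-8 : ℝ)) ^ (1.6e9 : ℝ) := by
              rw [← Real.rpow_mul hl0.le, ← Real.rpow_natCast]; norm_num
          _ ≤ _ := Real.rpow_le_rpow (by positivity) h.le (by norm_num)
      calc _ ≤ (l : ℝ) ^ 3 * 1 := by
            refine mul_le_mul_of_nonneg_left ?_ (by positivity)
            exact pow_le_one₀ (le_min zero_le_one (by positivity)) (min_le_left _ _)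
        _ = (l : ℝ) ^ 5 * ((l : ℝ) ^ 2)⁻¹ := by field_simp
        _ ≤ _ := by gcongr

/-- Without small divisors every l > 1 benefits from the saving, and the sum is 1 up to the
adjustable error 2^(-u), with no constant factor lost. -/
theorem collision_sum_le_of_rough {m D : ℕ} (hm : 0 < m) {C : ℝ} (hC : 1 ≤ C) (hD : C ≤ (D : ℝ) ^ (0.3125e-8 : ℝ))
    (hrough : ∀ l, l ∣ m → 2 ≤ l → D ≤ l) {u : ℝ} (hu : 0 ≤ u) {r : ℕ} (hr : 3.2e8 * (5 + u) ≤ (r : ℝ)) :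
    ∑ l ∈ m.divisors, (l : ℝ) ^ 3 * (min 1 (C * (((1 : ℕ) : ℝ) ^ (5e-8 : ℝ) * (l : ℝ) ^ (-0.625e-8 : ℝ)))) ^ r ≤
      1 + 2 ^ (-u) := by
  rw [Nat.cast_one, Real.one_rpow]
  refine sum_divisors_inv_sq_le hm _ _ (by positivity) ?_ fun l hlm hl => ?_
  · rw [Nat.cast_one, one_pow, one_mul]
    exact pow_le_one₀ (le_min zero_le_one (by positivity)) (min_le_left _ _)
  · rw [one_mul]
    refine collision_term_le (by exact_mod_cast hl) (by linarith) (hD.trans ?_) hu hr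
    exact Real.rpow_le_rpow (Nat.cast_nonneg _) (by exact_mod_cast hrough l hlm hl) (by norm_num)

theorem expansion_lower_bound {Q M F S G X N θ s : ℝ} {r : ℕ} (hQ : 1 ≤ Q) (hM : 1 ≤ M) (hF : Q ^ (3 - θ) < F)
    (hS : M ^ (3 - θ) < S) (hG0 : 0 ≤ G) (hG : G ≤ M ^ 3) (hX0 : 0 ≤ X) (hX : X ≤ M ^ (81 * s)) (hN : 0 ≤ N)
    (h : F * S ^ (r + 1) ≤ G ^ r * X * N) (hθ : θ ≤ 1e10 * s) (hr : (r + 1) * θ + 81 * s ≤ 1e10 * s) :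
    (Q * M) ^ (3 - 1e10 * s) < N := by
  have hQ0 : 0 < Q := by linarith
  have hM0 : 0 < M := by linarith
  set e := 3 - ((r + 1) * θ + 81 * s)
  have h1 : M ^ ((3 - θ) * (r + 1)) = M ^ ((3 : ℝ) * r) * M ^ (81 * s) * M ^ e := by
    rw [← Real.rpow_add hM0, ← Real.rpow_add hM0]; congr 1; simp only [e]; ring
  have h2 : Q ^ (3 - θ) * M ^ ((3 - θ) * (r + 1)) < M ^ ((3 : ℝ) * r) * M ^ (81 * s) * N := by
    calc Q ^ (3 - θ) * M ^ ((3 - θ) * (r + 1)) = Q ^ (3 - θ) * (M ^ (3 - θ)) ^ (r + 1) := by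
          rw [Real.rpow_mul hM0.le, ← Real.rpow_natCast (M ^ (3 - θ))]; push_cast; rfl
      _ < F * S ^ (r + 1) := by
          have : (M ^ (3 - θ)) ^ (r + 1) < S ^ (r + 1) := pow_lt_pow_left₀ hS (by positivity) (by omega)
          have hF0 : 0 < F := lt_of_le_of_lt (by positivity) hF
          calc Q ^ (3 - θ) * (M ^ (3 - θ)) ^ (r + 1) ≤ F * (M ^ (3 - θ)) ^ (r + 1) := by gcongr
            _ < _ := by gcongr
      _ ≤ G ^ r * X * N := h
      _ ≤ (M ^ 3) ^ r * M ^ (81 * s) * N := by gcongr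
      _ = _ := by
          rw [← Real.rpow_natCast (M ^ 3) r, ← Real.rpow_natCast M 3, ← Real.rpow_mul hM0.le]; push_cast; rfl
  rw [h1] at h2
  have hpos : 0 < M ^ ((3 : ℝ) * r) * M ^ (81 * s) := by positivity
  have h3 : Q ^ (3 - θ) * M ^ e < N := by
    refine lt_of_mul_lt_mul_left ?_ hpos.le
    linarith
  refine lt_of_le_of_lt ?_ h3
  rw [Real.mul_rpow hQ0.le hM0.le]
  exact mul_le_mul (Real.rpow_le_rpow_of_exponent_le hQ (by linarith))
    (Real.rpow_le_rpow_of_exponent_le hM (by simp only [e]; linarith)) (by positivity) (by positivity)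

end CollisionSum

/-! ### Choice of the numbers of stages and letters. -/

section Parameters

/-- Both J and r are constant multiples of log(1/s²), so the total word length is quadratic in it.
The density loss r s² remains O(s) because s·log(1/s²) ≤ 2. -/
theorem expansion_parameters {s : ℝ} (hs : 0 < s) (hs1 : s < 1e-7) : ∃ J r : ℕ, (1 - 1e-8 : ℝ) ^ J < s ∧
    3.2e8 * (5 + 2 * Real.log (1 / s ^ 2)) ≤ (r : ℝ) ∧ (r + 1) * s ^ 2 + 81 * s ≤ 1e10 * s ∧
    (((3 * J + 1) * (r + 1) + 1 : ℕ) : ℝ) ≤ 1e19 * (Real.log (1 / s ^ 2)) ^ 2 := by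
  set L := Real.log (1 / s ^ 2) with hL
  have hexp : Real.exp (-L) = s ^ 2 := by
    rw [hL, ← Real.log_inv, Real.exp_log (by positivity)]; simp
  have hL1 : 1 ≤ L := by
    by_contra! h
    have h1 : Real.exp (-1) < s ^ 2 := by rw [← hexp]; exact Real.exp_lt_exp.2 (by linarith)
    have h2 := Real.add_one_le_exp (-(1 / 2) : ℝ)
    have h3 : Real.exp (-1) = Real.exp (-(1 / 2)) * Real.exp (-(1 / 2)) := by rw [← Real.exp_add]; norm_num
    nlinarith
  have hLs : L * s ≤ 2 := by
    have h1 : L = 2 * Real.log (1 / s) := by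
      rw [hL, ← one_div_pow, Real.log_pow]; norm_num
    have h2 := Real.log_le_sub_one_of_pos (show 0 < 1 / s by positivity)
    calc L * s ≤ 2 * (1 / s) * s := by
          refine mul_le_mul_of_nonneg_right ?_ hs.le
          linarith
      _ = 2 := by field_simp
  refine ⟨⌈1e8 * L⌉₊, ⌈3.2e8 * (5 + 2 * L)⌉₊, ?_, Nat.le_ceil _, ?_, ?_⟩
  · have hJ := Nat.le_ceil (1e8 * L)
    set J := ⌈1e8 * L⌉₊
    calc (1 - 1e-8 : ℝ) ^ J ≤ (Real.exp (-1e-8)) ^ J := by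
          refine pow_le_pow_left₀ (by norm_num) ?_ J
          have := Real.add_one_le_exp (-1e-8 : ℝ)
          linarith
      _ = Real.exp (J * (-1e-8)) := (Real.exp_nat_mul _ _).symm
      _ ≤ Real.exp (-L) := Real.exp_le_exp.2 (by linarith)
      _ = s ^ 2 := hexp
      _ < s := by nlinarith
  · have hr := (Nat.ceil_lt_add_one (show 0 ≤ 3.2e8 * (5 + 2 * L) by positivity)).le
    have h1 : ((⌈3.2e8 * (5 + 2 * L)⌉₊ : ℝ) + 1) ≤ 2.3e9 * L := by linarith
    have h2 : ((⌈3.2e8 * (5 + 2 * L)⌉₊ : ℝ) + 1) * s ^ 2 ≤ 2.3e9 * L * s ^ 2 := by gcongr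
    have h3 : L * s * s ≤ 2 * s := by gcongr
    nlinarith
  · have hr := (Nat.ceil_lt_add_one (show 0 ≤ 3.2e8 * (5 + 2 * L) by positivity)).le
    have hJ := (Nat.ceil_lt_add_one (show 0 ≤ 1e8 * L by positivity)).le
    push_cast
    have h1 : ((⌈3.2e8 * (5 + 2 * L)⌉₊ : ℝ) + 1) ≤ 2.3e9 * L := by linarith
    have h2 : (3 * (⌈1e8 * L⌉₊ : ℝ) + 1) ≤ 3.1e8 * L := by linarith
    have h3 : (3 * (⌈1e8 * L⌉₊ : ℝ) + 1) * ((⌈3.2e8 * (5 + 2 * L)⌉₊ : ℝ) + 1) ≤ (3.1e8 * L) * (2.3e9 * L) := by gcongr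
    nlinarith

end Parameters

/-! ### Consequences of high density. -/

section Density

variable {m : ℕ} [NeZero m]

theorem card_le_card_image_reduction_mul {d : ℕ} (hd : d ∣ m) (S : Finset SL(2, ZMod m)) :
    S.card ≤ (S.image (reduction hd)).card * (m / d) ^ 3 := by
  rw [mul_comm]
  refine Finset.card_le_mul_card_image _ _ fun b hb => ?_
  obtain ⟨w, -, rfl⟩ := Finset.mem_image.1 hb
  refine (Finset.card_le_card fun z hz => ?_).trans (card_cong_le hd w)
  simpa [reduction_eq_iff] using (Finset.mem_filter.1 hz).2

/-- A set which nearly fills `SL₂(ℤ/m)` forces all the prime factors of `m` to be large. -/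
theorem le_of_dvd_of_dense {D : ℕ} (hD : 0 < D) (S : Finset SL(2, ZMod m)) {θ : ℝ} (hS : (m : ℝ) ^ (3 - θ) < S.card)
    (hθ : (m : ℝ) ^ θ ≤ 1 + ((D : ℝ) ^ 2)⁻¹) {l : ℕ} (hl : l ∣ m) (hl2 : 2 ≤ l) : D ≤ l := by
  have hp : l.minFac.Prime := Nat.minFac_prime (by omega)
  refine le_trans ?_ (Nat.minFac_le (by omega))
  set p := l.minFac
  by_contra! hpD
  have hpm : p ∣ m := (Nat.minFac_dvd l).trans hl
  have : NeZero p := ⟨hp.ne_zero⟩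
  have hm0 : (0 : ℝ) < m := by exact_mod_cast Nat.pos_of_ne_zero (NeZero.ne m)
  have hp0 : (0 : ℝ) < p := by exact_mod_cast hp.pos
  have hD0 : (0 : ℝ) < D := by exact_mod_cast hD
  -- A prime p ∣ m with p < D already costs the proportion p⁻² > D⁻² of m³, while the hypotheses
  -- allow a loss of a factor 1 + D⁻² only.
  have h1 : (S.card : ℝ) ≤ (m : ℝ) ^ 3 * (1 - ((p : ℝ) ^ 2)⁻¹) := by
    have h2 : S.card ≤ (p ^ 2 - 1) * p * (m / p) ^ 3 :=
      (card_le_card_image_reduction_mul hpm S).trans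
        (Nat.mul_le_mul_right _ ((Finset.card_le_univ _).trans (card_SL2_prime hp)))
    have h3 : (S.card : ℝ) ≤ (((p ^ 2 - 1) * p * (m / p) ^ 3 : ℕ) : ℝ) := by exact_mod_cast h2
    refine h3.trans (le_of_eq ?_)
    have h4 : 1 ≤ p ^ 2 := Nat.one_le_pow _ _ hp.pos
    push_cast [Nat.cast_sub h4, Nat.cast_div hpm hp0.ne']
    field_simp
  have h5 : ((D : ℝ) ^ 2)⁻¹ ≤ ((p : ℝ) ^ 2)⁻¹ := by
    have : (p : ℝ) ≤ D := by exact_mod_cast hpD.le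
    gcongr
  have h6 : (m : ℝ) ^ 3 = (m : ℝ) ^ (3 - θ) * (m : ℝ) ^ θ := by
    rw [← Real.rpow_add hm0, ← Real.rpow_natCast]; congr 1; norm_num
  have hE : 0 < ((D : ℝ) ^ 2)⁻¹ := by positivity
  have h7 : (m : ℝ) ^ 3 < (m : ℝ) ^ 3 * (1 - ((D : ℝ) ^ 2)⁻¹) * (1 + ((D : ℝ) ^ 2)⁻¹) := by
    calc (m : ℝ) ^ 3 = (m : ℝ) ^ (3 - θ) * (m : ℝ) ^ θ := h6
      _ < (m : ℝ) ^ 3 * (1 - ((p : ℝ) ^ 2)⁻¹) * (m : ℝ) ^ θ := by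
          have := hS.trans_le h1
          gcongr
      _ ≤ (m : ℝ) ^ 3 * (1 - ((D : ℝ) ^ 2)⁻¹) * (1 + ((D : ℝ) ^ 2)⁻¹) := by
          refine mul_le_mul ?_ hθ (by positivity) ?_
          · gcongr
          · have : ((D : ℝ) ^ 2)⁻¹ ≤ 1 := inv_le_one_of_one_le₀ (one_le_pow₀ (by exact_mod_cast hD))
            have : 0 ≤ 1 - ((D : ℝ) ^ 2)⁻¹ := by linarith
            positivity
  have h8 : 0 < (m : ℝ) ^ 3 := by positivity
  nlinarith [mul_pos h8 (mul_pos hE hE)]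

theorem card_le_of_dense {d : ℕ} (hd : d ∣ m) (S : Finset SL(2, ZMod m)) {θ s : ℝ} (hS : (m : ℝ) ^ (3 - θ) < S.card)
    (hθ : θ ≤ 1e-7 * s) (hds : (m : ℝ) ^ s ≤ d) :
    (Nat.card SL(2, ZMod d) : ℝ) ≤ (d : ℝ) ^ (1e-7 : ℝ) * (S.image (reduction hd)).card := by
  have hmn : 0 < m := Nat.pos_of_ne_zero (NeZero.ne m)
  have hdn : 0 < d := Nat.pos_of_dvd_of_pos hd hmn
  have : NeZero d := ⟨hdn.ne'⟩
  have hm0 : (0 : ℝ) < m := by exact_mod_cast hmn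
  have hm1 : (1 : ℝ) ≤ m := by exact_mod_cast hmn
  have hd0 : (0 : ℝ) < d := by exact_mod_cast hdn
  have h1 : (S.card : ℝ) ≤ (S.image (reduction hd)).card * ((m : ℝ) / d) ^ 3 := by
    rw [← Nat.cast_div hd hd0.ne']
    exact_mod_cast card_le_card_image_reduction_mul hd S
  have h2 : (Nat.card SL(2, ZMod d) : ℝ) ≤ (d : ℝ) ^ 3 := by
    rw [Nat.card_eq_fintype_card]; exact_mod_cast card_SL2_le
  have h3 : (m : ℝ) ^ θ ≤ (d : ℝ) ^ (1e-7 : ℝ) := by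
    calc (m : ℝ) ^ θ ≤ (m : ℝ) ^ (s * 1e-7) := Real.rpow_le_rpow_of_exponent_le hm1 (by linarith)
      _ = ((m : ℝ) ^ s) ^ (1e-7 : ℝ) := Real.rpow_mul hm0.le _ _
      _ ≤ _ := Real.rpow_le_rpow (by positivity) hds (by norm_num)
  have h6 : (m : ℝ) ^ 3 = (m : ℝ) ^ (3 - θ) * (m : ℝ) ^ θ := by
    rw [← Real.rpow_add hm0, ← Real.rpow_natCast]; congr 1; norm_num
  set I := ((S.image (reduction hd)).card : ℝ)
  have h7 : (m : ℝ) ^ 3 ≤ I * ((m : ℝ) / d) ^ 3 * (d : ℝ) ^ (1e-7 : ℝ) := by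
    rw [h6]
    exact mul_le_mul (hS.le.trans h1) h3 (by positivity) (by positivity)
  refine h2.trans ?_
  have h8 : (d : ℝ) ^ 3 * ((m : ℝ) / d) ^ 3 = (m : ℝ) ^ 3 := by rw [← mul_pow]; field_simp
  refine le_of_mul_le_mul_right ?_ (show 0 < ((m : ℝ) / d) ^ 3 by positivity)
  rw [h8]
  linarith

end Density

/-! ### Expansion in a product of two coprime factors. -/

theorem card_le_of_dense_of_le {q : ℕ} [NeZero q] {m d n θ s : ℝ} (hm : 1 ≤ m) (hs : 0 ≤ s) (hn : (q : ℝ) ^ (3 - θ) < n)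
    (hθ : θ = s ^ 2) (hqm : (q : ℝ) ^ (1e7 * s) ≤ m) (hds : m ^ s ≤ d) :
    (Fintype.card SL(2, ZMod q) : ℝ) ≤ d ^ (1e-7 : ℝ) * n := by
  have hq0 : (0 : ℝ) < q := by exact_mod_cast Nat.pos_of_ne_zero (NeZero.ne q)
  have h2 : (Fintype.card SL(2, ZMod q) : ℝ) ≤ (q : ℝ) ^ 3 := by exact_mod_cast card_SL2_le
  have h3 : (q : ℝ) ^ θ ≤ d ^ (1e-7 : ℝ) := by
    calc (q : ℝ) ^ θ = ((q : ℝ) ^ (1e7 * s)) ^ (s * 1e-7) := by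
          rw [← Real.rpow_mul hq0.le, hθ]; congr 1; ring
      _ ≤ m ^ (s * 1e-7) := Real.rpow_le_rpow (by positivity) hqm (by positivity)
      _ = (m ^ s) ^ (1e-7 : ℝ) := Real.rpow_mul (by linarith) _ _
      _ ≤ _ := Real.rpow_le_rpow (by positivity) hds (by norm_num)
  have h6 : (q : ℝ) ^ 3 = (q : ℝ) ^ θ * (q : ℝ) ^ (3 - θ) := by
    rw [← Real.rpow_add hq0, ← Real.rpow_natCast]; congr 1; norm_num
  refine h2.trans ?_
  rw [h6]
  have : 0 ≤ (q : ℝ) ^ θ := by positivity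
  exact mul_le_mul h3 hn.le (by positivity) (by linarith)

theorem one_add_two_rpow_le {m s : ℝ} (hm : 2 ≤ m) (hs : 0 < s) (hs1 : s < 1e-7) :
    1 + (2 : ℝ) ^ (-(2 * Real.log (1 / s ^ 2))) ≤ m ^ (81 * s) := by
  have h1 : Real.log 2 ≥ 1 / 2 := by have := Real.log_two_gt_d9; linarith
  have h0 : 0 ≤ Real.log (1 / s ^ 2) := Real.log_nonneg (by rw [le_div_iff₀ (by positivity)]; nlinarith)
  have h2 : (2 : ℝ) ^ (-(2 * Real.log (1 / s ^ 2))) ≤ s ^ 2 := by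
    rw [Real.rpow_def_of_pos (by norm_num)]
    calc _ ≤ Real.exp (-Real.log (1 / s ^ 2)) := Real.exp_le_exp.2 (by nlinarith)
      _ = s ^ 2 := by rw [← Real.log_inv, Real.exp_log (by positivity)]; simp
  have h3 : (2 : ℝ) ^ (81 * s) ≤ m ^ (81 * s) := Real.rpow_le_rpow (by norm_num) hm (by positivity)
  have h4 : 1 + Real.log 2 * (81 * s) ≤ (2 : ℝ) ^ (81 * s) := by
    rw [Real.rpow_def_of_pos (by norm_num), add_comm]
    exact Real.add_one_le_exp _
  nlinarith

/-- Assembles stages and collisions. The condition q^(1e7 s) ≤ m makes density exponent s² in the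
first factor admissible at every stage d ≥ m^s, because q^(s²) ≤ d^(1e-7). -/
theorem exists_expansion : ∃ s₀ : ℝ, 0 < s₀ ∧ ∀ s : ℝ, 0 < s → s < s₀ → ∃ k : ℕ, 0 < k ∧
    (k : ℝ) ≤ 1e19 * (Real.log (1 / s ^ 2)) ^ 2 ∧ ∀ (q m : ℕ) [NeZero q] [NeZero m], 2 ≤ m → Nat.Coprime q m →
    (q : ℝ) ^ (1e7 * s) ≤ m → ∀ A : Finset (SL(2, ZMod q) × SL(2, ZMod m)),
    (q : ℝ) ^ (3 - s ^ 2) < (A.image Prod.fst).card → (m : ℝ) ^ (3 - s ^ 2) < (A.image Prod.snd).card →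
    ((q : ℝ) * m) ^ (3 - 1e10 * s) < (A ^ k).card := by
  obtain ⟨D₁, hD₁, hspread⟩ := exists_hasSpread
  obtain ⟨C, hC, hconj⟩ := conjSum_le_of_spread
  obtain ⟨D, hDD₁, hDC⟩ : ∃ D : ℕ, D₁ ≤ D ∧ 2 * C ^ (1.6e9 : ℝ) ≤ D :=
    ⟨max D₁ ⌈2 * C ^ (1.6e9 : ℝ)⌉₊, le_max_left _ _, (Nat.le_ceil _).trans (by exact_mod_cast le_max_right _ _)⟩
  have hD2 : (2 : ℝ) ≤ D := by exact_mod_cast hD₁.trans hDD₁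
  have hlogD : 0 < Real.log D := Real.log_pos (by linarith)
  have hDinv : 0 < ((D : ℝ) ^ 2)⁻¹ := by positivity
  have hDC' : C ≤ (D : ℝ) ^ (0.3125e-8 : ℝ) := by
    have h1 : C ^ (3.2e8 : ℝ) ≤ D := by
      have h2 : C ^ (3.2e8 : ℝ) ≤ C ^ (1.6e9 : ℝ) := Real.rpow_le_rpow_of_exponent_le hC (by norm_num)
      have h3 : 0 ≤ C ^ (1.6e9 : ℝ) := by positivity
      linarith
    calc C = (C ^ (3.2e8 : ℝ)) ^ (0.3125e-8 : ℝ) := by rw [← Real.rpow_mul (by linarith)]; norm_num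
      _ ≤ _ := Real.rpow_le_rpow (by positivity) h1 (by norm_num)
  -- The threshold gives D^s ≤ 1 + D⁻². Hence if m^s < D, the loss m^(s²) is below 1 + D⁻² and m has
  -- no divisor between 2 and D - 1.
  refine ⟨min 1e-7 (Real.log (1 + ((D : ℝ) ^ 2)⁻¹) / Real.log D),
    lt_min (by norm_num) (div_pos (Real.log_pos (by linarith)) hlogD), fun s hs hs' => ?_⟩
  have hs7 := hs'.trans_le (min_le_left _ _)
  have hsD : (D : ℝ) ^ s ≤ 1 + ((D : ℝ) ^ 2)⁻¹ := by
    have h1 := ((lt_div_iff₀ hlogD).1 (hs'.trans_le (min_le_right _ _))).le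
    rw [Real.rpow_def_of_pos (by linarith), mul_comm]
    exact (Real.exp_le_exp.2 h1).trans (le_of_eq (Real.exp_log (by linarith)))
  obtain ⟨J, r, hJ, hr, hrs, hk⟩ := expansion_parameters hs hs7
  refine ⟨(3 * J + 1) * (r + 1) + 1, Nat.succ_pos _, hk, ?_⟩
  clear hk
  intro q m _ _ hm hqm hqs A hfst hsnd
  have hL0 : 0 ≤ Real.log (1 / s ^ 2) := Real.log_nonneg (by rw [le_div_iff₀ (by positivity)]; nlinarith)
  have hm2 : (2 : ℝ) ≤ m := by exact_mod_cast hm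
  have hm0 : (0 : ℝ) < m := by linarith
  have hq1 : (1 : ℝ) ≤ q := by exact_mod_cast Nat.pos_of_ne_zero (NeZero.ne q)
  have hA : A.Nonempty := by
    rw [Finset.nonempty_iff_ne_empty]
    rintro rfl
    have : (0 : ℝ) ≤ (m : ℝ) ^ (3 - s ^ 2) := by positivity
    simp at hsnd
    linarith
  have hms : 1 < (m : ℝ) ^ s := Real.one_lt_rpow (by linarith) hs
  have hrough : (m : ℝ) ^ s < D → ∀ l, l ∣ m → 2 ≤ l → D ≤ l := by
    intro h l hl hl2
    refine le_of_dvd_of_dense (by omega) _ hsnd ?_ hl hl2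
    calc (m : ℝ) ^ (s ^ 2) = ((m : ℝ) ^ s) ^ s := by rw [← Real.rpow_mul hm0.le, sq]
      _ ≤ (D : ℝ) ^ s := Real.rpow_le_rpow (by positivity) h.le hs.le
      _ ≤ _ := hsD
  have hlarge : ∀ d, d ∣ m → (m : ℝ) ^ s ≤ d → D ≤ d := by
    intro d hd hds
    rcases lt_or_ge ((m : ℝ) ^ s) D with h | h
    · exact hrough h d hd (by have := hms.trans_le hds; exact_mod_cast this)
    · exact_mod_cast h.trans hds
  obtain ⟨d, hd, hdm, ι, _, _, g, f, hfA, hfd, hf⟩ := hspread q m hm hqm A hA s (fun d hd hds =>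
    ⟨hDD₁.trans (hlarge d hd hds), card_le_of_dense_of_le (by linarith) hs.le hfst rfl hqs hds,
      card_le_of_dense hd _ hsnd (by nlinarith) hds⟩) J hJ
  have hd0 : 0 < d := Nat.pos_of_dvd_of_pos hd (by omega)
  obtain ⟨X, hX0, hX1, hX⟩ : ∃ X : ℝ, 0 ≤ X ∧ X ≤ (m : ℝ) ^ (81 * s) ∧
      ∑ l ∈ m.divisors, (l : ℝ) ^ 3 * (min 1 (C * ((d : ℝ) ^ (5e-8 : ℝ) * (l : ℝ) ^ (-0.625e-8 : ℝ)))) ^ r ≤ X := by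
    -- If m^s < D, the final modulus d < D must be 1 and the sum is close to 1, which matters since
    -- m^(81s) may be barely above 1. If m^s ≥ D, the factor m^s absorbs the constant and d^80 ≤
    -- m^(80s).
    rcases lt_or_ge ((m : ℝ) ^ s) D with h | h
    · have hd1 : d = 1 := by
        by_contra hne
        have h1 : D ≤ d := hrough h d hd (by omega)
        have h2 : (D : ℝ) ≤ d := by exact_mod_cast h1
        linarith
      subst hd1
      exact ⟨1 + 2 ^ (-(2 * Real.log (1 / s ^ 2))), by positivity, one_add_two_rpow_le hm2 hs hs7,
        collision_sum_le_of_rough (by omega) hC hDC' (hrough h) (by linarith) hr⟩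
    · refine ⟨2 * (C ^ (1.6e9 : ℝ) * (d : ℝ) ^ (80 : ℝ)), by positivity, ?_,
        collision_sum_le_of_large (by omega) hd0 hC (by linarith)⟩
      calc 2 * (C ^ (1.6e9 : ℝ) * (d : ℝ) ^ (80 : ℝ)) = 2 * C ^ (1.6e9 : ℝ) * (d : ℝ) ^ (80 : ℝ) := by ring
        _ ≤ (m : ℝ) ^ s * ((m : ℝ) ^ s) ^ (80 : ℝ) := by
            refine mul_le_mul (hDC.trans h) ?_ (by positivity) (by positivity)
            exact Real.rpow_le_rpow (Nat.cast_nonneg _) hdm.le (by norm_num)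
        _ = (m : ℝ) ^ (81 * s) := by
            rw [← Real.rpow_mul hm0.le, ← Real.rpow_add hm0]; congr 1; ring
  refine expansion_lower_bound hq1 (by linarith) hfst hsnd (Nat.cast_nonneg _)
    (G := (Fintype.card SL(2, ZMod m) : ℝ)) (by exact_mod_cast card_SL2_le) hX0 hX1 (Nat.cast_nonneg _)
    (card_pow_ge_of_family A hA (3 * J) g f hfA r X hX0 fun y => ?_) (by nlinarith) hrs
  exact (hconj m d hd0 f hf r y).trans (by gcongr)

/-! ### Passage to the product of the two quotients, and the conclusion. -/

section Transfer

variable {q q₁ q₂ : ℕ}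

theorem card_image_reduction_le_card_pow (h₁ : q₁ ∣ q) (h : q₁ * q₂ ∣ q) (F : Finset SL(2, ZMod q)) {k : ℕ} (hk : 0 < k) :
    (F.image (reduction h₁)).card ≤ ((F ^ k).image (reduction h)).card := by
  calc (F.image (reduction h₁)).card ≤ ((F.image (reduction h₁)) ^ k).card := Finset.card_le_card_pow hk.ne'
    _ = (((F ^ k).image (reduction h)).image (reduction (dvd_mul_right q₁ q₂))).card := by
        rw [← Finset.image_pow, Finset.image_image]
        congr 2
        funext z
        exact (reduction_reduction _ h z).symm
    _ ≤ _ := Finset.card_image_le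

theorem card_pow_image_prod_le (h₁ : q₁ ∣ q) (h₂ : q₂ ∣ q) (h : q₁ * q₂ ∣ q) (F : Finset SL(2, ZMod q)) (k : ℕ) :
    ((F.image ((reduction h₁).prod (reduction h₂))) ^ k).card ≤ ((F ^ k).image (reduction h)).card := by
  calc _ = (((F ^ k).image (reduction h)).image
        ((reduction (dvd_mul_right q₁ q₂)).prod (reduction (dvd_mul_left q₂ q₁)))).card := by
        rw [← Finset.image_pow, Finset.image_image]
        congr 2
        funext z
        exact Prod.ext (reduction_reduction _ h z).symm (reduction_reduction _ h z).symm
    _ ≤ _ := Finset.card_image_le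

end Transfer

/-- Covers the situations where the first factor alone suffices: either the target exponent is not
positive, or M is so small that the gain 1e7 s in the exponent is outweighed by C s. -/
theorem mul_rpow_le_of_small {Q M s C : ℝ} (hQ : 1 ≤ Q) (hM : 1 ≤ M) (hs : 0 < s) (hs1 : s < 1) (hC : 1e10 ≤ C)
    (h : 3 ≤ C * s ∨ M ≤ Q ^ (1e7 * s)) : (Q * M) ^ (3 - C * s) ≤ Q ^ (3 - s ^ 2) := by
  have hQ0 : 0 < Q := by linarith
  rcases le_or_gt 3 (C * s) with h0 | h0
  · exact (Real.rpow_le_one_of_one_le_of_nonpos (one_le_mul_of_one_le_of_one_le hQ hM) (by linarith)).trans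
      (Real.one_le_rpow hQ (by nlinarith))
  · have hM' : M ≤ Q ^ (1e7 * s) := h.resolve_left (by linarith)
    calc (Q * M) ^ (3 - C * s) ≤ (Q * Q ^ (1e7 * s)) ^ (3 - C * s) :=
          Real.rpow_le_rpow (by positivity) (by gcongr) (by linarith)
      _ = Q ^ ((1 + 1e7 * s) * (3 - C * s)) := by
          rw [Real.rpow_mul hQ0.le (1 + 1e7 * s), Real.rpow_add hQ0, Real.rpow_one]
      _ ≤ _ := Real.rpow_le_rpow_of_exponent_le hQ (by nlinarith)

end Gluing

theorem mainTheorem7 :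
    ∃ C₁ C₂ : ℝ, 0 < C₁ ∧ 0 < C₂ ∧
      ∀ (L : ℕ) (θ : ℝ), 0 < L → 0 < θ → θ < min ((10 : ℝ) ^ (-12 : ℤ)) (1 / (L : ℝ)) →
        ∃ k : ℕ, 0 < k ∧ (k : ℝ) ≤ C₁ * (Real.log (1 / θ)) ^ 2 ∧
          ∀ (q q₁ q₂ : ℕ) (_ : 0 < q) (h₁ : Gluing.ExactDvd q₁ q)
            (h₂ : Gluing.ExactDvd q₂ (Gluing.largeExponentPart L q))
            (hc : Nat.Coprime q₁ q₂) (A : Set SL(2, ZMod q)),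
            (q₁ : ℝ) ^ (3 - θ) < ((Gluing.reduction h₁.1 '' A).ncard : ℝ) →
            (q₂ : ℝ) ^ (3 - θ) < ((Gluing.reduction h₂.dvd_of_large '' A).ncard : ℝ) →
            ∃ (q₃ : ℕ) (h₃ : Gluing.ExactDvd q₃ q₂),
              (q₂ : ℝ) ^ ((1 / 4 : ℝ) * (10 : ℝ) ^ (-4 : ℤ)) < (q₃ : ℝ) ∧
              ((q₁ : ℝ) * (q₃ : ℝ)) ^ (3 - C₂ * Real.sqrt θ) <
                ((Gluing.reduction (h₁.mul_dvd h₂.dvd_of_large hc h₃) '' (A ^ k)).ncard : ℝ) := by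
  classical
  obtain ⟨s₀, hs₀, H⟩ := Gluing.exists_expansion
  -- The summand 3/s₀ makes C₂ s ≥ 3 as soon as s ≥ s₀, so in that range the required bound is at
  -- most 1.
  refine ⟨1e19, 1e10 + 3 / s₀, by norm_num, by positivity, fun L θ hL hθ hθ' => ?_⟩
  obtain ⟨s, hs, rfl⟩ : ∃ s : ℝ, 0 < s ∧ θ = s ^ 2 := ⟨√θ, Real.sqrt_pos.2 hθ, (Real.sq_sqrt hθ.le).symm⟩
  have hθ12 : s ^ 2 < 1e-12 := by
    have := hθ'.trans_le (min_le_left _ _)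
    norm_num at this ⊢
    exact this
  have hs1 : s < 1 := by nlinarith
  rw [Real.sqrt_sq hs.le]
  have h3 : 0 ≤ 3 / s₀ := by positivity
  set C := 1e10 + 3 / s₀
  have hC : 1e10 ≤ C := by simp only [C]; linarith
  obtain ⟨k, hk, hkL, hcase⟩ : ∃ k : ℕ, 0 < k ∧ (k : ℝ) ≤ 1e19 * (Real.log (1 / s ^ 2)) ^ 2 ∧
      (3 ≤ C * s ∨ ∀ (q m : ℕ) [NeZero q] [NeZero m], 2 ≤ m → Nat.Coprime q m →
        (q : ℝ) ^ (1e7 * s) ≤ m → ∀ A : Finset (SL(2, ZMod q) × SL(2, ZMod m)),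
        (q : ℝ) ^ (3 - s ^ 2) < (A.image Prod.fst).card → (m : ℝ) ^ (3 - s ^ 2) < (A.image Prod.snd).card →
        ((q : ℝ) * m) ^ (3 - 1e10 * s) < (A ^ k).card) := by
    rcases lt_or_ge s s₀ with h | h
    · obtain ⟨k, hk, hkL, hH⟩ := H s hs h
      exact ⟨k, hk, hkL, Or.inr hH⟩
    · refine ⟨1, one_pos, ?_, Or.inl ?_⟩
      · have h1 : 1 ≤ Real.log (1 / s ^ 2) := by
          rw [Real.le_log_iff_exp_le (by positivity), le_div_iff₀ (by positivity)]
          have := Real.exp_one_lt_d9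
          nlinarith
        push_cast
        nlinarith
      · calc (3 : ℝ) = 3 / s₀ * s₀ := by field_simp
          _ ≤ C * s := by
            refine mul_le_mul ?_ h hs₀.le (by linarith)
            simp only [C]; linarith
  refine ⟨k, hk, hkL, ?_⟩
  intro q q₁ q₂ hq h₁ h₂ hc A hA₁ hA₂
  have hd₂ := h₂.dvd_of_large
  have hq₁ : 0 < q₁ := Nat.pos_of_dvd_of_pos h₁.1 hq
  have hq₂ : 0 < q₂ := Nat.pos_of_dvd_of_pos hd₂ hq
  have : NeZero q := ⟨hq.ne'⟩
  have : NeZero q₁ := ⟨hq₁.ne'⟩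
  have : NeZero q₂ := ⟨hq₂.ne'⟩
  -- Over the trivial modulus the image has one element, so the strict density inequality 1 <
  -- |image| fails.
  have hm : 2 ≤ q₂ := by
    by_contra! h
    obtain rfl : q₂ = 1 := by omega
    have h1 : (Gluing.reduction hd₂ '' A).ncard ≤ Fintype.card SL(2, ZMod 1) := by
      rw [← Nat.card_eq_fintype_card]; exact Set.ncard_le_card _
    have h2 := h1.trans Gluing.card_SL2_le
    rw [Nat.cast_one, Real.one_rpow] at hA₂
    have h3 : 1 < (Gluing.reduction hd₂ '' A).ncard := by exact_mod_cast hA₂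
    omega
  have hQ : (1 : ℝ) ≤ q₁ := by exact_mod_cast hq₁
  have hM : (2 : ℝ) ≤ q₂ := by exact_mod_cast hm
  refine ⟨q₂, ⟨dvd_rfl, fun _ _ _ => rfl⟩, ?_, ?_⟩
  · calc (q₂ : ℝ) ^ ((1 / 4 : ℝ) * (10 : ℝ) ^ (-4 : ℤ)) < (q₂ : ℝ) ^ (1 : ℝ) :=
        Real.rpow_lt_rpow_of_exponent_lt (by linarith) (by norm_num)
      _ = q₂ := Real.rpow_one _
  · obtain ⟨F, rfl⟩ : ∃ F : Finset SL(2, ZMod q), (F : Set SL(2, ZMod q)) = A :=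
      ⟨A.toFinset, Set.coe_toFinset A⟩
    rw [← Finset.coe_image, Set.ncard_coe_finset] at hA₁ hA₂
    rw [← Finset.coe_pow, ← Finset.coe_image, Set.ncard_coe_finset]
    set h := h₁.mul_dvd hd₂ hc ⟨dvd_rfl, fun _ _ _ => rfl⟩
    -- In the first case the density of A modulo q₁ is enough, and the projection of the k-th power
    -- is no smaller than that of A.
    by_cases hsmall : 3 ≤ C * s ∨ (q₂ : ℝ) ≤ (q₁ : ℝ) ^ (1e7 * s)
    · refine ((Gluing.mul_rpow_le_of_small hQ (by linarith) hs hs1 hC hsmall).trans_lt hA₁).trans_le ?_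
      exact_mod_cast Gluing.card_image_reduction_le_card_pow h₁.1 h F hk
    · push Not at hsmall
      have hexp := hcase.resolve_left (by linarith) q₁ q₂ hm hc hsmall.2.le
        (F.image ((Gluing.reduction h₁.1).prod (Gluing.reduction hd₂)))
        (by rw [Finset.image_image]; exact hA₁) (by rw [Finset.image_image]; exact hA₂)
      calc ((q₁ : ℝ) * q₂) ^ (3 - C * s) ≤ ((q₁ : ℝ) * q₂) ^ (3 - 1e10 * s) := by
            refine Real.rpow_le_rpow_of_exponent_le (by nlinarith) ?_
            nlinarith
        _ < _ := hexp
        _ ≤ _ := by exact_mod_cast Gluing.card_pow_image_prod_le h₁.1 hd₂ h F k
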